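/- Let $q\in\mathbb C$ with $0<|q|<1$. Write $(a;q)_\infty=\prod_{n\ge 0}(1-aq^n)$, $(a_1,\dots,a_m;q)_\infty=\prod_j(a_j;q)_\infty$, $(az^{\pm1};q)_\infty=(az,az^{-1};q)_\infty$, $\theta(z;q)=(z,q/z;q)_\infty$, with products of theta functions abbreviated in the same way. Let $\mathcal H_1=\{t\in\mathbb C^8 : \prod_{j=1}^8t_j=1\}/\{\pm1\}$. In each integral below, $\mathcal C$ is a deformation in $\mathbb C^\times$ of the positively oriented unit circle that encloses the indicated decreasing sequences of points and excludes the indicated increasing ones. The trigonometric Euler integral is $$E_t(t)=\int_{\mathcal C}\frac{(z^{\pm2},t_1^{-1}z^{\pm1};q)_\infty}{\prod_{j=2}^6(t_jz^{\pm1};q)_\infty}\frac{dz}{2\pi iz},\qquad t\in(\mathbb C^\times)^6,$$ where $\mathcal C$ encloses $t_jq^n$ and excludes $t_j^{-1}q^{-n}$ ($2\le j\le 6$, $n\ge0$). The trigonometric Barnes integral is $$B_t(t)=2\int_{\mathcal C}\frac{\theta(t_2t_7/\mu z,z/\mu;q)}{\theta(t_2/\mu,t_7/\mu;q)}\frac{(z/t_1,z/t_8;q)_\infty}{\prod_{j=3}^6(t_jz;q)_\infty\,(t_2/z,t_7/z;q)_\infty}\frac{dz}{2\pi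 iz},\qquad \prod_{j=1}^8t_j=1,$$ where $\mathcal C$ encloses $t_2q^n,t_7q^n$ and excludes $t_j^{-1}q^{-n}$ ($3\le j\le6$, $n\ge0$), and where $\mu\in\mathbb C^\times$ is any auxiliary parameter with $\theta(t_2/\mu,t_7/\mu;q)\ne0$, of which the integral is independent. Finally, $$V_t(t)=2\int_{\mathcal C}\frac{\theta(qt_2t_3t_4t_5t_6z;q)}{\theta(qt_1t_2t_3t_4t_5t_6;q)}\Bigl(1-\frac{z^2}{q}\Bigr)\prod_{j=2}^6\frac{(z/t_j;q)_\infty}{(t_jz;q)_\infty}\,\frac{1}{(t_1z/q,t_1/z;q)_\infty}\frac{dz}{2\pi iz},\qquad t\in(\mathbb C^\times)^6,$$ where $\theta(qt_1\cdots t_6;q)\neq0$ and $\mathcal C$ encloses $t_1q^n$ and excludes $t_1^{-1}q^{1-n}$ and $t_j^{-1}q^{-n}$ ($2\le j\le6$, $n\ge0$). These integrals extend to meromorphic functions, $B_t$ on $\mathcal H_1$, and $V_t$ and $E_t$ on $(\mathbb C^\times)^6/\{\pm1\}$, and any such extensions satisfy the following. As meromorphic functions in $t\in\mathcal H_1$,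 $$B_t(t)=\frac{(1/t_1t_6,1/t_8t_6;q)_\infty}{(t_2t_3,t_2t_4,t_2t_5,t_6t_7;q)_\infty}\,V_t\bigl(t_7/s,t_3s,t_4s,t_5s,t_1/s,t_8/s\bigr)$$ $$\phantom{B_t(t)}=\frac{(1/t_1t_3,1/t_1t_4,1/t_1t_5,1/t_6t_8;q)_\infty}{(t_2t_6,t_7t_6;q)_\infty}\,E_t\bigl(t_8/v,t_7/v,t_3v,t_4v,t_5v,t_2/v\bigr),$$ where $s^2=t_1t_6t_7t_8=1/t_2t_3t_4t_5$ and $v^2=t_2t_6t_7t_8=1/t_1t_3t_4t_5$ (for either choice of the square roots). Consequently one has the Nassrallah–Rahman integral representation: as meromorphic functions on $\{t\in(\mathbb C^\times)^6 : |t_1t_2|>1\}$, $$E_t(t)=\frac{2\,(1/t_1t_2,\;t_2/t_1;q)_\infty\prod_{j=3}^6(t_2t_3t_4t_5t_6/t_j;q)_\infty}{(q,\;t_2^2t_3t_4t_5t_6;q)_\infty\prod_{2\le j<k\le6}(t_jt_k;q)_\infty}\;{}_8W_7\Bigl(\frac{t_2^2t_3t_4t_5t_6}{q};\,t_2t_3,t_2t_4,t_2t_5,t_2t_6,t_1t_2t_3t_4t_5t_6;\,q,\frac1{t_1t_2}\Bigr),$$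 where, with $(a;q)_n=\prod_{j=0}^{n-1}(1-aq^j)$ and $(a_1,\dots,a_m;q)_n=\prod_j(a_j;q)_n$, $${}_8W_7(a;b_1,\dots,b_5;q,z)=\sum_{n\ge0}\frac{(a,qa^{1/2},-qa^{1/2},b_1,\dots,b_5;q)_n}{(q,a^{1/2},-a^{1/2},qa/b_1,\dots,qa/b_5;q)_n}z^n\qquad(|z|<1).$$ -/

import Mathlib

open Filter Topology

noncomputable section

/-! Coordinates are numbered from `0`: the parameter `t_j` is `t (j - 1)`. -/

/-- The infinite `q`-shifted factorial `(a; q)_∞`. -/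
def qPochInf (q a : ℂ) : ℂ := ∏' n : ℕ, (1 - a * q ^ n)

/-- `(a₁, …, a_m; q)_∞`. -/
def qPochs (q : ℂ) (as : List ℂ) : ℂ := (as.map (qPochInf q)).prod

/-- The theta function `θ(z; q) = (z, q / z; q)_∞`. -/
def qTheta (q z : ℂ) : ℂ := qPochs q [z, q / z]

/-- `(a₁, …, a_m; q)_n`. -/
def qPochsFin (q : ℂ) (n : ℕ) (as : List ℂ) : ℂ :=
  (as.map fun a => ∏ j ∈ Finset.range n, (1 - a * q ^ j)).prod

/-- The basic hypergeometric series `_{r+1}φ_r (as; bs; q, z)`, for `‖z‖ < 1`. -/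
def qHypergeometric (q : ℂ) (as bs : List ℂ) (z : ℂ) : ℂ :=
  ∑' n : ℕ, qPochsFin q n as / qPochsFin q n (q :: bs) * z ^ n

/-- The very-well-poised series `_{r+1}W_r (a; as; q, z)`. -/
def qVeryWellPoised (q a : ℂ) (as : List ℂ) (z : ℂ) : ℂ :=
  qHypergeometric q
    (a :: q * a ^ (1 / 2 : ℂ) :: -q * a ^ (1 / 2 : ℂ) :: as)
    (a ^ (1 / 2 : ℂ) :: -a ^ (1 / 2 : ℂ) :: as.map fun b => q * a / b) z

/-! ### Contours -/

/-- `γ` restricted to `[0, 1]` is a continuous, piecewise `C¹` curve: it is `C¹` on each closed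
interval that has no break point in its interior. -/
def IsPiecewiseC1 (γ : ℝ → ℂ) : Prop :=
  ContinuousOn γ (Set.Icc 0 1) ∧
  ∃ S : Finset ℝ, ∀ a b : ℝ, 0 ≤ a → a < b → b ≤ 1 → (∀ x ∈ S, x ∉ Set.Ioo a b) →
    ContDiffOn ℝ 1 γ (Set.Icc a b)

/-- The integral `∫_γ f(z) dz` along `γ : [0, 1] → ℂ`. -/
def curveInt (f : ℂ → ℂ) (γ : ℝ → ℂ) : ℂ := ∫ x in (0 : ℝ)..1, f (γ x) * deriv γ x

/-- The integral `∫_γ f(z) dz / (2 π i z)`. -/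
def normCurveInt (f : ℂ → ℂ) (γ : ℝ → ℂ) : ℂ :=
  curveInt (fun z => f z / (2 * Real.pi * Complex.I * z)) γ

/-- The winding number of a closed curve around a point off the curve. -/
def windingNum (γ : ℝ → ℂ) (w : ℂ) : ℂ :=
  curveInt (fun z => 1 / (2 * Real.pi * Complex.I * (z - w))) γ

/-- `γ` is a deformation, in `ℂ \ {0}`, of the positively oriented unit circle, which includes the
points of `down` and excludes the points of `up`. -/
structure IsSeparatingContour (γ : ℝ → ℂ) (down up : Set ℂ) : Prop where
  piecewiseC1 : IsPiecewiseC1 γ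
  closed : γ 0 = γ 1
  avoids : ∀ x ∈ Set.Icc (0 : ℝ) 1, γ x ≠ 0 ∧ γ x ∉ down ∧ γ x ∉ up
  winding_zero : windingNum γ 0 = 1
  winding_down : ∀ w ∈ down, windingNum γ w = 1
  winding_up : ∀ w ∈ up, windingNum γ w = 0

/-- The decreasing sequence `a q^n`, `n ≥ 0`. -/
def downSeq (q a : ℂ) : Set ℂ := {z | ∃ n : ℕ, z = a * q ^ n}

/-- The increasing sequence `a q^{-n}`, `n ≥ 0`. -/
def upSeq (q a : ℂ) : Set ℂ := {z | ∃ n : ℕ, z = a * (q ^ n)⁻¹}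

/-! ### Meromorphic functions of several variables

The sets `X` below are complex submanifolds of `E`. A meromorphic function on `X` is given by a
function on `E`, whose values off `X` and on the polar set do not matter. -/

/-- `P` holds on `X` off a thin analytic set: locally at each point of `X`, it holds wherever some
analytic function, which is not identically zero near this point of `X`, does not vanish. -/
def GenericallyOn {E : Type*} [NormedAddCommGroup E] [NormedSpace ℂ E]
    (X : Set E) (P : E → Prop) : Prop :=
  ∀ x ∈ X, ∃ h : E → ℂ, AnalyticAt ℂ h x ∧ (∃ᶠ y in 𝓝[X] x, h y ≠ 0) ∧
    ∀ᶠ y in 𝓝[X] x, h y ≠ 0 → P y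

/-- `f` is locally on `X` a quotient `g / h` of analytic functions, with `h` not identically
zero. -/
def IsMeromorphicOnSet {E : Type*} [NormedAddCommGroup E] [NormedSpace ℂ E]
    (f : E → ℂ) (X : Set E) : Prop :=
  ∀ x ∈ X, ∃ g h : E → ℂ, AnalyticAt ℂ g x ∧ AnalyticAt ℂ h x ∧ (∃ᶠ y in 𝓝[X] x, h y ≠ 0) ∧
    ∀ᶠ y in 𝓝[X] x, h y ≠ 0 → f y = g y / h y

/-- The hypersurface `t₁ ⋯ t₈ = 1`, a double cover of `𝓗₁`. -/
def balancedSet : Set (Fin 8 → ℂ) := {t | ∏ j, t j = 1}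

/-- `(ℂ \ {0})⁶`. -/
def torusSix : Set (Fin 6 → ℂ) := {t | ∀ j, t j ≠ 0}

/-! ### The three integrals -/

/-- The integrand of the trigonometric Euler integral. -/
def eulerIntegrand (q : ℂ) (t : Fin 6 → ℂ) (z : ℂ) : ℂ :=
  qPochs q [z ^ 2, (z ^ 2)⁻¹, (t 0)⁻¹ * z, (t 0)⁻¹ * z⁻¹] /
    ∏ j ∈ {1, 2, 3, 4, 5}, qPochs q [t j * z, t j * z⁻¹]

def IsEulerContour (q : ℂ) (t : Fin 6 → ℂ) (γ : ℝ → ℂ) : Prop :=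
  IsSeparatingContour γ
    (⋃ j ∈ ({1, 2, 3, 4, 5} : Set (Fin 6)), downSeq q (t j))
    (⋃ j ∈ ({1, 2, 3, 4, 5} : Set (Fin 6)), upSeq q (t j)⁻¹)

/-- `F` is the trigonometric Euler integral `E_t`, meromorphically extended to `(ℂ \ {0})⁶ / ±1`. -/
structure IsTrigEuler (q : ℂ) (F : (Fin 6 → ℂ) → ℂ) : Prop where
  meromorphic : IsMeromorphicOnSet F torusSix
  even : ∀ t ∈ torusSix, F (-t) = F t
  eq_integral : ∀ t ∈ torusSix, ∀ γ, IsEulerContour q t γ →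
    F t = normCurveInt (eulerIntegrand q t) γ

/-- The integrand of the trigonometric Barnes integral, with auxiliary parameter `μ`. -/
def barnesIntegrand (q μ : ℂ) (t : Fin 8 → ℂ) (z : ℂ) : ℂ :=
  qTheta q (t 1 * t 6 / (μ * z)) * qTheta q (z / μ) /
      (qTheta q (t 1 / μ) * qTheta q (t 6 / μ)) *
    (qPochs q [z / t 0, z / t 7] /
      ((∏ j ∈ {2, 3, 4, 5}, qPochInf q (t j * z)) * qPochs q [t 1 / z, t 6 / z]))

def IsBarnesContour (q : ℂ) (t : Fin 8 → ℂ) (γ : ℝ → ℂ) : Prop :=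
  IsSeparatingContour γ
    (downSeq q (t 1) ∪ downSeq q (t 6))
    (⋃ j ∈ ({2, 3, 4, 5} : Set (Fin 8)), upSeq q (t j)⁻¹)

/-- `F` is the trigonometric Barnes integral `B_t`, meromorphically extended to `𝓗₁`; the integral
does not depend on the auxiliary parameter `μ`. -/
structure IsTrigBarnes (q : ℂ) (F : (Fin 8 → ℂ) → ℂ) : Prop where
  meromorphic : IsMeromorphicOnSet F balancedSet
  even : ∀ t ∈ balancedSet, F (-t) = F t
  eq_integral : ∀ t ∈ balancedSet, ∀ μ : ℂ, μ ≠ 0 →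
    qTheta q (t 1 / μ) ≠ 0 → qTheta q (t 6 / μ) ≠ 0 → ∀ γ, IsBarnesContour q t γ →
      F t = 2 * normCurveInt (barnesIntegrand q μ t) γ

/-- The integrand of the third trigonometric integral `V_t`. -/
def vIntegrand (q : ℂ) (t : Fin 6 → ℂ) (z : ℂ) : ℂ :=
  qTheta q (q * t 1 * t 2 * t 3 * t 4 * t 5 * z) /
      qTheta q (q * t 0 * t 1 * t 2 * t 3 * t 4 * t 5) *
    (1 - z ^ 2 / q) *
    (∏ j ∈ {1, 2, 3, 4, 5}, qPochInf q (z / t j) / qPochInf q (t j * z)) *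
    (1 / qPochs q [t 0 * z / q, t 0 / z])

def IsVContour (q : ℂ) (t : Fin 6 → ℂ) (γ : ℝ → ℂ) : Prop :=
  IsSeparatingContour γ
    (downSeq q (t 0))
    (upSeq q (q / t 0) ∪ ⋃ j ∈ ({1, 2, 3, 4, 5} : Set (Fin 6)), upSeq q (t j)⁻¹)

/-- `F` is the trigonometric integral `V_t`, meromorphically extended to `(ℂ \ {0})⁶ / ±1`. -/
structure IsTrigV (q : ℂ) (F : (Fin 6 → ℂ) → ℂ) : Prop where
  meromorphic : IsMeromorphicOnSet F torusSix
  even : ∀ t ∈ torusSix, F (-t) = F t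
  eq_integral : ∀ t ∈ torusSix, qTheta q (q * t 0 * t 1 * t 2 * t 3 * t 4 * t 5) ≠ 0 →
    ∀ γ, IsVContour q t γ → F t = 2 * normCurveInt (vIntegrand q t) γ

end

/-! All three integrals are evaluated over circles for parameters in one open set, compared there,
and the comparison is spread to all parameters by analytic continuation.

Barnes and Euler. In `barnesCircle_eq_eulerCircle` a double integral couples z on the unit circle
with w on a smaller circle through the kernel 1/(zw, w/z; q)_∞. Its z-integral is an Askey–Wilson
integral with w as fourth parameter (`askeyWilson_eval`), its w-integral is the integral form of the
nonterminating q-Saalschütz sum (`saalIntegral_eval`), so Fubini relates the Barnes integral to the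
Euler integral. Both evaluations follow one scheme: a combination of integrands with a parameter b
and with bq integrates to zero, the resulting recursion is iterated until b has become 0, and the
constant that is left is read off at special parameters.

Euler and V. Both are multiples of the same very-well-poised series. If one parameter is specialized
so that the Barnes integral collapses to a q-Saalschütz integral, the comparison becomes Rahman's
integral (`rahman_integral`). The nonterminating 6φ5 sum (`sixSum_eq`) expands (uz, u/z)_∞/(tz,
t/z)_∞ in a series each of whose terms integrates by Rahman's formula; this is the Nassrallah–Rahman
formula `nassrallahRahman_circle`. On the other side V is the sum of its residues at the points a
q^n (`hasSum_vForm`), and these are the terms of the same series.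

Arbitrary contours. Dixon's form of Cauchy's theorem (`curveInt_eq_of_windInt_eq`) shows that only
winding numbers matter. A Bezout identity splits an integrand into two parts, one whose contour may
be replaced by a large circle and one whose contour may be replaced by a small circle. The integral
thereby becomes, locally in the parameters, an analytic function divided by a finite product that
vanishes only where the enclosed and the excluded sequences collide (`exists_sepValue`). This
produces the meromorphic extensions. For the Barnes integral the independence of μ is itself proved
by continuation.

Continuation. In logarithmic coordinates the parameter spaces become ℂ^7, ℂ^6 and a half-space of
ℂ^6, all convex, and the square roots s and v become exponentials of linear forms. The identity
theorem `IsLineMero.genericallyOn_eq` then extends each identity from the open set `EulerRegion`;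
the evenness of V and E takes care of the other square root. -/

open Filter Topology

noncomputable section

/-! ### The infinite `q`-shifted factorial and the theta function -/

section QPoch

variable {q : ℂ}

lemma qpoch_summable (hq : ‖q‖ < 1) (a : ℂ) : Summable fun n : ℕ => ‖-(a * q ^ n)‖ := by
  simp only [norm_neg, norm_mul, norm_pow]
  exact (summable_geometric_of_lt_one (norm_nonneg _) hq).mul_left _

lemma qpoch_multipliable (hq : ‖q‖ < 1) (a : ℂ) : Multipliable fun n : ℕ => (1 - a * q ^ n) := by
  simpa [sub_eq_add_neg] using multipliable_one_add_of_summable (qpoch_summable hq a)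

lemma qPochInf_succ (hq : ‖q‖ < 1) (a : ℂ) :
    qPochInf q a = (1 - a) * qPochInf q (a * q) := by
  have h2 : (fun n : ℕ => (1 - a * q * q ^ n)) = fun n : ℕ => (1 - a * q ^ (n + 1)) := by
    funext n; ring
  have h : Multipliable (fun n : ℕ => (1 - a * q ^ (n + 1))) :=
    h2 ▸ qpoch_multipliable hq (a * q)
  have h3 := tprod_eq_zero_mul' (f := fun n : ℕ => (1 - a * q ^ n)) h
  rw [pow_zero, mul_one] at h3
  unfold qPochInf
  rw [h3, h2]

lemma qPochInf_split (hq : ‖q‖ < 1) (a : ℂ) (n : ℕ) :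
    qPochInf q a = (∏ j ∈ Finset.range n, (1 - a * q ^ j)) * qPochInf q (a * q ^ n) := by
  induction n with
  | zero => simp
  | succ n ih =>
    rw [ih, qPochInf_succ hq (a * q ^ n), Finset.prod_range_succ, pow_succ]
    ring_nf

lemma qPochInf_zero : qPochInf q 0 = 1 := by simp [qPochInf]

lemma qPochInf_ne_zero (hq : ‖q‖ < 1) {a : ℂ} (h : ∀ n : ℕ, a * q ^ n ≠ 1) :
    qPochInf q a ≠ 0 := by
  unfold qPochInf
  simp only [sub_eq_add_neg]
  refine tprod_one_add_ne_zero_of_summable (fun n => ?_) (qpoch_summable hq a)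
  intro h0
  exact h n (by linear_combination -h0)

lemma qPochInf_eq_zero (hq : ‖q‖ < 1) {a : ℂ} {n : ℕ} (h : a * q ^ n = 1) :
    qPochInf q a = 0 := by
  rw [qPochInf_split hq a n, qPochInf_succ hq, h]; simp

lemma norm_mul_pow_lt_one (hq : ‖q‖ < 1) {a : ℂ} (ha : ‖a‖ < 1) (n : ℕ) : ‖a * q ^ n‖ < 1 := by
  rw [norm_mul, norm_pow]
  calc ‖a‖ * ‖q‖ ^ n ≤ ‖a‖ * 1 := by
        gcongr; exact pow_le_one₀ (norm_nonneg _) hq.le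
    _ < 1 := by simpa using ha

lemma qPochInf_ne_zero_of_norm_lt_one (hq : ‖q‖ < 1) {a : ℂ} (ha : ‖a‖ < 1) :
    qPochInf q a ≠ 0 := by
  refine qPochInf_ne_zero hq fun n h => ?_
  have := norm_mul_pow_lt_one hq ha n
  rw [h] at this; simp at this

lemma qPochInf_self_ne_zero (hq : ‖q‖ < 1) : qPochInf q q ≠ 0 :=
  qPochInf_ne_zero_of_norm_lt_one hq hq

lemma differentiable_qPochInf (hq : ‖q‖ < 1) : Differentiable ℂ (qPochInf q) := by
  have key : ∀ R : ℝ, DifferentiableOn ℂ (qPochInf q) (Metric.ball 0 R) := by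
    intro R
    have h := Summable.hasProdLocallyUniformlyOn_nat_one_add (K := Metric.ball (0 : ℂ) R)
      (f := fun n a => -(a * q ^ n)) (u := fun n => R * ‖q‖ ^ n) Metric.isOpen_ball
      ((summable_geometric_of_lt_one (norm_nonneg _) hq).mul_left _)
      (.of_forall fun n x hx => by
        rw [norm_neg, norm_mul, norm_pow]
        gcongr
        simpa using (Metric.mem_ball.1 hx).le) (fun n => by fun_prop)
    refine (h.differentiableOn (.of_forall fun s => ?_) Metric.isOpen_ball).congr ?_
    · simpa [Finset.prod_fn] using DifferentiableOn.finsetProd (fun _ _ ↦ by fun_prop)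
    · intro a _; simp [qPochInf, sub_eq_add_neg]
  intro a
  exact (key (‖a‖ + 1)).differentiableAt (Metric.isOpen_ball.mem_nhds (by simp))

lemma continuous_qPochInf (hq : ‖q‖ < 1) : Continuous (qPochInf q) :=
  (differentiable_qPochInf hq).continuous

lemma norm_qpochFin_le (hq : ‖q‖ < 1) (a : ℂ) (n : ℕ) :
    ‖∏ j ∈ Finset.range n, (1 - a * q ^ j)‖ ≤ Real.exp (‖a‖ / (1 - ‖q‖)) := by
  rw [norm_prod]
  calc ∏ j ∈ Finset.range n, ‖1 - a * q ^ j‖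
      ≤ ∏ j ∈ Finset.range n, (1 + ‖a‖ * ‖q‖ ^ j) := by
        refine Finset.prod_le_prod (fun _ _ => norm_nonneg _) fun j _ => ?_
        simpa using norm_sub_le (1 : ℂ) (a * q ^ j)
    _ ≤ Real.exp (∑ j ∈ Finset.range n, ‖a‖ * ‖q‖ ^ j) :=
        Real.prod_one_add_le_exp_sum _ fun _ => by positivity
    _ ≤ _ := by
        refine Real.exp_le_exp.2 ?_
        rw [← Finset.mul_sum, div_eq_mul_inv, ← tsum_geometric_of_lt_one (norm_nonneg _) hq]
        gcongr
        exact (summable_geometric_of_lt_one (norm_nonneg _) hq).sum_le_tsum _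
          fun _ _ => by positivity

lemma tendsto_qpochFin (hq : ‖q‖ < 1) (a : ℂ) :
    Tendsto (fun n => ∏ j ∈ Finset.range n, (1 - a * q ^ j)) atTop (𝓝 (qPochInf q a)) :=
  (qpoch_multipliable hq a).tendsto_prod_tprod_nat

lemma norm_qPochInf_le (hq : ‖q‖ < 1) (a : ℂ) :
    ‖qPochInf q a‖ ≤ Real.exp (‖a‖ / (1 - ‖q‖)) :=
  le_of_tendsto (tendsto_qpochFin hq a).norm (.of_forall fun n => norm_qpochFin_le hq a n)

lemma tendsto_mul_pow_zero (hq : ‖q‖ < 1) (a : ℂ) :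
    Tendsto (fun n : ℕ => a * q ^ n) atTop (𝓝 0) := by
  simpa using (tendsto_pow_atTop_nhds_zero_of_norm_lt_one hq).const_mul a

lemma tendsto_qPochInf_mul_pow (hq : ‖q‖ < 1) (a : ℂ) :
    Tendsto (fun n : ℕ => qPochInf q (a * q ^ n)) atTop (𝓝 1) := by
  have := ((continuous_qPochInf hq).tendsto 0).comp (tendsto_mul_pow_zero hq a)
  rwa [qPochInf_zero] at this

lemma qTheta_eq (q z : ℂ) : qTheta q z = qPochInf q z * qPochInf q (q / z) := by
  simp [qTheta, qPochs]

lemma qTheta_mul_q (hq0 : q ≠ 0) (hq : ‖q‖ < 1) {z : ℂ} (hz : z ≠ 0) :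
    qTheta q (q * z) = -qTheta q z / z := by
  rw [qTheta_eq, qTheta_eq, qPochInf_succ hq z, qPochInf_succ hq (q / (q * z))]
  have h1 : q / (q * z) = 1 / z := by field_simp
  have h2 : 1 / z * q = q / z := by field_simp
  rw [h1, h2, mul_comm z q]
  field_simp
  ring

lemma qTheta_div_q (hq0 : q ≠ 0) (hq : ‖q‖ < 1) {z : ℂ} (hz : z ≠ 0) :
    qTheta q (z / q) = -(z / q) * qTheta q z := by
  have h := qTheta_mul_q hq0 hq (z := z / q) (by positivity)
  rw [mul_div_cancel₀ _ hq0] at h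
  rw [h]; field_simp

lemma qTheta_ne_zero_of_annulus (hq : ‖q‖ < 1) {z : ℂ} (h1 : ‖q‖ < ‖z‖)
    (h2 : ‖z‖ < 1) : qTheta q z ≠ 0 := by
  rw [qTheta_eq]
  refine mul_ne_zero (qPochInf_ne_zero_of_norm_lt_one hq h2)
    (qPochInf_ne_zero_of_norm_lt_one hq ?_)
  rw [norm_div, div_lt_one (lt_of_le_of_lt (norm_nonneg _) h1)]
  exact h1

lemma differentiableAt_qTheta (hq : ‖q‖ < 1) {z : ℂ} (hz : z ≠ 0) :
    DifferentiableAt ℂ (qTheta q) z := by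
  have : qTheta q = fun z => qPochInf q z * qPochInf q (q / z) := funext (qTheta_eq q)
  rw [this]
  have h := differentiable_qPochInf hq
  exact (h z).mul ((h _).comp z ((differentiableAt_const q).div differentiableAt_id hz))

lemma qPochInf_mul_neg (hq : ‖q‖ < 1) (a : ℂ) :
    qPochInf q a * qPochInf q (-a) = qPochInf (q ^ 2) (a ^ 2) := by
  unfold qPochInf
  rw [← (qpoch_multipliable hq a).tprod_mul (qpoch_multipliable hq (-a))]
  congr 1; funext n; ring

lemma qPochInf_even_odd (hq : ‖q‖ < 1) (a : ℂ) :
    qPochInf q a = qPochInf (q ^ 2) a * qPochInf (q ^ 2) (a * q) := by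
  have hq2 : ‖q ^ 2‖ < 1 := by rw [norm_pow]; exact pow_lt_one₀ (norm_nonneg _) hq two_ne_zero
  have h1 : (fun k : ℕ => (1 - a * (q ^ 2) ^ k)) = fun k => (1 - a * q ^ (2 * k)) := by
    funext k; rw [pow_mul]
  have h2 : (fun k : ℕ => (1 - a * q * (q ^ 2) ^ k)) = fun k => (1 - a * q ^ (2 * k + 1)) := by
    funext k; rw [pow_succ q (2 * k), pow_mul]; ring
  have := tprod_even_mul_odd (f := fun n : ℕ => (1 - a * q ^ n))
    (h1 ▸ qpoch_multipliable hq2 a) (h2 ▸ qpoch_multipliable hq2 (a * q))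
  unfold qPochInf
  rw [← this, h1, h2]

end QPoch

/-! ### Circle averages -/

section CircleAverages

open Real (circleAverage)
open Metric (sphere ball closedBall)

lemma circleMap_mem_sphere_zero {r : ℝ} (hr : 0 < r) (θ : ℝ) : circleMap 0 r θ ∈ sphere (0 : ℂ) r :=
  circleMap_mem_sphere 0 hr.le θ

lemma ContinuousOn.comp_circleMap {f : ℂ → ℂ} {r : ℝ} (hr : 0 < r)
    (hf : ContinuousOn f (sphere 0 r)) : Continuous fun θ => f (circleMap 0 r θ) :=
  hf.comp_continuous (continuous_circleMap 0 r) (circleMap_mem_sphere_zero hr)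

lemma circleIntegrable_of_continuousOn {f : ℂ → ℂ} {r : ℝ} (hr : 0 < r)
    (hf : ContinuousOn f (sphere 0 r)) : CircleIntegrable f 0 r :=
  hf.circleIntegrable hr.le

lemma circleAverage_add_of_continuousOn {f g : ℂ → ℂ} {r : ℝ} (hr : 0 < r)
    (hf : ContinuousOn f (sphere 0 r)) (hg : ContinuousOn g (sphere 0 r)) :
    circleAverage (fun z => f z + g z) 0 r = circleAverage f 0 r + circleAverage g 0 r :=
  Real.circleAverage_fun_add (circleIntegrable_of_continuousOn hr hf)
    (circleIntegrable_of_continuousOn hr hg)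

lemma circleAverage_sub_of_continuousOn {f g : ℂ → ℂ} {r : ℝ} (hr : 0 < r)
    (hf : ContinuousOn f (sphere 0 r)) (hg : ContinuousOn g (sphere 0 r)) :
    circleAverage (fun z => f z - g z) 0 r = circleAverage f 0 r - circleAverage g 0 r :=
  Real.circleAverage_fun_sub (circleIntegrable_of_continuousOn hr hf)
    (circleIntegrable_of_continuousOn hr hg)

lemma circleAverage_congr_on {f g : ℂ → ℂ} {r : ℝ} (hr : 0 < r)
    (h : ∀ z, ‖z‖ = r → f z = g z) : circleAverage f 0 r = circleAverage g 0 r :=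
  Real.circleAverage_congr_sphere fun z hz => h z (by simpa [abs_of_pos hr] using hz)

lemma norm_circleAverage_le {f : ℂ → ℂ} {r M : ℝ} (hr : 0 < r)
    (h : ∀ z, ‖z‖ = r → ‖f z‖ ≤ M) : ‖circleAverage f 0 r‖ ≤ M := by
  rw [Real.circleAverage_def, norm_smul]
  have := intervalIntegral.norm_integral_le_of_norm_le_const (a := 0) (b := 2 * Real.pi)
    (f := fun θ => f (circleMap 0 r θ)) (C := M)
    (fun θ _ => h _ (by simpa using circleMap_mem_sphere_zero hr θ))
  have hpi := Real.pi_pos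
  rw [sub_zero, abs_of_pos (by positivity)] at this
  rw [norm_inv, Real.norm_of_nonneg (by positivity : (0:ℝ) ≤ 2 * Real.pi)]
  calc _ ≤ (2 * Real.pi)⁻¹ * (M * (2 * Real.pi)) := by gcongr
    _ = M := by field_simp

lemma circleAverage_const_mul (c : ℂ) (f : ℂ → ℂ) (r : ℝ) :
    circleAverage (fun z => c * f z) 0 r = c * circleAverage f 0 r := by
  simpa using Real.circleAverage_fun_smul (a := c) (f := f) (c := 0) (R := r)

lemma circleAverage_lin_comb {f g : ℂ → ℂ} {r : ℝ} (hr : 0 < r)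
    (hf : ContinuousOn f (sphere 0 r)) (hg : ContinuousOn g (sphere 0 r)) (c d : ℂ) :
    circleAverage (fun z => c * f z - d * g z) 0 r =
      c * circleAverage f 0 r - d * circleAverage g 0 r := by
  have hf' : ContinuousOn (fun z => c * f z) (sphere 0 r) := continuousOn_const.mul hf
  have hg' : ContinuousOn (fun z => d * g z) (sphere 0 r) := continuousOn_const.mul hg
  rw [circleAverage_sub_of_continuousOn hr hf' hg', circleAverage_const_mul,
    circleAverage_const_mul]

/-- Multiplication by c stretches by ‖c‖ and rotates by arg c, and the rotation is absorbed by
periodicity in the angle. This turns the substitution z ↦ qz into a change of radius, the basic move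
behind all the q-difference equations. -/
lemma circleAverage_mul_left (c : ℂ) (f : ℂ → ℂ) (r : ℝ) :
    circleAverage (fun z => f (c * z)) 0 r = circleAverage f 0 (‖c‖ * r) := by
  rw [Real.circleAverage_def, Real.circleAverage_eq_integral_add (Complex.arg c)]
  congr 1
  refine intervalIntegral.integral_congr fun θ _ => ?_
  simp only [circleMap, zero_add]
  congr 1
  push_cast
  rw [add_mul, Complex.exp_add]
  nth_rewrite 1 [← Complex.norm_mul_exp_arg_mul_I c]
  ring

lemma circleAverage_neg_arg (f : ℂ → ℂ) (r : ℝ) :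
    circleAverage (fun z => f (-z)) 0 r = circleAverage f 0 r := by
  have := circleAverage_mul_left (-1) f r
  simpa using this

lemma circleAverage_annulus {f : ℂ → ℂ} {r R : ℝ} (hr : 0 < r) (hrR : r ≤ R)
    (h : ∀ z, r ≤ ‖z‖ → ‖z‖ ≤ R → DifferentiableAt ℂ f z) :
    circleAverage f 0 R = circleAverage f 0 r := by
  rw [Real.circleAverage_eq_circleIntegral (by linarith),
    Real.circleAverage_eq_circleIntegral hr.ne']
  congr 1
  refine Complex.circleIntegral_sub_center_inv_smul_eq_of_differentiable_on_annulus_off_countable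
    hr hrR Set.countable_empty (fun z hz => ?_) (fun z hz => ?_)
  · simp only [Set.mem_sdiff, Metric.mem_closedBall, dist_zero_right, Metric.mem_ball, not_lt] at hz
    exact (h z hz.2 hz.1).continuousAt.continuousWithinAt
  · simp only [Set.mem_sdiff, Metric.mem_closedBall, dist_zero_right, Metric.mem_ball, not_le,
      Set.mem_empty_iff_false, not_false_eq_true, and_true] at hz
    exact h z hz.2.le hz.1.le

lemma circleAverage_eq_of_differentiable {f : ℂ → ℂ} {r R : ℝ} (hr : 0 < r) (hR : 0 < R)
    (h : ∀ z, min r R ≤ ‖z‖ → ‖z‖ ≤ max r R → DifferentiableAt ℂ f z) :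
    circleAverage f 0 R = circleAverage f 0 r := by
  rcases le_total r R with hle | hle
  · exact circleAverage_annulus hr hle (by simpa [hle] using h)
  · exact (circleAverage_annulus hR hle (by simpa [hle] using h)).symm

lemma circleAverage_eq_center {f : ℂ → ℂ} {r : ℝ} (hr : 0 < r)
    (h : ∀ z, ‖z‖ ≤ r → DifferentiableAt ℂ f z) : circleAverage f 0 r = f 0 := by
  refine circleAverage_of_differentiable_on_off_countable Set.countable_empty
    (fun z hz => ?_) (fun z hz => ?_)
  · exact (h z (by simpa [abs_of_pos hr] using hz)).continuousAt.continuousWithinAt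
  · exact h z (by simpa [abs_of_pos hr] using (Metric.ball_subset_closedBall hz.1))

/-- The contribution of a simple pole between two circles. -/
lemma circleAverage_sub_of_pole {φ : ℂ → ℂ} {r R : ℝ} {a : ℂ} (hr : 0 < r) (h1 : r < ‖a‖)
    (h2 : ‖a‖ < R) (h : ∀ z, r ≤ ‖z‖ → ‖z‖ ≤ R → DifferentiableAt ℂ φ z) :
    circleAverage (fun z => z / (z - a) * φ z) 0 R -
      circleAverage (fun z => z / (z - a) * φ z) 0 r = φ a := by
  have hR : 0 < R := by linarith
  -- Splitting off φ(a): the difference quotient is holomorphic in the annulus, so its average is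
  -- the same on both circles, while z/(z - a) averages to 1 outside and to 0 inside.
  have key : ∀ ρ, 0 < ρ → r ≤ ρ → ρ ≤ R → ρ ≠ ‖a‖ →
      circleAverage (fun z => z / (z - a) * φ z) 0 ρ =
        circleAverage (fun z => z * dslope φ a z) 0 ρ +
          φ a * circleAverage (fun z => z / (z - a)) 0 ρ := by
    intro ρ hρ hρ1 hρ2 hne
    have hna : ∀ z : ℂ, z ∈ sphere (0:ℂ) ρ → z - a ≠ 0 := by
      intro z hz h0
      rw [sub_eq_zero] at h0
      simp at hz
      exact hne (by rw [← hz, h0])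
    have hc1 : ContinuousOn (fun z : ℂ => z / (z - a)) (sphere 0 ρ) :=
      continuousOn_id.div (continuousOn_id.sub continuousOn_const) hna
    have hφ : ContinuousOn φ (sphere 0 ρ) := fun z hz => by
      simp at hz
      exact (h z (by linarith) (by linarith)).continuousAt.continuousWithinAt
    have hds : ContinuousOn (dslope φ a) (sphere 0 ρ) := by
      refine ContinuousOn.congr (f := fun z => (φ z - φ a) / (z - a))
        ((hφ.sub continuousOn_const).div (continuousOn_id.sub continuousOn_const) hna) ?_
      intro z hz
      rw [dslope_of_ne _ (sub_ne_zero.1 (hna z hz)), slope_def_field]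
    rw [← circleAverage_const_mul, ← circleAverage_add_of_continuousOn hρ
      (f := fun z => z * dslope φ a z) (g := fun z => φ a * (z / (z - a)))
      (continuousOn_id.mul hds) (continuousOn_const.mul hc1)]
    refine circleAverage_congr_on hρ fun z hz => ?_
    have := hna z (by simpa using hz)
    rw [dslope_of_ne _ (sub_ne_zero.1 this), slope_def_field]
    field_simp
    ring
  rw [key R hR (by linarith) le_rfl h2.ne', key r hr le_rfl (by linarith) h1.ne]
  have e1 : circleAverage (fun z => z * dslope φ a z) 0 R =
      circleAverage (fun z => z * dslope φ a z) 0 r := by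
    refine circleAverage_annulus hr (by linarith) fun z hz1 hz2 => ?_
    refine differentiableAt_id.mul ?_
    rcases eq_or_ne z a with rfl | hza
    · have hev : DifferentiableOn ℂ φ (ball 0 R \ closedBall 0 r) := fun w hw => by
        simp at hw
        exact (h w (by linarith) (by linarith)).differentiableWithinAt
      have hop : IsOpen (ball (0:ℂ) R \ closedBall 0 r) :=
        Metric.isOpen_ball.sdiff Metric.isClosed_closedBall
      have hmem : (ball (0:ℂ) R \ closedBall 0 r) ∈ 𝓝 z := hop.mem_nhds (by simp [h1, h2])
      exact ((Complex.differentiableOn_dslope hmem).2 hev).differentiableAt hmem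
    · exact (differentiableAt_dslope_of_ne hza).2 (h z hz1 hz2)
  have e2 : circleAverage (fun z => z / (z - a)) 0 R = 1 := by
    have := circleAverage_sub_sub_inv_smul_of_differentiable_on_off_countable (c := 0) (R := R)
      (w := a) (f := fun _ => (1:ℂ)) Set.countable_empty continuousOn_const
      (fun z _ => differentiableAt_const _) (by simpa [abs_of_pos hR] using h2)
    simpa using this
  have e3 : circleAverage (fun z => z / (z - a)) 0 r = 0 := by
    rw [circleAverage_eq_center hr]
    · simp
    · intro z hz
      refine differentiableAt_id.div (differentiableAt_id.sub_const a) ?_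
      intro h0
      simp only [sub_eq_zero] at h0
      rw [h0] at hz; linarith
  rw [e1, e2, e3]; ring

lemma continuous_circleAverage_param {X : Type*} [TopologicalSpace X] [FirstCountableTopology X]
    {F : X → ℂ → ℂ} {r : ℝ}
    (h : Continuous fun p : X × ℝ => F p.1 (circleMap 0 r p.2)) :
    Continuous fun x => circleAverage (F x) 0 r := by
  unfold circleAverage
  exact (intervalIntegral.continuous_parametric_intervalIntegral_of_continuous'
    (f := fun x θ => F x (circleMap 0 r θ)) h _ _).const_smul _

lemma continuousOn_circleAverage_param {X : Type*} [TopologicalSpace X]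
    [FirstCountableTopology X] {K : Set X} {F : X → ℂ → ℂ} {r : ℝ} (hr : 0 < r)
    (h : ContinuousOn (fun p : X × ℂ => F p.1 p.2) (K ×ˢ sphere 0 r)) :
    ContinuousOn (fun x => circleAverage (F x) 0 r) K := by
  rw [continuousOn_iff_continuous_domRestrict]
  refine continuous_circleAverage_param (X := K) (F := fun x => F x) ?_
  exact h.comp_continuous (f := fun p : K × ℝ => ((p.1 : X), circleMap 0 r p.2))
    (by fun_prop) fun p => ⟨p.1.2, circleMap_mem_sphere_zero hr _⟩

lemma circleAverage_swap {F : ℂ → ℂ → ℂ} {r ρ : ℝ} (hr : 0 < r) (hρ : 0 < ρ)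
    (h : ContinuousOn (fun p : ℂ × ℂ => F p.1 p.2) (sphere 0 r ×ˢ sphere 0 ρ)) :
    circleAverage (fun z => circleAverage (fun w => F z w) 0 ρ) 0 r =
      circleAverage (fun w => circleAverage (fun z => F z w) 0 r) 0 ρ := by
  have hc : Continuous fun p : ℝ × ℝ => F (circleMap 0 r p.1) (circleMap 0 ρ p.2) :=
    h.comp_continuous (f := fun p : ℝ × ℝ => (circleMap 0 r p.1, circleMap 0 ρ p.2))
    (by fun_prop) fun p => ⟨circleMap_mem_sphere_zero hr _, circleMap_mem_sphere_zero hρ _⟩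
  simp only [Real.circleAverage_def, intervalIntegral.integral_smul]
  congr 2
  have hpi : (0:ℝ) ≤ 2 * Real.pi := by positivity
  simp only [intervalIntegral.integral_of_le hpi]
  refine MeasureTheory.integral_integral_swap
    (f := fun θ φ => F (circleMap 0 r θ) (circleMap 0 ρ φ)) ?_
  rw [MeasureTheory.Measure.prod_restrict]
  refine MeasureTheory.IntegrableOn.mono_set (t := Set.Icc 0 (2 * Real.pi) ×ˢ Set.Icc 0 (2 * Real.pi))
    ?_ (Set.prod_mono Set.Ioc_subset_Icc_self Set.Ioc_subset_Icc_self)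
  exact hc.continuousOn.integrableOn_compact (isCompact_Icc.prod isCompact_Icc)

lemma hasSum_circleAverage {F : ℕ → ℂ → ℂ} {f : ℂ → ℂ} {u : ℕ → ℝ} {r : ℝ} (hr : 0 < r)
    (hF : ∀ n, ContinuousOn (F n) (sphere 0 r)) (hu : Summable u)
    (hb : ∀ n z, ‖z‖ = r → ‖F n z‖ ≤ u n) (hs : ∀ z, ‖z‖ = r → HasSum (fun n => F n z) (f z)) :
    HasSum (fun n => circleAverage (F n) 0 r) (circleAverage f 0 r) := by
  unfold circleAverage
  refine HasSum.const_smul _ ?_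
  have hn : ∀ θ, ‖circleMap 0 r θ‖ = r := fun θ => by
    simpa using circleMap_mem_sphere_zero hr θ
  refine intervalIntegral.hasSum_integral_of_dominated_convergence (fun n _ => u n)
    (fun n => ((hF n).comp_circleMap hr).aestronglyMeasurable)
    (fun n => .of_forall fun θ _ => hb n _ (hn θ)) (.of_forall fun _ _ => hu)
    (by simp) (.of_forall fun θ _ => hs _ (hn θ))

end CircleAverages

/-! ### The Askey–Wilson integral -/

section AskeyWilson

open Real (circleAverage)
open Metric (sphere ball closedBall)

variable {q : ℂ}

/-- `(a z, a / z; q)_∞`. -/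
def qPair (q a z : ℂ) : ℂ := qPochInf q (a * z) * qPochInf q (a * z⁻¹)

/-- `(z ^ 2, z ^ (-2); q)_∞`. -/
def qWeyl (q z : ℂ) : ℂ := qPochInf q (z ^ 2) * qPochInf q ((z ^ 2)⁻¹)

lemma qPair_succ (hq : ‖q‖ < 1) (a z : ℂ) :
    qPair q a z = (1 - a * z) * (1 - a * z⁻¹) * qPair q (a * q) z := by
  unfold qPair
  rw [qPochInf_succ hq (a * z), qPochInf_succ hq (a * z⁻¹), mul_right_comm a z q,
    mul_right_comm a z⁻¹ q]
  ring

lemma qPair_ne_zero (hq : ‖q‖ < 1) {a z : ℂ} (ha : ‖a‖ < 1) (hz : ‖z‖ = 1) : qPair q a z ≠ 0 :=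
  mul_ne_zero (qPochInf_ne_zero_of_norm_lt_one hq (by simp [hz, ha]))
    (qPochInf_ne_zero_of_norm_lt_one hq (by simp [hz, ha]))

lemma continuousOn_qPair (hq : ‖q‖ < 1) :
    ContinuousOn (fun p : ℂ × ℂ => qPair q p.1 p.2) {p | p.2 ≠ 0} := by
  have h := continuous_qPochInf hq
  unfold qPair
  refine (h.comp_continuousOn (by fun_prop)).mul (h.comp_continuousOn ?_)
  exact continuousOn_fst.mul (continuousOn_snd.inv₀ fun _ h => h)

lemma continuousOn_qPair_right (hq : ‖q‖ < 1) (a : ℂ) {r : ℝ} (hr : 0 < r) :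
    ContinuousOn (fun z => qPair q a z) (sphere 0 r) := by
  refine (continuousOn_qPair hq).comp (f := fun z => (a, z)) (by fun_prop) fun z hz => ?_
  simp only [Set.mem_ofPred_eq]
  rintro rfl
  simp at hz; linarith

lemma continuousOn_qWeyl (hq : ‖q‖ < 1) {r : ℝ} (hr : 0 < r) :
    ContinuousOn (fun z => qWeyl q z) (sphere 0 r) := by
  have h := continuous_qPochInf hq
  unfold qWeyl
  refine (h.comp_continuousOn (by fun_prop)).mul (h.comp_continuousOn ?_)
  refine ContinuousOn.inv₀ (by fun_prop) fun z hz h0 => ?_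
  simp at hz
  rw [pow_eq_zero_iff two_ne_zero] at h0
  simp [h0] at hz; linarith

/-- The Askey–Wilson integral. -/
def askeyWilson (q a b c d : ℂ) : ℂ :=
  circleAverage (fun z => qWeyl q z / (qPair q a z * qPair q b z * qPair q c z * qPair q d z)) 0 1

lemma ne_zero_of_norm_eq_one {z : ℂ} (hz : ‖z‖ = 1) : z ≠ 0 := by
  rintro rfl; simp at hz

lemma continuousOn_askeyWilson_integrand (hq : ‖q‖ < 1) {a b c d : ℂ} (ha : ‖a‖ < 1)
    (hb : ‖b‖ < 1) (hc : ‖c‖ < 1) (hd : ‖d‖ < 1) :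
    ContinuousOn (fun z => qWeyl q z / (qPair q a z * qPair q b z * qPair q c z * qPair q d z))
      (sphere 0 1) := by
  have hp := fun a => continuousOn_qPair_right hq a one_pos
  refine (continuousOn_qWeyl hq one_pos).div ((((hp a).mul (hp b)).mul (hp c)).mul (hp d)) ?_
  intro z hz
  have hz : ‖z‖ = 1 := by simpa using hz
  have h := fun {a : ℂ} (ha : ‖a‖ < 1) => qPair_ne_zero hq ha hz
  exact mul_ne_zero (mul_ne_zero (mul_ne_zero (h ha) (h hb)) (h hc)) (h hd)

lemma continuousOn_askeyWilson (hq : ‖q‖ < 1) {b c d : ℂ}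
    (hb : ‖b‖ < 1) (hc : ‖c‖ < 1) (hd : ‖d‖ < 1) :
    ContinuousOn (fun a => askeyWilson q a b c d) (ball 0 1) := by
  refine continuousOn_circleAverage_param one_pos ?_
  have hz0 : ∀ p ∈ ball (0:ℂ) 1 ×ˢ sphere (0:ℂ) 1, ‖p.2‖ = 1 := fun p hp => by simpa using hp.2
  have hp := fun a => (continuousOn_qPair_right hq a one_pos).comp
    (s := ball (0:ℂ) 1 ×ˢ sphere (0:ℂ) 1) continuousOn_snd fun p hp => hp.2
  have hp1 : ContinuousOn (fun p : ℂ × ℂ => qPair q p.1 p.2) (ball (0:ℂ) 1 ×ˢ sphere (0:ℂ) 1) :=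
    (continuousOn_qPair hq).mono fun p hp => ne_zero_of_norm_eq_one (hz0 p hp)
  have hw := (continuousOn_qWeyl hq one_pos).comp
    (s := ball (0:ℂ) 1 ×ˢ sphere (0:ℂ) 1) continuousOn_snd fun p hp => hp.2
  refine hw.div (((hp1.mul (hp b)).mul (hp c)).mul (hp d)) ?_
  intro p hp
  have h := fun {a : ℂ} (ha : ‖a‖ < 1) => qPair_ne_zero hq ha (hz0 p hp)
  exact mul_ne_zero (mul_ne_zero (mul_ne_zero (h (by simpa using hp.1)) (h hb)) (h hc)) (h hd)

/-- The function g is holomorphic in 1 ≤ ‖z‖ ≤ ‖q‖⁻¹, so its average over the outer circle is that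
over the unit circle. But g(z/q) = -g(1/z), and inversion preserves averages over the unit circle,
so the average equals its own negative. -/
lemma askeyWilson_aux (hq0 : q ≠ 0) (hq : ‖q‖ < 1) {a b c d : ℂ} (ha : ‖a‖ < 1)
    (hb : ‖b‖ < 1) (hc : ‖c‖ < 1) (hd : ‖d‖ < 1) {g : ℂ → ℂ}
    (hg : g = fun z => qPochInf q (q * z ^ 2) * qPochInf q ((z ^ 2)⁻¹) /
      (z * ((qPochInf q (q * a * z) * qPochInf q (a * z⁻¹)) *
      (qPochInf q (q * b * z) * qPochInf q (b * z⁻¹)) *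
      (qPochInf q (q * c * z) * qPochInf q (c * z⁻¹)) *
      (qPochInf q (q * d * z) * qPochInf q (d * z⁻¹))))) :
    circleAverage g 0 1 = 0 := by
  have hqpos : 0 < ‖q‖ := norm_pos_iff.2 hq0
  have h1 : circleAverage g 0 ‖q⁻¹‖ = circleAverage g 0 1 := by
    refine circleAverage_annulus one_pos ?_ fun z hz1 hz2 => ?_
    · rw [norm_inv]; exact (one_le_inv₀ hqpos).2 hq.le
    · have hz0 : z ≠ 0 := by rintro rfl; norm_num at hz1
      have hP := differentiable_qPochInf hq
      have hzq : ‖q‖ * ‖z‖ ≤ 1 := by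
        rw [norm_inv] at hz2
        calc ‖q‖ * ‖z‖ ≤ ‖q‖ * ‖q‖⁻¹ := by gcongr
          _ = 1 := mul_inv_cancel₀ hqpos.ne'
      have hn : ∀ {a : ℂ}, ‖a‖ < 1 → qPochInf q (q * a * z) * qPochInf q (a * z⁻¹) ≠ 0 := by
        intro a ha
        refine mul_ne_zero (qPochInf_ne_zero_of_norm_lt_one hq ?_)
          (qPochInf_ne_zero_of_norm_lt_one hq ?_)
        · rw [norm_mul, norm_mul]
          calc ‖q‖ * ‖a‖ * ‖z‖ = ‖a‖ * (‖q‖ * ‖z‖) := by ring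
            _ ≤ ‖a‖ * 1 := by gcongr
            _ < 1 := by simpa
        · rw [norm_mul, norm_inv]
          calc ‖a‖ * ‖z‖⁻¹ ≤ ‖a‖ * 1 := by gcongr; exact inv_le_one_of_one_le₀ hz1
            _ < 1 := by simpa
      have hinv : DifferentiableAt ℂ (fun z : ℂ => z⁻¹) z := differentiableAt_inv hz0
      have hd' : ∀ a : ℂ, DifferentiableAt ℂ
          (fun z => qPochInf q (q * a * z) * qPochInf q (a * z⁻¹)) z := fun a =>
        ((hP _).comp z (by fun_prop)).mul ((hP _).comp z (hinv.const_mul a))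
      rw [hg]
      refine DifferentiableAt.div (((hP _).comp z (by fun_prop)).mul
        ((hP _).comp z (DifferentiableAt.inv (by fun_prop) (pow_ne_zero 2 hz0))))
        (differentiableAt_id.mul ((((hd' a).mul (hd' b)).mul (hd' c)).mul (hd' d))) ?_
      exact mul_ne_zero hz0 (mul_ne_zero (mul_ne_zero (mul_ne_zero (hn ha) (hn hb)) (hn hc)) (hn hd))
  have h2 : circleAverage (fun z => g (q⁻¹ * z)) 0 1 = circleAverage g 0 1 := by
    rw [circleAverage_mul_left q⁻¹ g 1, mul_one, h1]
  have h3 : circleAverage (fun z => g (q⁻¹ * z)) 0 1 = circleAverage (fun z => -1 * g z⁻¹) 0 1 := by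
    refine circleAverage_congr_on one_pos fun z hz => ?_
    have hz0 := ne_zero_of_norm_eq_one hz
    have e1 : q * (q⁻¹ * z) ^ 2 = z ^ 2 / q := by field_simp
    have e2 : ((q⁻¹ * z) ^ 2)⁻¹ = q * (z ^ 2)⁻¹ * q := by field_simp
    have e3 : ∀ a : ℂ, q * a * (q⁻¹ * z) = a * z := fun a => by field_simp
    have e4 : ∀ a : ℂ, a * (q⁻¹ * z)⁻¹ = q * a * z⁻¹ := fun a => by field_simp
    have e5 : q * z⁻¹ ^ 2 = q * (z ^ 2)⁻¹ := by field_simp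
    have e6 : (z⁻¹ ^ 2)⁻¹ = z ^ 2 := by field_simp
    have e7 : z ^ 2 / q * q = z ^ 2 := by field_simp
    simp only [hg, e1, e2, e3, e4, e5, e6, inv_inv]
    rw [qPochInf_succ hq (z ^ 2 / q), e7, qPochInf_succ hq (q * (z ^ 2)⁻¹)]
    have : q⁻¹ * z ≠ 0 := by positivity
    generalize qPochInf q (q * (z ^ 2)⁻¹ * q) = X
    have hD : ∀ A B C D A' B' C' D' : ℂ, A * A' * (B * B') * (C * C') * (D * D') =
      A' * A * (B' * B) * (C' * C) * (D' * D) := fun _ _ _ _ _ _ _ _ => by ring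
    rw [hD]
    generalize (qPochInf q (q * a * z⁻¹) * qPochInf q (a * z) *
      (qPochInf q (q * b * z⁻¹) * qPochInf q (b * z)) *
      (qPochInf q (q * c * z⁻¹) * qPochInf q (c * z)) *
      (qPochInf q (q * d * z⁻¹) * qPochInf q (d * z))) = D
    rcases eq_or_ne D 0 with rfl | hD
    · simp
    field_simp
    ring
  have h4 := Real.circleAverage_zero_one_congr_inv (f := g)
  rw [circleAverage_const_mul, h4] at h3
  rw [h3] at h2
  linear_combination (-1 / 2 : ℂ) * h2

/-- X, Y, A1, …, D2 stand for the infinite products that are left once their first factors are split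
off. They cancel, and the Laurent polynomial identity `hp` remains. -/
lemma askeyWilson_pointwise {z a b c d X Y A1 A2 B1 B2 C1 C2 D1 D2 : ℂ} (hz : z ≠ 0)
    (a1 : 1 - a * z ≠ 0) (a2 : 1 - a * z⁻¹ ≠ 0) (a3 : A1 ≠ 0) (a4 : A2 ≠ 0)
    (b1 : 1 - b * z ≠ 0) (b2 : 1 - b * z⁻¹ ≠ 0) (b3 : B1 ≠ 0) (b4 : B2 ≠ 0)
    (c1 : 1 - c * z ≠ 0) (c2 : 1 - c * z⁻¹ ≠ 0) (c3 : C1 ≠ 0) (c4 : C2 ≠ 0)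
    (d1 : 1 - d * z ≠ 0) (d2 : 1 - d * z⁻¹ ≠ 0) (d3 : D1 ≠ 0) (d4 : D2 ≠ 0) :
    (1 - a * b * c * d) * ((1 - z ^ 2) * X * ((1 - z⁻¹ ^ 2) * Y) /
        (A1 * A2 * ((1 - b * z) * B1 * ((1 - b * z⁻¹) * B2)) *
        ((1 - c * z) * C1 * ((1 - c * z⁻¹) * C2)) * ((1 - d * z) * D1 * ((1 - d * z⁻¹) * D2)))) -
      (1 - a * b) * (1 - a * c) * (1 - a * d) * ((1 - z ^ 2) * X * ((1 - z⁻¹ ^ 2) * Y) /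
        ((1 - a * z) * (1 - a * z⁻¹) * (A1 * A2) * ((1 - b * z) * B1 * ((1 - b * z⁻¹) * B2)) *
        ((1 - c * z) * C1 * ((1 - c * z⁻¹) * C2)) * ((1 - d * z) * D1 * ((1 - d * z⁻¹) * D2)))) =
    -a * (X * ((1 - z⁻¹ ^ 2) * Y) / (z * (A1 * ((1 - a * z⁻¹) * A2) * (B1 * ((1 - b * z⁻¹) * B2)) *
        (C1 * ((1 - c * z⁻¹) * C2)) * (D1 * ((1 - d * z⁻¹) * D2)))) +
      Y * ((1 - z ^ 2) * X) / (z⁻¹ * (A2 * ((1 - a * z) * A1) * (B2 * ((1 - b * z) * B1)) *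
        (C2 * ((1 - c * z) * C1)) * (D2 * ((1 - d * z) * D1))))) := by
  have hp : (1 - a * b * c * d) * ((1 - z ^ 2) * (1 - z⁻¹ ^ 2)) * ((1 - a * z) * (1 - a * z⁻¹)) -
      (1 - a * b) * (1 - a * c) * (1 - a * d) * ((1 - z ^ 2) * (1 - z⁻¹ ^ 2)) =
      -a * ((1 - z⁻¹ ^ 2) * ((1 - a * z) * (1 - b * z) * (1 - c * z) * (1 - d * z)) / z +
      (1 - z ^ 2) * ((1 - a * z⁻¹) * (1 - b * z⁻¹) * (1 - c * z⁻¹) * (1 - d * z⁻¹)) / z⁻¹) := by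
    field_simp
    ring
  have hy : z⁻¹ ≠ 0 := inv_ne_zero hz
  generalize z⁻¹ = y at *
  generalize 1 - a * z = e1 at *
  generalize 1 - a * y = e2 at *
  generalize 1 - b * z = e3 at *
  generalize 1 - b * y = e4 at *
  generalize 1 - c * z = e5 at *
  generalize 1 - c * y = e6 at *
  generalize 1 - d * z = e7 at *
  generalize 1 - d * y = e8 at *
  generalize 1 - a * b * c * d = f1 at *
  generalize (1 - a * b) * (1 - a * c) * (1 - a * d) = f2 at *
  field_simp at hp ⊢
  linear_combination (X * Y) * hp

/-- The two sides differ by the average of a multiple of g(z) + g(1/z), with the g of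
`askeyWilson_aux`, and each of these has average zero. -/
lemma askeyWilson_shift (hq0 : q ≠ 0) (hq : ‖q‖ < 1) {a b c d : ℂ} (ha : ‖a‖ < 1)
    (hb : ‖b‖ < 1) (hc : ‖c‖ < 1) (hd : ‖d‖ < 1) :
    (1 - a * b) * (1 - a * c) * (1 - a * d) * askeyWilson q a b c d =
      (1 - a * b * c * d) * askeyWilson q (a * q) b c d := by
  obtain ⟨g, hg⟩ : ∃ g : ℂ → ℂ, g = fun z => qPochInf q (q * z ^ 2) * qPochInf q ((z ^ 2)⁻¹) /
      (z * ((qPochInf q (q * a * z) * qPochInf q (a * z⁻¹)) *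
      (qPochInf q (q * b * z) * qPochInf q (b * z⁻¹)) *
      (qPochInf q (q * c * z) * qPochInf q (c * z⁻¹)) *
      (qPochInf q (q * d * z) * qPochInf q (d * z⁻¹)))) := ⟨_, rfl⟩
  have h0 := askeyWilson_aux hq0 hq ha hb hc hd hg
  have haq : ‖a * q‖ < 1 := by simpa using norm_mul_pow_lt_one hq ha 1
  have hcont1 := continuousOn_askeyWilson_integrand hq haq hb hc hd
  have hcont2 := continuousOn_askeyWilson_integrand hq ha hb hc hd
  have hP := continuous_qPochInf hq
  have hsph : ∀ z ∈ sphere (0:ℂ) 1, ‖z‖ = 1 := fun z hz => by simpa using hz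
  have hqm : ∀ {a : ℂ}, ‖a‖ < 1 → ‖q * a‖ < 1 := fun {a} ha => by
    simpa [mul_comm] using norm_mul_pow_lt_one hq ha 1
  have hn : ∀ {a z : ℂ}, ‖a‖ < 1 → ‖z‖ = 1 →
      qPochInf q (q * a * z) * qPochInf q (a * z⁻¹) ≠ 0 := fun {a z} ha hz =>
    mul_ne_zero (qPochInf_ne_zero_of_norm_lt_one hq (by
      rw [norm_mul, hz, mul_one]; exact hqm ha))
      (qPochInf_ne_zero_of_norm_lt_one hq (by simp [hz, ha]))
  have hgc : ContinuousOn g (sphere 0 1) := by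
    have hinv : ContinuousOn (fun z : ℂ => z⁻¹) (sphere 0 1) :=
      continuousOn_id.inv₀ fun z hz => ne_zero_of_norm_eq_one (hsph z hz)
    have hd' : ∀ a : ℂ, ContinuousOn (fun z => qPochInf q (q * a * z) * qPochInf q (a * z⁻¹))
        (sphere 0 1) := fun a => (hP.comp_continuousOn (by fun_prop)).mul
          (hP.comp_continuousOn (continuousOn_const.mul hinv))
    rw [hg]
    refine ContinuousOn.div ((hP.comp_continuousOn (by fun_prop)).mul (hP.comp_continuousOn
      (ContinuousOn.inv₀ (by fun_prop) fun z hz =>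
        pow_ne_zero 2 (ne_zero_of_norm_eq_one (hsph z hz)))))
      (continuousOn_id.mul ((((hd' a).mul (hd' b)).mul (hd' c)).mul (hd' d))) ?_
    intro z hz
    have hz := hsph z hz
    exact mul_ne_zero (ne_zero_of_norm_eq_one hz)
      (mul_ne_zero (mul_ne_zero (mul_ne_zero (hn ha hz) (hn hb hz)) (hn hc hz)) (hn hd hz))
  have hgi : ContinuousOn (fun z => g z⁻¹) (sphere 0 1) :=
    hgc.comp (continuousOn_id.inv₀ fun z hz => ne_zero_of_norm_eq_one (hsph z hz))
      fun z hz => by simpa using hz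
  have key : circleAverage (fun z => (1 - a * b * c * d) *
        (qWeyl q z / (qPair q (a * q) z * qPair q b z * qPair q c z * qPair q d z)) -
      (1 - a * b) * (1 - a * c) * (1 - a * d) *
        (qWeyl q z / (qPair q a z * qPair q b z * qPair q c z * qPair q d z))) 0 1 =
      circleAverage (fun z => -a * (g z + g z⁻¹)) 0 1 := by
    refine circleAverage_congr_on one_pos fun z hz => ?_
    have hz0 := ne_zero_of_norm_eq_one hz
    have hzi : ‖z⁻¹‖ = 1 := by simp [hz]
    have e1 : q * z⁻¹ ^ 2 = (z ^ 2)⁻¹ * q := by field_simp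
    have e2 : (z⁻¹ ^ 2)⁻¹ = z ^ 2 := by field_simp
    have f : ∀ a z : ℂ, qPochInf q (a * z) = (1 - a * z) * qPochInf q (q * a * z) := fun a z => by
      rw [qPochInf_succ hq (a * z)]; ring_nf
    simp only [hg, e1, e2, qWeyl]
    rw [qPair_succ hq a z]
    have hA := qPair_ne_zero hq haq hz
    simp only [qPair] at hA ⊢
    rw [qPochInf_succ hq (z ^ 2), qPochInf_succ hq ((z ^ 2)⁻¹), inv_inv, mul_comm (z ^ 2) q]
    rw [show a * q * z = q * a * z by ring, show a * q * z⁻¹ = q * a * z⁻¹ by ring] at hA ⊢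
    rw [f a z, f a z⁻¹, f b z, f b z⁻¹, f c z, f c z⁻¹, f d z, f d z⁻¹]
    have g1 : ∀ {a : ℂ}, ‖a‖ < 1 → ∀ {z : ℂ}, ‖z‖ = 1 → 1 - a * z ≠ 0 := fun {a} ha {z} hz h => by
      have : a * z = 1 := by linear_combination -h
      have := congrArg norm this
      rw [norm_mul, hz] at this; simp at this; linarith
    have g2 : ∀ {a : ℂ}, ‖a‖ < 1 → ∀ {z : ℂ}, ‖z‖ = 1 → qPochInf q (q * a * z) ≠ 0 :=
      fun {a} ha {z} hz => qPochInf_ne_zero_of_norm_lt_one hq (by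
        rw [norm_mul, hz, mul_one]; exact hqm ha)
    have a1 := g1 ha hz; have a2 := g1 ha hzi; have a3 := g2 ha hz; have a4 := g2 ha hzi
    have b1 := g1 hb hz; have b2 := g1 hb hzi; have b3 := g2 hb hz; have b4 := g2 hb hzi
    have c1 := g1 hc hz; have c2 := g1 hc hzi; have c3 := g2 hc hz; have c4 := g2 hc hzi
    have d1 := g1 hd hz; have d2 := g1 hd hzi; have d3 := g2 hd hz; have d4 := g2 hd hzi
    generalize qPochInf q (q * z ^ 2) = X at *
    generalize qPochInf q ((z ^ 2)⁻¹ * q) = Y at *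
    generalize qPochInf q (q * a * z) = A1 at *
    generalize qPochInf q (q * b * z) = B1 at *
    generalize qPochInf q (q * c * z) = C1 at *
    generalize qPochInf q (q * d * z) = D1 at *
    generalize qPochInf q (q * a * z⁻¹) = A2 at *
    generalize qPochInf q (q * b * z⁻¹) = B2 at *
    generalize qPochInf q (q * c * z⁻¹) = C2 at *
    generalize qPochInf q (q * d * z⁻¹) = D2 at *
    have hyy : (z ^ 2)⁻¹ = z⁻¹ ^ 2 := by field_simp
    rw [hyy]
    exact askeyWilson_pointwise hz0 a1 a2 a3 a4 b1 b2 b3 b4 c1 c2 c3 c4 d1 d2 d3 d4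
  rw [circleAverage_lin_comb one_pos hcont1 hcont2,
    circleAverage_const_mul, circleAverage_add_of_continuousOn one_pos hgc hgi,
    Real.circleAverage_zero_one_congr_inv, h0] at key
  unfold askeyWilson
  linear_combination -key

/-- The recursion a ↦ aq is iterated n times and n tends to infinity; continuity of the integral at
a = 0 gives the limit. The factor 1 - abcd q^n that has to be cancelled is nonzero because all
parameters lie in the unit disc. -/
lemma askeyWilson_to_zero (hq0 : q ≠ 0) (hq : ‖q‖ < 1) {a b c d : ℂ} (ha : ‖a‖ < 1)
    (hb : ‖b‖ < 1) (hc : ‖c‖ < 1) (hd : ‖d‖ < 1) :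
    qPochInf q (a * b) * qPochInf q (a * c) * qPochInf q (a * d) * askeyWilson q a b c d =
      qPochInf q (a * b * c * d) * askeyWilson q 0 b c d := by
  have hlt : ∀ {x y : ℂ}, ‖x‖ < 1 → ‖y‖ < 1 → ‖x * y‖ < 1 := fun {x y} hx hy => by
    rw [norm_mul]; nlinarith [norm_nonneg x, norm_nonneg y]
  have step : ∀ n : ℕ,
      qPochInf q (a * b) * qPochInf q (a * c) * qPochInf q (a * d) * askeyWilson q a b c d *
        qPochInf q (a * b * c * d * q ^ n) =
      qPochInf q (a * b * c * d) * (qPochInf q (a * b * q ^ n) * qPochInf q (a * c * q ^ n) *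
        qPochInf q (a * d * q ^ n) * askeyWilson q (a * q ^ n) b c d) := by
    intro n
    induction n with
    | zero => simp; ring
    | succ n ih =>
      have han := norm_mul_pow_lt_one hq ha n
      have h := askeyWilson_shift hq0 hq han hb hc hd
      have hne : (1 - a * q ^ n * b * c * d) ≠ 0 := by
        intro h0
        have h1 := hlt (hlt (hlt han hb) hc) hd
        rw [← sub_eq_zero.1 h0] at h1
        simp at h1
      rw [qPochInf_succ hq (a * b * q ^ n), qPochInf_succ hq (a * c * q ^ n),
        qPochInf_succ hq (a * d * q ^ n), qPochInf_succ hq (a * b * c * d * q ^ n)] at ih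
      simp only [pow_succ, ← mul_assoc] at ih ⊢
      refine mul_left_cancel₀ hne ?_
      linear_combination ih + qPochInf q (a * b * c * d) * qPochInf q (a * b * q ^ n * q) *
        qPochInf q (a * c * q ^ n * q) * qPochInf q (a * d * q ^ n * q) * h
  have t1 := (tendsto_qPochInf_mul_pow hq (a * b * c * d)).const_mul
    (qPochInf q (a * b) * qPochInf q (a * c) * qPochInf q (a * d) * askeyWilson q a b c d)
  have hcn := (continuousOn_askeyWilson hq hb hc hd).continuousAt (x := 0)
    (Metric.isOpen_ball.mem_nhds (by simp))
  have t2 := ((((tendsto_qPochInf_mul_pow hq (a * b)).mul (tendsto_qPochInf_mul_pow hq (a * c))).mul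
    (tendsto_qPochInf_mul_pow hq (a * d))).mul
    (hcn.tendsto.comp (tendsto_mul_pow_zero hq a))).const_mul (qPochInf q (a * b * c * d))
  have := tendsto_nhds_unique (t1.congr step) t2
  simpa using this

lemma askeyWilson_comm12 (a b c d : ℂ) : askeyWilson q a b c d = askeyWilson q b a c d := by
  unfold askeyWilson; congr 1; funext z; ring
lemma askeyWilson_comm13 (a b c d : ℂ) : askeyWilson q a b c d = askeyWilson q c b a d := by
  unfold askeyWilson; congr 1; funext z; ring
lemma askeyWilson_comm14 (a b c d : ℂ) : askeyWilson q a b c d = askeyWilson q d b c a := by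
  unfold askeyWilson; congr 1; funext z; ring

/-- The integral is symmetric in its parameters, so each of the four can be moved to the front and
sent to 0 in turn. -/
lemma askeyWilson_eq_const (hq0 : q ≠ 0) (hq : ‖q‖ < 1) {a b c d : ℂ} (ha : ‖a‖ < 1)
    (hb : ‖b‖ < 1) (hc : ‖c‖ < 1) (hd : ‖d‖ < 1) :
    qPochInf q (a * b) * qPochInf q (a * c) * qPochInf q (a * d) * qPochInf q (b * c) *
      qPochInf q (b * d) * qPochInf q (c * d) * askeyWilson q a b c d =
      qPochInf q (a * b * c * d) * askeyWilson q 0 0 0 0 := by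
  have z : ‖(0:ℂ)‖ < 1 := by simp
  have h1 := askeyWilson_to_zero hq0 hq ha hb hc hd
  have h2 := askeyWilson_to_zero hq0 hq hb z hc hd
  have h3 := askeyWilson_to_zero hq0 hq hc z z hd
  have h4 := askeyWilson_to_zero hq0 hq hd z z z
  rw [askeyWilson_comm12 b] at h2
  rw [askeyWilson_comm13 c] at h3
  rw [askeyWilson_comm14 d] at h4
  simp only [mul_zero, zero_mul, qPochInf_zero, one_mul] at h2 h3 h4
  linear_combination qPochInf q (b * c) * qPochInf q (b * d) * qPochInf q (c * d) * h1 +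
    qPochInf q (a * b * c * d) * (qPochInf q (c * d) * h2 + h3 + h4)

/-- This is the right-hand side of the Askey–Wilson formula at q, -q, √q, -√q, needed to find its
constant. The duplication formulas (x, -x; q)_∞ = (x²; q²)_∞ and (x; q)_∞ = (x, xq; q²)_∞ collapse
the six pairwise products. -/
lemma qPochInf_base (hq : ‖q‖ < 1) {p : ℂ} (hp : p ^ 2 = q) :
    qPochInf q q * (qPochInf q (q * -q) * qPochInf q (q * p) * qPochInf q (q * -p) *
      qPochInf q (-q * p) * qPochInf q (-q * -p) * qPochInf q (p * -p)) =
      qPochInf q (q * -q * p * -p) := by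
  have hq2 : ‖q ^ 2‖ < 1 := by rw [norm_pow]; exact pow_lt_one₀ (norm_nonneg _) hq two_ne_zero
  have e1 : q * -q * p * -p = q * q * q := by linear_combination q ^ 2 * hp
  have e2 : -q * -p = q * p := by ring
  have e3 : p * -p = -q := by linear_combination -hp
  have e4 : -q * p = -(q * p) := by ring
  have e5 : q * -p = -(q * p) := by ring
  have h1 := qPochInf_mul_neg hq (q * p)
  have e6 : (q * p) ^ 2 = q * q ^ 2 := by rw [mul_pow, hp]; ring
  rw [e6] at h1
  have h2 := qPochInf_even_odd hq q
  have h3 := qPochInf_mul_neg hq q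
  have h4 := qPochInf_succ hq2 q
  have h5 := qPochInf_succ hq (-q)
  have h6 := qPochInf_succ hq q
  have h7 := qPochInf_succ hq (q * q)
  have n1 : qPochInf (q ^ 2) (q ^ 2) ≠ 0 := qPochInf_self_ne_zero hq2
  have n2 : (1 - q) ≠ 0 := fun h => by
    rw [← sub_eq_zero.1 h] at hq; simp at hq
  have n3 : (1 - q * q) ≠ 0 := fun h => by
    rw [pow_two, ← sub_eq_zero.1 h] at hq2; simp at hq2
  rw [e1, e2, e3, e4, e5, show q * -q = -q * q by ring]
  rw [show q * q = q ^ 2 by ring] at h2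
  -- Euler's identity (q; q²)_∞ (-q; q)_∞ = 1, after cancelling (q²; q²)_∞.
  have key : qPochInf (q ^ 2) q * qPochInf q (-q) = 1 := by
    rw [h2] at h3
    refine mul_left_cancel₀ n1 ?_
    linear_combination h3
  refine mul_left_cancel₀ (mul_ne_zero n2 n3) ?_
  calc _ = qPochInf q q * ((1 - -q) * qPochInf q (-q * q)) * qPochInf q (-q) *
        ((1 - q) * (qPochInf q (q * p) * qPochInf q (-(q * p)))) ^ 2 := by ring
    _ = qPochInf q q * (qPochInf (q ^ 2) q * qPochInf q (-q)) ^ 2 := by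
        rw [h1, ← h4, ← h5]; ring
    _ = _ := by rw [key, h6, h7]; ring

/-- At the parameters q, -q, √q, -√q the denominator cancels the numerator up to (1 - z²)(1 - z⁻²),
whose average is 2. Comparing with the general formula gives the constant. -/
lemma askeyWilson_zero (hq0 : q ≠ 0) (hq : ‖q‖ < 1) :
    qPochInf q q * askeyWilson q 0 0 0 0 = 2 := by
  obtain ⟨p, hp⟩ : ∃ p : ℂ, p ^ 2 = q := ⟨q ^ (1 / 2 : ℂ), by
    rw [← Complex.cpow_nat_mul]; simp⟩
  have hpn : ‖p‖ < 1 := by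
    have : ‖p‖ ^ 2 < 1 := by rw [← norm_pow, hp]; exact hq
    nlinarith [norm_nonneg p]
  have h := askeyWilson_eq_const hq0 hq hq (b := -q) (c := p) (d := -p) (by simpa) hpn (by simpa)
  have hb := qPochInf_base hq hp
  have hne : qPochInf q (q * -q * p * -p) ≠ 0 := by
    refine qPochInf_ne_zero_of_norm_lt_one hq ?_
    have e1 : q * -q * p * -p = q * q ^ 2 := by linear_combination q ^ 2 * hp
    rw [e1]; exact norm_mul_pow_lt_one hq hq 2
  have hv : askeyWilson q q (-q) p (-p) = 2 := by
    have e : askeyWilson q q (-q) p (-p) =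
        circleAverage (fun z => 2 + (-1 * z ^ 2 + -1 * z⁻¹ ^ 2)) 0 1 := by
      refine circleAverage_congr_on one_pos fun z hz => ?_
      have hz0 := ne_zero_of_norm_eq_one hz
      -- Duplication twice: (y²; q)_∞ is (±y, ±√q y; q)_∞, and the first factors of (y; q)_∞ and
      -- (-y; q)_∞ give 1 - y².
      have hW : ∀ y : ℂ, qPochInf q (y ^ 2) = (1 - y ^ 2) * (qPochInf q (q * y) *
          qPochInf q (-q * y) * (qPochInf q (p * y) * qPochInf q (-p * y))) := by
        intro y
        have h1 := qPochInf_even_odd hq (y ^ 2)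
        have h2 := qPochInf_mul_neg hq y
        have h3 := qPochInf_mul_neg hq (p * y)
        have h4 := qPochInf_succ hq y
        have h5 := qPochInf_succ hq (-y)
        rw [h1, show y ^ 2 * q = (p * y) ^ 2 by rw [mul_pow, hp]; ring, ← h2, ← h3, h4, h5]
        rw [show -(p * y) = -p * y by ring, show y * q = q * y by ring,
          show -y * q = -q * y by ring]
        ring
      have n1 := qPair_ne_zero hq hq hz
      have n2 := qPair_ne_zero hq (a := -q) (by simpa) hz
      have n3 := qPair_ne_zero hq hpn hz
      have n4 := qPair_ne_zero hq (a := -p) (by simpa) hz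
      have hi : (z ^ 2)⁻¹ = z⁻¹ ^ 2 := by field_simp
      rw [div_eq_iff (by positivity)]
      unfold qWeyl qPair
      rw [hi, hW z, hW z⁻¹]
      have : z * z⁻¹ = 1 := mul_inv_cancel₀ hz0
      linear_combination (qPochInf q (q * z) *
          qPochInf q (-q * z) * (qPochInf q (p * z) * qPochInf q (-p * z))) * (qPochInf q (q * z⁻¹) *
          qPochInf q (-q * z⁻¹) * (qPochInf q (p * z⁻¹) * qPochInf q (-p * z⁻¹))) *
          (z * z⁻¹ + 1) * this
    have hc : ContinuousOn (fun z : ℂ => z⁻¹) (sphere 0 1) :=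
      continuousOn_id.inv₀ fun z hz => ne_zero_of_norm_eq_one (by simpa using hz)
    have m : circleAverage (fun z : ℂ => -1 * z ^ 2) 0 1 = 0 := by
      rw [circleAverage_eq_center one_pos fun z _ => by fun_prop]; simp
    have hc2 : ContinuousOn (fun z : ℂ => -1 * z⁻¹ ^ 2) (sphere 0 1) :=
      continuousOn_const.mul (hc.pow 2)
    have hc3 : ContinuousOn (fun z : ℂ => -1 * z ^ 2 + -1 * z⁻¹ ^ 2) (sphere 0 1) :=
      ContinuousOn.add (by fun_prop) hc2
    rw [e, circleAverage_add_of_continuousOn one_pos continuousOn_const hc3,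
      circleAverage_add_of_continuousOn one_pos (by fun_prop) hc2,
      Real.circleAverage_zero_one_congr_inv (f := fun z : ℂ => -1 * z ^ 2), m,
      Real.circleAverage_const]
    simp
  rw [hv] at h
  refine mul_left_cancel₀ hne ?_
  linear_combination -qPochInf q q * h + 2 * hb

/-- The Askey–Wilson integral evaluation. -/
theorem askeyWilson_eval (hq0 : q ≠ 0) (hq : ‖q‖ < 1) {a b c d : ℂ} (ha : ‖a‖ < 1)
    (hb : ‖b‖ < 1) (hc : ‖c‖ < 1) (hd : ‖d‖ < 1) :
    qPochInf q q * (qPochInf q (a * b) * qPochInf q (a * c) * qPochInf q (a * d) *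
      qPochInf q (b * c) * qPochInf q (b * d) * qPochInf q (c * d)) * askeyWilson q a b c d =
      2 * qPochInf q (a * b * c * d) := by
  linear_combination qPochInf q q * askeyWilson_eq_const hq0 hq ha hb hc hd +
    qPochInf q (a * b * c * d) * askeyWilson_zero hq0 hq

end AskeyWilson

/-! ### The integral form of the nonterminating `q`-Saalschütz sum -/

section QSaalschutz

open Real (circleAverage)
open Metric (sphere ball closedBall)

variable {q : ℂ}

/-- The theta factor `θ(a b / (μ w), w / μ; q)` of the Barnes type integrals. -/
def barnesTheta (q μ a b w : ℂ) : ℂ := qTheta q (a * b / (μ * w)) * qTheta q (w / μ)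

/-- The multiplier is free of μ, so all the difference equations below are the same for every μ. -/
lemma barnesTheta_mul_q (hq0 : q ≠ 0) (hq : ‖q‖ < 1) {μ a b w : ℂ} (hμ : μ ≠ 0) (ha : a ≠ 0)
    (hb : b ≠ 0) (hw : w ≠ 0) :
    barnesTheta q μ a b (q * w) = a * b / (q * w ^ 2) * barnesTheta q μ a b w := by
  unfold barnesTheta
  have e1 : a * b / (μ * (q * w)) = a * b / (μ * w) / q := by field_simp
  have e2 : q * w / μ = q * (w / μ) := by ring
  rw [e1, e2, qTheta_div_q hq0 hq (by positivity), qTheta_mul_q hq0 hq (by positivity)]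
  field_simp

lemma differentiableAt_barnesTheta (hq : ‖q‖ < 1) {μ a b w : ℂ} (hμ : μ ≠ 0) (ha : a ≠ 0)
    (hb : b ≠ 0) (hw : w ≠ 0) : DifferentiableAt ℂ (barnesTheta q μ a b) w := by
  have h1 : DifferentiableAt ℂ (fun w => a * b / (μ * w)) w :=
    (differentiableAt_const _).div (by fun_prop) (by positivity)
  have h2 : DifferentiableAt ℂ (fun w : ℂ => w / μ) w := by fun_prop
  exact (DifferentiableAt.comp w (g := qTheta q) (differentiableAt_qTheta hq (by positivity))
    h1).mul (DifferentiableAt.comp w (g := qTheta q) (differentiableAt_qTheta hq (by positivity)) h2)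

lemma differentiableAt_qPochInf_mul (hq : ‖q‖ < 1) (b w : ℂ) :
    DifferentiableAt ℂ (fun w => qPochInf q (b * w)) w :=
  (differentiable_qPochInf hq _).comp w (by fun_prop)

lemma differentiableAt_qPochInf_div (hq : ‖q‖ < 1) (a : ℂ) {w : ℂ} (hw : w ≠ 0) :
    DifferentiableAt ℂ (fun w => qPochInf q (a / w)) w :=
  (differentiable_qPochInf hq _).comp w ((differentiableAt_const a).div differentiableAt_id hw)

lemma continuousOn_of_differentiableAt_sphere {f : ℂ → ℂ} {r : ℝ}
    (h : ∀ z, ‖z‖ = r → DifferentiableAt ℂ f z) : ContinuousOn f (sphere 0 r) :=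
  fun z hz => (h z (by simpa using hz)).continuousAt.continuousWithinAt

/-- The integrand of the `q`-Saalschütz integral. -/
def saalIntegrand (q μ a1 a2 b1 b2 b3 w : ℂ) : ℂ :=
  barnesTheta q μ a1 a2 w * qPochInf q (a1 * a2 * b1 * b2 * b3 * w) /
    (qPochInf q (b1 * w) * qPochInf q (b2 * w) * qPochInf q (b3 * w) *
      (qPochInf q (a1 / w) * qPochInf q (a2 / w)))

lemma norm_mul_lt_one_of {b w : ℂ} {ρ : ℝ} (hb : ‖b‖ * ρ < 1) (hw : ‖w‖ ≤ ρ) : ‖b * w‖ < 1 := by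
  rw [norm_mul]
  exact lt_of_le_of_lt (by gcongr) hb

lemma norm_div_lt_one_of {a w : ℂ} {ρ : ℝ} (ha : ‖a‖ < ρ) (hw : ρ ≤ ‖w‖) : ‖a / w‖ < 1 := by
  rw [norm_div, div_lt_one (lt_of_lt_of_le (lt_of_le_of_lt (norm_nonneg _) ha) hw)]
  linarith

lemma differentiableAt_saalIntegrand (hq : ‖q‖ < 1) {μ a1 a2 b1 b2 b3 w : ℂ}
    (hμ : μ ≠ 0) (ha1 : a1 ≠ 0) (ha2 : a2 ≠ 0) (hw : w ≠ 0) (h1 : ‖b1 * w‖ < 1)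
    (h2 : ‖b2 * w‖ < 1) (h3 : ‖b3 * w‖ < 1) (h4 : ‖a1 / w‖ < 1) (h5 : ‖a2 / w‖ < 1) :
    DifferentiableAt ℂ (saalIntegrand q μ a1 a2 b1 b2 b3) w := by
  have hp := fun b => differentiableAt_qPochInf_mul hq b w
  have hn := fun {a} => qPochInf_ne_zero_of_norm_lt_one hq (a := a)
  unfold saalIntegrand
  exact ((differentiableAt_barnesTheta hq hμ ha1 ha2 hw).mul (hp _)).div
    ((((hp b1).mul (hp b2)).mul (hp b3)).mul ((differentiableAt_qPochInf_div hq a1 hw).mul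
      (differentiableAt_qPochInf_div hq a2 hw)))
    (mul_ne_zero (mul_ne_zero (mul_ne_zero (hn h1) (hn h2)) (hn h3)) (mul_ne_zero (hn h4) (hn h5)))

/-- The `q`-Saalschütz integral over the circle of radius `ρ`. -/
def saalIntegral (q μ : ℂ) (ρ : ℝ) (a1 a2 b1 b2 b3 : ℂ) : ℂ :=
  circleAverage (saalIntegrand q μ a1 a2 b1 b2 b3) 0 ρ

/-- As in the Askey–Wilson case, the first factors of the infinite products are split off and a
rational identity `hp` in w remains; L is the theta factor and the other capital letters are the
remaining products. -/
lemma saal_pointwise {w a1 a2 b1 b2 b3 L X A1 A2 B1 B2 B3 : ℂ} (hw : w ≠ 0)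
    (h1 : 1 - b1 * w ≠ 0) (h2 : 1 - b2 * w ≠ 0) (h3 : 1 - b3 * w ≠ 0) (hB1 : B1 ≠ 0)
    (hB2 : B2 ≠ 0) (hB3 : B3 ≠ 0) (hA1 : A1 ≠ 0) (hA2 : A2 ≠ 0)
    (h4 : 1 - a1 / w ≠ 0) (h5 : 1 - a2 / w ≠ 0) :
    (1 - a1 * b1) * (1 - a2 * b1) * (L * ((1 - a1 * a2 * b1 * b2 * b3 * w) * X) /
        ((1 - b1 * w) * B1 * ((1 - b2 * w) * B2) * ((1 - b3 * w) * B3) *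
          ((1 - a1 / w) * A1 * ((1 - a2 / w) * A2)))) -
      (1 - a1 * a2 * b1 * b2) * (1 - a1 * a2 * b1 * b3) * (L * X /
        (B1 * ((1 - b2 * w) * B2) * ((1 - b3 * w) * B3) *
          ((1 - a1 / w) * A1 * ((1 - a2 / w) * A2)))) =
    b1 * (w * L * ((1 - a1 * a2 * b1 * b2 * b3 * w) * X) / ((1 - b1 * w) * B1 * ((1 - b2 * w) * B2) *
        ((1 - b3 * w) * B3) * (A1 * A2))) -
      b1 * (a1 * a2 / w * L * X / (B1 * B2 * B3 * ((1 - a1 / w) * A1 * ((1 - a2 / w) * A2)))) := by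
  have hp : (1 - a1 * b1) * (1 - a2 * b1) * (1 - a1 * a2 * b1 * b2 * b3 * w) -
      (1 - a1 * a2 * b1 * b2) * (1 - a1 * a2 * b1 * b3) * (1 - b1 * w) =
      b1 * w * (1 - a1 * a2 * b1 * b2 * b3 * w) * ((1 - a1 / w) * (1 - a2 / w)) -
      b1 * (a1 * a2 / w) * ((1 - b1 * w) * (1 - b2 * w) * (1 - b3 * w)) := by
    field_simp
    ring
  generalize 1 - a1 * a2 * b1 * b2 * b3 * w = f1 at *
  generalize (1 - a1 * a2 * b1 * b2) * (1 - a1 * a2 * b1 * b3) = f2 at *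
  generalize (1 - a1 * b1) * (1 - a2 * b1) = f3 at *
  generalize 1 - b1 * w = e1 at *
  generalize 1 - b2 * w = e2 at *
  generalize 1 - b3 * w = e3 at *
  generalize 1 - a1 / w = e4 at *
  generalize 1 - a2 / w = e5 at *
  field_simp at hp ⊢
  linear_combination (L * X) * hp

/-- The combination of the two integrands is b1 (g(w) - g(qw)). In g the parameters a1, a2 are
replaced by a1 q, a2 q, which makes it holomorphic in ‖q‖ρ ≤ ‖w‖ ≤ ρ, so g(w) and g(qw) have the
same average. -/
lemma saalIntegral_shift (hq0 : q ≠ 0) (hq : ‖q‖ < 1) {μ a1 a2 b1 b2 b3 : ℂ} {ρ : ℝ}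
    (hμ : μ ≠ 0) (ha1 : a1 ≠ 0) (ha2 : a2 ≠ 0) (h1 : ‖a1‖ < ρ) (h2 : ‖a2‖ < ρ)
    (hb1 : ‖b1‖ * ρ < 1) (hb2 : ‖b2‖ * ρ < 1) (hb3 : ‖b3‖ * ρ < 1) :
    (1 - a1 * b1) * (1 - a2 * b1) * saalIntegral q μ ρ a1 a2 b1 b2 b3 =
      (1 - a1 * a2 * b1 * b2) * (1 - a1 * a2 * b1 * b3) *
        saalIntegral q μ ρ a1 a2 (b1 * q) b2 b3 := by
  have hρ : 0 < ρ := lt_of_le_of_lt (norm_nonneg _) h1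
  have hqpos : 0 < ‖q‖ := norm_pos_iff.2 hq0
  have hP := differentiable_qPochInf hq
  obtain ⟨g, hg⟩ : ∃ g : ℂ → ℂ, g = fun w => w * barnesTheta q μ a1 a2 w *
      qPochInf q (a1 * a2 * b1 * b2 * b3 * w) /
      (qPochInf q (b1 * w) * qPochInf q (b2 * w) * qPochInf q (b3 * w) *
      (qPochInf q (a1 * q / w) * qPochInf q (a2 * q / w))) := ⟨_, rfl⟩
  have hn := fun {a} => qPochInf_ne_zero_of_norm_lt_one hq (a := a)
  have haq : ∀ {a w : ℂ}, ‖a‖ < ρ → ‖q‖ * ρ ≤ ‖w‖ → ‖a * q / w‖ < 1 := fun {a w} ha hw => by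
    refine norm_div_lt_one_of (ρ := ‖q‖ * ρ) ?_ hw
    rw [norm_mul, mul_comm]; gcongr
  have hgd : ∀ w, ‖q‖ * ρ ≤ ‖w‖ → ‖w‖ ≤ ρ → DifferentiableAt ℂ g w := by
    intro w hw1 hw2
    have hw0 : w ≠ 0 := norm_pos_iff.1 (lt_of_lt_of_le (by positivity) hw1)
    have hp := fun b => differentiableAt_qPochInf_mul hq b w
    rw [hg]
    exact ((differentiableAt_id.mul (differentiableAt_barnesTheta hq hμ ha1 ha2 hw0)).mul
      (hp _)).div ((((hp b1).mul (hp b2)).mul (hp b3)).mul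
      ((differentiableAt_qPochInf_div hq (a1 * q) hw0).mul
      (differentiableAt_qPochInf_div hq (a2 * q) hw0)))
      (mul_ne_zero (mul_ne_zero (mul_ne_zero (hn (norm_mul_lt_one_of hb1 hw2))
        (hn (norm_mul_lt_one_of hb2 hw2))) (hn (norm_mul_lt_one_of hb3 hw2)))
        (mul_ne_zero (hn (haq h1 hw1)) (hn (haq h2 hw1))))
  have hqρ : ‖q‖ * ρ ≤ ρ := by nlinarith
  have hc1 : ContinuousOn g (sphere 0 ρ) :=
    continuousOn_of_differentiableAt_sphere fun w hw => hgd w (by rw [hw]; exact hqρ) hw.le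
  have hc2 : ContinuousOn (fun w => g (q * w)) (sphere 0 ρ) :=
    continuousOn_of_differentiableAt_sphere fun w hw =>
      (hgd (q * w) (by rw [norm_mul, hw]) (by rw [norm_mul, hw]; exact hqρ)).comp w (by fun_prop)
  have hshift : circleAverage (fun w => g (q * w)) 0 ρ = circleAverage g 0 ρ := by
    rw [circleAverage_mul_left q g ρ]
    exact (circleAverage_annulus (by positivity) hqρ hgd).symm
  have hb1q : ‖b1 * q‖ * ρ < 1 := by
    rw [norm_mul]
    calc ‖b1‖ * ‖q‖ * ρ ≤ ‖b1‖ * 1 * ρ := by gcongr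
      _ < 1 := by simpa using hb1
  have hd : ∀ {b : ℂ}, ‖b‖ * ρ < 1 → ContinuousOn (saalIntegrand q μ a1 a2 b b2 b3) (sphere 0 ρ) :=
    fun {b} hb => continuousOn_of_differentiableAt_sphere fun w hw =>
      differentiableAt_saalIntegrand hq hμ ha1 ha2 (norm_pos_iff.1 (by rw [hw]; exact hρ))
        (norm_mul_lt_one_of hb hw.le) (norm_mul_lt_one_of hb2 hw.le)
        (norm_mul_lt_one_of hb3 hw.le) (norm_div_lt_one_of h1 hw.ge) (norm_div_lt_one_of h2 hw.ge)
  have key : circleAverage (fun w => (1 - a1 * b1) * (1 - a2 * b1) *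
        saalIntegrand q μ a1 a2 b1 b2 b3 w - (1 - a1 * a2 * b1 * b2) * (1 - a1 * a2 * b1 * b3) *
        saalIntegrand q μ a1 a2 (b1 * q) b2 b3 w) 0 ρ =
      circleAverage (fun w => b1 * g w - b1 * g (q * w)) 0 ρ := by
    refine circleAverage_congr_on hρ fun w hw => ?_
    have hw0 : w ≠ 0 := norm_pos_iff.1 (by rw [hw]; exact hρ)
    have f : ∀ b : ℂ, qPochInf q (b * w) = (1 - b * w) * qPochInf q (b * (q * w)) := fun b => by
      rw [qPochInf_succ hq (b * w)]; ring_nf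
    have f' : ∀ a : ℂ, qPochInf q (a / w) = (1 - a / w) * qPochInf q (a * q / w) := fun a => by
      rw [qPochInf_succ hq (a / w)]; ring_nf
    have f'' : ∀ a : ℂ, a * q / (q * w) = a / w := fun a => by field_simp
    have e1 : b1 * q * w = b1 * (q * w) := by ring
    have e2 : a1 * a2 * (b1 * q) * b2 * b3 * w = a1 * a2 * b1 * b2 * b3 * (q * w) := by ring
    have e3 : q * w * (a1 * a2 / (q * w ^ 2) * barnesTheta q μ a1 a2 w) =
      a1 * a2 / w * barnesTheta q μ a1 a2 w := by field_simp
    simp only [hg, saalIntegrand, barnesTheta_mul_q hq0 hq hμ ha1 ha2 hw0, e1, e2, e3, f'']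
    rw [f (a1 * a2 * b1 * b2 * b3), f b1, f b2, f b3, f' a1, f' a2]
    have g1 : ∀ {x : ℂ}, ‖x‖ < 1 → 1 - x ≠ 0 := fun {x} hx h0 => by
      rw [← sub_eq_zero.1 h0] at hx; simp at hx
    have g2 : ∀ {b : ℂ}, ‖b‖ * ρ < 1 → qPochInf q (b * (q * w)) ≠ 0 := fun {b} hb =>
      hn (norm_mul_lt_one_of hb (by rw [norm_mul, hw]; exact hqρ))
    exact saal_pointwise hw0 (g1 (norm_mul_lt_one_of hb1 hw.le))
      (g1 (norm_mul_lt_one_of hb2 hw.le)) (g1 (norm_mul_lt_one_of hb3 hw.le)) (g2 hb1) (g2 hb2)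
      (g2 hb3) (hn (haq h1 (by rw [hw]; exact hqρ))) (hn (haq h2 (by rw [hw]; exact hqρ)))
      (g1 (norm_div_lt_one_of h1 hw.ge)) (g1 (norm_div_lt_one_of h2 hw.ge))
  rw [circleAverage_lin_comb hρ (hd hb1) (hd hb1q), circleAverage_lin_comb hρ hc1 hc2,
    hshift, sub_self] at key
  unfold saalIntegral
  linear_combination key

lemma continuousOn_saalIntegral (hq : ‖q‖ < 1) {μ a1 a2 b2 b3 : ℂ} {ρ : ℝ}
    (hμ : μ ≠ 0) (ha1 : a1 ≠ 0) (ha2 : a2 ≠ 0) (h1 : ‖a1‖ < ρ) (h2 : ‖a2‖ < ρ)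
    (hb2 : ‖b2‖ * ρ < 1) (hb3 : ‖b3‖ * ρ < 1) :
    ContinuousOn (fun b => saalIntegral q μ ρ a1 a2 b b2 b3) (ball 0 ρ⁻¹) := by
  have hρ : 0 < ρ := lt_of_le_of_lt (norm_nonneg _) h1
  refine continuousOn_circleAverage_param hρ fun p hp => ContinuousAt.continuousWithinAt ?_
  obtain ⟨b, w⟩ := p
  simp only [Set.mem_prod, Metric.mem_ball, dist_zero_right, mem_sphere_iff_norm, sub_zero] at hp
  obtain ⟨hb, hw⟩ := hp
  have hb' : ‖b‖ * ρ < 1 := by rwa [← lt_inv_mul_iff₀' hρ, mul_one]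
  have hw0 : w ≠ 0 := norm_pos_iff.1 (by rw [hw]; exact hρ)
  have hn := fun {a} => qPochInf_ne_zero_of_norm_lt_one hq (a := a)
  have hP := continuous_qPochInf hq
  have hs : ContinuousAt (Prod.snd : ℂ × ℂ → ℂ) (b, w) := continuousAt_snd
  have c1 := (differentiableAt_barnesTheta hq hμ ha1 ha2 hw0).continuousAt.comp_of_eq hs rfl
  have c2 := fun b' => (differentiableAt_qPochInf_mul hq b' w).continuousAt.comp_of_eq hs rfl
  have c3 := fun a => (differentiableAt_qPochInf_div hq a hw0).continuousAt.comp_of_eq hs rfl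
  have c4 : ContinuousAt (fun p : ℂ × ℂ => qPochInf q (p.1 * p.2)) (b, w) :=
    (hP.comp (by fun_prop)).continuousAt
  have c5 : ContinuousAt (fun p : ℂ × ℂ => qPochInf q (a1 * a2 * p.1 * b2 * b3 * p.2)) (b, w) :=
    (hP.comp (by fun_prop)).continuousAt
  exact (c1.mul c5).div (((c4.mul (c2 b2)).mul (c2 b3)).mul ((c3 a1).mul (c3 a2)))
    (mul_ne_zero (mul_ne_zero (mul_ne_zero (hn (norm_mul_lt_one_of hb' hw.le))
      (hn (norm_mul_lt_one_of hb2 hw.le))) (hn (norm_mul_lt_one_of hb3 hw.le)))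
      (mul_ne_zero (hn (norm_div_lt_one_of h1 hw.ge)) (hn (norm_div_lt_one_of h2 hw.ge))))

/-- The recursion b1 ↦ b1 q is iterated down to b1 = 0, where the integral is continuous in b1. -/
lemma saalIntegral_to_zero (hq0 : q ≠ 0) (hq : ‖q‖ < 1) {μ a1 a2 b1 b2 b3 : ℂ} {ρ : ℝ}
    (hμ : μ ≠ 0) (ha1 : a1 ≠ 0) (ha2 : a2 ≠ 0) (h1 : ‖a1‖ < ρ) (h2 : ‖a2‖ < ρ)
    (hb1 : ‖b1‖ * ρ < 1) (hb2 : ‖b2‖ * ρ < 1) (hb3 : ‖b3‖ * ρ < 1) :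
    qPochInf q (a1 * b1) * qPochInf q (a2 * b1) * saalIntegral q μ ρ a1 a2 b1 b2 b3 =
      qPochInf q (a1 * a2 * b1 * b2) * qPochInf q (a1 * a2 * b1 * b3) *
        saalIntegral q μ ρ a1 a2 0 b2 b3 := by
  have hρ : 0 < ρ := lt_of_le_of_lt (norm_nonneg _) h1
  have hab : ∀ {a b : ℂ}, ‖a‖ < ρ → ‖b‖ * ρ < 1 → ‖a * b‖ < 1 := fun {a b} ha hb => by
    rw [mul_comm]; exact norm_mul_lt_one_of hb ha.le
  have hbn : ∀ n : ℕ, ‖b1 * q ^ n‖ * ρ < 1 := fun n => by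
    rw [norm_mul, norm_pow]
    calc ‖b1‖ * ‖q‖ ^ n * ρ ≤ ‖b1‖ * 1 * ρ := by
          gcongr; exact pow_le_one₀ (norm_nonneg _) hq.le
      _ < 1 := by simpa using hb1
  have hne : ∀ {b : ℂ}, ‖b‖ * ρ < 1 → ∀ n, 1 - a1 * a2 * (b1 * q ^ n) * b ≠ 0 := fun {b} hb n h0 => by
    have e1 := hab h1 (hbn n)
    have e2 := hab h2 hb
    have e3 : ‖a1 * a2 * (b1 * q ^ n) * b‖ < 1 := by
      rw [show a1 * a2 * (b1 * q ^ n) * b = a1 * (b1 * q ^ n) * (a2 * b) by ring, norm_mul]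
      nlinarith [norm_nonneg (a1 * (b1 * q ^ n)), norm_nonneg (a2 * b)]
    rw [← sub_eq_zero.1 h0] at e3; simp at e3
  have step : ∀ n : ℕ,
      qPochInf q (a1 * b1) * qPochInf q (a2 * b1) * saalIntegral q μ ρ a1 a2 b1 b2 b3 *
        (qPochInf q (a1 * a2 * b1 * b2 * q ^ n) * qPochInf q (a1 * a2 * b1 * b3 * q ^ n)) =
      qPochInf q (a1 * a2 * b1 * b2) * qPochInf q (a1 * a2 * b1 * b3) *
        (qPochInf q (a1 * b1 * q ^ n) * qPochInf q (a2 * b1 * q ^ n) *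
          saalIntegral q μ ρ a1 a2 (b1 * q ^ n) b2 b3) := by
    intro n
    induction n with
    | zero => simp; ring
    | succ n ih =>
      have h := saalIntegral_shift hq0 hq hμ ha1 ha2 h1 h2 (hbn n) hb2 hb3
      rw [qPochInf_succ hq (a1 * b1 * q ^ n), qPochInf_succ hq (a2 * b1 * q ^ n),
        qPochInf_succ hq (a1 * a2 * b1 * b2 * q ^ n),
        qPochInf_succ hq (a1 * a2 * b1 * b3 * q ^ n)] at ih
      have n1 := hne hb2 n
      have n2 := hne hb3 n
      simp only [pow_succ, ← mul_assoc] at ih h n1 n2 ⊢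
      refine mul_left_cancel₀ (mul_ne_zero n1 n2) ?_
      linear_combination ih + qPochInf q (a1 * a2 * b1 * b2) * qPochInf q (a1 * a2 * b1 * b3) *
        qPochInf q (a1 * b1 * q ^ n * q) * qPochInf q (a2 * b1 * q ^ n * q) * h
  have t1 := ((tendsto_qPochInf_mul_pow hq (a1 * a2 * b1 * b2)).mul
    (tendsto_qPochInf_mul_pow hq (a1 * a2 * b1 * b3))).const_mul
    (qPochInf q (a1 * b1) * qPochInf q (a2 * b1) * saalIntegral q μ ρ a1 a2 b1 b2 b3)
  have hcn := (continuousOn_saalIntegral hq hμ ha1 ha2 h1 h2 hb2 hb3).continuousAt (x := 0)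
    (Metric.isOpen_ball.mem_nhds (by simpa using hρ))
  have t2 := (((tendsto_qPochInf_mul_pow hq (a1 * b1)).mul
    (tendsto_qPochInf_mul_pow hq (a2 * b1))).mul
    (hcn.tendsto.comp (tendsto_mul_pow_zero hq b1))).const_mul
    (qPochInf q (a1 * a2 * b1 * b2) * qPochInf q (a1 * a2 * b1 * b3))
  have := tendsto_nhds_unique (t1.congr step) t2
  simpa using this

lemma saalIntegral_comm12 (μ : ℂ) (ρ : ℝ) (a1 a2 b1 b2 b3 : ℂ) :
    saalIntegral q μ ρ a1 a2 b1 b2 b3 = saalIntegral q μ ρ a1 a2 b2 b1 b3 := by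
  unfold saalIntegral saalIntegrand; congr 1; funext w; ring_nf
lemma saalIntegral_comm13 (μ : ℂ) (ρ : ℝ) (a1 a2 b1 b2 b3 : ℂ) :
    saalIntegral q μ ρ a1 a2 b1 b2 b3 = saalIntegral q μ ρ a1 a2 b3 b2 b1 := by
  unfold saalIntegral saalIntegrand; congr 1; funext w; ring_nf

lemma saalIntegral_eq_const (hq0 : q ≠ 0) (hq : ‖q‖ < 1) {μ a1 a2 b1 b2 b3 : ℂ} {ρ : ℝ}
    (hμ : μ ≠ 0) (ha1 : a1 ≠ 0) (ha2 : a2 ≠ 0) (h1 : ‖a1‖ < ρ) (h2 : ‖a2‖ < ρ)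
    (hb1 : ‖b1‖ * ρ < 1) (hb2 : ‖b2‖ * ρ < 1) (hb3 : ‖b3‖ * ρ < 1) :
    (qPochInf q (a1 * b1) * qPochInf q (a2 * b1) * qPochInf q (a1 * b2) * qPochInf q (a2 * b2) *
      qPochInf q (a1 * b3) * qPochInf q (a2 * b3)) * saalIntegral q μ ρ a1 a2 b1 b2 b3 =
      qPochInf q (a1 * a2 * b1 * b2) * qPochInf q (a1 * a2 * b1 * b3) *
        qPochInf q (a1 * a2 * b2 * b3) * saalIntegral q μ ρ a1 a2 0 0 0 := by
  have z : ‖(0:ℂ)‖ * ρ < 1 := by simp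
  have e1 := saalIntegral_to_zero hq0 hq hμ ha1 ha2 h1 h2 hb1 hb2 hb3
  have e2 := saalIntegral_to_zero hq0 hq hμ ha1 ha2 h1 h2 hb2 z hb3
  have e3 := saalIntegral_to_zero hq0 hq hμ ha1 ha2 h1 h2 hb3 z z
  rw [saalIntegral_comm12 μ ρ a1 a2 b2] at e2
  rw [saalIntegral_comm13 μ ρ a1 a2 b3] at e3
  simp only [mul_zero, qPochInf_zero, one_mul] at e2 e3
  linear_combination qPochInf q (a1 * b2) * qPochInf q (a2 * b2) * qPochInf q (a1 * b3) *
    qPochInf q (a2 * b3) * e1 + qPochInf q (a1 * a2 * b1 * b2) * qPochInf q (a1 * a2 * b1 * b3) *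
    (qPochInf q (a1 * b3) * qPochInf q (a2 * b3) * e2 + qPochInf q (a1 * a2 * b2 * b3) * e3)

/-- The constant is found from b1 = q/a1, b2 = q/a2, b3 = 0. There the denominator is a product of
two theta functions and the integrand f satisfies f(qw) = q f(w). Hence the integrals over the radii
r and ‖q‖r differ by the factor q, while their difference is the sum of the residues at a1 and a2.
-/
lemma saalIntegral_zero (hq0 : q ≠ 0) (hq : ‖q‖ < 1) {μ a1 a2 : ℂ} {ρ : ℝ}
    (hμ : μ ≠ 0) (ha1 : a1 ≠ 0) (ha2 : a2 ≠ 0) (h1 : ‖a1‖ < ρ) (h2 : ‖a2‖ < ρ) (hne : a1 ≠ a2)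
    (h12 : ‖q‖ * ‖a1‖ < ‖a2‖) (h21 : ‖q‖ * ‖a2‖ < ‖a1‖) :
    qPochInf q q * saalIntegral q μ ρ a1 a2 0 0 0 = qTheta q (a1 / μ) * qTheta q (a2 / μ) := by
  have hqpos : 0 < ‖q‖ := norm_pos_iff.2 hq0
  have n1 : 0 < ‖a1‖ := norm_pos_iff.2 ha1
  have n2 : 0 < ‖a2‖ := norm_pos_iff.2 ha2
  have hn := fun {a} => qPochInf_ne_zero_of_norm_lt_one hq (a := a)
  -- The radius is such that the annulus between ‖q‖r and r contains a1 and a2 and no further point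
  -- of the sequences a_i q^n. The ratio hypotheses make room for it.
  obtain ⟨r, hr1, hr2⟩ : ∃ r, max ‖a1‖ ‖a2‖ < r ∧ r < min ‖a1‖ ‖a2‖ / ‖q‖ := by
    refine exists_between ?_
    rw [lt_div_iff₀ hqpos]
    rcases max_choice ‖a1‖ ‖a2‖ with h | h <;> rcases min_choice ‖a1‖ ‖a2‖ with h' | h' <;>
      rw [h, h'] <;> nlinarith
  rw [max_lt_iff] at hr1
  rw [lt_div_iff₀ hqpos, lt_min_iff] at hr2
  have hr : 0 < r := by linarith
  have hρ : 0 < ρ := by linarith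
  have hrad : saalIntegral q μ ρ a1 a2 0 0 0 = saalIntegral q μ r a1 a2 0 0 0 := by
    refine circleAverage_eq_of_differentiable hr hρ fun w hw _ => ?_
    have hm : max ‖a1‖ ‖a2‖ < min r ρ := by
      rw [max_lt_iff, lt_min_iff, lt_min_iff]; exact ⟨⟨hr1.1, h1⟩, hr1.2, h2⟩
    rw [max_lt_iff] at hm
    have hw0 : w ≠ 0 := norm_pos_iff.1 (by linarith)
    exact differentiableAt_saalIntegrand hq hμ ha1 ha2 hw0 (by simp) (by simp) (by simp)
      (norm_div_lt_one_of hm.1 hw) (norm_div_lt_one_of hm.2 hw)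
  have hqa : ∀ {a : ℂ}, a ≠ 0 → r * ‖q‖ < ‖a‖ → ‖q / a‖ * r < 1 := fun {a} ha h => by
    rw [norm_div, div_mul_eq_mul_div, div_lt_one (norm_pos_iff.2 ha), mul_comm]; exact h
  have hc := saalIntegral_eq_const hq0 hq hμ ha1 ha2 hr1.1 hr1.2 (hqa ha1 hr2.1) (hqa ha2 hr2.2)
    (b3 := 0) (by simp)
  obtain ⟨φ, hφ⟩ : ∃ φ : ℂ → ℂ, φ = fun w => barnesTheta q μ a1 a2 w /
      (qPochInf q (q / a1 * w) * qPochInf q (q / a2 * w) *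
      (qPochInf q (a1 * q / w) * qPochInf q (a2 * q / w))) := ⟨_, rfl⟩
  have hqr : ‖q‖ * r < r := by nlinarith
  have haq : ∀ {a w : ℂ}, ‖a‖ < r → ‖q‖ * r ≤ ‖w‖ → ‖a * q / w‖ < 1 := fun {a w} ha hw => by
    refine norm_div_lt_one_of (ρ := ‖q‖ * r) ?_ hw
    rw [norm_mul, mul_comm]; gcongr
  have hφd : ∀ w, ‖q‖ * r ≤ ‖w‖ → ‖w‖ ≤ r → DifferentiableAt ℂ (fun w => w * φ w) w := by
    intro w hw1 hw2
    have hw0 : w ≠ 0 := norm_pos_iff.1 (lt_of_lt_of_le (by positivity) hw1)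
    have hp := fun b => differentiableAt_qPochInf_mul hq b w
    rw [hφ]
    exact differentiableAt_id.mul ((differentiableAt_barnesTheta hq hμ ha1 ha2 hw0).div
      (((hp _).mul (hp _)).mul ((differentiableAt_qPochInf_div hq (a1 * q) hw0).mul
      (differentiableAt_qPochInf_div hq (a2 * q) hw0)))
      (mul_ne_zero (mul_ne_zero (hn (norm_mul_lt_one_of (hqa ha1 hr2.1) hw2))
        (hn (norm_mul_lt_one_of (hqa ha2 hr2.2) hw2)))
        (mul_ne_zero (hn (haq hr1.1 hw1)) (hn (haq hr1.2 hw1)))))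
  have hs : a1 - a2 ≠ 0 := sub_ne_zero.2 hne
  -- Partial fractions in w separate the two simple poles; this is where a1 ≠ a2 enters.
  have hψ : ∀ w, ‖q‖ * r ≤ ‖w‖ → w - a1 ≠ 0 → w - a2 ≠ 0 →
      saalIntegrand q μ a1 a2 (q / a1) (q / a2) 0 w =
      1 / (a1 - a2) * (w / (w - a1) * (w * φ w)) - 1 / (a1 - a2) * (w / (w - a2) * (w * φ w)) := by
    intro w hw h1 h2
    have hw0 : w ≠ 0 := norm_pos_iff.1 (lt_of_lt_of_le (by positivity) hw)
    have f' : ∀ a : ℂ, qPochInf q (a / w) = (w - a) / w * qPochInf q (a * q / w) := fun a => by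
      rw [qPochInf_succ hq (a / w)]
      rw [show a / w * q = a * q / w by ring, sub_div, div_self hw0]
    simp only [saalIntegrand, hφ, mul_zero, zero_mul, qPochInf_zero, mul_one]
    rw [f' a1, f' a2]
    generalize qPochInf q (q / a1 * w) * qPochInf q (q / a2 * w) = Z
    generalize qPochInf q (a1 * q / w) = Z1
    generalize qPochInf q (a2 * q / w) = Z2
    rcases eq_or_ne Z 0 with rfl | hZ
    · simp
    rcases eq_or_ne Z1 0 with rfl | hZ1
    · simp
    rcases eq_or_ne Z2 0 with rfl | hZ2
    · simp
    field_simp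
    ring
  have hcirc : ∀ R, ‖q‖ * r ≤ R → R ≤ r → R ≠ ‖a1‖ → R ≠ ‖a2‖ →
      saalIntegral q μ R a1 a2 (q / a1) (q / a2) 0 =
      1 / (a1 - a2) * circleAverage (fun w => w / (w - a1) * (w * φ w)) 0 R -
      1 / (a1 - a2) * circleAverage (fun w => w / (w - a2) * (w * φ w)) 0 R := by
    intro R hR1 hR2 hRa1 hRa2
    have hR : 0 < R := lt_of_lt_of_le (by positivity) hR1
    have hwa : ∀ {w a : ℂ}, ‖w‖ = R → R ≠ ‖a‖ → w - a ≠ 0 := fun {w a} hw ha h0 => by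
      rw [sub_eq_zero.1 h0] at hw; exact ha hw.symm
    have hcc : ∀ {a : ℂ}, R ≠ ‖a‖ →
        ContinuousOn (fun w => w / (w - a) * (w * φ w)) (sphere 0 R) := fun {a} ha =>
      continuousOn_of_differentiableAt_sphere fun w hw =>
        (differentiableAt_id.div (differentiableAt_id.sub_const a) (hwa hw ha)).mul
          (hφd w (by rw [hw]; exact hR1) (by rw [hw]; exact hR2))
    rw [← circleAverage_lin_comb hR (hcc hRa1) (hcc hRa2)]
    exact circleAverage_congr_on hR fun w hw => hψ w (by rw [hw]; exact hR1)
      (hwa hw hRa1) (hwa hw hRa2)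
  have k1 := hcirc r hqr.le le_rfl hr1.1.ne' hr1.2.ne'
  have k2 := hcirc (‖q‖ * r) le_rfl hqr.le (by rw [mul_comm]; exact hr2.1.ne)
    (by rw [mul_comm]; exact hr2.2.ne)
  have p1 := circleAverage_sub_of_pole (a := a1) (r := ‖q‖ * r) (R := r) (by positivity)
    (by rw [mul_comm]; exact hr2.1) hr1.1 hφd
  have p2 := circleAverage_sub_of_pole (a := a2) (r := ‖q‖ * r) (R := r) (by positivity)
    (by rw [mul_comm]; exact hr2.2) hr1.2 hφd
  -- The substitution w ↦ qw multiplies the theta factor by a1 a2/(q w²) and the denominator by a1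
  -- a2/(q² w²), and the quotient of the two multipliers is q.
  have hsh : saalIntegral q μ (‖q‖ * r) a1 a2 (q / a1) (q / a2) 0 =
      q * saalIntegral q μ r a1 a2 (q / a1) (q / a2) 0 := by
    unfold saalIntegral
    rw [← circleAverage_mul_left q, ← circleAverage_const_mul]
    refine circleAverage_congr_on hr fun w hw => ?_
    have hw0 : w ≠ 0 := norm_pos_iff.1 (by rw [hw]; exact hr)
    have hθ : ∀ {a : ℂ}, a ≠ 0 → qPochInf q (q / a * (q * w)) * qPochInf q (a / (q * w)) =
        -(a / w / q) * (qPochInf q (q / a * w) * qPochInf q (a / w)) := fun {a} ha => by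
      have := qTheta_div_q hq0 hq (z := a / w) (by positivity)
      rw [qTheta_eq, qTheta_eq] at this
      have e1 : q / (a / w / q) = q / a * (q * w) := by field_simp
      have e2 : q / (a / w) = q / a * w := by field_simp
      have e3 : a / w / q = a / (q * w) := by field_simp
      rw [e1, e2] at this
      rw [e3] at this ⊢
      linear_combination this
    have hθ1 := hθ ha1
    have hθ2 := hθ ha2
    simp only [saalIntegrand, mul_zero, zero_mul, qPochInf_zero, mul_one,
      barnesTheta_mul_q hq0 hq hμ ha1 ha2 hw0]
    have hden : qPochInf q (q / a1 * (q * w)) * qPochInf q (q / a2 * (q * w)) *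
        (qPochInf q (a1 / (q * w)) * qPochInf q (a2 / (q * w))) = a1 / w / q * (a2 / w / q) *
        (qPochInf q (q / a1 * w) * qPochInf q (q / a2 * w) *
        (qPochInf q (a1 / w) * qPochInf q (a2 / w))) := by
      linear_combination qPochInf q (q / a2 * (q * w)) * qPochInf q (a2 / (q * w)) * hθ1 -
        (a1 / w / q) * (qPochInf q (q / a1 * w) * qPochInf q (a1 / w)) * hθ2
    rw [hden]
    generalize qPochInf q (q / a1 * w) * qPochInf q (q / a2 * w) *
        (qPochInf q (a1 / w) * qPochInf q (a2 / w)) = D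
    rcases eq_or_ne D 0 with rfl | hD
    · simp
    field_simp
  -- Passing from w = a1 to w = a2 merely interchanges factors, so the two residues combine to (a1
  -- φ(a1) - a2 φ(a2))/(a1 - a2) = φ(a1).
  have hφ1 : φ a1 = φ a2 := by
    simp only [hφ, barnesTheta]
    rw [show a1 * a2 / (μ * a1) = a2 / μ by field_simp,
      show a1 * a2 / (μ * a2) = a1 / μ by field_simp]
    rw [show q / a1 * a1 = q by field_simp, show q / a2 * a2 = q by field_simp,
      show a1 * q / a1 = q by field_simp, show a2 * q / a2 = q by field_simp]
    rw [show q / a2 * a1 = a1 * q / a2 by ring, show q / a1 * a2 = a2 * q / a1 by ring]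
    ring
  have hφv : φ a1 * (qPochInf q q * qPochInf q q * (qPochInf q (a1 * (q / a2)) *
      qPochInf q (a2 * (q / a1)))) = qTheta q (a1 / μ) * qTheta q (a2 / μ) := by
    have d1 : qPochInf q (a1 * (q / a2)) ≠ 0 := hn (by
      rw [norm_mul, norm_div, ← mul_div_assoc, div_lt_one n2, mul_comm]; exact h12)
    have d2 : qPochInf q (a2 * (q / a1)) ≠ 0 := hn (by
      rw [norm_mul, norm_div, ← mul_div_assoc, div_lt_one n1, mul_comm]; exact h21)
    have d3 := qPochInf_self_ne_zero hq
    simp only [hφ, barnesTheta]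
    rw [show a1 * a2 / (μ * a1) = a2 / μ by field_simp, show q / a1 * a1 = q by field_simp,
      show a1 * q / a1 = q by field_simp, show q / a2 * a1 = a1 * (q / a2) by ring,
      show a2 * q / a1 = a2 * (q / a1) by ring]
    generalize qPochInf q (a1 * (q / a2)) = X at d1 ⊢
    generalize qPochInf q (a2 * (q / a1)) = Y at d2 ⊢
    field_simp
  have d1q : (1 - q) ≠ 0 := fun h => by rw [← sub_eq_zero.1 h] at hq; simp at hq
  have main : (1 - q) * saalIntegral q μ r a1 a2 (q / a1) (q / a2) 0 = φ a1 := by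
    have : (1 - q) * saalIntegral q μ r a1 a2 (q / a1) (q / a2) 0 =
        1 / (a1 - a2) * (a1 * φ a1 - a2 * φ a2) := by
      rw [← p1, ← p2]; linear_combination k1 - k2 + hsh
    rw [this, ← hφ1]; field_simp
  rw [show a1 * (q / a1) = q by field_simp, show a2 * (q / a2) = q by field_simp,
    show a1 * a2 * (q / a1) * (q / a2) = q * q by field_simp] at hc
  simp only [mul_zero, qPochInf_zero, mul_one] at hc
  have hPq := qPochInf_succ hq q
  rw [hrad, ← hφv, ← main]
  linear_combination saalIntegral q μ r a1 a2 0 0 0 * hPq - (1 - q) * hc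

/-- The integral form of the nonterminating `q`-Saalschütz sum. -/
theorem saalIntegral_eval (hq0 : q ≠ 0) (hq : ‖q‖ < 1) {μ a1 a2 b1 b2 b3 : ℂ} {ρ : ℝ}
    (hμ : μ ≠ 0) (ha1 : a1 ≠ 0) (ha2 : a2 ≠ 0) (h1 : ‖a1‖ < ρ) (h2 : ‖a2‖ < ρ) (hne : a1 ≠ a2)
    (h12 : ‖q‖ * ‖a1‖ < ‖a2‖) (h21 : ‖q‖ * ‖a2‖ < ‖a1‖)
    (hb1 : ‖b1‖ * ρ < 1) (hb2 : ‖b2‖ * ρ < 1) (hb3 : ‖b3‖ * ρ < 1) :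
    qPochInf q q * (qPochInf q (a1 * b1) * qPochInf q (a2 * b1) * qPochInf q (a1 * b2) *
      qPochInf q (a2 * b2) * qPochInf q (a1 * b3) * qPochInf q (a2 * b3)) *
        saalIntegral q μ ρ a1 a2 b1 b2 b3 =
      qPochInf q (a1 * a2 * b1 * b2) * qPochInf q (a1 * a2 * b1 * b3) *
        qPochInf q (a1 * a2 * b2 * b3) * (qTheta q (a1 / μ) * qTheta q (a2 / μ)) := by
  rw [← saalIntegral_zero hq0 hq hμ ha1 ha2 h1 h2 hne h12 h21]
  linear_combination qPochInf q q *
    saalIntegral_eq_const hq0 hq hμ ha1 ha2 h1 h2 hb1 hb2 hb3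

end QSaalschutz

/-! ### Barnes and Euler integrals over circles -/

section BarnesEuler

open Real (circleAverage)
open Metric (sphere ball closedBall)

variable {q : ℂ}

/-- The Euler type integral over the unit circle. -/
def eulerCircle (q u p1 p2 p3 p4 p5 : ℂ) : ℂ :=
  circleAverage (fun z => qWeyl q z * qPair q u z /
    (qPair q p1 z * qPair q p2 z * qPair q p3 z * qPair q p4 z * qPair q p5 z)) 0 1

/-- The Barnes type integral over the circle of radius `ρ`. -/
def barnesCircle (q μ : ℂ) (ρ : ℝ) (u a1 a2 c1 c2 c3 : ℂ) : ℂ :=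
  circleAverage (fun w => barnesTheta q μ a1 a2 w *
    (qPochInf q (c1 * c2 * c3 * w) * qPochInf q (u * w)) /
    (qPochInf q (c1 * w) * qPochInf q (c2 * w) * qPochInf q (c3 * w) *
      qPochInf q (u / (a1 * a2) * w) * (qPochInf q (a1 / w) * qPochInf q (a2 / w)))) 0 ρ

lemma norm_mul_lt_one {x y : ℂ} (hx : ‖x‖ < 1) (hy : ‖y‖ < 1) : ‖x * y‖ < 1 := by
  rw [norm_mul]; nlinarith [norm_nonneg x, norm_nonneg y]

lemma norm_ne_zero_of_lt {a : ℂ} {ρ : ℝ} (h : ‖a‖ < ρ) : 0 < ρ := lt_of_le_of_lt (norm_nonneg _) h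

/-- The double integral of F is evaluated in both orders. For fixed w the function F is an
Askey–Wilson integrand in z with parameters c1, c2, c3, w; for fixed z it is a q-Saalschütz
integrand in w with parameters u/(a1 a2), z, 1/z. The condition ρ < 1 keeps the poles of the kernel
1/(zw, w/z)_∞ away from the two circles. -/
theorem barnesCircle_eq_eulerCircle (hq0 : q ≠ 0) (hq : ‖q‖ < 1) {μ u a1 a2 c1 c2 c3 : ℂ} {ρ : ℝ}
    (hμ : μ ≠ 0) (ha1 : a1 ≠ 0) (ha2 : a2 ≠ 0) (h1 : ‖a1‖ < ρ) (h2 : ‖a2‖ < ρ) (hne : a1 ≠ a2)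
    (h12 : ‖q‖ * ‖a1‖ < ‖a2‖) (h21 : ‖q‖ * ‖a2‖ < ‖a1‖) (hρ1 : ρ < 1)
    (hc1 : ‖c1‖ < 1) (hc2 : ‖c2‖ < 1) (hc3 : ‖c3‖ < 1) (hu : ‖u / (a1 * a2)‖ * ρ < 1) :
    2 * (qPochInf q (u / a1) * qPochInf q (u / a2)) * barnesCircle q μ ρ u a1 a2 c1 c2 c3 =
      qTheta q (a1 / μ) * qTheta q (a2 / μ) * (qPochInf q (c1 * c2) * qPochInf q (c1 * c3) *
        qPochInf q (c2 * c3) * qPochInf q (a1 * a2)) * eulerCircle q u a1 a2 c1 c2 c3 := by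
  have hρ := norm_ne_zero_of_lt h1
  have hn := fun {a} => qPochInf_ne_zero_of_norm_lt_one hq (a := a)
  have hPq := qPochInf_self_ne_zero hq
  have hz1 : ∀ {z : ℂ}, ‖z‖ = 1 → ‖z‖ * ρ < 1 := fun hz => by rw [hz, one_mul]; exact hρ1
  have hzi : ∀ {z : ℂ}, ‖z‖ = 1 → ‖z⁻¹‖ = 1 := fun hz => by simp [hz]
  obtain ⟨F, hF⟩ : ∃ F : ℂ → ℂ → ℂ, F = fun z w => qWeyl q z /
      (qPair q c1 z * qPair q c2 z * qPair q c3 z) *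
      saalIntegrand q μ a1 a2 (u / (a1 * a2)) z z⁻¹ w := ⟨_, rfl⟩
  have hcont : ContinuousOn (fun p : ℂ × ℂ => F p.1 p.2) (sphere 0 1 ×ˢ sphere 0 ρ) := by
    intro p hp
    obtain ⟨z, w⟩ := p
    simp only [Set.mem_prod, mem_sphere_iff_norm, sub_zero] at hp
    obtain ⟨hz, hw⟩ := hp
    have hz0 := ne_zero_of_norm_eq_one hz
    have hw0 : w ≠ 0 := norm_pos_iff.1 (by rw [hw]; exact hρ)
    have hP := continuous_qPochInf hq
    have hmem : (z, w) ∈ sphere (0:ℂ) 1 ×ˢ sphere (0:ℂ) ρ := by simp [hz, hw]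
    have hs : ContinuousAt (Prod.snd : ℂ × ℂ → ℂ) (z, w) := continuousAt_snd
    have hpair := fun c => (continuousOn_qPair_right hq c one_pos).comp
      (s := sphere (0:ℂ) 1 ×ˢ sphere (0:ℂ) ρ) continuousOn_fst (fun p hp => hp.1) (z, w) hmem
    have hweyl := (continuousOn_qWeyl hq one_pos).comp
      (s := sphere (0:ℂ) 1 ×ˢ sphere (0:ℂ) ρ) continuousOn_fst (fun p hp => hp.1) (z, w) hmem
    rw [hF]
    refine (hweyl.div (((hpair c1).mul (hpair c2)).mul (hpair c3)) ?_).mul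
      (ContinuousAt.continuousWithinAt ?_)
    · exact mul_ne_zero (mul_ne_zero (qPair_ne_zero hq hc1 hz) (qPair_ne_zero hq hc2 hz))
        (qPair_ne_zero hq hc3 hz)
    have c1 := (differentiableAt_barnesTheta hq hμ ha1 ha2 hw0).continuousAt.comp_of_eq hs rfl
    have c2 := fun b' => (differentiableAt_qPochInf_mul hq b' w).continuousAt.comp_of_eq hs rfl
    have c3 := fun a => (differentiableAt_qPochInf_div hq a hw0).continuousAt.comp_of_eq hs rfl
    have c4 : ContinuousAt (fun p : ℂ × ℂ => qPochInf q (p.1 * p.2)) (z, w) :=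
      (hP.comp (by fun_prop)).continuousAt
    have ci : ContinuousAt (fun p : ℂ × ℂ => p.1⁻¹) (z, w) := continuousAt_fst.inv₀ hz0
    have c6 : ContinuousAt (fun p : ℂ × ℂ => qPochInf q (p.1⁻¹ * p.2)) (z, w) :=
      ContinuousAt.comp (g := qPochInf q) hP.continuousAt (ci.mul continuousAt_snd)
    have c5 : ContinuousAt (fun p : ℂ × ℂ =>
        qPochInf q (a1 * a2 * (u / (a1 * a2)) * p.1 * p.1⁻¹ * p.2)) (z, w) :=
      ContinuousAt.comp (g := qPochInf q) hP.continuousAt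
        (((continuousAt_const.mul continuousAt_fst).mul ci).mul continuousAt_snd)
    exact (c1.mul c5).div ((((c2 _).mul c4).mul c6).mul ((c3 a1).mul (c3 a2)))
      (mul_ne_zero (mul_ne_zero (mul_ne_zero (hn (norm_mul_lt_one_of hu hw.le))
        (hn (norm_mul_lt_one_of (hz1 hz) hw.le))) (hn (norm_mul_lt_one_of (hz1 (hzi hz)) hw.le)))
        (mul_ne_zero (hn (norm_div_lt_one_of h1 hw.ge)) (hn (norm_div_lt_one_of h2 hw.ge))))
  have hcc : qPochInf q (c1 * c2) * qPochInf q (c1 * c3) * qPochInf q (c2 * c3) ≠ 0 :=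
    mul_ne_zero (mul_ne_zero (hn (norm_mul_lt_one hc1 hc2)) (hn (norm_mul_lt_one hc1 hc3)))
      (hn (norm_mul_lt_one hc2 hc3))
  have hu12 : a1 * a2 * (u / (a1 * a2)) = u := by field_simp
  have left : circleAverage (fun w => circleAverage (fun z => F z w) 0 1) 0 ρ =
      2 / (qPochInf q q * (qPochInf q (c1 * c2) * qPochInf q (c1 * c3) * qPochInf q (c2 * c3))) *
        barnesCircle q μ ρ u a1 a2 c1 c2 c3 := by
    unfold barnesCircle
    rw [← circleAverage_const_mul]
    refine circleAverage_congr_on hρ fun w hw => ?_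
    have hw1 : ‖w‖ < 1 := by rw [hw]; exact hρ1
    have haw := askeyWilson_eval hq0 hq hc1 hc2 hc3 hw1
    have n1 := hn (norm_mul_lt_one hc1 hw1)
    have n2 := hn (norm_mul_lt_one hc2 hw1)
    have n3 := hn (norm_mul_lt_one hc3 hw1)
    have e : circleAverage (fun z => F z w) 0 1 = barnesTheta q μ a1 a2 w * qPochInf q (u * w) /
        (qPochInf q (u / (a1 * a2) * w) * (qPochInf q (a1 / w) * qPochInf q (a2 / w))) *
        askeyWilson q c1 c2 c3 w := by
      unfold askeyWilson
      rw [← circleAverage_const_mul]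
      refine circleAverage_congr_on one_pos fun z hz => ?_
      have hz0 := ne_zero_of_norm_eq_one hz
      simp only [hF, saalIntegrand, hu12]
      rw [show u * z * z⁻¹ * w = u * w by field_simp]
      simp only [qPair, mul_comm z w, mul_comm z⁻¹ w]
      ring
    rw [e]
    have haw' : askeyWilson q c1 c2 c3 w = 2 / (qPochInf q q * (qPochInf q (c1 * c2) *
        qPochInf q (c1 * c3) * qPochInf q (c2 * c3))) * (qPochInf q (c1 * c2 * c3 * w) /
        (qPochInf q (c1 * w) * qPochInf q (c2 * w) * qPochInf q (c3 * w))) := by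
      rw [div_mul_div_comm, eq_div_iff (mul_ne_zero (mul_ne_zero hPq hcc)
        (mul_ne_zero (mul_ne_zero n1 n2) n3))]
      linear_combination haw
    rw [haw']
    ring
  have right : circleAverage (fun z => circleAverage (fun w => F z w) 0 ρ) 0 1 *
      (qPochInf q q * (qPochInf q (u / a1) * qPochInf q (u / a2))) =
      qTheta q (a1 / μ) * qTheta q (a2 / μ) * qPochInf q (a1 * a2) *
        eulerCircle q u a1 a2 c1 c2 c3 := by
    unfold eulerCircle
    rw [mul_comm, ← circleAverage_const_mul, ← circleAverage_const_mul]
    refine circleAverage_congr_on one_pos fun z hz => ?_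
    have hz0 := ne_zero_of_norm_eq_one hz
    have hsaal := saalIntegral_eval hq0 hq hμ ha1 ha2 h1 h2 hne h12 h21 hu (hz1 hz) (hz1 (hzi hz))
    have ha11 : ‖a1‖ < 1 := h1.trans hρ1
    have ha21 : ‖a2‖ < 1 := h2.trans hρ1
    have n1 := qPair_ne_zero hq ha11 hz
    have n2 := qPair_ne_zero hq ha21 hz
    have e : circleAverage (fun w => F z w) 0 ρ = qWeyl q z /
      (qPair q c1 z * qPair q c2 z * qPair q c3 z) *
      saalIntegral q μ ρ a1 a2 (u / (a1 * a2)) z z⁻¹ := by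
      unfold saalIntegral
      rw [← circleAverage_const_mul, hF]
    rw [e]
    rw [show a1 * (u / (a1 * a2)) = u / a2 by field_simp,
      show a2 * (u / (a1 * a2)) = u / a1 by field_simp, hu12,
      show a1 * a2 * z * z⁻¹ = a1 * a2 by field_simp] at hsaal
    have hs2 : (qPochInf q q * (qPochInf q (u / a1) * qPochInf q (u / a2))) *
        saalIntegral q μ ρ a1 a2 (u / (a1 * a2)) z z⁻¹ = qTheta q (a1 / μ) * qTheta q (a2 / μ) *
        qPochInf q (a1 * a2) * (qPair q u z / (qPair q a1 z * qPair q a2 z)) := by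
      rw [mul_div_assoc', eq_div_iff (mul_ne_zero n1 n2)]
      unfold qPair
      linear_combination hsaal
    rw [mul_left_comm, hs2]
    ring
  have hsw := circleAverage_swap one_pos hρ hcont
  rw [left] at hsw
  rw [hsw] at right
  have k1 := hn (norm_mul_lt_one hc1 hc2)
  have k2 := hn (norm_mul_lt_one hc1 hc3)
  have k3 := hn (norm_mul_lt_one hc2 hc3)
  field_simp at right
  linear_combination right

/-- Rahman's integral. -/
theorem rahman_integral (hq0 : q ≠ 0) (hq : ‖q‖ < 1) {a1 a2 c1 c2 c3 : ℂ}
    (h1 : ‖a1‖ < 1) (h2 : ‖a2‖ < 1) (hne : a1 ≠ a2)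
    (h12 : ‖q‖ * ‖a1‖ < ‖a2‖) (h21 : ‖q‖ * ‖a2‖ < ‖a1‖)
    (hc1 : ‖c1‖ < 1) (hc2 : ‖c2‖ < 1) (hc3 : ‖c3‖ < 1) :
    qPochInf q q * (qPochInf q (a1 * a2) * (qPochInf q (a1 * c1) * qPochInf q (a1 * c2) *
      qPochInf q (a1 * c3) * qPochInf q (a2 * c1) * qPochInf q (a2 * c2) * qPochInf q (a2 * c3)) *
      (qPochInf q (c1 * c2) * qPochInf q (c1 * c3) * qPochInf q (c2 * c3))) *
      eulerCircle q (a1 * a2 * c1 * c2 * c3) a1 a2 c1 c2 c3 =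
    2 * (qPochInf q (a1 * c1 * c2 * c3) * qPochInf q (a2 * c1 * c2 * c3) *
      (qPochInf q (a1 * a2 * c1 * c2) * qPochInf q (a1 * a2 * c1 * c3) *
      qPochInf q (a1 * a2 * c2 * c3))) := by
  have hqpos : 0 < ‖q‖ := norm_pos_iff.2 hq0
  have n1 : 0 < ‖a1‖ := by
    by_contra h
    have : ‖a1‖ = 0 := le_antisymm (not_lt.1 h) (norm_nonneg _)
    rw [this] at h21; nlinarith [norm_nonneg a2]
  have n2 : 0 < ‖a2‖ := by
    by_contra h
    have : ‖a2‖ = 0 := le_antisymm (not_lt.1 h) (norm_nonneg _)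
    rw [this] at h12; nlinarith [norm_nonneg a1]
  have ha1 : a1 ≠ 0 := norm_pos_iff.1 n1
  have ha2 : a2 ≠ 0 := norm_pos_iff.1 n2
  obtain ⟨ρ, hρ1, hρ2⟩ := exists_between (max_lt h1 h2)
  rw [max_lt_iff] at hρ1
  have hρ := norm_ne_zero_of_lt hρ1.1
  -- This r serves as μ: both a1/r and a2/r lie in the annulus ‖q‖ < ‖z‖ < 1, where the theta
  -- function has no zero, so the theta factors can be cancelled at the end.
  obtain ⟨r, hr1, hr2⟩ : ∃ r, max ‖a1‖ ‖a2‖ < r ∧ r < min ‖a1‖ ‖a2‖ / ‖q‖ := by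
    refine exists_between ?_
    rw [lt_div_iff₀ hqpos]
    rcases max_choice ‖a1‖ ‖a2‖ with h | h <;> rcases min_choice ‖a1‖ ‖a2‖ with h' | h' <;>
      rw [h, h'] <;> nlinarith
  rw [max_lt_iff] at hr1
  rw [lt_div_iff₀ hqpos, lt_min_iff] at hr2
  have hr : 0 < r := by linarith
  have hμ : (r : ℂ) ≠ 0 := by exact_mod_cast hr.ne'
  have hμn : ‖(r : ℂ)‖ = r := by simp [hr.le]
  have t1 : qTheta q (a1 / r) ≠ 0 := qTheta_ne_zero_of_annulus hq
    (by rw [norm_div, hμn, lt_div_iff₀ hr]; linarith) (by rw [norm_div, hμn, div_lt_one hr]; exact hr1.1)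
  have t2 : qTheta q (a2 / r) ≠ 0 := qTheta_ne_zero_of_annulus hq
    (by rw [norm_div, hμn, lt_div_iff₀ hr]; linarith) (by rw [norm_div, hμn, div_lt_one hr]; exact hr1.2)
  have hcr : ∀ {c : ℂ}, ‖c‖ < 1 → ‖c‖ * ρ < 1 := fun {c} hc => by nlinarith [norm_nonneg c]
  have hccc : ‖c1 * c2 * c3‖ < 1 := norm_mul_lt_one (norm_mul_lt_one hc1 hc2) hc3
  have hu : a1 * a2 * c1 * c2 * c3 / (a1 * a2) = c1 * c2 * c3 := by field_simp
  have hB := barnesCircle_eq_eulerCircle hq0 hq hμ ha1 ha2 hρ1.1 hρ1.2 hne h12 h21 hρ2 hc1 hc2 hc3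
    (u := a1 * a2 * c1 * c2 * c3) (by rw [hu]; exact hcr hccc)
  have hS := saalIntegral_eval hq0 hq hμ ha1 ha2 hρ1.1 hρ1.2 hne h12 h21 (hcr hc1) (hcr hc2) (hcr hc3)
  -- With u = a1 a2 c1 c2 c3 the denominator factor with parameter u/(a1 a2) cancels the numerator
  -- factor (c1 c2 c3 w)_∞.
  have hBS : barnesCircle q r ρ (a1 * a2 * c1 * c2 * c3) a1 a2 c1 c2 c3 =
      saalIntegral q r ρ a1 a2 c1 c2 c3 := by
    refine circleAverage_congr_on hρ fun w hw => ?_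
    have hcw := qPochInf_ne_zero_of_norm_lt_one hq (norm_mul_lt_one_of (hcr hccc) hw.le)
    simp only [saalIntegrand, hu]
    field_simp
  rw [hBS, show a1 * a2 * c1 * c2 * c3 / a1 = a2 * c1 * c2 * c3 by field_simp,
    show a1 * a2 * c1 * c2 * c3 / a2 = a1 * c1 * c2 * c3 by field_simp] at hB
  refine mul_left_cancel₀ (mul_ne_zero t1 t2) ?_
  linear_combination 2 * (qPochInf q (a2 * c1 * c2 * c3) * qPochInf q (a1 * c1 * c2 * c3)) * hS -
    qPochInf q q * (qPochInf q (a1 * c1) * qPochInf q (a1 * c2) *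
      qPochInf q (a1 * c3) * qPochInf q (a2 * c1) * qPochInf q (a2 * c2) * qPochInf q (a2 * c3)) * hB

end BarnesEuler

/-! ### The nonterminating `₆φ₅` summation -/

section SixPhiFive

variable {q : ℂ}

/-- `(a; q)_n`. -/
def qFin (q a : ℂ) (n : ℕ) : ℂ := ∏ j ∈ Finset.range n, (1 - a * q ^ j)

lemma qFin_zero (a : ℂ) : qFin q a 0 = 1 := by simp [qFin]

lemma qFin_succ (a : ℂ) (n : ℕ) : qFin q a (n + 1) = qFin q a n * (1 - a * q ^ n) := by
  simp [qFin, Finset.prod_range_succ]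

lemma qPochInf_eq_qFin_mul (hq : ‖q‖ < 1) (a : ℂ) (n : ℕ) :
    qPochInf q a = qFin q a n * qPochInf q (a * q ^ n) := qPochInf_split hq a n

lemma qFin_self_ne_zero (hq : ‖q‖ < 1) (n : ℕ) : qFin q q n ≠ 0 := by
  have h := qPochInf_self_ne_zero hq
  rw [qPochInf_eq_qFin_mul hq q n] at h
  exact left_ne_zero_of_mul h

lemma norm_qFin_le (hq : ‖q‖ < 1) {a : ℂ} {R : ℝ} (h : ‖a‖ ≤ R) (n : ℕ) :
    ‖qFin q a n‖ ≤ Real.exp (R / (1 - ‖q‖)) :=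
  (norm_qpochFin_le hq a n).trans (Real.exp_le_exp.2 (by
    have : 0 < 1 - ‖q‖ := by linarith
    gcongr))

lemma norm_qPochInf_le_of (hq : ‖q‖ < 1) {a : ℂ} {R : ℝ} (h : ‖a‖ ≤ R) :
    ‖qPochInf q a‖ ≤ Real.exp (R / (1 - ‖q‖)) :=
  (norm_qPochInf_le hq a).trans (Real.exp_le_exp.2 (by
    have : 0 < 1 - ‖q‖ := by linarith
    gcongr))

lemma norm_mul_pow_le (hq : ‖q‖ < 1) (a : ℂ) (n : ℕ) : ‖a * q ^ n‖ ≤ ‖a‖ := by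
  rw [norm_mul, norm_pow]
  exact mul_le_of_le_one_right (norm_nonneg _) (pow_le_one₀ (norm_nonneg _) hq.le)

lemma norm_inv_qFin_self_le (hq : ‖q‖ < 1) (n : ℕ) :
    ‖(qFin q q n)⁻¹‖ ≤ Real.exp (1 / (1 - ‖q‖)) / ‖qPochInf q q‖ := by
  have h := qPochInf_eq_qFin_mul hq q n
  have h0 := qPochInf_self_ne_zero hq
  have h1 := qFin_self_ne_zero hq n
  have : (qFin q q n)⁻¹ = qPochInf q (q * q ^ n) / qPochInf q q := by
    rw [eq_div_iff h0, h]; field_simp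
  rw [this, norm_div]
  gcongr
  exact norm_qPochInf_le_of hq ((norm_mul_pow_le hq q n).trans hq.le)

/-- `(aq; q)_{n-1} (1 - a q ^ (2n))`, the very-well-poised factor, for `c = a q`. -/
def wpCoef (q c : ℂ) : ℕ → ℂ
  | 0 => 1
  | n + 1 => qFin q c n * (1 - c * q ^ (2 * n + 1))

lemma norm_wpCoef_le (hq : ‖q‖ < 1) {c : ℂ} {R : ℝ} (h : ‖c‖ ≤ R) (n : ℕ) :
    ‖wpCoef q c n‖ ≤ Real.exp (R / (1 - ‖q‖)) * (1 + R) := by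
  have hR : 0 ≤ R := (norm_nonneg _).trans h
  have h1 : 0 < 1 - ‖q‖ := by linarith
  cases n with
  | zero =>
    have : 1 ≤ Real.exp (R / (1 - ‖q‖)) := Real.one_le_exp (by positivity)
    simp only [wpCoef, norm_one]
    nlinarith
  | succ n =>
    simp only [wpCoef, norm_mul]
    gcongr
    · exact norm_qFin_le hq h n
    · refine (norm_sub_le _ _).trans ?_
      rw [norm_one]
      have := (norm_mul_pow_le hq c (2 * n + 1)).trans h
      gcongr

/-- `∏_{j < n} (u - T q ^ j)`. -/
def shiftedProd (q u T : ℂ) (n : ℕ) : ℂ := ∏ j ∈ Finset.range n, (u - T * q ^ j)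

lemma shiftedProd_succ (u T : ℂ) (n : ℕ) :
    shiftedProd q u T (n + 1) = shiftedProd q u T n * (u - T * q ^ n) := by
  simp [shiftedProd, Finset.prod_range_succ]

lemma shiftedProd_mul_q (u T : ℂ) (n : ℕ) :
    shiftedProd q (q * u) T (n + 1) = (q * u - T) * q ^ n * shiftedProd q u T n := by
  simp only [shiftedProd]
  rw [Finset.prod_range_succ']
  have : ∀ j, q * u - T * q ^ (j + 1) = q * (u - T * q ^ j) := fun j => by ring
  simp only [this, Finset.prod_mul_distrib, Finset.prod_const, Finset.card_range]
  ring

lemma norm_shiftedProd_le (hq : ‖q‖ < 1) {u : ℂ} (T : ℂ) {r : ℝ} (hr : 0 < r) (hu : ‖u‖ ≤ r)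
    (n : ℕ) : ‖shiftedProd q u T n‖ ≤ r ^ n * Real.exp (‖T‖ / r / (1 - ‖q‖)) := by
  have h1 : 0 < 1 - ‖q‖ := by linarith
  have key : ∀ n, ∏ j ∈ Finset.range n, (r + ‖T‖ * ‖q‖ ^ j) ≤
      r ^ n * Real.exp (∑ j ∈ Finset.range n, ‖T‖ / r * ‖q‖ ^ j) := fun n => by
    rw [Real.exp_sum, ← Finset.card_range n, ← Finset.prod_const, Finset.card_range,
      ← Finset.prod_mul_distrib]
    refine Finset.prod_le_prod (fun _ _ => by positivity) fun j _ => ?_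
    have := Real.add_one_le_exp (‖T‖ / r * ‖q‖ ^ j)
    calc r + ‖T‖ * ‖q‖ ^ j = r * (‖T‖ / r * ‖q‖ ^ j + 1) := by field_simp; ring
      _ ≤ _ := by gcongr
  unfold shiftedProd
  rw [norm_prod]
  refine (Finset.prod_le_prod (fun _ _ => norm_nonneg _) fun j _ => ?_).trans ((key n).trans ?_)
  · refine (norm_sub_le _ _).trans ?_
    rw [norm_mul, norm_pow]
    gcongr
  · gcongr
    rw [← Finset.mul_sum, div_eq_mul_one_div (‖T‖ / r)]
    gcongr
    rw [one_div, ← tsum_geometric_of_lt_one (norm_nonneg _) hq]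
    exact (summable_geometric_of_lt_one (norm_nonneg _) hq).sum_le_tsum _
      fun _ _ => by positivity

/-- The terms of the `₆φ₅` series, cleared of denominators. -/
def sixTerm (q t T z u : ℂ) (k : ℕ) : ℂ :=
  wpCoef q (t * T) k * (qFin q q k)⁻¹ * (qFin q (t * z) k * qFin q (t * z⁻¹) k) *
    qPair q (T * q ^ k) z * (shiftedProd q u T k / t ^ k) * qPochInf q (t * u * q ^ k)

/-- The telescoping companion of `sixTerm`. -/
def sixCert (q t T z u : ℂ) (k : ℕ) : ℂ :=
  -(u / t) * (qFin q (t * T) k * (qFin q q k)⁻¹ * (qFin q (t * z) (k + 1) *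
    qFin q (t * z⁻¹) (k + 1)) * qPair q (T * q ^ k) z * (shiftedProd q u T k / t ^ k) *
    qPochInf q (t * u * q ^ (k + 1)))

/-- A certificate of Wilf–Zeilberger type: the combination of the k-th terms at u and at qu is the
difference of `sixCert` at k and at k - 1. Induction reduces this to a rational identity in the
first factors of the products. -/
lemma sixCert_telescope (hq : ‖q‖ < 1) {t z : ℂ} (ht : t ≠ 0) (hz : z ≠ 0) (T u : ℂ) (N : ℕ) :
    ∑ k ∈ Finset.range (N + 1), ((1 - u / t) * sixTerm q t T z u k -
      (1 - u * z) * (1 - u * z⁻¹) * sixTerm q t T z (q * u) k) = sixCert q t T z u N := by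
  induction N with
  | zero =>
    have e1 : t * (q * u) = t * u * q := by ring
    simp only [zero_add, Finset.sum_range_one, sixTerm, sixCert, wpCoef, qFin_succ, qFin_zero,
      shiftedProd, Finset.range_zero, Finset.prod_empty, pow_zero, mul_one, pow_one, div_one,
      inv_one, one_mul]
    rw [e1, qPochInf_succ hq (t * u)]
    field_simp
    ring
  | succ N ih =>
    rw [Finset.sum_range_succ, ih]
    have hQ := qFin_self_ne_zero hq (N + 1)
    have hQ0 := qFin_self_ne_zero hq N
    have e1 : t * (q * u) * q ^ (N + 1) = t * u * q ^ (N + 1) * q := by ring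
    have e2 : t * u * q ^ (N + 1 + 1) = t * u * q ^ (N + 1) * q := by ring
    have e3 : q ^ (2 * N + 1) = (q ^ N) ^ 2 * q := by ring
    have e4 : T * q ^ (N + 1) = T * q ^ N * q := by ring
    rw [qFin_succ] at hQ
    simp only [sixTerm, sixCert, wpCoef]
    rw [shiftedProd_mul_q, shiftedProd_succ, e1, e2, qPochInf_succ hq (t * u * q ^ (N + 1)),
      qPair_succ hq (T * q ^ N), e3, e4, qFin_succ q N, qFin_succ (t * T) N,
      qFin_succ (t * z) (N + 1), qFin_succ (t * z⁻¹) (N + 1)]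
    generalize qFin q (t * T) N = A at *
    generalize qFin q q N = Q at *
    generalize qFin q (t * z) (N + 1) = Z1 at *
    generalize qFin q (t * z⁻¹) (N + 1) = Z2 at *
    generalize shiftedProd q u T N = S at *
    generalize qPair q (T * q ^ N * q) z = W at *
    generalize qPochInf q (t * u * q ^ (N + 1) * q) = R at *
    rw [pow_succ q N, pow_succ t N]
    have htN : t ^ N ≠ 0 := pow_ne_zero _ ht
    generalize t ^ N = tN at *
    generalize q ^ N = x at *
    have hx : 1 - q * x ≠ 0 := right_ne_zero_of_mul hQ
    have hx' : 1 - x * q ≠ 0 := by rwa [mul_comm]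
    field_simp
    ring

/-- All factors are bounded uniformly in k except `shiftedProd q u T k / t ^ k`, which is of order
(r/‖t‖)^k. The bound is uniform in ‖z‖ = 1 and ‖u‖ ≤ r, as needed both for continuity in u and for
termwise integration. -/
lemma norm_sixTerm_le (hq : ‖q‖ < 1) {t : ℂ} (ht : t ≠ 0) (T : ℂ) {r : ℝ} (hr : 0 < r) :
    ∃ M : ℝ, 0 ≤ M ∧ ∀ z u k, ‖z‖ = 1 → ‖u‖ ≤ r →
      ‖sixTerm q t T z u k‖ ≤ M * (r / ‖t‖) ^ k ∧ ‖sixCert q t T z u k‖ ≤ M * (r / ‖t‖) ^ k := by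
  have h1 : 0 < 1 - ‖q‖ := by linarith
  have hPq := norm_pos_iff.2 (qPochInf_self_ne_zero hq)
  have ht' := norm_pos_iff.2 ht
  set e := fun R : ℝ => Real.exp (R / (1 - ‖q‖)) with he
  set C := e ‖t * T‖ * (1 + ‖t * T‖) * (e 1 / ‖qPochInf q q‖) * (e ‖t‖ * e ‖t‖) * (e ‖T‖ * e ‖T‖) *
    e (‖T‖ / r) * e (‖t‖ * r) with hC
  have hC0 : 0 ≤ C := by positivity
  have hz : ∀ {z a : ℂ}, ‖z‖ = 1 → ‖a * z‖ ≤ ‖a‖ := fun h => by simp [h]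
  have hzi : ∀ {z a : ℂ}, ‖z‖ = 1 → ‖a * z⁻¹‖ ≤ ‖a‖ := fun h => by simp [h]
  have hS : ∀ (u : ℂ) (k : ℕ), ‖u‖ ≤ r → ‖shiftedProd q u T k / t ^ k‖ ≤
      e (‖T‖ / r) * (r / ‖t‖) ^ k := fun u k hu => by
    rw [norm_div, norm_pow, div_pow, mul_div_assoc']
    gcongr
    rw [mul_comm]
    exact norm_shiftedProd_le hq T hr hu k
  have hP : ∀ (z : ℂ) (k : ℕ), ‖z‖ = 1 → ‖qPair q (T * q ^ k) z‖ ≤ e ‖T‖ * e ‖T‖ := fun z k h => by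
    rw [qPair, norm_mul]
    gcongr
    · exact norm_qPochInf_le_of hq ((hz h).trans (norm_mul_pow_le hq _ _))
    · exact norm_qPochInf_le_of hq ((hzi h).trans (norm_mul_pow_le hq _ _))
  have hF : ∀ (z : ℂ) (k : ℕ), ‖z‖ = 1 → ‖qFin q (t * z) k * qFin q (t * z⁻¹) k‖ ≤ e ‖t‖ * e ‖t‖ :=
    fun z k h => by
      rw [norm_mul]
      gcongr
      · exact norm_qFin_le hq (hz h) _
      · exact norm_qFin_le hq (hzi h) _
  have hR : ∀ (u : ℂ) (k : ℕ), ‖u‖ ≤ r → ‖qPochInf q (t * u * q ^ k)‖ ≤ e (‖t‖ * r) := fun u k hu =>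
    norm_qPochInf_le_of hq ((norm_mul_pow_le hq _ _).trans (by rw [norm_mul]; gcongr))
  refine ⟨C + r / ‖t‖ * C, by positivity, fun z u k h hu => ⟨?_, ?_⟩⟩
  · refine le_trans ?_ (mul_le_mul_of_nonneg_right (le_add_of_nonneg_right (by positivity))
      (by positivity))
    calc ‖sixTerm q t T z u k‖ ≤ e ‖t * T‖ * (1 + ‖t * T‖) * (e 1 / ‖qPochInf q q‖) *
        (e ‖t‖ * e ‖t‖) * (e ‖T‖ * e ‖T‖) * (e (‖T‖ / r) * (r / ‖t‖) ^ k) * e (‖t‖ * r) := by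
          unfold sixTerm
          rw [norm_mul, norm_mul, norm_mul, norm_mul, norm_mul]
          gcongr
          · exact norm_wpCoef_le hq le_rfl k
          · exact norm_inv_qFin_self_le hq k
          · exact hF z k h
          · exact hP z k h
          · exact hS u k hu
          · exact hR u k hu
      _ = C * (r / ‖t‖) ^ k := by rw [hC]; ring
  · refine le_trans ?_ (mul_le_mul_of_nonneg_right (le_add_of_nonneg_left (by positivity))
      (by positivity))
    calc ‖sixCert q t T z u k‖ ≤ (r / ‖t‖) * (e ‖t * T‖ * (e 1 / ‖qPochInf q q‖) *
        (e ‖t‖ * e ‖t‖) * (e ‖T‖ * e ‖T‖) * (e (‖T‖ / r) * (r / ‖t‖) ^ k) * e (‖t‖ * r)) := by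
          unfold sixCert
          rw [norm_mul, norm_neg, norm_div]
          refine mul_le_mul (by gcongr) ?_ (norm_nonneg _) (by positivity)
          rw [norm_mul, norm_mul, norm_mul, norm_mul, norm_mul]
          gcongr
          · exact norm_qFin_le hq le_rfl k
          · exact norm_inv_qFin_self_le hq k
          · exact hF z _ h
          · exact hP z k h
          · exact hS u k hu
          · exact hR u _ hu
      _ ≤ (r / ‖t‖) * ((e ‖t * T‖ * (1 + ‖t * T‖)) * (e 1 / ‖qPochInf q q‖) *
        (e ‖t‖ * e ‖t‖) * (e ‖T‖ * e ‖T‖) * (e (‖T‖ / r) * (r / ‖t‖) ^ k) * e (‖t‖ * r)) := by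
          gcongr
          exact le_mul_of_one_le_right (by positivity) (by linarith [norm_nonneg (t * T)])
      _ = (r / ‖t‖) * C * (r / ‖t‖) ^ k := by rw [hC]; ring

lemma hasSum_of_norm_le_geom {f : ℕ → ℂ} {M ρ : ℝ} (h0 : 0 ≤ ρ) (h1 : ρ < 1)
    (h : ∀ k, ‖f k‖ ≤ M * ρ ^ k) : Summable f :=
  .of_norm_bounded ((summable_geometric_of_lt_one h0 h1).mul_left M) h

/-- The sum of the series of `sixTerm`s. -/
def sixSum (q t T z u : ℂ) : ℂ := ∑' k, sixTerm q t T z u k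

lemma summable_sixTerm (hq : ‖q‖ < 1) {t z u : ℂ} (ht : t ≠ 0) (hz : ‖z‖ = 1) (T : ℂ)
    (hu : ‖u‖ < ‖t‖) : Summable (sixTerm q t T z u) := by
  have ht' := norm_pos_iff.2 ht
  obtain ⟨r, hr, hr2⟩ := exists_between hu
  obtain ⟨M, hM, h⟩ := norm_sixTerm_le hq ht T (lt_of_le_of_lt (norm_nonneg _) hr)
  exact hasSum_of_norm_le_geom (div_nonneg (norm_nonneg _ |>.trans hr.le) ht'.le)
    ((div_lt_one ht').2 hr2) fun k => (h z u k hz hr.le).1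

/-- The partial sums telescope to `sixCert`, which tends to 0 because ‖u‖ < ‖t‖. -/
lemma sixSum_shift (hq : ‖q‖ < 1) {t z u : ℂ} (ht : t ≠ 0) (hz : ‖z‖ = 1) (T : ℂ)
    (hu : ‖u‖ < ‖t‖) : (1 - u / t) * sixSum q t T z u =
      (1 - u * z) * (1 - u * z⁻¹) * sixSum q t T z (q * u) := by
  have ht' := norm_pos_iff.2 ht
  have hqu : ‖q * u‖ < ‖t‖ := by
    rw [norm_mul]; exact (mul_le_of_le_one_left (norm_nonneg _) hq.le).trans_lt hu
  obtain ⟨r, hr, hr2⟩ := exists_between hu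
  have hr0 := lt_of_le_of_lt (norm_nonneg _) hr
  obtain ⟨M, hM, h⟩ := norm_sixTerm_le hq ht T hr0
  have hs := ((summable_sixTerm hq ht hz T hu).hasSum.mul_left (1 - u / t)).sub
    ((summable_sixTerm hq ht hz T hqu).hasSum.mul_left ((1 - u * z) * (1 - u * z⁻¹)))
  have h1 := (tendsto_add_atTop_iff_nat 1).2 hs.tendsto_sum_nat
  simp only [sixCert_telescope hq ht (ne_zero_of_norm_eq_one hz)] at h1
  have h2 : Tendsto (fun k => sixCert q t T z u k) atTop (𝓝 0) := by
    refine squeeze_zero_norm (fun k => (h z u k hz hr.le).2) ?_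
    simpa using (tendsto_pow_atTop_nhds_zero_of_lt_one (div_nonneg hr0.le ht'.le)
      ((div_lt_one ht').2 hr2)).const_mul M
  exact sub_eq_zero.1 (tendsto_nhds_unique h1 h2)

lemma continuousOn_sixSum (hq : ‖q‖ < 1) {t z : ℂ} (ht : t ≠ 0) (hz : ‖z‖ = 1) (T : ℂ) {r : ℝ}
    (hr : 0 < r) (hrt : r < ‖t‖) :
    ContinuousOn (sixSum q t T z) (Metric.closedBall 0 r) := by
  have ht' := norm_pos_iff.2 ht
  obtain ⟨M, hM, h⟩ := norm_sixTerm_le hq ht T hr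
  refine continuousOn_tsum (fun k => ?_) ((summable_geometric_of_lt_one
    (div_nonneg hr.le ht'.le) ((div_lt_one ht').2 hrt)).mul_left M)
    fun k u hu => (h z u k hz (by simpa using hu)).1
  have hP := continuous_qPochInf hq
  unfold sixTerm shiftedProd
  fun_prop (disch := assumption)

/-- The nonterminating `₆φ₅` summation. -/
theorem sixSum_eq (hq : ‖q‖ < 1) {t z u T : ℂ} (ht : t ≠ 0) (hz : ‖z‖ = 1) (hT1 : ‖T‖ < 1)
    (hT : ‖T‖ < ‖t‖) (hu : ‖u‖ < ‖t‖) :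
    qPochInf q (u / t) * sixSum q t T z u =
      qPochInf q (t * T) * qPochInf q (T / t) * qPair q u z := by
  have ht' := norm_pos_iff.2 ht
  have hP := continuous_qPochInf hq
  -- The recursion u ↦ qu is iterated down to u = 0, where the sum is continuous, so the dependence
  -- on u is known up to the value at u = 0.
  have key : ∀ u : ℂ, ‖u‖ < ‖t‖ → qPochInf q (u / t) * sixSum q t T z u =
      qPair q u z * sixSum q t T z 0 := by
    intro u hu
    have hun : ∀ n : ℕ, ‖u * q ^ n‖ < ‖t‖ := fun n => (norm_mul_pow_le hq u n).trans_lt hu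
    have step : ∀ n : ℕ, qPochInf q (u / t) * sixSum q t T z u = qFin q (u * z) n *
        qFin q (u * z⁻¹) n * (qPochInf q (u * q ^ n / t) * sixSum q t T z (u * q ^ n)) := by
      intro n
      induction n with
      | zero => simp [qFin_zero]
      | succ n ih =>
        rw [ih, qFin_succ, qFin_succ, qPochInf_succ hq (u * q ^ n / t)]
        have := sixSum_shift hq ht hz T (hun n)
        rw [show q * (u * q ^ n) = u * q ^ (n + 1) by ring] at this
        rw [show u * q ^ n / t * q = u * q ^ (n + 1) / t by ring]
        linear_combination (qFin q (u * z) n * qFin q (u * z⁻¹) n *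
          qPochInf q (u * q ^ (n + 1) / t)) * this
    have hc := (continuousOn_sixSum hq ht hz T (half_pos ht') (half_lt_self ht')).continuousAt
      (Metric.closedBall_mem_nhds 0 (half_pos ht'))
    have l1 := (tendsto_qpochFin hq (u * z)).mul (tendsto_qpochFin hq (u * z⁻¹))
    have l2 : Tendsto (fun n : ℕ => qPochInf q (u * q ^ n / t)) atTop (𝓝 1) := by
      have := tendsto_qPochInf_mul_pow hq (u / t)
      refine this.congr fun n => by rw [div_mul_eq_mul_div]
    have l3 := l1.mul (l2.mul (hc.tendsto.comp (tendsto_mul_pow_zero hq u)))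
    have := tendsto_nhds_unique (tendsto_const_nhds.congr step) l3
    rw [this, one_mul, qPair]
  -- At u = T only the term k = 0 survives. Together with `key` this determines the value at u = 0.
  have hT0 : sixSum q t T z T = qPair q T z * qPochInf q (t * T) := by
    unfold sixSum
    rw [tsum_eq_single 0]
    · simp [sixTerm, wpCoef, qFin_zero, shiftedProd]
    · intro k hk
      have : shiftedProd q T T k = 0 := by
        unfold shiftedProd
        exact Finset.prod_eq_zero (Finset.mem_range.2 (Nat.pos_of_ne_zero hk)) (by simp)
      simp [sixTerm, this]
  have h1 := key T hT
  rw [hT0] at h1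
  have hne := qPair_ne_zero hq hT1 hz
  have h2 : sixSum q t T z 0 = qPochInf q (t * T) * qPochInf q (T / t) := by
    apply mul_left_cancel₀ hne
    linear_combination -h1
  rw [key u hu, h2]
  ring

end SixPhiFive

/-! ### The Nassrallah–Rahman formula over the unit circle -/

section NassrallahRahman

open Real (circleAverage)
open Metric (sphere ball closedBall)

variable {q : ℂ}

/-- The terms of a very-well-poised series with parameters `b₁, …, b₅` and `c = a q`. -/
def wpTerm (q c b1 b2 b3 b4 b5 ζ : ℂ) (k : ℕ) : ℂ :=
  wpCoef q c k * (qFin q q k)⁻¹ * ζ ^ k *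
    (qPochInf q (c / b1 * q ^ k) / qPochInf q (b1 * q ^ k) *
    (qPochInf q (c / b2 * q ^ k) / qPochInf q (b2 * q ^ k)) *
    (qPochInf q (c / b3 * q ^ k) / qPochInf q (b3 * q ^ k)) *
    (qPochInf q (c / b4 * q ^ k) / qPochInf q (b4 * q ^ k)) *
    (qPochInf q (c / b5 * q ^ k) / qPochInf q (b5 * q ^ k)))

lemma qPair_eq_qFin_mul (hq : ‖q‖ < 1) (t z : ℂ) (k : ℕ) :
    qPair q t z = qFin q (t * z) k * qFin q (t * z⁻¹) k * qPair q (t * q ^ k) z := by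
  unfold qPair
  rw [qPochInf_eq_qFin_mul hq (t * z) k, qPochInf_eq_qFin_mul hq (t * z⁻¹) k,
    mul_right_comm t z, mul_right_comm t z⁻¹]
  ring

/-- The q-shifted factorial with T/u is only available for u ≠ 0, whereas the recursion for `sixSum`
ends at u = 0; hence the polynomial form in the definition of the terms. -/
lemma shiftedProd_eq {u : ℂ} (hu : u ≠ 0) (T : ℂ) (k : ℕ) :
    shiftedProd q u T k = u ^ k * qFin q (T / u) k := by
  unfold shiftedProd qFin
  have : ∀ j, u - T * q ^ j = u * (1 - T / u * q ^ j) := fun j => by field_simp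
  simp only [this, Finset.prod_mul_distrib, Finset.prod_const, Finset.card_range]

/-- The k-th term integrates to an Euler integral with denominator parameters a1, a2, c1, c2, t q^k
and numerator parameter T q^k. Since T = t a1 a2 c1 c2, the numerator parameter is the product of
the other five, which is the balancing condition in Rahman's integral. -/
lemma nassrallahRahman_term (hq0 : q ≠ 0) (hq : ‖q‖ < 1) {t a1 a2 c1 c2 u T : ℂ}
    (hT : T = t * a1 * a2 * c1 * c2) (ht0 : t ≠ 0) (hc10 : c1 ≠ 0) (hc20 : c2 ≠ 0) (hu0 : u ≠ 0)
    (ht : ‖t‖ < 1) (h1 : ‖a1‖ < 1) (h2 : ‖a2‖ < 1) (hne : a1 ≠ a2)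
    (h12 : ‖q‖ * ‖a1‖ < ‖a2‖) (h21 : ‖q‖ * ‖a2‖ < ‖a1‖) (hc1 : ‖c1‖ < 1) (hc2 : ‖c2‖ < 1)
    (hTu : qPochInf q (T / u) ≠ 0) (k : ℕ) :
    qPochInf q q * (qPochInf q (a1 * a2) * qPochInf q (a1 * c1) *
      qPochInf q (a1 * c2) * qPochInf q (a2 * c1) * qPochInf q (a2 * c2) * qPochInf q (c1 * c2)) *
      ((wpCoef q (t * T) k * (qFin q q k)⁻¹ * (shiftedProd q u T k / t ^ k) *
        qPochInf q (t * u * q ^ k)) * eulerCircle q (T * q ^ k) a1 a2 c1 c2 (t * q ^ k)) =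
      2 * qPochInf q (T / u) * qPochInf q (T / t) *
      wpTerm q (t * T) (t * a1) (t * a2) (t * c1) (t * c2) (T / u) (u / t) k := by
  have hn := fun {a} => qPochInf_ne_zero_of_norm_lt_one hq (a := a)
  have ha10 : a1 ≠ 0 := by
    rintro rfl; rw [norm_zero] at h21; nlinarith [norm_nonneg a2, norm_nonneg q]
  have ha20 : a2 ≠ 0 := by
    rintro rfl; rw [norm_zero] at h12; nlinarith [norm_nonneg a1, norm_nonneg q]
  have htk : ‖t * q ^ k‖ < 1 := norm_mul_pow_lt_one hq ht k
  have hR := rahman_integral hq0 hq h1 h2 hne h12 h21 hc1 hc2 htk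
  have hTt : T / t = a1 * a2 * c1 * c2 := by rw [hT]; field_simp
  have hTk : a1 * a2 * c1 * c2 * (t * q ^ k) = T * q ^ k := by rw [hT]; ring
  rw [hTk] at hR
  have hcT : ∀ {b b' : ℂ}, b ≠ 0 → T = b * b' → t * T / (t * b) = b' := fun hb h => by
    rw [h]; field_simp
  have d1 : t * T / (t * a1) = t * a2 * c1 * c2 := hcT ha10 (by rw [hT]; ring)
  have d2 : t * T / (t * a2) = t * a1 * c1 * c2 := hcT ha20 (by rw [hT]; ring)
  have d3 : t * T / (t * c1) = t * a1 * a2 * c2 := hcT hc10 (by rw [hT]; ring)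
  have d4 : t * T / (t * c2) = t * a1 * a2 * c1 := hcT hc20 (by rw [hT]; ring)
  have hT0 : T ≠ 0 := by
    rw [hT]; exact mul_ne_zero (mul_ne_zero (mul_ne_zero (mul_ne_zero ht0 ha10) ha20) hc10) hc20
  have d5 : t * T / (T / u) = t * u := by field_simp
  have s1 : T / u ≠ 0 := div_ne_zero hT0 hu0
  rw [wpTerm, d1, d2, d3, d4, d5, shiftedProd_eq hu0]
  rw [qPochInf_eq_qFin_mul hq (T / u) k] at hTu
  rw [hTt, qPochInf_eq_qFin_mul hq (T / u) k]
  have g1 : a1 * c1 * c2 * (t * q ^ k) = t * a1 * c1 * c2 * q ^ k := by ring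
  have g2 : a2 * c1 * c2 * (t * q ^ k) = t * a2 * c1 * c2 * q ^ k := by ring
  have g3 : a1 * a2 * c1 * (t * q ^ k) = t * a1 * a2 * c1 * q ^ k := by ring
  have g4 : a1 * a2 * c2 * (t * q ^ k) = t * a1 * a2 * c2 * q ^ k := by ring
  have g5 : ∀ b, b * (t * q ^ k) = t * b * q ^ k := fun b => by ring
  rw [g1, g2, g3, g4, g5 a1, g5 a2, g5 c1, g5 c2] at hR
  have m1 := hn (norm_mul_pow_lt_one hq (norm_mul_lt_one ht h1) k)
  have m2 := hn (norm_mul_pow_lt_one hq (norm_mul_lt_one ht h2) k)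
  have m3 := hn (norm_mul_pow_lt_one hq (norm_mul_lt_one ht hc1) k)
  have m4 := hn (norm_mul_pow_lt_one hq (norm_mul_lt_one ht hc2) k)
  have m5 := right_ne_zero_of_mul hTu
  generalize eulerCircle q (T * q ^ k) a1 a2 c1 c2 (t * q ^ k) = EE at *
  rw [div_pow]
  have htk0 : t ^ k ≠ 0 := pow_ne_zero _ ht0
  generalize qPochInf q (T / u * q ^ k) = Y5 at *
  generalize qPochInf q (t * a1 * q ^ k) = Y1 at *
  generalize qPochInf q (t * a2 * q ^ k) = Y2 at *
  generalize qPochInf q (t * c1 * q ^ k) = Y3 at *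
  generalize qPochInf q (t * c2 * q ^ k) = Y4 at *
  generalize qPochInf q (t * a1 * c1 * c2 * q ^ k) = X1 at *
  generalize qPochInf q (t * a2 * c1 * c2 * q ^ k) = X2 at *
  generalize qPochInf q (t * a1 * a2 * c1 * q ^ k) = X3 at *
  generalize qPochInf q (t * a1 * a2 * c2 * q ^ k) = X4 at *
  generalize qPochInf q (t * u * q ^ k) = X5 at *
  generalize qPochInf q (a1 * a2 * c1 * c2) = X6 at *
  generalize (qFin q q k)⁻¹ = G at *
  generalize qFin q (T / u) k = G' at *
  field_simp
  linear_combination (wpCoef q (t * T) k * G * G' * X5) * hR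

lemma sixTerm_integrand (D1 D2 D3 D4 W C F1 F2 Q U S R : ℂ) (h1 : F1 ≠ 0) (h2 : F2 ≠ 0) :
    W / (F1 * F2 * Q * D1 * D2 * D3 * D4) * (C * U⁻¹ * (F1 * F2) * R * S) =
      (C * U⁻¹ * S) * (W * R / (D1 * D2 * D3 * D4 * Q)) := by
  field_simp

/-- The 6φ5 sum expands (uz, u/z)_∞/(tz, t/z)_∞ in the functions (Tq^k z, Tq^k/z)_∞/(tq^k z,
tq^k/z)_∞. The geometric bound on the terms, uniform on the unit circle, allows termwise
integration, and each term is a Rahman integral. -/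
theorem nassrallahRahman_circle (hq0 : q ≠ 0) (hq : ‖q‖ < 1) {t a1 a2 c1 c2 u T : ℂ}
    (hT : T = t * a1 * a2 * c1 * c2) (ht0 : t ≠ 0) (hc10 : c1 ≠ 0) (hc20 : c2 ≠ 0) (hu0 : u ≠ 0)
    (ht : ‖t‖ < 1) (h1 : ‖a1‖ < 1) (h2 : ‖a2‖ < 1) (hne : a1 ≠ a2)
    (h12 : ‖q‖ * ‖a1‖ < ‖a2‖) (h21 : ‖q‖ * ‖a2‖ < ‖a1‖) (hc1 : ‖c1‖ < 1) (hc2 : ‖c2‖ < 1)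
    (hu : ‖u‖ < ‖t‖) (hTu : qPochInf q (T / u) ≠ 0) :
    HasSum (fun k => 2 * (qPochInf q (u / t) * qPochInf q (T / u)) *
      wpTerm q (t * T) (t * a1) (t * a2) (t * c1) (t * c2) (T / u) (u / t) k)
    (qPochInf q q * qPochInf q (t * T) * (qPochInf q (a1 * a2) * qPochInf q (a1 * c1) *
      qPochInf q (a1 * c2) * qPochInf q (a2 * c1) * qPochInf q (a2 * c2) * qPochInf q (c1 * c2)) *
      eulerCircle q u t a1 a2 c1 c2) := by
  have hn := fun {a} => qPochInf_ne_zero_of_norm_lt_one hq (a := a)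
  have hPq := qPochInf_self_ne_zero hq
  have hqpos : 0 < ‖q‖ := norm_pos_iff.2 hq0
  have ha10 : a1 ≠ 0 := by
    rintro rfl; rw [norm_zero] at h21; nlinarith [norm_nonneg a2]
  have ha20 : a2 ≠ 0 := by
    rintro rfl; rw [norm_zero] at h12; nlinarith [norm_nonneg a1]
  have ht' := norm_pos_iff.2 ht0
  have hTt : T / t = a1 * a2 * c1 * c2 := by rw [hT]; field_simp
  have hTt1 : ‖T / t‖ < 1 := by
    rw [hTt]; exact norm_mul_lt_one (norm_mul_lt_one (norm_mul_lt_one h1 h2) hc1) hc2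
  have hTlt : ‖T‖ < ‖t‖ := by rwa [norm_div, div_lt_one ht'] at hTt1
  have hT1 : ‖T‖ < 1 := hTlt.trans ht
  obtain ⟨r, hr, hr2⟩ := exists_between hu
  have hr0 := lt_of_le_of_lt (norm_nonneg _) hr
  obtain ⟨M, hM, hMb⟩ := norm_sixTerm_le hq ht0 T hr0
  set D : ℂ → ℂ := fun z => qWeyl q z /
    (qPair q t z * qPair q a1 z * qPair q a2 z * qPair q c1 z * qPair q c2 z) with hD
  have hDc : ContinuousOn D (sphere 0 1) := by
    have hp := fun c => continuousOn_qPair_right hq c one_pos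
    refine (continuousOn_qWeyl hq one_pos).div
      (((((hp t).mul (hp a1)).mul (hp a2)).mul (hp c1)).mul (hp c2)) fun z hz => ?_
    have hz1 : ‖z‖ = 1 := by simpa using hz
    have := fun {c} hc => qPair_ne_zero hq (a := c) hc hz1
    exact mul_ne_zero (mul_ne_zero (mul_ne_zero (mul_ne_zero (this ht) (this h1)) (this h2))
      (this hc1)) (this hc2)
  obtain ⟨K, hK⟩ := (isCompact_sphere (0:ℂ) 1).exists_bound_of_continuousOn hDc
  have hK0 : 0 ≤ K := (norm_nonneg _).trans (hK 1 (by simp))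
  have hsum : HasSum (fun k => circleAverage (fun z => D z * sixTerm q t T z u k) 0 1)
      (circleAverage (fun z => D z * sixSum q t T z u) 0 1) := by
    refine hasSum_circleAverage one_pos (u := fun k => K * (M * (r / ‖t‖) ^ k)) (fun k => ?_)
      (((summable_geometric_of_lt_one (div_nonneg hr0.le ht'.le)
        ((div_lt_one ht').2 hr2)).mul_left M).mul_left K) (fun k z hz => ?_) fun z hz => ?_
    · refine hDc.mul ?_
      have hinv : ContinuousOn (fun z : ℂ => z⁻¹) (sphere 0 1) :=
        continuousOn_inv₀.mono fun z hz => ne_zero_of_norm_eq_one (by simpa using hz)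
      have hF : ∀ n, Continuous fun a => qFin q a n := fun n => by unfold qFin; fun_prop
      have f1 : ContinuousOn (fun z => qFin q (t * z) k) (sphere 0 1) :=
        ((hF k).comp (by fun_prop)).continuousOn
      have f2 : ContinuousOn (fun z => qFin q (t * z⁻¹) k) (sphere 0 1) :=
        (hF k).comp_continuousOn (hinv.const_smul t)
      have f3 := continuousOn_qPair_right hq (T * q ^ k) one_pos
      unfold sixTerm
      exact (((continuousOn_const.mul (f1.mul f2)).mul f3).mul continuousOn_const).mul
        continuousOn_const
    · rw [norm_mul]
      exact mul_le_mul (hK z (by simpa using hz)) (hMb z u k hz hr.le).1 (norm_nonneg _) hK0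
    · exact (summable_sixTerm hq ht0 hz T hu).hasSum.mul_left _
  have htot : qPochInf q (u / t) * circleAverage (fun z => D z * sixSum q t T z u) 0 1 =
      qPochInf q (t * T) * qPochInf q (T / t) * eulerCircle q u t a1 a2 c1 c2 := by
    unfold eulerCircle
    rw [← circleAverage_const_mul, ← circleAverage_const_mul]
    refine circleAverage_congr_on one_pos fun z hz => ?_
    have := sixSum_eq hq ht0 hz hT1 hTlt hu
    rw [mul_left_comm, this]
    simp only [hD]
    ring
  have hterm : ∀ k, qPochInf q q * (qPochInf q (a1 * a2) * qPochInf q (a1 * c1) *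
      qPochInf q (a1 * c2) * qPochInf q (a2 * c1) * qPochInf q (a2 * c2) * qPochInf q (c1 * c2)) *
      circleAverage (fun z => D z * sixTerm q t T z u k) 0 1 =
      2 * qPochInf q (T / u) * qPochInf q (T / t) *
      wpTerm q (t * T) (t * a1) (t * a2) (t * c1) (t * c2) (T / u) (u / t) k := by
    intro k
    have e : circleAverage (fun z => D z * sixTerm q t T z u k) 0 1 =
        (wpCoef q (t * T) k * (qFin q q k)⁻¹ * (shiftedProd q u T k / t ^ k) *
        qPochInf q (t * u * q ^ k)) * eulerCircle q (T * q ^ k) a1 a2 c1 c2 (t * q ^ k) := by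
      unfold eulerCircle
      rw [← circleAverage_const_mul]
      refine circleAverage_congr_on one_pos fun z hz => ?_
      have n1 := qPair_ne_zero hq ht hz
      simp only [hD, sixTerm]
      rw [qPair_eq_qFin_mul hq t z k] at n1 ⊢
      have n2 := right_ne_zero_of_mul n1
      have n3 := right_ne_zero_of_mul (left_ne_zero_of_mul n1)
      have n4 := left_ne_zero_of_mul (left_ne_zero_of_mul n1)
      have := sixTerm_integrand (qPair q a1 z) (qPair q a2 z) (qPair q c1 z) (qPair q c2 z)
        (qWeyl q z) (wpCoef q (t * T) k) (qFin q (t * z) k) (qFin q (t * z⁻¹) k)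
        (qPair q (t * q ^ k) z) (qFin q q k) (shiftedProd q u T k / t ^ k * qPochInf q (t * u * q ^ k))
        (qPair q (T * q ^ k) z) n4 n3
      linear_combination this
    rw [e]
    exact nassrallahRahman_term hq0 hq hT ht0 hc10 hc20 hu0 ht h1 h2 hne h12 h21 hc1 hc2 hTu k
  have hTtne := hn hTt1
  have := (hsum.mul_left (qPochInf q (u / t) * (qPochInf q q * (qPochInf q (a1 * a2) *
    qPochInf q (a1 * c1) * qPochInf q (a1 * c2) * qPochInf q (a2 * c1) * qPochInf q (a2 * c2) *
    qPochInf q (c1 * c2)))/ qPochInf q (T / t)))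
  have e1 : ∀ k, qPochInf q (u / t) * (qPochInf q q * (qPochInf q (a1 * a2) *
      qPochInf q (a1 * c1) * qPochInf q (a1 * c2) * qPochInf q (a2 * c1) * qPochInf q (a2 * c2) *
      qPochInf q (c1 * c2))) / qPochInf q (T / t) *
      circleAverage (fun z => D z * sixTerm q t T z u k) 0 1 =
      2 * (qPochInf q (u / t) * qPochInf q (T / u)) *
        wpTerm q (t * T) (t * a1) (t * a2) (t * c1) (t * c2) (T / u) (u / t) k := fun k => by
    rw [div_mul_eq_mul_div, div_eq_iff hTtne]
    linear_combination qPochInf q (u / t) * hterm k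
  have e2 : qPochInf q (u / t) * (qPochInf q q * (qPochInf q (a1 * a2) *
      qPochInf q (a1 * c1) * qPochInf q (a1 * c2) * qPochInf q (a2 * c1) * qPochInf q (a2 * c2) *
      qPochInf q (c1 * c2))) / qPochInf q (T / t) *
      circleAverage (fun z => D z * sixSum q t T z u) 0 1 =
      qPochInf q q * qPochInf q (t * T) * (qPochInf q (a1 * a2) * qPochInf q (a1 * c1) *
      qPochInf q (a1 * c2) * qPochInf q (a2 * c1) * qPochInf q (a2 * c2) * qPochInf q (c1 * c2)) *
      eulerCircle q u t a1 a2 c1 c2 := by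
    rw [div_mul_eq_mul_div, div_eq_iff hTtne]
    linear_combination (qPochInf q q * (qPochInf q (a1 * a2) *
      qPochInf q (a1 * c1) * qPochInf q (a1 * c2) * qPochInf q (a2 * c1) * qPochInf q (a2 * c2) *
      qPochInf q (c1 * c2))) * htot
  rw [e2] at this
  simpa only [e1] using this

end NassrallahRahman

/-! ### The third integral over a circle -/

section ThirdIntegral

open Real (circleAverage)
open Metric (sphere ball closedBall)

variable {q : ℂ}

/-- The integrand of the third integral. -/
def vForm (q a b1 b2 b3 b4 b5 x : ℂ) : ℂ :=
  qTheta q (q * (b1 * b2 * b3 * b4 * b5) * x) / qTheta q (q * a * (b1 * b2 * b3 * b4 * b5)) *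
    (1 - x ^ 2 / q) *
    (qPochInf q (x / b1) / qPochInf q (b1 * x) * (qPochInf q (x / b2) / qPochInf q (b2 * x)) *
      (qPochInf q (x / b3) / qPochInf q (b3 * x)) * (qPochInf q (x / b4) / qPochInf q (b4 * x)) *
      (qPochInf q (x / b5) / qPochInf q (b5 * x))) *
    (1 / (qPochInf q (a * x / q) * qPochInf q (a / x)))

/-- The holomorphic part of `vForm`. -/
def vEntire (q a b1 b2 b3 b4 b5 x : ℂ) : ℂ :=
  (1 - x ^ 2 / q) * qPochInf q (q * x / a) *
    (qPochInf q (x / b1) / qPochInf q (b1 * x) * (qPochInf q (x / b2) / qPochInf q (b2 * x)) *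
      (qPochInf q (x / b3) / qPochInf q (b3 * x)) * (qPochInf q (x / b4) / qPochInf q (b4 * x)) *
      (qPochInf q (x / b5) / qPochInf q (b5 * x))) / qPochInf q (a * x / q)

lemma differentiableAt_vEntire (hq : ‖q‖ < 1) {a b1 b2 b3 b4 b5 x : ℂ}
    (h : ‖a * x / q‖ < 1) (h1 : ‖b1 * x‖ < 1) (h2 : ‖b2 * x‖ < 1) (h3 : ‖b3 * x‖ < 1)
    (h4 : ‖b4 * x‖ < 1) (h5 : ‖b5 * x‖ < 1) :
    DifferentiableAt ℂ (vEntire q a b1 b2 b3 b4 b5) x := by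
  have hn := fun {a} => qPochInf_ne_zero_of_norm_lt_one hq (a := a)
  have hd := differentiable_qPochInf hq
  have c : ∀ {g : ℂ → ℂ}, DifferentiableAt ℂ g x → DifferentiableAt ℂ (fun x => qPochInf q (g x)) x :=
    fun hg => (hd _).comp x hg
  have f : ∀ {b}, ‖b * x‖ < 1 →
      DifferentiableAt ℂ (fun x => qPochInf q (x / b) / qPochInf q (b * x)) x :=
    fun hb => (c (by fun_prop)).div (c (by fun_prop)) (hn hb)
  exact (((by fun_prop : DifferentiableAt ℂ (fun x : ℂ => 1 - x ^ 2 / q) x).mul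
    (c (by fun_prop))).mul (((((f h1).mul (f h2)).mul (f h3)).mul (f h4)).mul (f h5))).div
    (c (by fun_prop)) (hn h)

/-- At the pole x = a q^n the factor 1 - x²/q together with 1/(ax/q)_∞ produces the very-well-poised
coefficient, and (qx/a)_∞ = (q^{n+1})_∞ produces 1/(q; q)_n. -/
lemma vEntire_mul_pow (hq0 : q ≠ 0) (hq : ‖q‖ < 1) {a b1 b2 b3 b4 b5 : ℂ} (ha : a ≠ 0)
    (haq : ‖a * a / q‖ < 1) (n : ℕ) :
    qPochInf q (a * a) * vEntire q a b1 b2 b3 b4 b5 (a * q ^ n) =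
      qPochInf q q * (wpCoef q (a * a) n * (qFin q q n)⁻¹ *
      (qPochInf q (a * q ^ n / b1) / qPochInf q (b1 * (a * q ^ n)) *
      (qPochInf q (a * q ^ n / b2) / qPochInf q (b2 * (a * q ^ n))) *
      (qPochInf q (a * q ^ n / b3) / qPochInf q (b3 * (a * q ^ n))) *
      (qPochInf q (a * q ^ n / b4) / qPochInf q (b4 * (a * q ^ n))) *
      (qPochInf q (a * q ^ n / b5) / qPochInf q (b5 * (a * q ^ n))))) := by
  have hn := fun {a} => qPochInf_ne_zero_of_norm_lt_one hq (a := a)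
  have h1 := qPochInf_eq_qFin_mul hq q n
  have h2 := qFin_self_ne_zero hq n
  have h3 : qPochInf q (a * a) * (1 - (a * q ^ n) ^ 2 / q) =
      wpCoef q (a * a) n * qPochInf q (a * (a * q ^ n) / q) := by
    cases n with
    | zero =>
      simp only [wpCoef, pow_zero, mul_one, one_mul]
      rw [qPochInf_succ hq (a * a / q), show a * a / q * q = a * a by field_simp]
      ring
    | succ n =>
      rw [wpCoef, qPochInf_eq_qFin_mul hq (a * a) n,
        show a * (a * q ^ (n + 1)) / q = a * a * q ^ n by rw [pow_succ]; field_simp,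
        show (a * q ^ (n + 1)) ^ 2 / q = a * a * q ^ (2 * n + 1) by rw [div_eq_iff hq0]; ring]
      ring
  have h4 : qPochInf q (a * (a * q ^ n) / q) ≠ 0 := hn (by
    rw [show a * (a * q ^ n) / q = a * a / q * q ^ n by ring]
    exact norm_mul_pow_lt_one hq haq n)
  have h5 : q * (a * q ^ n) / a = q * q ^ n := by field_simp
  rw [vEntire, h5, h1, mul_div_assoc', div_eq_iff h4]
  generalize (qPochInf q (a * q ^ n / b1) / qPochInf q (b1 * (a * q ^ n)) *
      (qPochInf q (a * q ^ n / b2) / qPochInf q (b2 * (a * q ^ n))) *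
      (qPochInf q (a * q ^ n / b3) / qPochInf q (b3 * (a * q ^ n))) *
      (qPochInf q (a * q ^ n / b4) / qPochInf q (b4 * (a * q ^ n))) *
      (qPochInf q (a * q ^ n / b5) / qPochInf q (b5 * (a * q ^ n)))) = Z
  have h6 : qFin q q n * (qFin q q n)⁻¹ = 1 := mul_inv_cancel₀ h2
  linear_combination (qPochInf q (q * q ^ n) * Z) * h3 -
    (wpCoef q (a * a) n * qPochInf q (a * (a * q ^ n) / q) * qPochInf q (q * q ^ n) * Z) * h6

lemma vForm_coefficient {p θ : ℂ} (hp : p ≠ 0) (hθ : θ ≠ 0) (s y w : ℂ) :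
    p * s / θ * (y * (θ / (p * p) * w)) = p⁻¹ * y * (s * w) := by
  field_simp

lemma vForm_factor {θ x : ℂ} (hθ : θ ≠ 0) (hx : x ≠ 0) (t s z d a : ℂ) :
    t / x * (s * x * z / d) * (1 / a) = θ * (t / θ * s * z * (1 / (d * a))) := by
  field_simp

set_option maxHeartbeats 400000 in
/-- The third integral as a very-well-poised series. -/
theorem hasSum_vForm (hq0 : q ≠ 0) (hq : ‖q‖ < 1) {a b1 b2 b3 b4 b5 : ℂ} {r : ℝ} (ha : a ≠ 0)
    (hb1 : b1 ≠ 0) (hb2 : b2 ≠ 0) (hb3 : b3 ≠ 0) (hb4 : b4 ≠ 0) (hb5 : b5 ≠ 0)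
    (har : ‖a‖ < r) (hra : ‖q‖ * r < ‖a‖) (hraq : ‖a‖ * r < ‖q‖)
    (h1 : ‖b1‖ * r < 1) (h2 : ‖b2‖ * r < 1) (h3 : ‖b3‖ * r < 1) (h4 : ‖b4‖ * r < 1)
    (h5 : ‖b5‖ * r < 1) (hB : 1 < ‖a * (b1 * b2 * b3 * b4 * b5)‖)
    (hθ : qTheta q (q * a * (b1 * b2 * b3 * b4 * b5)) ≠ 0) :
    HasSum (wpTerm q (a * a) (a * b1) (a * b2) (a * b3) (a * b4) (a * b5)
        (1 / (a * (b1 * b2 * b3 * b4 * b5))))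
      (qPochInf q q * qPochInf q (a * a) * circleAverage (vForm q a b1 b2 b3 b4 b5) 0 r) := by
  have hn := fun {a} => qPochInf_ne_zero_of_norm_lt_one hq (a := a)
  have hqpos : 0 < ‖q‖ := norm_pos_iff.2 hq0
  have hr : 0 < r := norm_ne_zero_of_lt har
  have hPq := qPochInf_self_ne_zero hq
  have hapos := norm_pos_iff.2 ha
  have haq : ‖a * a / q‖ < 1 := by
    rw [norm_div, norm_mul, div_lt_one hqpos]; nlinarith
  have hax : ∀ x : ℂ, ‖x‖ ≤ r → ‖a * x / q‖ < 1 := fun x hx => by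
    rw [norm_div, norm_mul, div_lt_one hqpos]; nlinarith
  have hGd : ∀ x : ℂ, ‖x‖ ≤ r → DifferentiableAt ℂ (vEntire q a b1 b2 b3 b4 b5) x := fun x hx =>
    differentiableAt_vEntire hq (hax x hx) (norm_mul_lt_one_of h1 hx) (norm_mul_lt_one_of h2 hx)
      (norm_mul_lt_one_of h3 hx) (norm_mul_lt_one_of h4 hx) (norm_mul_lt_one_of h5 hx)
  obtain ⟨M, hM⟩ := (isCompact_closedBall (0:ℂ) r).exists_bound_of_continuousOn
    (f := vEntire q a b1 b2 b3 b4 b5) fun x hx =>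
      (hGd x (by simpa using hx)).continuousAt.continuousWithinAt
  set B := b1 * b2 * b3 * b4 * b5 with hBdef
  have hB0 : B ≠ 0 := by
    rw [hBdef]; exact mul_ne_zero (mul_ne_zero (mul_ne_zero (mul_ne_zero hb1 hb2) hb3) hb4) hb5
  -- Multiplying and dividing `vForm` by (qy/a)_∞ completes 1/(a/y)_∞ to the quasi-periodic quotient
  -- θ(qBy)/θ(a/y). In K n only the remaining factor `vEntire`, holomorphic in the disc, is
  -- evaluated at q^n y.
  obtain ⟨K, hK⟩ : ∃ K : ℕ → ℂ → ℂ, K = fun n y => qTheta q (q * B * y) / qPochInf q (q * y / a) *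
    vEntire q a b1 b2 b3 b4 b5 (q ^ n * y) := ⟨_, rfl⟩
  set G := vEntire q a b1 b2 b3 b4 b5 with hG
  obtain ⟨J, hJ⟩ : ∃ J : ℕ → ℂ, J = fun n =>
    circleAverage (fun y => K n y * (1 / qPochInf q (a / y))) 0 r := ⟨_, rfl⟩
  have hpow : ∀ (n : ℕ) (y : ℂ), ‖y‖ ≤ r → ‖q ^ n * y‖ ≤ r := fun n y hy => by
    rw [mul_comm]; exact (norm_mul_pow_le hq y n).trans hy
  have hden : ∀ y : ℂ, ‖y‖ ≤ r → qPochInf q (q * y / a) ≠ 0 := fun y hy => hn (by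
    rw [norm_div, norm_mul, div_lt_one hapos]; nlinarith)
  have hJbound : ∃ C, ∀ n, ‖J n‖ ≤ C := by
    have hc : ContinuousOn (fun y => qTheta q (q * B * y) / qPochInf q (q * y / a) *
        (1 / qPochInf q (a / y))) (sphere 0 r) := by
      refine continuousOn_of_differentiableAt_sphere fun y hy => ?_
      have hy0 : y ≠ 0 := norm_pos_iff.1 (by rw [hy]; exact hr)
      have t1 : DifferentiableAt ℂ (fun y => qTheta q (q * B * y)) y :=
        (differentiableAt_qTheta hq (mul_ne_zero (mul_ne_zero hq0 hB0) hy0)).comp y (by fun_prop)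
      have t2 : DifferentiableAt ℂ (fun y => qPochInf q (q * y / a)) y :=
        (differentiable_qPochInf hq _).comp y (by fun_prop)
      exact (t1.div t2 (hden y hy.le)).mul ((differentiableAt_const 1).div
        (differentiableAt_qPochInf_div hq a hy0) (hn (norm_div_lt_one_of har hy.ge)))
    obtain ⟨C, hC⟩ := (isCompact_sphere (0:ℂ) r).exists_bound_of_continuousOn hc
    refine ⟨C * M, fun n => ?_⟩
    rw [hJ]
    refine norm_circleAverage_le hr fun y hy => ?_
    have e : K n y * (1 / qPochInf q (a / y)) = qTheta q (q * B * y) / qPochInf q (q * y / a) *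
        (1 / qPochInf q (a / y)) * G (q ^ n * y) := by rw [hK]; ring
    rw [e, norm_mul]
    exact mul_le_mul (hC y (by simpa using hy)) (hM _ (by simpa using hpow n y hy.le))
      (norm_nonneg _) ((norm_nonneg _).trans (hC y (by simpa using hy)))
  -- Moving the circle from radius r to ‖q‖r crosses only the pole y = a. On the smaller circle the
  -- substitution y ↦ qy turns the index n into n + 1 and contributes the multiplier 1/(aB) of the
  -- theta quotient.
  have hstep : ∀ n, J n - 1 / (a * B) * J (n + 1) =
      qTheta q (q * a * B) / (qPochInf q q * qPochInf q q) * G (a * q ^ n) := by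
    intro n
    have hpole := circleAverage_sub_of_pole (φ := fun y => K n y / qPochInf q (a * q / y))
      (r := ‖q‖ * r) (R := r) (a := a) (by positivity) hra har (fun y hy1 hy2 => by
        have hy0 : y ≠ 0 := norm_pos_iff.1 (lt_of_lt_of_le (by positivity) hy1)
        have t1 : DifferentiableAt ℂ (fun y => qTheta q (q * B * y)) y :=
          (differentiableAt_qTheta hq (mul_ne_zero (mul_ne_zero hq0 hB0) hy0)).comp y (by fun_prop)
        have t2 : DifferentiableAt ℂ (fun y => qPochInf q (q * y / a)) y :=
          (differentiable_qPochInf hq _).comp y (by fun_prop)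
        have t3 : DifferentiableAt ℂ (fun y => G (q ^ n * y)) y :=
          (hGd _ (hpow n y hy2)).comp y (by fun_prop)
        rw [hK]
        refine ((t1.div t2 (hden y hy2)).mul t3).div (differentiableAt_qPochInf_div hq _ hy0)
          (hn ?_)
        rw [norm_div, norm_mul, div_lt_one (norm_pos_iff.2 hy0)]
        nlinarith)
    have hpt : ∀ y : ℂ, y ≠ 0 → y / (y - a) * (K n y / qPochInf q (a * q / y)) =
        K n y * (1 / qPochInf q (a / y)) := fun y hy => by
      rw [qPochInf_succ hq (a / y), div_mul_eq_mul_div a y q]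
      by_cases hya : y = a
      · subst hya; simp [div_self hy]
      · have h1 : y - a ≠ 0 := sub_ne_zero.2 hya
        have h2 : 1 - a / y = (y - a) / y := by field_simp
        rw [h2, one_div, mul_inv, inv_div, div_eq_mul_inv (K n y)]
        ring
    have e1 : circleAverage (fun z => z / (z - a) * (K n z / qPochInf q (a * q / z))) 0 r = J n := by
      rw [hJ]
      exact circleAverage_congr_on hr fun y hy => hpt y (norm_pos_iff.1 (by rw [hy]; exact hr))
    have e2 : circleAverage (fun z => z / (z - a) * (K n z / qPochInf q (a * q / z))) 0 (‖q‖ * r) =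
        1 / (a * B) * J (n + 1) := by
      rw [hJ, ← circleAverage_const_mul, ← circleAverage_mul_left]
      refine circleAverage_congr_on hr fun y hy => ?_
      have hy0 : y ≠ 0 := norm_pos_iff.1 (by rw [hy]; exact hr)
      have hqy : q * y ≠ 0 := mul_ne_zero hq0 hy0
      rw [hpt (q * y) hqy, hK]
      simp only
      rw [show q * B * (q * y) = q * (q * B * y) by ring,
        qTheta_mul_q hq0 hq (mul_ne_zero (mul_ne_zero hq0 hB0) hy0),
        show q ^ n * (q * y) = q ^ (n + 1) * y by ring, qPochInf_succ hq (q * y / a),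
        qPochInf_succ hq (a / (q * y)), show a / (q * y) * q = a / y by field_simp,
        show q * y / a * q = q * (q * y) / a by ring]
      have hne : q * y - a ≠ 0 := by
        intro h
        have : ‖q * y‖ = ‖a‖ := by rw [sub_eq_zero.1 h]
        rw [norm_mul, hy] at this
        linarith
      have hne' : a - q * y ≠ 0 := fun h => hne (by linear_combination -h)
      have g1 : 1 - a / (q * y) = (q * y - a) / (q * y) := by field_simp
      have g2 : 1 - q * y / a = -(q * y - a) / a := by field_simp; ring
      have g3 : qPochInf q (q * (q * y) / a) ≠ 0 := hden _ (by simpa using hpow 1 y hy.le)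
      have g4 : qPochInf q (a / y) ≠ 0 := hn (norm_div_lt_one_of har hy.ge)
      rw [g1, g2]
      generalize qPochInf q (q * (q * y) / a) = X at *
      generalize qPochInf q (a / y) = Y at *
      generalize G (q ^ (n + 1) * y) = GG at *
      generalize qTheta q (q * B * y) = TT at *
      generalize q * y - a = w at *
      field_simp
    rw [e1, e2] at hpole
    rw [hpole, hK]
    simp only
    rw [show q * a / a = q by field_simp, show a * q / a = q by field_simp,
      mul_right_comm q B a, mul_comm (q ^ n) a]
    field_simp
  set ζ := 1 / (a * B) with hζ
  have hζ1 : ‖ζ‖ < 1 := by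
    rw [hζ, norm_div, norm_one]; exact (div_lt_one (by linarith)).2 hB
  -- Summing the residues at a, aq, …, a q^{N-1}. The remainder tends to 0 because J is bounded and
  -- ‖ζ‖ < 1, which is the hypothesis on a b1 ⋯ b5.
  have hpartial : ∀ N, J 0 - ζ ^ N * J N = ∑ n ∈ Finset.range N,
      ζ ^ n * (qTheta q (q * a * B) / (qPochInf q q * qPochInf q q) * G (a * q ^ n)) := by
    intro N
    induction N with
    | zero => simp
    | succ N ih =>
      rw [Finset.sum_range_succ, ← ih, ← hstep N]
      ring
  obtain ⟨C, hC⟩ := hJbound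
  have hlim : Tendsto (fun N => ζ ^ N * J N) atTop (𝓝 0) := by
    refine squeeze_zero_norm (a := fun N => C * ‖ζ‖ ^ N) (fun N => ?_) ?_
    · rw [norm_mul, norm_pow, mul_comm]
      gcongr
      exact hC N
    · simpa using (tendsto_pow_atTop_nhds_zero_of_lt_one (norm_nonneg _) hζ1).const_mul C
  have hsummable : Summable fun n => ζ ^ n * (qTheta q (q * a * B) /
      (qPochInf q q * qPochInf q q) * G (a * q ^ n)) := by
    refine hasSum_of_norm_le_geom (norm_nonneg ζ) hζ1
      (M := ‖qTheta q (q * a * B) / (qPochInf q q * qPochInf q q)‖ * M) fun n => ?_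
    rw [norm_mul, norm_mul, norm_pow, mul_comm]
    gcongr
    exact hM _ (by simpa using (norm_mul_pow_le hq a n).trans har.le)
  have hsum : HasSum (fun n => ζ ^ n * (qTheta q (q * a * B) /
      (qPochInf q q * qPochInf q q) * G (a * q ^ n))) (J 0) := by
    have h := hsummable.hasSum
    have h2 := h.tendsto_sum_nat
    simp only [← hpartial] at h2
    have h3 := hlim.const_sub (J 0)
    rw [sub_zero] at h3
    rwa [tendsto_nhds_unique h2 h3] at h
  have hJ0 : J 0 = qTheta q (q * a * B) * circleAverage (vForm q a b1 b2 b3 b4 b5) 0 r := by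
    rw [hJ, ← circleAverage_const_mul]
    refine circleAverage_congr_on hr fun y hy => ?_
    have g3 := hden y hy.le
    rw [hK, hG]
    simp only [vForm, vEntire, pow_zero, one_mul, ← hBdef]
    exact vForm_factor hθ g3 _ _ _ _ _
  have := hsum.mul_left (qPochInf q q * qPochInf q (a * a) / qTheta q (q * a * B))
  rw [hJ0] at this
  have e3 : qPochInf q q * qPochInf q (a * a) / qTheta q (q * a * B) *
      (qTheta q (q * a * B) * circleAverage (vForm q a b1 b2 b3 b4 b5) 0 r) =
      qPochInf q q * qPochInf q (a * a) * circleAverage (vForm q a b1 b2 b3 b4 b5) 0 r := by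
    rw [← mul_assoc, div_mul_cancel₀ _ hθ]
  rw [e3] at this
  refine Eq.mp (congrArg (fun f => HasSum f _) (funext fun n => ?_)) this
  have h : qPochInf q (a * a) * G (a * q ^ n) = _ := vEntire_mul_pow hq0 hq (b1 := b1) (b2 := b2) (b3 := b3) (b4 := b4) (b5 := b5) ha haq n
  have e : ∀ b, a * a / (a * b) * q ^ n = a * q ^ n / b := fun b => by
    rw [mul_div_mul_left _ _ ha]; ring
  have e' : ∀ b, a * b * q ^ n = b * (a * q ^ n) := fun b => by ring
  rw [wpTerm, e, e, e, e, e, e', e', e', e', e']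
  generalize (qPochInf q (a * q ^ n / b1) / qPochInf q (b1 * (a * q ^ n)) *
      (qPochInf q (a * q ^ n / b2) / qPochInf q (b2 * (a * q ^ n))) *
      (qPochInf q (a * q ^ n / b3) / qPochInf q (b3 * (a * q ^ n))) *
      (qPochInf q (a * q ^ n / b4) / qPochInf q (b4 * (a * q ^ n))) *
      (qPochInf q (a * q ^ n / b5) / qPochInf q (b5 * (a * q ^ n)))) = Z at *
  generalize G (a * q ^ n) = W at *
  have h6 : qPochInf q q * qPochInf q (a * a) / qTheta q (q * a * B) *
      (ζ ^ n * (qTheta q (q * a * B) / (qPochInf q q * qPochInf q q) * W)) =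
      (qPochInf q q)⁻¹ * ζ ^ n * (qPochInf q (a * a) * W) := by
    exact vForm_coefficient hPq hθ _ _ _
  rw [h6, h]
  rw [mul_comm (qPochInf q q)⁻¹, mul_assoc, ← mul_assoc (qPochInf q q)⁻¹, inv_mul_cancel₀ hPq]
  ring

end ThirdIntegral

/-! ### Cauchy's theorem for cycles (Dixon's proof) -/

section Cauchy

open MeasureTheory Set
open Metric (sphere ball closedBall)

/-- The trace of a curve. -/
def trace (γ : ℝ → ℂ) : Set ℂ := γ '' Icc 0 1

lemma mem_trace {γ : ℝ → ℂ} {x : ℝ} (hx : x ∈ Icc (0:ℝ) 1) : γ x ∈ trace γ := ⟨x, hx, rfl⟩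

lemma IsPiecewiseC1.isCompact_trace {γ : ℝ → ℂ} (h : IsPiecewiseC1 γ) : IsCompact (trace γ) :=
  isCompact_Icc.image_of_continuousOn h.1

lemma IsPiecewiseC1.exists_hasDerivAt {γ : ℝ → ℂ} (h : IsPiecewiseC1 γ) :
    ∃ S : Finset ℝ, ∀ x ∈ Ioo (0:ℝ) 1 \ S, HasDerivAt γ (deriv γ x) x := by
  obtain ⟨hc, S, hS⟩ := h
  refine ⟨S, fun x hx => ?_⟩
  have hopen : IsOpen (Ioo (0:ℝ) 1 \ S) := isOpen_Ioo.sdiff S.finite_toSet.isClosed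
  obtain ⟨ε, hε, hball⟩ := Metric.isOpen_iff.1 hopen x hx
  rw [Real.ball_eq_Ioo] at hball
  have h1 : Ioo (x - ε / 2) (x + ε / 2) ⊆ Ioo (x - ε) (x + ε) := Ioo_subset_Ioo (by linarith) (by linarith)
  have m1 := (hball (show x - ε / 2 ∈ Ioo (x - ε) (x + ε) by constructor <;> linarith)).1
  have m2 := (hball (show x + ε / 2 ∈ Ioo (x - ε) (x + ε) by constructor <;> linarith)).1
  have := hS (x - ε / 2) (x + ε / 2) m1.1.le (by linarith) m2.2.le
    fun y hy hy' => (hball (h1 hy')).2 hy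
  exact ((this.differentiableOn one_ne_zero).differentiableAt
    (Icc_mem_nhds (by linarith) (by linarith))).hasDerivAt

lemma ContDiffOn.intervalIntegrable_deriv {γ : ℝ → ℂ} {a b : ℝ} (hab : a < b)
    (h : ContDiffOn ℝ 1 γ (Icc a b)) : IntervalIntegrable (deriv γ) volume a b := by
  have hc : ContinuousOn (derivWithin γ (Icc a b)) (Icc a b) :=
    h.continuousOn_derivWithin (uniqueDiffOn_Icc hab) le_rfl
  have hi : IntervalIntegrable (derivWithin γ (Icc a b)) volume a b :=
    ContinuousOn.intervalIntegrable (by rwa [uIcc_of_le hab.le])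
  rw [intervalIntegrable_iff_integrableOn_Ioo_of_le hab.le] at hi ⊢
  refine hi.congr_fun (fun x hx => ?_) measurableSet_Ioo
  exact derivWithin_of_mem_nhds (Icc_mem_nhds hx.1 hx.2)

/-- Strong induction on the number of break points inside the interval: the interval is cut at one
of them, which lies inside neither half. -/
lemma IsPiecewiseC1.intervalIntegrable_deriv {γ : ℝ → ℂ} (h : IsPiecewiseC1 γ) :
    IntervalIntegrable (deriv γ) volume 0 1 := by
  obtain ⟨hc, S, hS⟩ := h
  have key : ∀ n : ℕ, ∀ a b : ℝ, 0 ≤ a → a < b → b ≤ 1 →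
      (S.filter fun x => x ∈ Ioo a b).card = n → IntervalIntegrable (deriv γ) volume a b := by
    intro n
    induction n using Nat.strong_induction_on with
    | _ n ih =>
      intro a b ha hab hb hn
      by_cases hex : ∃ x ∈ S, x ∈ Ioo a b
      · obtain ⟨c, hcS, hc'⟩ := hex
        have l1 : (S.filter fun x => x ∈ Ioo a c).card < n := by
          rw [← hn]
          refine Finset.card_lt_card ⟨fun x hx => ?_, fun hsub => ?_⟩
          · simp only [Finset.mem_filter] at hx ⊢
            exact ⟨hx.1, hx.2.1, hx.2.2.trans hc'.2⟩
          · have := hsub (Finset.mem_filter.2 ⟨hcS, hc'⟩)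
            exact lt_irrefl _ (Finset.mem_filter.1 this).2.2
        have l2 : (S.filter fun x => x ∈ Ioo c b).card < n := by
          rw [← hn]
          refine Finset.card_lt_card ⟨fun x hx => ?_, fun hsub => ?_⟩
          · simp only [Finset.mem_filter] at hx ⊢
            exact ⟨hx.1, hc'.1.trans hx.2.1, hx.2.2⟩
          · have := hsub (Finset.mem_filter.2 ⟨hcS, hc'⟩)
            exact lt_irrefl _ (Finset.mem_filter.1 this).2.1
        exact (ih _ l1 a c ha hc'.1 (hc'.2.le.trans hb) rfl).trans
          (ih _ l2 c b (ha.trans hc'.1.le) hc'.2 hb rfl)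
      · push Not at hex
        exact (hS a b ha hab hb hex).intervalIntegrable_deriv hab
  exact key _ 0 1 le_rfl one_pos le_rfl rfl

lemma uIoc_zero_one_subset {x : ℝ} (hx : x ∈ uIoc (0:ℝ) 1) : x ∈ Icc (0:ℝ) 1 := by
  rw [uIoc_of_le zero_le_one] at hx; exact ⟨hx.1.le, hx.2⟩

lemma IsPiecewiseC1.continuousOn_comp {γ : ℝ → ℂ} (h : IsPiecewiseC1 γ) {f : ℂ → ℂ}
    (hf : ContinuousOn f (trace γ)) : ContinuousOn (fun x => f (γ x)) (uIcc 0 1) := by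
  rw [uIcc_of_le zero_le_one]
  exact hf.comp h.1 fun x hx => mem_trace hx

lemma IsPiecewiseC1.intervalIntegrable {γ : ℝ → ℂ} (h : IsPiecewiseC1 γ) {f : ℂ → ℂ}
    (hf : ContinuousOn f (trace γ)) :
    IntervalIntegrable (fun x => f (γ x) * deriv γ x) volume 0 1 :=
  h.intervalIntegrable_deriv.continuousOn_mul (h.continuousOn_comp hf)

lemma curveInt_sub {γ : ℝ → ℂ} (h : IsPiecewiseC1 γ) {f g : ℂ → ℂ}
    (hf : ContinuousOn f (trace γ)) (hg : ContinuousOn g (trace γ)) :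
    curveInt (fun z => f z - g z) γ = curveInt f γ - curveInt g γ := by
  unfold curveInt
  rw [← intervalIntegral.integral_sub (h.intervalIntegrable hf) (h.intervalIntegrable hg)]
  simp only [sub_mul]

lemma curveInt_add {γ : ℝ → ℂ} (h : IsPiecewiseC1 γ) {f g : ℂ → ℂ}
    (hf : ContinuousOn f (trace γ)) (hg : ContinuousOn g (trace γ)) :
    curveInt (fun z => f z + g z) γ = curveInt f γ + curveInt g γ := by
  unfold curveInt
  rw [← intervalIntegral.integral_add (h.intervalIntegrable hf) (h.intervalIntegrable hg)]
  simp only [add_mul]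

lemma curveInt_const_mul (c : ℂ) (f : ℂ → ℂ) (γ : ℝ → ℂ) :
    curveInt (fun z => c * f z) γ = c * curveInt f γ := by
  unfold curveInt
  rw [← intervalIntegral.integral_const_mul]
  simp only [mul_assoc]

lemma curveInt_congr {γ : ℝ → ℂ} {f g : ℂ → ℂ} (h : ∀ w ∈ trace γ, f w = g w) :
    curveInt f γ = curveInt g γ := by
  unfold curveInt
  refine intervalIntegral.integral_congr fun x hx => ?_
  rw [uIcc_of_le zero_le_one] at hx
  simp only [h _ (mem_trace hx)]

lemma norm_curveInt_le {γ : ℝ → ℂ} (h : IsPiecewiseC1 γ) {f : ℂ → ℂ} {C : ℝ}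
    (hC : ∀ w ∈ trace γ, ‖f w‖ ≤ C) :
    ‖curveInt f γ‖ ≤ C * ∫ x in (0:ℝ)..1, ‖deriv γ x‖ := by
  unfold curveInt
  rw [← intervalIntegral.integral_const_mul]
  refine intervalIntegral.norm_integral_le_of_norm_le zero_le_one (ae_of_all _ fun x hx => ?_)
    (h.intervalIntegrable_deriv.norm.const_mul C)
  rw [norm_mul]
  gcongr
  exact hC _ (mem_trace ⟨hx.1.le, hx.2⟩)

/-- The fundamental theorem of calculus along a closed curve. -/
lemma curveInt_deriv_eq_zero {γ : ℝ → ℂ} (h : IsPiecewiseC1 γ) (hcl : γ 0 = γ 1) {G g : ℂ → ℂ}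
    (hG : ∀ w ∈ trace γ, HasDerivAt G (g w) w) (hg : ContinuousOn g (trace γ)) :
    curveInt g γ = 0 := by
  obtain ⟨S, hS⟩ := h.exists_hasDerivAt
  have hGc : ContinuousOn G (trace γ) := fun w hw => (hG w hw).continuousAt.continuousWithinAt
  have := integral_eq_of_hasDerivAt_off_countable_of_le (fun x => G (γ x))
    (fun x => g (γ x) * deriv γ x) zero_le_one S.countable_toSet
    (by simpa [uIcc_of_le zero_le_one] using h.continuousOn_comp hGc)
    (fun x hx => (hG _ (mem_trace ⟨hx.1.1.le, hx.1.2.le⟩)).comp x (hS x hx))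
    (h.intervalIntegrable hg)
  unfold curveInt
  rw [this, hcl, sub_self]

/-- Holomorphy of integrals depending on a parameter. -/
lemma differentiableOn_curveInt {γ : ℝ → ℂ} (h : IsPiecewiseC1 γ) {V : Set ℂ} {K : ℂ → ℂ → ℂ}
    (hKc : ∀ z ∈ V, ContinuousOn (fun w => K w z) (trace γ))
    (hKd : ∀ w ∈ trace γ, DifferentiableOn ℂ (K w) V)
    (hKb : ∀ z ∈ V, ∃ ε > 0, ∃ C, ball z ε ⊆ V ∧ ∀ w ∈ trace γ, ∀ z' ∈ ball z ε, ‖K w z'‖ ≤ C) :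
    DifferentiableOn ℂ (fun z => curveInt (fun w => K w z) γ) V := by
  intro z hz
  obtain ⟨ε, hε, C, hball, hC⟩ := hKb z hz
  have hdiff : ∀ w ∈ trace γ, ∀ z' ∈ ball z ε, HasDerivAt (K w) (deriv (K w) z') z' :=
    fun w hw z' hz' => ((hKd w hw).differentiableAt
      (mem_of_superset (Metric.isOpen_ball.mem_nhds hz') hball)).hasDerivAt
  -- Cauchy's estimate on circles of radius ε/4, which stay inside the ball of radius ε. It supplies
  -- the integrable bound for differentiation under the integral.
  have hderiv : ∀ w ∈ trace γ, ∀ z' ∈ ball z (ε / 2), ‖deriv (K w) z'‖ ≤ C / (ε / 2 / 2) := by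
    intro w hw z' hz'
    have hsub : closedBall z' (ε / 2 / 2) ⊆ ball z ε := by
      intro y hy
      rw [Metric.mem_closedBall] at hy
      rw [Metric.mem_ball] at hz' ⊢
      linarith [dist_triangle y z' z]
    refine Complex.norm_deriv_le_of_forall_mem_sphere_norm_le (by positivity) ?_
      fun y hy => hC w hw y (hsub (Metric.sphere_subset_closedBall hy))
    refine (((hKd w hw).mono hball).mono hsub).diffContOnCl_ball subset_rfl
  have hu : Set.uIoc (0:ℝ) 1 = Ioc 0 1 := uIoc_of_le zero_le_one
  have hmeas : ∀ z' ∈ V, AEStronglyMeasurable (fun x => K (γ x) z' * deriv γ x)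
      (volume.restrict (uIoc 0 1)) := fun z' hz' =>
    (h.intervalIntegrable (hKc z' hz')).def'.aestronglyMeasurable
  refine ((intervalIntegral.hasDerivAt_integral_of_dominated_loc_of_deriv_le
    (F := fun z x => K (γ x) z * deriv γ x) (F' := fun z x => deriv (K (γ x)) z * deriv γ x)
    (s := ball z (ε / 2)) (bound := fun x => C / (ε / 2 / 2) * ‖deriv γ x‖)
    (Metric.ball_mem_nhds z (by positivity)) ?_ (h.intervalIntegrable (hKc z hz)) ?_ ?_ ?_
    ?_).2.differentiableAt).differentiableWithinAt
  · filter_upwards [Metric.ball_mem_nhds z hε] with z' hz' using hmeas z' (hball hz')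
  -- The parameter derivative is measurable along the curve as a pointwise limit of difference
  -- quotients with the increments ε/(2(n+1)).
  · have hseq : ∀ n : ℕ, z + ((ε / 2 / (n + 1) : ℝ) : ℂ) ∈ ball z ε := fun n => by
      rw [Metric.mem_ball, dist_eq_norm, add_sub_cancel_left, Complex.norm_real, Real.norm_eq_abs,
        abs_of_nonneg (by positivity)]
      have : ε / 2 / (n + 1) ≤ ε / 2 := div_le_self (by positivity) (by linarith [n.cast_nonneg (α := ℝ)])
      linarith
    refine aestronglyMeasurable_of_tendsto_ae (u := atTop) (f := fun (n : ℕ) x =>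
      (((ε / 2 / (n + 1) : ℝ) : ℂ))⁻¹ * (K (γ x) (z + ((ε / 2 / (n + 1) : ℝ) : ℂ)) * deriv γ x -
        K (γ x) z * deriv γ x)) (fun n => ?_) ?_
    · exact ((hmeas _ (hball (hseq n))).sub (hmeas z hz)).const_mul _
    · refine (ae_restrict_iff' measurableSet_uIoc).2 (ae_of_all _ fun x hx => ?_)
      have hw := mem_trace (γ := γ) (uIoc_zero_one_subset hx)
      have hd := (hdiff _ hw z (Metric.mem_ball_self hε)).tendsto_slope_zero
      have ht : Tendsto (fun n : ℕ => ((ε / 2 / (n + 1) : ℝ) : ℂ)) atTop (𝓝[≠] 0) := by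
        refine tendsto_nhdsWithin_iff.2 ⟨?_, .of_forall fun n => ?_⟩
        · have : Tendsto (fun n : ℕ => ε / 2 * (1 / ((n : ℝ) + 1))) atTop (𝓝 (ε / 2 * 0)) :=
            tendsto_one_div_add_atTop_nhds_zero_nat.const_mul _
          rw [mul_zero] at this
          have h2 := (Complex.continuous_ofReal.tendsto 0).comp this
          simp only [Complex.ofReal_zero] at h2
          refine h2.congr fun n => ?_
          simp only [Function.comp]
          congr 1
          ring
        · simp only [mem_compl_iff, mem_singleton_iff, Complex.ofReal_eq_zero]
          positivity
      refine ((hd.comp ht).mul_const (deriv γ x)).congr fun n => ?_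
      simp only [Function.comp, smul_eq_mul]
      ring
  · refine ae_of_all _ fun x hx z' hz' => ?_
    rw [norm_mul]
    gcongr
    exact hderiv _ (mem_trace (uIoc_zero_one_subset hx)) z' hz'
  · exact h.intervalIntegrable_deriv.norm.const_mul _
  · refine ae_of_all _ fun x hx z' hz' => ?_
    exact (hdiff _ (mem_trace (uIoc_zero_one_subset hx)) z'
      (Metric.ball_subset_ball (by linarith) hz')).mul_const _

lemma exists_dist_trace {γ : ℝ → ℂ} (h : IsPiecewiseC1 γ) {z : ℂ} (hz : z ∉ trace γ) :
    ∃ ε > 0, ball z ε ⊆ (trace γ)ᶜ ∧ ∀ w ∈ trace γ, ∀ z' ∈ ball z ε, ε ≤ ‖w - z'‖ := by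
  have hopen : IsOpen (trace γ)ᶜ := h.isCompact_trace.isClosed.isOpen_compl
  obtain ⟨ε, hε, hb⟩ := Metric.isOpen_iff.1 hopen z hz
  refine ⟨ε / 2, by positivity, (Metric.ball_subset_ball (by linarith)).trans hb, ?_⟩
  intro w hw z' hz'
  by_contra hlt
  push Not at hlt
  refine hb (show w ∈ ball z ε from ?_) hw
  rw [Metric.mem_ball] at hz' ⊢
  rw [← dist_eq_norm] at hlt
  linarith [dist_triangle w z' z]

/-- The Cauchy type integral is holomorphic off the curve. -/
lemma differentiableOn_cauchyInt {γ : ℝ → ℂ} (h : IsPiecewiseC1 γ) {f : ℂ → ℂ}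
    (hf : ContinuousOn f (trace γ)) :
    DifferentiableOn ℂ (fun z => curveInt (fun w => f w / (w - z)) γ) (trace γ)ᶜ := by
  obtain ⟨M, hM⟩ := h.isCompact_trace.exists_bound_of_continuousOn hf
  have hne : ∀ {w z : ℂ}, w ∈ trace γ → z ∈ (trace γ)ᶜ → w - z ≠ 0 := fun hw hz h0 =>
    hz (by rwa [← sub_eq_zero.1 h0])
  refine differentiableOn_curveInt h (K := fun w z => f w / (w - z)) (fun z hz => ?_)
    (fun w hw => ?_) fun z hz => ?_
  · exact hf.div (by fun_prop) fun w hw => hne hw hz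
  · exact (differentiableOn_const _).div (by fun_prop) fun z hz => hne hw hz
  · obtain ⟨ε, hε, hb, hd⟩ := exists_dist_trace h hz
    refine ⟨ε, hε, M / ε, hb, fun w hw z' hz' => ?_⟩
    rw [norm_div]
    have := hd w hw z' hz'
    have hM0 : 0 ≤ M := (norm_nonneg _).trans (hM w hw)
    gcongr
    exact hM w hw

/-- The integral whose multiple is the winding number. -/
def windInt (γ : ℝ → ℂ) (z : ℂ) : ℂ := curveInt (fun w => 1 / (w - z)) γ

lemma windingNum_eq (γ : ℝ → ℂ) (z : ℂ) :
    windInt γ z = 2 * Real.pi * Complex.I * windingNum γ z := by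
  unfold windingNum windInt
  rw [← curveInt_const_mul]
  congr 1
  funext w
  rw [mul_one_div, mul_comm _ (w - z), div_mul_eq_div_div_swap,
    div_self (by simp [Real.pi_ne_zero])]

/-- The derivative is the integral of 1/(w - z)², which vanishes because -1/(w - z) is a primitive.
So the integral is locally constant off the curve; its integrality is never needed. -/
lemma hasDerivAt_windInt {γ : ℝ → ℂ} (h : IsPiecewiseC1 γ) (hcl : γ 0 = γ 1) {z : ℂ}
    (hz : z ∉ trace γ) : HasDerivAt (windInt γ) 0 z := by
  have hopen : IsOpen (trace γ)ᶜ := h.isCompact_trace.isClosed.isOpen_compl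
  have hne : ∀ {w z : ℂ}, w ∈ trace γ → z ∈ (trace γ)ᶜ → w - z ≠ 0 := fun hw hz h0 =>
    hz (by rwa [← sub_eq_zero.1 h0])
  have hd := (differentiableOn_cauchyInt h (f := fun _ => 1) continuousOn_const).differentiableAt
    (hopen.mem_nhds hz)
  have hd' : HasDerivAt (windInt γ) (deriv (windInt γ) z) z := hd.hasDerivAt
  have hc1 : ∀ {z : ℂ}, z ∈ (trace γ)ᶜ → ContinuousOn (fun w => 1 / (w - z)) (trace γ) := fun hz =>
    continuousOn_const.div (by fun_prop) fun w hw => hne hw hz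
  have hzero : curveInt (fun w => 1 / ((w - z) * (w - z))) γ = 0 := by
    refine curveInt_deriv_eq_zero h hcl (G := fun w => -(w - z)⁻¹) (fun w hw => ?_) ?_
    · have := ((hasDerivAt_id w).sub_const z).inv (hne hw hz)
      have h2 := this.neg
      have e : -(-1 / (id w - z) ^ 2) = 1 / ((w - z) * (w - z)) := by
        rw [id, neg_div, neg_neg, sq]
      rwa [e] at h2
    · exact continuousOn_const.div (by fun_prop) fun w hw => mul_ne_zero (hne hw hz) (hne hw hz)
  have hcont := (differentiableOn_cauchyInt h (f := fun w => 1 / (w - z))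
    (hc1 hz)).continuousOn.continuousAt
    (hopen.mem_nhds hz)
  have hlim : Tendsto (fun z' => curveInt (fun w => 1 / (w - z) / (w - z')) γ) (𝓝[≠] z) (𝓝 0) := by
    have := hcont.tendsto.mono_left (nhdsWithin_le_nhds (s := {z}ᶜ))
    simp only [div_div] at this ⊢
    rwa [hzero] at this
  have hslope := hasDerivAt_iff_tendsto_slope.1 hd'
  have heq : (fun z' => curveInt (fun w => 1 / (w - z) / (w - z')) γ) =ᶠ[𝓝[≠] z]
      slope (windInt γ) z := by
    filter_upwards [nhdsWithin_le_nhds (hopen.mem_nhds hz), self_mem_nhdsWithin] with z' h1 h2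
    have h3 : z' - z ≠ 0 := sub_ne_zero.2 h2
    rw [slope_def_field, windInt, windInt, eq_div_iff h3, mul_comm, ← curveInt_const_mul,
      ← curveInt_sub h (hc1 h1) (hc1 hz)]
    refine curveInt_congr fun w hw => ?_
    have a1 := hne hw h1
    have a2 := hne hw hz
    field_simp
    ring
  rw [← tendsto_nhds_unique (hlim.congr' heq) hslope] at hd'
  exact hd'

lemma exists_norm_trace_lt {γ : ℝ → ℂ} (h : IsPiecewiseC1 γ) : ∃ M > 0, ∀ w ∈ trace γ, ‖w‖ < M := by
  obtain ⟨M, hM⟩ := h.isCompact_trace.exists_bound_of_continuousOn continuousOn_id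
  exact ⟨|M| + 1, by positivity, fun w hw => ((hM w hw).trans (le_abs_self M)).trans_lt (by linarith)⟩

lemma tendsto_cauchyInt {γ : ℝ → ℂ} (h : IsPiecewiseC1 γ) {f : ℂ → ℂ}
    (hf : ContinuousOn f (trace γ)) :
    Tendsto (fun z => curveInt (fun w => f w / (w - z)) γ) (cocompact ℂ) (𝓝 0) := by
  obtain ⟨M, hM0, hM⟩ := exists_norm_trace_lt h
  obtain ⟨C, hC⟩ := h.isCompact_trace.exists_bound_of_continuousOn hf
  set L := ∫ x in (0:ℝ)..1, ‖deriv γ x‖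
  have hC0 : 0 ≤ C := (norm_nonneg _).trans (hC _ (mem_trace (by simp : (0:ℝ) ∈ Icc (0:ℝ) 1)))
  have hn : Tendsto (fun z : ℂ => ‖z‖ - M) (cocompact ℂ) atTop :=
    tendsto_atTop_add_const_right _ _ (tendsto_norm_cocompact_atTop)
  refine squeeze_zero_norm' (a := fun z => C * L * (‖z‖ - M)⁻¹) ?_ ?_
  · filter_upwards [hn.eventually (eventually_gt_atTop 0)] with z hz
    have : ∀ w ∈ trace γ, ‖f w / (w - z)‖ ≤ C * (‖z‖ - M)⁻¹ := fun w hw => by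
      rw [norm_div, div_eq_mul_inv]
      have h1 : ‖z‖ - M ≤ ‖w - z‖ := by
        have := norm_sub_norm_le z w
        rw [norm_sub_rev] at this
        linarith [hM w hw]
      gcongr
      exact hC w hw
    exact (norm_curveInt_le h this).trans (le_of_eq (by ring))
  · simpa using hn.inv_tendsto_atTop.const_mul (C * L)

/-- The ray from z away from the origin never meets the curve. Along it the integral is constant and
tends to 0. -/
lemma windInt_eq_zero {γ : ℝ → ℂ} (h : IsPiecewiseC1 γ) (hcl : γ 0 = γ 1) {M : ℝ} (hM0 : 0 < M)
    (hM : ∀ w ∈ trace γ, ‖w‖ < M) {z : ℂ} (hz : M ≤ ‖z‖) : windInt γ z = 0 := by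
  have hz0 : z ≠ 0 := norm_pos_iff.1 (hM0.trans_le hz)
  have hnt : ∀ s : ℝ, 1 ≤ s → (s : ℂ) * z ∉ trace γ := fun s hs hmem => by
    have := hM _ hmem
    rw [norm_mul, Complex.norm_real, Real.norm_of_nonneg (by linarith)] at this
    nlinarith
  have hd : ∀ s : ℝ, 1 ≤ s → HasDerivAt (fun s : ℝ => windInt γ ((s : ℂ) * z)) 0 s := fun s hs => by
    have h1 : HasDerivAt (fun s : ℝ => (s : ℂ) * z) (1 * z) s :=
      (Complex.ofRealCLM.hasDerivAt).mul_const z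
    have := (hasDerivAt_windInt h hcl (hnt s hs)).comp s h1
    rw [zero_mul] at this
    exact this
  have hconst : ∀ s : ℝ, 1 ≤ s → windInt γ ((s : ℂ) * z) = windInt γ z := fun s hs => by
    have := constant_of_has_deriv_right_zero (f := fun s : ℝ => windInt γ ((s : ℂ) * z))
      (a := 1) (b := s) (fun x hx => (hd x hx.1).continuousAt.continuousWithinAt)
      (fun x hx => (hd x hx.1).hasDerivWithinAt) s ⟨hs, le_rfl⟩
    simpa using this
  have hlim : Tendsto (fun s : ℝ => windInt γ ((s : ℂ) * z)) atTop (𝓝 0) := by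
    refine (tendsto_cauchyInt h (f := fun _ => 1) continuousOn_const).comp ?_
    refine tendsto_cocompact_of_tendsto_dist_comp_atTop (0 : ℂ) ?_
    simp only [dist_zero_right, norm_mul, Complex.norm_real, Real.norm_eq_abs]
    exact (tendsto_abs_atTop_atTop).atTop_mul_const (norm_pos_iff.2 hz0)
  refine tendsto_nhds_unique (tendsto_const_nhds.congr' ?_) hlim
  filter_upwards [eventually_ge_atTop 1] with s hs using (hconst s hs).symm

lemma dslope_comm (f : ℂ → ℂ) (a b : ℂ) : dslope f a b = dslope f b a := by
  by_cases h : a = b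
  · rw [h]
  · rw [dslope_of_ne f (Ne.symm h), dslope_of_ne f h, slope_comm]

lemma dslope_eq_div {f : ℂ → ℂ} {a b : ℂ} (h : b - a ≠ 0) : dslope f a b = (f b - f a) / (b - a) := by
  rw [dslope_of_ne f (sub_ne_zero.1 h), slope_def_field]

/-- The integral of the difference quotients is holomorphic. -/
lemma differentiableOn_dslopeInt {γ : ℝ → ℂ} (h : IsPiecewiseC1 γ) {U : Set ℂ} (hU : IsOpen U)
    (hγ : trace γ ⊆ U) {f : ℂ → ℂ} (hf : DifferentiableOn ℂ f U) :
    DifferentiableOn ℂ (fun z => curveInt (fun w => dslope f w z) γ) U := by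
  refine differentiableOn_curveInt h (K := fun w z => dslope f w z) (fun z hz => ?_)
    (fun w hw => (Complex.differentiableOn_dslope (hU.mem_nhds (hγ hw))).2 hf) fun z hz => ?_
  · simp only [fun w => dslope_comm f w z]
    exact ((Complex.differentiableOn_dslope (hU.mem_nhds hz)).2 hf).continuousOn.mono hγ
  · obtain ⟨ε, hε, hb⟩ := Metric.isOpen_iff.1 hU z hz
    obtain ⟨ρ, hρ, hρε⟩ : ∃ ρ > 0, 3 * ρ < ε := ⟨ε / 4, by positivity, by linarith⟩
    have hsub : closedBall z (3 * ρ) ⊆ U := (Metric.closedBall_subset_ball hρε).trans hb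
    obtain ⟨M1, hM1⟩ := h.isCompact_trace.exists_bound_of_continuousOn (hf.continuousOn.mono hγ)
    obtain ⟨M2, hM2⟩ := (isCompact_closedBall z (3 * ρ)).exists_bound_of_continuousOn
      (hf.continuousOn.mono hsub)
    obtain ⟨C, hC⟩ := (isCompact_closedBall z (3 * ρ)).exists_bound_of_continuousOn
      ((hf.deriv hU).continuousOn.mono hsub)
    have hM20 := (norm_nonneg _).trans (hM2 z (Metric.mem_closedBall_self (by positivity)))
    have hC0 := (norm_nonneg _).trans (hC z (Metric.mem_closedBall_self (by positivity)))
    refine ⟨ρ, hρ, (M2 + M1) / ρ + C, (Metric.ball_subset_closedBall.trans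
      (Metric.closedBall_subset_closedBall (by linarith))).trans hsub, fun w hw z' hz' => ?_⟩
    have hM10 := (norm_nonneg _).trans (hM1 w hw)
    have hz3 : z' ∈ closedBall z (3 * ρ) :=
      Metric.closedBall_subset_closedBall (by linarith) (Metric.ball_subset_closedBall hz')
    -- For w far from z the difference quotient is bounded through its denominator; for w near z it
    -- is bounded by the supremum of the derivative, by the mean value inequality on a ball.
    rcases le_or_gt (2 * ρ) (dist w z) with hd | hd
    · have hρ' : ρ ≤ ‖z' - w‖ := by
        rw [← dist_eq_norm, dist_comm]
        rw [Metric.mem_ball] at hz'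
        linarith [dist_triangle w z' z]
      have hne : z' - w ≠ 0 := norm_pos_iff.1 (hρ.trans_le hρ')
      rw [dslope_eq_div hne, norm_div]
      refine le_trans ?_ (le_add_of_nonneg_right hC0)
      gcongr
      exact (norm_sub_le _ _).trans (add_le_add (hM2 _ hz3) (hM1 _ hw))
    · refine le_trans ?_ (le_add_of_nonneg_left (by positivity))
      have hw3 : w ∈ closedBall z (3 * ρ) := Metric.mem_closedBall.2 (by linarith)
      by_cases hne : z' - w = 0
      · rw [sub_eq_zero.1 hne, dslope_same]
        exact hC w hw3
      · rw [dslope_eq_div hne, norm_div, div_le_iff₀ (norm_pos_iff.2 hne)]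
        exact (convex_closedBall z (3 * ρ)).norm_image_sub_le_of_norm_deriv_le
          (fun x hx => hf.differentiableAt (hU.mem_nhds (hsub hx))) hC hw3 hz3

/-- Cauchy's theorem: integrals over two closed curves with the same winding numbers outside the
domain of holomorphy agree. -/
theorem curveInt_eq_of_windInt_eq {γ₁ γ₂ : ℝ → ℂ} (h1 : IsPiecewiseC1 γ₁) (h2 : IsPiecewiseC1 γ₂)
    (hc1 : γ₁ 0 = γ₁ 1) (hc2 : γ₂ 0 = γ₂ 1) {U : Set ℂ} (hU : IsOpen U) (ht1 : trace γ₁ ⊆ U)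
    (ht2 : trace γ₂ ⊆ U) (hw : ∀ z, z ∉ U → windInt γ₁ z = windInt γ₂ z) {f : ℂ → ℂ}
    (hf : DifferentiableOn ℂ f U) : curveInt f γ₁ = curveInt f γ₂ := by
  classical
  set z₀ := γ₁ 0 with hz₀
  have hz₀U : z₀ ∈ U := ht1 (mem_trace (by simp))
  -- With this F the difference quotient based at z₀ is f itself, so D(z₀) is the difference of the
  -- two integrals and it suffices to show that D vanishes there.
  set F : ℂ → ℂ := fun w => (w - z₀) * f w with hF
  have hFd : DifferentiableOn ℂ F U := (by fun_prop : DifferentiableOn ℂ (fun w => w - z₀) U).mul hf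
  have hFc1 := hFd.continuousOn.mono ht1
  have hFc2 := hFd.continuousOn.mono ht2
  set D : ℂ → ℂ := fun z => curveInt (fun w => dslope F w z) γ₁ - curveInt (fun w => dslope F w z) γ₂
    with hD
  set H : ℂ → ℂ := fun z => curveInt (fun w => F w / (w - z)) γ₁ - curveInt (fun w => F w / (w - z)) γ₂
    with hH
  have hDd : DifferentiableOn ℂ D U :=
    (differentiableOn_dslopeInt h1 hU ht1 hFd).sub (differentiableOn_dslopeInt h2 hU ht2 hFd)
  have hHd : DifferentiableOn ℂ H ((trace γ₁)ᶜ ∩ (trace γ₂)ᶜ) :=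
    ((differentiableOn_cauchyInt h1 hFc1).mono inter_subset_left).sub
      ((differentiableOn_cauchyInt h2 hFc2).mono inter_subset_right)
  have hopen : IsOpen ((trace γ₁)ᶜ ∩ (trace γ₂)ᶜ) :=
    h1.isCompact_trace.isClosed.isOpen_compl.inter h2.isCompact_trace.isClosed.isOpen_compl
  have hDH1 : ∀ {γ : ℝ → ℂ}, IsPiecewiseC1 γ → ContinuousOn F (trace γ) → ∀ z, z ∉ trace γ →
      curveInt (fun w => dslope F w z) γ = curveInt (fun w => F w / (w - z)) γ - F z * windInt γ z := by
    intro γ hγ hFc z hz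
    have hne : ∀ {w}, w ∈ trace γ → w - z ≠ 0 := fun hw h0 => hz (by rwa [← sub_eq_zero.1 h0])
    have k1 : ContinuousOn (fun w => F w / (w - z)) (trace γ) :=
      hFc.div (by fun_prop) fun w hw => hne hw
    have k2 : ContinuousOn (fun w => F z * (1 / (w - z))) (trace γ) :=
      continuousOn_const.mul (continuousOn_const.div (by fun_prop) fun w hw => hne hw)
    rw [windInt, ← curveInt_const_mul, ← curveInt_sub hγ k1 k2]
    refine curveInt_congr fun w hw => ?_
    rw [dslope_comm, dslope_eq_div (hne hw), sub_div, mul_one_div]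
  have hDH : ∀ z, z ∈ (trace γ₁)ᶜ ∩ (trace γ₂)ᶜ → windInt γ₁ z = windInt γ₂ z → D z = H z := by
    intro z hz hwz
    simp only [hD, hH]
    rw [hDH1 h1 hFc1 z hz.1, hDH1 h2 hFc2 z hz.2, hwz]
    ring
  -- Dixon's gluing. D and H agree off the curves wherever the two winding numbers coincide; these
  -- are locally constant, so they coincide in a neighbourhood of each point outside U. Hence G is
  -- entire.
  set G : ℂ → ℂ := fun z => if z ∈ U then D z else H z with hG
  have hGd : Differentiable ℂ G := by
    intro z
    by_cases hz : z ∈ U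
    · refine (hDd.differentiableAt (hU.mem_nhds hz)).congr_of_eventuallyEq ?_
      filter_upwards [hU.mem_nhds hz] with z' hz'
      simp [hG, hz']
    · have hzt : z ∈ (trace γ₁)ᶜ ∩ (trace γ₂)ᶜ := ⟨fun h => hz (ht1 h), fun h => hz (ht2 h)⟩
      obtain ⟨ε, hε, hb⟩ := Metric.isOpen_iff.1 hopen z hzt
      have hwc : ∀ {γ : ℝ → ℂ}, IsPiecewiseC1 γ → γ 0 = γ 1 → ball z ε ⊆ (trace γ)ᶜ →
          ∀ z' ∈ ball z ε, windInt γ z' = windInt γ z := by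
        intro γ hγ hcl hbγ z' hz'
        refine Metric.isOpen_ball.is_const_of_deriv_eq_zero (convex_ball z ε).isPreconnected
          (fun x hx => (hasDerivAt_windInt hγ hcl (hbγ hx)).differentiableAt.differentiableWithinAt)
          (fun x hx => (hasDerivAt_windInt hγ hcl (hbγ hx)).deriv) hz' (Metric.mem_ball_self hε)
      refine (hHd.differentiableAt (hopen.mem_nhds hzt)).congr_of_eventuallyEq ?_
      filter_upwards [Metric.ball_mem_nhds z hε] with z' hz'
      by_cases hzU : z' ∈ U
      · simp only [hG, hzU, if_true]
        refine hDH z' (hb hz') ?_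
        rw [hwc h1 hc1 (hb.trans inter_subset_left) z' hz',
          hwc h2 hc2 (hb.trans inter_subset_right) z' hz', hw z hz]
      · simp [hG, hzU]
  -- Far out both winding numbers vanish, so G is the Cauchy-type integral H, which tends to 0;
  -- Liouville's theorem then gives G = 0.
  have hGlim : Tendsto G (cocompact ℂ) (𝓝 0) := by
    have hHlim : Tendsto H (cocompact ℂ) (𝓝 0) := by
      simpa using (tendsto_cauchyInt h1 hFc1).sub (tendsto_cauchyInt h2 hFc2)
    refine hHlim.congr' ?_
    obtain ⟨M1, hM10, hM1⟩ := exists_norm_trace_lt h1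
    obtain ⟨M2, hM20, hM2⟩ := exists_norm_trace_lt h2
    filter_upwards [(tendsto_norm_cocompact_atTop (E := ℂ)).eventually (eventually_ge_atTop (max M1 M2))]
      with z hz
    rw [max_le_iff] at hz
    by_cases hzU : z ∈ U
    · simp only [hG, hzU, if_true]
      refine (hDH z ⟨fun hm => absurd (hM1 z hm) (by linarith), fun hm => absurd (hM2 z hm)
        (by linarith)⟩ ?_).symm
      rw [windInt_eq_zero h1 hc1 hM10 hM1 hz.1, windInt_eq_zero h2 hc2 hM20 hM2 hz.2]
    · simp [hG, hzU]
  have hG0 := hGd.apply_eq_of_tendsto_cocompact z₀ hGlim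
  simp only [hG, hz₀U, if_true, hD] at hG0
  have hval : ∀ {γ : ℝ → ℂ}, trace γ ⊆ U →
      curveInt (fun w => dslope F w z₀) γ = curveInt f γ := by
    intro γ hγ
    refine curveInt_congr fun w hw => ?_
    by_cases hwz : w - z₀ = 0
    · rw [sub_eq_zero.1 hwz, dslope_same]
      have hfd := hf.differentiableAt (hU.mem_nhds hz₀U)
      have := ((hasDerivAt_id z₀).sub_const z₀).mul hfd.hasDerivAt
      rw [show F = (fun x => id x - z₀) * f from rfl, this.deriv]
      simp
    · rw [dslope_comm, dslope_eq_div hwz]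
      simp only [hF, sub_self, zero_mul, sub_zero]
      field_simp
  rw [hval ht1, hval ht2] at hG0
  exact sub_eq_zero.1 hG0

end Cauchy

/-! ### Values of contour integrals -/

section Separation

open MeasureTheory Set
open Real (circleAverage)
open Metric (sphere ball closedBall)

/-- The circle of radius `r` around `0`, parametrized by `[0, 1]`. -/
def circleCurve (r : ℝ) (x : ℝ) : ℂ := circleMap 0 r (2 * Real.pi * x)

lemma hasDerivAt_circleCurve (r x : ℝ) :
    HasDerivAt (circleCurve r) (2 * Real.pi * Complex.I * circleCurve r x) x := by
  have h := (hasDerivAt_circleMap 0 r (2 * Real.pi * x)).scomp x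
    ((hasDerivAt_id x).const_mul (2 * Real.pi))
  refine h.congr_deriv ?_
  simp [circleCurve]
  ring

lemma isPiecewiseC1_circleCurve (r : ℝ) : IsPiecewiseC1 (circleCurve r) := by
  have : ContDiff ℝ 1 (circleCurve r) := (contDiff_circleMap 0 r).comp (by fun_prop)
  exact ⟨this.continuous.continuousOn, ∅, fun a b _ _ _ _ => this.contDiffOn⟩

lemma circleCurve_closed (r : ℝ) : circleCurve r 0 = circleCurve r 1 := by
  simp [circleCurve, circleMap]

lemma norm_circleCurve {r : ℝ} (hr : 0 < r) (x : ℝ) : ‖circleCurve r x‖ = r := by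
  have := circleMap_mem_sphere_zero hr (2 * Real.pi * x)
  rwa [mem_sphere_iff_norm, sub_zero] at this

lemma trace_circleCurve {r : ℝ} (hr : 0 < r) : trace (circleCurve r) ⊆ {z | ‖z‖ = r} := by
  rintro _ ⟨x, _, rfl⟩
  exact norm_circleCurve hr x

lemma normCurveInt_circleCurve {r : ℝ} (hr : 0 < r) (f : ℂ → ℂ) :
    normCurveInt f (circleCurve r) = circleAverage f 0 r := by
  have h1 : normCurveInt f (circleCurve r) = ∫ x in (0:ℝ)..1, f (circleMap 0 r (2 * Real.pi * x)) := by
    refine intervalIntegral.integral_congr fun x _ => ?_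
    have h0 : circleCurve r x ≠ 0 := norm_pos_iff.1 (by rw [norm_circleCurve hr]; exact hr)
    have hpi : (Real.pi : ℂ) ≠ 0 := by exact_mod_cast Real.pi_ne_zero
    simp only [(hasDerivAt_circleCurve r x).deriv]
    rw [div_mul_cancel₀ _ (mul_ne_zero (mul_ne_zero (mul_ne_zero two_ne_zero hpi) Complex.I_ne_zero) h0)]
    rfl
  rw [h1, intervalIntegral.integral_comp_mul_left (fun θ => f (circleMap 0 r θ)) (by positivity),
    mul_zero, mul_one, Real.circleAverage_def]

lemma windingNum_eq_normCurveInt {γ : ℝ → ℂ} (h : ∀ w ∈ trace γ, w ≠ 0) (z : ℂ) :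
    windingNum γ z = normCurveInt (fun w => w / (w - z)) γ := by
  unfold windingNum normCurveInt
  refine curveInt_congr fun w hw => ?_
  have := h w hw
  rw [div_div, show (w - z) * (2 * Real.pi * Complex.I * w) =
    w * (2 * Real.pi * Complex.I * (w - z)) by ring, ← div_div w w, div_self this]

lemma windingNum_circleCurve_of_lt {r : ℝ} {w : ℂ} (hw : ‖w‖ < r) :
    windingNum (circleCurve r) w = 1 := by
  have hr : 0 < r := norm_ne_zero_of_lt hw
  have h0 : ∀ z ∈ trace (circleCurve r), z ≠ 0 := fun z hz => norm_pos_iff.1 (by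
    rw [show ‖z‖ = r from trace_circleCurve hr hz]; exact hr)
  rw [windingNum_eq_normCurveInt h0, normCurveInt_circleCurve hr,
    Real.circleAverage_eq_circleIntegral hr.ne']
  have : (∮ z in C(0, r), (z - 0)⁻¹ • (z / (z - w))) = ∮ z in C(0, r), (z - w)⁻¹ := by
    refine circleIntegral.integral_congr hr.le fun z hz => ?_
    have hz0 : z ≠ 0 := norm_pos_iff.1 (by
      rw [show ‖z‖ = r by simpa using hz]; exact hr)
    simp only [sub_zero, smul_eq_mul]
    rw [div_eq_mul_inv, inv_mul_cancel_left₀ hz0]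
  rw [this, circleIntegral.integral_sub_inv_of_mem_ball (by simpa using hw), smul_eq_mul,
    inv_mul_cancel₀ Complex.two_pi_I_ne_zero]

lemma windingNum_circleCurve_of_gt {r : ℝ} {w : ℂ} (hr : 0 < r) (hw : r < ‖w‖) :
    windingNum (circleCurve r) w = 0 := by
  have h0 : ∀ z ∈ trace (circleCurve r), z ≠ 0 := fun z hz => norm_pos_iff.1 (by
    rw [show ‖z‖ = r from trace_circleCurve hr hz]; exact hr)
  rw [windingNum_eq_normCurveInt h0, normCurveInt_circleCurve hr,
    circleAverage_eq_center hr fun z hz => ?_]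
  · simp
  · refine differentiableAt_id.div (by fun_prop) fun h => ?_
    rw [← sub_eq_zero.1 h] at hw
    exact absurd hw (not_lt.2 (by simpa using hz))

/-- A circle which separates the two sets is a separating contour. -/
lemma isSeparatingContour_circleCurve {r : ℝ} (hr : 0 < r) {down up : Set ℂ}
    (hd : ∀ w ∈ down, ‖w‖ < r) (hu : ∀ w ∈ up, r < ‖w‖) :
    IsSeparatingContour (circleCurve r) down up where
  piecewiseC1 := isPiecewiseC1_circleCurve r
  closed := circleCurve_closed r
  avoids x _ := by
    have h := norm_circleCurve hr x
    refine ⟨norm_pos_iff.1 (by rw [h]; exact hr), fun h' => ?_, fun h' => ?_⟩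
    · exact absurd (hd _ h') (by rw [h]; exact lt_irrefl r)
    · exact absurd (hu _ h') (by rw [h]; exact lt_irrefl r)
  winding_zero := windingNum_circleCurve_of_lt (by simpa using hr)
  winding_down w hw := windingNum_circleCurve_of_lt (hd w hw)
  winding_up w hw := windingNum_circleCurve_of_gt hr (hu w hw)

/-- `down` accumulates at most at `0`, and `up` at most at infinity. -/
structure IsPolarPair (down up : Set ℂ) : Prop where
  down_finite : ∀ ε > 0, {z ∈ down | ε ≤ ‖z‖}.Finite
  up_finite : ∀ M : ℝ, {z ∈ up | ‖z‖ ≤ M}.Finite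

lemma isClosed_of_finite_bounded {s : Set ℂ} (h : ∀ M : ℝ, {z ∈ s | ‖z‖ ≤ M}.Finite) :
    IsClosed s := by
  rw [← isOpen_compl_iff, Metric.isOpen_iff]
  intro z hz
  have hc := (h (‖z‖ + 1)).isClosed
  obtain ⟨ε, hε, hb⟩ := Metric.isOpen_iff.1 hc.isOpen_compl z fun h' => hz h'.1
  refine ⟨min ε 1, lt_min hε one_pos, fun w hw hws => ?_⟩
  rw [Metric.mem_ball] at hw
  refine hb (show w ∈ ball z ε from hw.trans_le (min_le_left _ _)) ⟨hws, ?_⟩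
  have h1 : ‖w - z‖ < 1 := by rw [← dist_eq_norm]; exact hw.trans_le (min_le_right _ _)
  have := norm_sub_norm_le w z
  linarith

lemma isClosed_insert_zero_of_finite {s : Set ℂ} (h : ∀ ε > 0, {z ∈ s | ε ≤ ‖z‖}.Finite) :
    IsClosed (insert 0 s) := by
  rw [← isOpen_compl_iff, Metric.isOpen_iff]
  intro z hz
  have hz0 : z ≠ 0 := fun h' => hz (by simp [h'])
  have hzp := norm_pos_iff.2 hz0
  have hc := (h (‖z‖ / 2) (by positivity)).isClosed
  obtain ⟨ε, hε, hb⟩ := Metric.isOpen_iff.1 hc.isOpen_compl z fun h' => hz (Or.inr h'.1)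
  refine ⟨min ε (‖z‖ / 2), lt_min hε (by positivity), fun w hw hws => ?_⟩
  rw [Metric.mem_ball] at hw
  have h1 : ‖w - z‖ < ‖z‖ / 2 := by rw [← dist_eq_norm]; exact hw.trans_le (min_le_right _ _)
  have h2 := norm_sub_norm_le z w
  rw [norm_sub_rev] at h2
  rcases hws with rfl | hws
  · rw [norm_zero] at h2; linarith
  · exact hb (show w ∈ ball z ε from hw.trans_le (min_le_left _ _)) ⟨hws, by linarith⟩

/-- `I` is the value of `∮ f(z) dz / (2πiz)` over contours separating `down` from `up`, obtained
through a splitting of `f` in two functions for which the contour may be replaced by a large,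
respectively a small, circle. -/
def SepValue (f : ℂ → ℂ) (down up : Set ℂ) (I : ℂ) : Prop :=
  ∃ (fA fB : ℂ → ℂ) (r R : ℝ), (0 < r ∧ r < 1 ∧ 1 < R) ∧ (∀ d ∈ down, ‖d‖ < R) ∧
    (∀ u ∈ up, r < ‖u‖) ∧ (∀ z, z ≠ 0 → z ∉ down → z ∉ up → f z = fA z + fB z) ∧
    (∀ z, z ≠ 0 → z ∉ down → (z ∈ up → ‖z‖ ≤ R) → DifferentiableAt ℂ fA z) ∧
    (∀ z, z ≠ 0 → z ∉ up → (z ∈ down → r ≤ ‖z‖) → DifferentiableAt ℂ fB z) ∧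
    I = circleAverage fA 0 R + circleAverage fB 0 r

/-- S contains 0 and all singularities of f; Cauchy's theorem on its complement only asks that the
curve and the circle wind equally around the points of S. -/
lemma normCurveInt_eq_circleAverage {γ : ℝ → ℂ} (hγ : IsPiecewiseC1 γ) (hcl : γ 0 = γ 1) {R : ℝ}
    (hR : 0 < R) {S : Set ℂ} (hS : IsClosed S) (h0 : 0 ∈ S) (hγS : ∀ w ∈ trace γ, w ∉ S)
    (hRS : ∀ w, ‖w‖ = R → w ∉ S) (hw : ∀ z ∈ S, windingNum γ z = windingNum (circleCurve R) z)
    {f : ℂ → ℂ} (hf : ∀ z ∉ S, DifferentiableAt ℂ f z) :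
    normCurveInt f γ = circleAverage f 0 R := by
  rw [← normCurveInt_circleCurve hR]
  refine curveInt_eq_of_windInt_eq hγ (isPiecewiseC1_circleCurve R) hcl (circleCurve_closed R)
    hS.isOpen_compl hγS (fun w hw => hRS w (trace_circleCurve hR hw)) (fun z hz => ?_)
    fun z hz => ?_
  · rw [windingNum_eq, windingNum_eq, hw z (not_not.1 hz)]
  · refine ((hf z hz).div (by fun_prop) ?_).differentiableWithinAt
    have hz0 : z ≠ 0 := by rintro rfl; exact hz h0
    exact mul_ne_zero Complex.two_pi_I_ne_zero hz0

/-- A separating contour computes the value. -/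
theorem SepValue.normCurveInt_eq {f : ℂ → ℂ} {down up : Set ℂ} {I : ℂ} (hf : SepValue f down up I)
    (hP : IsPolarPair down up) {γ : ℝ → ℂ} (hγ : IsSeparatingContour γ down up) :
    normCurveInt f γ = I := by
  obtain ⟨fA, fB, r, R, ⟨hr0, hr1, hR1⟩, hdR, hur, hsplit, hA, hB, rfl⟩ := hf
  have hR0 : 0 < R := by linarith
  have hav : ∀ w ∈ trace γ, w ≠ 0 ∧ w ∉ down ∧ w ∉ up := by
    rintro _ ⟨x, hx, rfl⟩; exact hγ.avoids x hx
  -- The singularities of fA are 0, the points of `down`, all inside the circle of radius R, and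
  -- points of `up` outside it. The curve has the same winding numbers around them as the circle.
  have eA : normCurveInt fA γ = circleAverage fA 0 R := by
    refine normCurveInt_eq_circleAverage hγ.piecewiseC1 hγ.closed hR0
      (S := insert 0 down ∪ {z ∈ up | R < ‖z‖}) ((isClosed_insert_zero_of_finite hP.down_finite).union
      (isClosed_of_finite_bounded fun M => (hP.up_finite M).subset fun z hz => ⟨hz.1.1, hz.2⟩))
      (Or.inl (mem_insert _ _)) ?_ ?_ ?_ ?_
    · rintro w hw ((rfl | h) | h)
      · exact (hav _ hw).1 rfl
      · exact (hav w hw).2.1 h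
      · exact (hav w hw).2.2 h.1
    · rintro w hw ((rfl | h) | h)
      · rw [norm_zero] at hw; linarith
      · exact absurd (hdR w h) (by rw [hw]; exact lt_irrefl R)
      · exact absurd h.2 (by rw [hw]; exact lt_irrefl R)
    · rintro z ((rfl | h) | h)
      · rw [hγ.winding_zero, windingNum_circleCurve_of_lt (by simpa using hR0)]
      · rw [hγ.winding_down z h, windingNum_circleCurve_of_lt (hdR z h)]
      · rw [hγ.winding_up z h.1, windingNum_circleCurve_of_gt hR0 h.2]
    · intro z hz
      simp only [mem_union, mem_insert_iff, Set.mem_ofPred_eq, not_or, not_and, not_lt] at hz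
      exact hA z hz.1.1 hz.1.2 hz.2
  -- Symmetrically, fB is singular at 0, at points of `down` inside the circle of radius r, and at
  -- the points of `up`, all of which lie outside.
  have eB : normCurveInt fB γ = circleAverage fB 0 r := by
    refine normCurveInt_eq_circleAverage hγ.piecewiseC1 hγ.closed hr0
      (S := insert 0 {z ∈ down | ‖z‖ < r} ∪ up) ((isClosed_insert_zero_of_finite
      fun ε hε => (hP.down_finite ε hε).subset fun z hz => ⟨hz.1.1, hz.2⟩).union
      (isClosed_of_finite_bounded hP.up_finite))
      (Or.inl (mem_insert _ _)) ?_ ?_ ?_ ?_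
    · rintro w hw ((rfl | h) | h)
      · exact (hav _ hw).1 rfl
      · exact (hav w hw).2.1 h.1
      · exact (hav w hw).2.2 h
    · rintro w hw ((rfl | h) | h)
      · rw [norm_zero] at hw; linarith
      · exact absurd h.2 (by rw [hw]; exact lt_irrefl r)
      · exact absurd (hur w h) (by rw [hw]; exact lt_irrefl r)
    · rintro z ((rfl | h) | h)
      · rw [hγ.winding_zero, windingNum_circleCurve_of_lt (by simpa using hr0)]
      · rw [hγ.winding_down z h.1, windingNum_circleCurve_of_lt h.2]
      · rw [hγ.winding_up z h, windingNum_circleCurve_of_gt hr0 (hur z h)]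
    · intro z hz
      simp only [mem_union, mem_insert_iff, Set.mem_ofPred_eq, not_or, not_and, not_lt] at hz
      exact hB z hz.1.1 hz.2 hz.1.2
  rw [← eA, ← eB]
  unfold normCurveInt
  have hden : ∀ w ∈ trace γ, 2 * (Real.pi : ℂ) * Complex.I * w ≠ 0 := fun w hw =>
    mul_ne_zero Complex.two_pi_I_ne_zero (hav w hw).1
  rw [← curveInt_add hγ.piecewiseC1]
  · refine curveInt_congr fun w hw => ?_
    rw [hsplit w (hav w hw).1 (hav w hw).2.1 (hav w hw).2.2, add_div]
  · refine ContinuousOn.div (fun w hw => ?_) (by fun_prop) hden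
    exact (hA w (hav w hw).1 (hav w hw).2.1
      fun h => absurd h (hav w hw).2.2).continuousAt.continuousWithinAt
  · refine ContinuousOn.div (fun w hw => ?_) (by fun_prop) hden
    exact (hB w (hav w hw).1 (hav w hw).2.2
      fun h => absurd h (hav w hw).2.1).continuousAt.continuousWithinAt

/-- The value does not depend on the splitting. -/
theorem SepValue.unique {f : ℂ → ℂ} {down up : Set ℂ} {I J : ℂ} (hI : SepValue f down up I)
    (hJ : SepValue f down up J) (hP : IsPolarPair down up) (hdis : Disjoint down up) : I = J := by
  classical
  obtain ⟨fA, fB, r, R, ⟨hr0, hr1, hR1⟩, hdR, hur, hsplit, hA, hB, rfl⟩ := hI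
  obtain ⟨gA, gB, r', R', ⟨hr0', hr1', hR1'⟩, hdR', hur', hsplit', hA', hB', rfl⟩ := hJ
  set R₀ := min R R'
  set r₀ := max r r'
  have hr₀ : 0 < r₀ := lt_max_of_lt_left hr0
  have hrR : r₀ < R₀ := (max_lt hr1 hr1').trans (lt_min hR1 hR1')
  have hR₀ : 0 < R₀ := hr₀.trans hrR
  have hd0 : ∀ d ∈ down, ‖d‖ < R₀ := fun d hd => lt_min (hdR d hd) (hdR' d hd)
  have hu0 : ∀ u ∈ up, r₀ < ‖u‖ := fun u hu => max_lt (hur u hu) (hur' u hu)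
  have hne : ∀ {z : ℂ} {ρ : ℝ}, 0 < ρ → ρ ≤ ‖z‖ → z ≠ 0 := fun h h' => norm_pos_iff.1 (h.trans_le h')
  have a1 : circleAverage fA 0 R = circleAverage fA 0 R₀ :=
    circleAverage_annulus hR₀ (min_le_left _ _) fun z h1 h2 =>
      hA z (hne hR₀ h1) (fun h => absurd (hd0 z h) (not_lt.2 h1)) fun _ => h2
  have a2 : circleAverage gA 0 R' = circleAverage gA 0 R₀ :=
    circleAverage_annulus hR₀ (min_le_right _ _) fun z h1 h2 =>
      hA' z (hne hR₀ h1) (fun h => absurd (hd0 z h) (not_lt.2 h1)) fun _ => h2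
  have a3 : circleAverage fB 0 r₀ = circleAverage fB 0 r :=
    circleAverage_annulus hr0 (le_max_left _ _) fun z h1 h2 =>
      hB z (hne hr0 h1) (fun h => absurd (hu0 z h) (not_lt.2 h2)) fun _ => h1
  have a4 : circleAverage gB 0 r₀ = circleAverage gB 0 r' :=
    circleAverage_annulus hr0' (le_max_right _ _) fun z h1 h2 =>
      hB' z (hne hr0' h1) (fun h => absurd (hu0 z h) (not_lt.2 h2)) fun _ => h1
  -- Off both sets fA - gA = gB - fB. Since `down` and `up` are disjoint, the two expressions glue
  -- to a function holomorphic in r₀ ≤ ‖z‖ ≤ R₀, and equality of its averages over the two boundary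
  -- circles is the claim.
  obtain ⟨D, hD⟩ : ∃ D : ℂ → ℂ, D = fun z => if z ∈ down then gB z - fB z else fA z - gA z := ⟨_, rfl⟩
  have hDeq : ∀ z, z ≠ 0 → z ∉ up → D z = gB z - fB z := fun z hz0 hz => by
    rw [hD]
    by_cases hzd : z ∈ down
    · simp [hzd]
    · simp only [hzd, if_false]
      linear_combination (hsplit' z hz0 hzd hz) - (hsplit z hz0 hzd hz)
  have hDdiff : ∀ z, r₀ ≤ ‖z‖ → ‖z‖ ≤ R₀ → DifferentiableAt ℂ D z := by
    intro z h1 h2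
    have hz0 := hne hr₀ h1
    by_cases hzd : z ∈ down
    · have hzu : z ∉ up := fun h => hdis.le_bot ⟨hzd, h⟩
      refine ((hB' z hz0 hzu fun _ => (le_max_right _ _).trans h1).sub
        (hB z hz0 hzu fun _ => (le_max_left _ _).trans h1)).congr_of_eventuallyEq ?_
      filter_upwards [(isClosed_of_finite_bounded hP.up_finite).isOpen_compl.mem_nhds hzu,
        isOpen_ne.mem_nhds hz0] with w hw hw0 using hDeq w hw0 hw
    · refine ((hA z hz0 hzd fun _ => h2.trans (min_le_left _ _)).sub
        (hA' z hz0 hzd fun _ => h2.trans (min_le_right _ _))).congr_of_eventuallyEq ?_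
      filter_upwards [(isClosed_insert_zero_of_finite hP.down_finite).isOpen_compl.mem_nhds
        (show z ∈ (insert 0 down)ᶜ from fun h => h.elim hz0 hzd)] with w hw
      have : w ∉ down := fun h => hw (Or.inr h)
      simp [hD, this]
  have key := circleAverage_annulus hr₀ hrR.le hDdiff
  have c : ∀ {g : ℂ → ℂ} {ρ : ℝ}, (∀ z, ‖z‖ = ρ → DifferentiableAt ℂ g z) →
      ContinuousOn g (sphere 0 ρ) := fun h => continuousOn_of_differentiableAt_sphere h
  have k1 : circleAverage D 0 R₀ = circleAverage fA 0 R₀ - circleAverage gA 0 R₀ := by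
    rw [← circleAverage_sub_of_continuousOn hR₀]
    · refine circleAverage_congr_on hR₀ fun z hz => ?_
      have : z ∉ down := fun h => absurd (hd0 z h) (by rw [hz]; exact lt_irrefl _)
      simp [hD, this]
    · exact c fun z hz => hA z (hne hR₀ hz.ge) (fun h => absurd (hd0 z h) (by rw [hz]; exact lt_irrefl _))
        fun _ => by rw [hz]; exact min_le_left _ _
    · exact c fun z hz => hA' z (hne hR₀ hz.ge) (fun h => absurd (hd0 z h) (by rw [hz]; exact lt_irrefl _))
        fun _ => by rw [hz]; exact min_le_right _ _
  have k2 : circleAverage D 0 r₀ = circleAverage gB 0 r₀ - circleAverage fB 0 r₀ := by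
    rw [← circleAverage_sub_of_continuousOn hr₀]
    · refine circleAverage_congr_on hr₀ fun z hz => ?_
      exact hDeq z (hne hr₀ hz.ge) fun h => absurd (hu0 z h) (by rw [hz]; exact lt_irrefl _)
    · exact c fun z hz => hB' z (hne hr₀ hz.ge) (fun h => absurd (hu0 z h) (by rw [hz]; exact lt_irrefl _))
        fun _ => by rw [hz]; exact le_max_right _ _
    · exact c fun z hz => hB z (hne hr₀ hz.ge) (fun h => absurd (hu0 z h) (by rw [hz]; exact lt_irrefl _))
        fun _ => by rw [hz]; exact le_max_left _ _
  rw [a1, a2, ← a3, ← a4]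
  rw [k1, k2] at key
  linear_combination key

lemma SepValue.comp_neg {f g : ℂ → ℂ} {down up down' up' : Set ℂ} {I : ℂ}
    (hf : SepValue f down up I) (hg : ∀ z, g z = f (-z)) (hd : ∀ z, z ∈ down' ↔ -z ∈ down)
    (hu : ∀ z, z ∈ up' ↔ -z ∈ up) : SepValue g down' up' I := by
  obtain ⟨fA, fB, r, R, hr, hdR, hur, hsplit, hA, hB, rfl⟩ := hf
  refine ⟨fun z => fA (-z), fun z => fB (-z), r, R, hr, fun d h => ?_, fun u h => ?_,
    fun z h0 h1 h2 => ?_, fun z h0 h1 h2 => ?_, fun z h0 h1 h2 => ?_, ?_⟩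
  · simpa using hdR _ ((hd d).1 h)
  · simpa using hur _ ((hu u).1 h)
  · rw [hg]
    exact hsplit _ (neg_ne_zero.2 h0) (fun h => h1 ((hd z).2 h)) fun h => h2 ((hu z).2 h)
  · exact (hA (-z) (neg_ne_zero.2 h0) (fun h => h1 ((hd z).2 h))
      fun h => by simpa using h2 ((hu z).2 h)).comp z (by fun_prop)
  · exact (hB (-z) (neg_ne_zero.2 h0) (fun h => h1 ((hu z).2 h))
      fun h => by simpa using h2 ((hd z).2 h)).comp z (by fun_prop)
  · rw [circleAverage_neg_arg, circleAverage_neg_arg]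

end Separation

/-! ### Analytic families of functions on a circle -/

section AnalyticFamily

open Real (circleAverage)
open Metric (sphere ball closedBall)

section Entire

variable {A : Type*} [NormedCommRing A] [NormedAlgebra ℂ A]

/-- The Taylor series of an entire function converges absolutely at every real point; the algebra
enters only through the constant max(1, ‖1‖). -/
lemma radius_ofScalars_taylor {φ : ℂ → ℂ} (hφ : Differentiable ℂ φ) :
    (FormalMultilinearSeries.ofScalars A
      (fun n : ℕ => (n.factorial : ℂ)⁻¹ * iteratedDeriv n φ 0)).radius = ⊤ := by
  refine FormalMultilinearSeries.radius_eq_top_of_summable_norm _ fun r => ?_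
  have h := (Complex.hasSum_taylorSeries_of_entire hφ 0 (r : ℂ)).summable.norm
  refine Summable.of_nonneg_of_le (fun n => by positivity) (fun n => ?_)
    (h.mul_left (max 1 ‖(1 : A)‖))
  have h1 : ‖FormalMultilinearSeries.ofScalars A
      (fun n : ℕ => (n.factorial : ℂ)⁻¹ * iteratedDeriv n φ 0) n‖ ≤
      ‖(n.factorial : ℂ)⁻¹ * iteratedDeriv n φ 0‖ * max 1 ‖(1 : A)‖ := by
    have h2 : FormalMultilinearSeries.ofScalars A
      (fun n : ℕ => (n.factorial : ℂ)⁻¹ * iteratedDeriv n φ 0) n =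
      ((n.factorial : ℂ)⁻¹ * iteratedDeriv n φ 0) • ContinuousMultilinearMap.mkPiAlgebraFin ℂ n A := rfl
    rw [h2, norm_smul]
    gcongr
    rcases n.eq_zero_or_pos with rfl | hn
    · rw [ContinuousMultilinearMap.norm_mkPiAlgebraFin_zero]; exact le_max_right _ _
    · exact (ContinuousMultilinearMap.norm_mkPiAlgebraFin_le_of_pos hn).trans (le_max_left _ _)
  calc _ ≤ ‖(n.factorial : ℂ)⁻¹ * iteratedDeriv n φ 0‖ * max 1 ‖(1 : A)‖ * (r : ℝ) ^ n := by
        gcongr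
    _ = _ := by simp; ring

/-- The action of an entire function on a Banach algebra is analytic. -/
lemma exists_analytic_entire [CompleteSpace A] {φ : ℂ → ℂ} (hφ : Differentiable ℂ φ) :
    ∃ Φ : A → A, (∀ x, AnalyticAt ℂ Φ x) ∧ ∀ x, HasSum
      (fun n : ℕ => ((n.factorial : ℂ)⁻¹ * iteratedDeriv n φ 0) • x ^ n) (Φ x) := by
  have hr := radius_ofScalars_taylor (A := A) hφ
  have hp := (FormalMultilinearSeries.ofScalars A
    (fun n : ℕ => (n.factorial : ℂ)⁻¹ * iteratedDeriv n φ 0)).hasFPowerSeriesOnBall (by rw [hr]; simp)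
  rw [hr] at hp
  refine ⟨_, fun x => hp.analyticAt_of_mem (by simp), fun x => ?_⟩
  have := hp.hasSum (y := x) (by simp)
  simpa only [FormalMultilinearSeries.ofScalars_apply_eq, zero_add] using this

end Entire

variable {E : Type*} [NormedAddCommGroup E] [NormedSpace ℂ E]

/-- A family of functions on the circle of radius `r`, analytic in the parameter near `t₀`. -/
def AnalyticFamily (r : ℝ) (F : E → ℂ → ℂ) (t₀ : E) : Prop :=
  ∃ G : E → C(sphere (0 : ℂ) r, ℂ), AnalyticAt ℂ G t₀ ∧
    ∀ᶠ t in 𝓝 t₀, ∀ z : sphere (0 : ℂ) r, G t z = F t z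

variable {r : ℝ} {F F' : E → ℂ → ℂ} {t₀ : E}

lemma analyticFamily_const {f : ℂ → ℂ} (hf : ContinuousOn f (sphere 0 r)) :
    AnalyticFamily r (fun _ z => f z) t₀ :=
  ⟨fun _ => ⟨fun z => f z, hf.domRestrict⟩, analyticAt_const, .of_forall fun _ _ => rfl⟩

lemma analyticFamily_param {a : E → ℂ} (ha : AnalyticAt ℂ a t₀) :
    AnalyticFamily r (fun t _ => a t) t₀ :=
  ⟨fun t => a t • (1 : C(sphere (0 : ℂ) r, ℂ)), ha.smul analyticAt_const,
    .of_forall fun _ _ => by simp⟩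

lemma AnalyticFamily.add (h : AnalyticFamily r F t₀) (h' : AnalyticFamily r F' t₀) :
    AnalyticFamily r (fun t z => F t z + F' t z) t₀ := by
  obtain ⟨G, hG, hGF⟩ := h
  obtain ⟨G', hG', hGF'⟩ := h'
  refine ⟨fun t => G t + G' t, hG.add hG', ?_⟩
  filter_upwards [hGF, hGF'] with t h1 h2 z
  rw [ContinuousMap.add_apply, h1, h2]

lemma AnalyticFamily.mul (h : AnalyticFamily r F t₀) (h' : AnalyticFamily r F' t₀) :
    AnalyticFamily r (fun t z => F t z * F' t z) t₀ := by
  obtain ⟨G, hG, hGF⟩ := h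
  obtain ⟨G', hG', hGF'⟩ := h'
  refine ⟨fun t => G t * G' t, hG.mul hG', ?_⟩
  filter_upwards [hGF, hGF'] with t h1 h2 z
  rw [ContinuousMap.mul_apply, h1, h2]

/-- The function φ acts on the Banach algebra of continuous functions on the circle through its
Taylor series. Evaluation at a point is continuous and linear, so this action is pointwise
composition. -/
lemma AnalyticFamily.entire (h : AnalyticFamily r F t₀) {φ : ℂ → ℂ} (hφ : Differentiable ℂ φ) :
    AnalyticFamily r (fun t z => φ (F t z)) t₀ := by
  obtain ⟨G, hG, hGF⟩ := h
  obtain ⟨Φ, hΦ, hsum⟩ := exists_analytic_entire (A := C(sphere (0 : ℂ) r, ℂ)) hφ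
  refine ⟨fun t => Φ (G t), (hΦ _).comp hG, ?_⟩
  filter_upwards [hGF] with t h1 z
  have h2 := (hsum (G t)).mapL (ContinuousMap.evalCLM ℂ z)
  have h3 := Complex.hasSum_taylorSeries_of_entire hφ 0 (F t z)
  refine h2.unique ?_
  refine Eq.mp (congrArg (fun f => HasSum f _) (funext fun n => ?_)) h3
  have h4 : (ContinuousMap.evalCLM ℂ z) (((n.factorial : ℂ)⁻¹ * iteratedDeriv n φ 0) • G t ^ n) =
    ((n.factorial : ℂ)⁻¹ * iteratedDeriv n φ 0) * (G t z) ^ n := rfl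
  rw [h4, h1]
  simp only [smul_eq_mul, sub_zero]
  ring

/-- A continuous function without zeros on the circle is a unit of the Banach algebra; units form an
open set on which inversion is analytic. -/
lemma AnalyticFamily.inv (h : AnalyticFamily r F t₀) (h0 : ∀ z, ‖z‖ = r → F t₀ z ≠ 0) :
    AnalyticFamily r (fun t z => (F t z)⁻¹) t₀ := by
  obtain ⟨G, hG, hGF⟩ := h
  have hu : IsUnit (G t₀) := (ContinuousMap.isUnit_iff_forall_ne_zero _).2 fun z => by
    rw [hGF.self_of_nhds z]; exact h0 z (by simp)
  obtain ⟨u, hu'⟩ := hu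
  have hinv : AnalyticAt ℂ Ring.inverse (G t₀) := by
    rw [← hu']; exact analyticAt_inverse u
  refine ⟨fun t => Ring.inverse (G t), hinv.comp hG, ?_⟩
  have hev : ∀ᶠ t in 𝓝 t₀, IsUnit (G t) := hG.continuousAt.eventually (by
    rw [← hu']; exact Units.nhds u)
  filter_upwards [hGF, hev] with t h1 h2 z
  have h3 := congrArg (fun f : C(sphere (0 : ℂ) r, ℂ) => f z) (Ring.mul_inverse_cancel _ h2)
  simp only [ContinuousMap.mul_apply, ContinuousMap.one_apply, h1] at h3
  exact eq_inv_of_mul_eq_one_right h3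

/-- The average is a continuous linear functional on continuous functions on the circle, so it
carries an analytic curve of functions to an analytic function of the parameter, in any number of
variables. -/
lemma AnalyticFamily.circleAverage (hr : 0 < r) (h : AnalyticFamily r F t₀) :
    AnalyticAt ℂ (fun t => Real.circleAverage (F t) 0 r) t₀ := by
  obtain ⟨G, hG, hGF⟩ := h
  have hc : ∀ f : C(sphere (0 : ℂ) r, ℂ), Continuous fun θ : ℝ => f ⟨circleMap 0 r θ,
      circleMap_mem_sphere_zero hr θ⟩ := fun f =>
    f.continuous.comp ((continuous_circleMap 0 r).subtype_mk _)
  obtain ⟨L, hL⟩ : ∃ L : C(sphere (0 : ℂ) r, ℂ) →L[ℂ] ℂ, ∀ f, L f = (2 * Real.pi)⁻¹ •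
      ∫ θ in (0:ℝ)..2 * Real.pi, f ⟨circleMap 0 r θ, circleMap_mem_sphere_zero hr θ⟩ := by
    refine ⟨LinearMap.mkContinuous
      { toFun := fun f => (2 * Real.pi)⁻¹ •
          ∫ θ in (0:ℝ)..2 * Real.pi, f ⟨circleMap 0 r θ, circleMap_mem_sphere_zero hr θ⟩
        map_add' := fun f g => ?_
        map_smul' := fun c f => ?_ } 1 fun f => ?_, fun f => rfl⟩
    · simp only [ContinuousMap.add_apply]
      rw [intervalIntegral.integral_add ((hc f).intervalIntegrable _ _)
        ((hc g).intervalIntegrable _ _), smul_add]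
    · simp only [ContinuousMap.smul_apply, smul_eq_mul, RingHom.id_apply]
      rw [intervalIntegral.integral_const_mul, mul_smul_comm]
    · simp only [LinearMap.coe_mk, AddHom.coe_mk, norm_smul, norm_inv, one_mul]
      have hpi : 0 < 2 * Real.pi := by positivity
      have := intervalIntegral.norm_integral_le_of_norm_le_const (a := 0) (b := 2 * Real.pi)
        (f := fun θ => f ⟨circleMap 0 r θ, circleMap_mem_sphere_zero hr θ⟩) (C := ‖f‖)
        fun θ _ => f.norm_coe_le_norm _
      rw [sub_zero, abs_of_pos hpi] at this
      rw [Real.norm_of_nonneg hpi.le, inv_mul_le_iff₀ hpi]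
      linarith
  refine ((L.analyticAt _).comp hG).congr ?_
  filter_upwards [hGF] with t ht
  simp only [Function.comp]
  rw [hL, Real.circleAverage_def]
  simp only [ht]

end AnalyticFamily

/-! ### Meromorphic continuation of contour integrals -/

section Continuation

open Set
open Real (circleAverage)
open Metric (sphere ball closedBall)

variable {q : ℂ} {E : Type*} [NormedAddCommGroup E] [NormedSpace ℂ E] {t₀ : E}

/-- A family of holomorphic functions on `ℂ \ {0}`, analytic in the parameter near `t₀`. -/
structure IsHolFamily (F : E → ℂ → ℂ) (t₀ : E) : Prop where
  family : ∀ r : ℝ, 0 < r → AnalyticFamily r F t₀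
  differentiableAt : ∀ᶠ t in 𝓝 t₀, ∀ z, z ≠ 0 → DifferentiableAt ℂ (F t) z

lemma isHolFamily_const {f : ℂ → ℂ} (hf : ∀ z, z ≠ 0 → DifferentiableAt ℂ f z) :
    IsHolFamily (fun _ z => f z) t₀ :=
  ⟨fun _ hr => analyticFamily_const (continuousOn_of_differentiableAt_sphere fun z hz =>
    hf z (norm_pos_iff.1 (by rw [hz]; exact hr))), .of_forall fun _ => hf⟩

lemma isHolFamily_param {a : E → ℂ} (ha : AnalyticAt ℂ a t₀) : IsHolFamily (fun t _ => a t) t₀ :=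
  ⟨fun _ _ => analyticFamily_param ha, .of_forall fun _ _ _ => differentiableAt_const _⟩

lemma IsHolFamily.add {F F' : E → ℂ → ℂ} (h : IsHolFamily F t₀) (h' : IsHolFamily F' t₀) :
    IsHolFamily (fun t z => F t z + F' t z) t₀ :=
  ⟨fun r hr => (h.family r hr).add (h'.family r hr), by
    filter_upwards [h.differentiableAt, h'.differentiableAt] with t h1 h2 z hz
    exact (h1 z hz).add (h2 z hz)⟩

lemma IsHolFamily.mul {F F' : E → ℂ → ℂ} (h : IsHolFamily F t₀) (h' : IsHolFamily F' t₀) :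
    IsHolFamily (fun t z => F t z * F' t z) t₀ :=
  ⟨fun r hr => (h.family r hr).mul (h'.family r hr), by
    filter_upwards [h.differentiableAt, h'.differentiableAt] with t h1 h2 z hz
    exact (h1 z hz).mul (h2 z hz)⟩

lemma IsHolFamily.prod {ι : Type*} {F : ι → E → ℂ → ℂ} (s : Finset ι)
    (h : ∀ i, IsHolFamily (F i) t₀) : IsHolFamily (fun t z => ∏ i ∈ s, F i t z) t₀ := by
  classical
  induction s using Finset.induction_on with
  | empty =>
    simpa using isHolFamily_const (t₀ := t₀) (f := fun _ => 1) fun _ _ => differentiableAt_const _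
  | insert i s hi ih =>
    simp only [Finset.prod_insert hi]
    exact (h i).mul ih

lemma IsHolFamily.entire {F : E → ℂ → ℂ} (h : IsHolFamily F t₀) {φ : ℂ → ℂ}
    (hφ : Differentiable ℂ φ) : IsHolFamily (fun t z => φ (F t z)) t₀ :=
  ⟨fun r hr => (h.family r hr).entire hφ, by
    filter_upwards [h.differentiableAt] with t h1 z hz
    exact (hφ _).comp z (h1 z hz)⟩

lemma isHolFamily_id : IsHolFamily (fun _ z => z) t₀ := isHolFamily_const fun _ _ => differentiableAt_id

lemma isHolFamily_inv : IsHolFamily (fun _ z => z⁻¹) t₀ :=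
  isHolFamily_const fun _ hz => differentiableAt_inv hz

lemma isHolFamily_qPochInf_mul (hq : ‖q‖ < 1) {a : E → ℂ} (ha : AnalyticAt ℂ a t₀) :
    IsHolFamily (fun t z => qPochInf q (a t * z)) t₀ :=
  ((isHolFamily_param ha).mul isHolFamily_id).entire (differentiable_qPochInf hq)

lemma isHolFamily_qPochInf_div (hq : ‖q‖ < 1) {a : E → ℂ} (ha : AnalyticAt ℂ a t₀) :
    IsHolFamily (fun t z => qPochInf q (a t / z)) t₀ := by
  simp only [div_eq_mul_inv]
  exact ((isHolFamily_param ha).mul isHolFamily_inv).entire (differentiable_qPochInf hq)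

lemma isHolFamily_qTheta (hq : ‖q‖ < 1) {a : E → ℂ} (ha : AnalyticAt ℂ a t₀) (ha0 : a t₀ ≠ 0) :
    IsHolFamily (fun t z => qTheta q (a t * z)) t₀ := by
  have h1 := (isHolFamily_qPochInf_mul hq ha).mul
    (isHolFamily_qPochInf_div hq ((analyticAt_const (v := q)).div ha ha0))
  simp only [qTheta_eq, ← div_div]
  exact h1

/-- `∏_j h_j` lies in the ideal generated by `x` and `∏_j y_j` if each `h_j` lies in the ideal
generated by `x` and `y_j`. -/
lemma exists_bezout_one {β : Type*} (T : Finset β) (x : E → ℂ → ℂ) (y h : β → E → ℂ → ℂ)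
    (hx : IsHolFamily x t₀) (hy : ∀ j, IsHolFamily (y j) t₀)
    (H : ∀ j, ∃ A B : E → ℂ → ℂ, IsHolFamily A t₀ ∧ IsHolFamily B t₀ ∧
      ∀ t z, z ≠ 0 → h j t z = A t z * x t z + B t z * y j t z) :
    ∃ A B : E → ℂ → ℂ, IsHolFamily A t₀ ∧ IsHolFamily B t₀ ∧
      ∀ t z, z ≠ 0 → ∏ j ∈ T, h j t z = A t z * x t z + B t z * ∏ j ∈ T, y j t z := by
  classical
  induction T using Finset.induction_on with
  | empty =>
    exact ⟨fun _ _ => 0, fun _ _ => 1, isHolFamily_const fun _ _ => differentiableAt_const _,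
      isHolFamily_const fun _ _ => differentiableAt_const _, fun t z _ => by simp⟩
  | insert j T hj ih =>
    obtain ⟨A, B, hA, hB, h1⟩ := ih
    obtain ⟨A', B', hA', hB', h2⟩ := H j
    have hyT := IsHolFamily.prod T hy
    refine ⟨fun t z => A' t z * (A t z * x t z + B t z * ∏ j ∈ T, y j t z) + B' t z * y j t z * A t z,
      fun t z => B' t z * B t z, (hA'.mul ((hA.mul hx).add (hB.mul hyT))).add
        ((hB'.mul (hy j)).mul hA), hB'.mul hB, fun t z hz => ?_⟩
    rw [Finset.prod_insert hj, Finset.prod_insert hj, h1 t z hz, h2 t z hz]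
    ring

/-- The one-sided statement is applied twice, with the roles of the two generators exchanged: over T
for each fixed i, and then over S. -/
lemma exists_bezout {α β : Type*} (S : Finset α) (T : Finset β) (x : α → E → ℂ → ℂ)
    (y : β → E → ℂ → ℂ) (h : α → β → E → ℂ → ℂ) (hx : ∀ i, IsHolFamily (x i) t₀)
    (hy : ∀ j, IsHolFamily (y j) t₀)
    (H : ∀ i j, ∃ A B : E → ℂ → ℂ, IsHolFamily A t₀ ∧ IsHolFamily B t₀ ∧
      ∀ t z, z ≠ 0 → h i j t z = A t z * x i t z + B t z * y j t z) :
    ∃ A B : E → ℂ → ℂ, IsHolFamily A t₀ ∧ IsHolFamily B t₀ ∧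
      ∀ t z, z ≠ 0 → ∏ i ∈ S, ∏ j ∈ T, h i j t z =
        A t z * ∏ i ∈ S, x i t z + B t z * ∏ j ∈ T, y j t z := by
  obtain ⟨A, B, hA, hB, h1⟩ := exists_bezout_one S (fun t z => ∏ j ∈ T, y j t z) x
    (fun i t z => ∏ j ∈ T, h i j t z) (IsHolFamily.prod T hy) hx fun i => by
      obtain ⟨A, B, hA, hB, h1⟩ := exists_bezout_one T (x i) y (h i) (hx i) hy (H i)
      exact ⟨B, A, hB, hA, fun t z hz => by rw [h1 t z hz]; ring⟩
  exact ⟨B, A, hB, hA, fun t z hz => by rw [h1 t z hz]; ring⟩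

/-! ### The sequences of poles and their collisions -/

variable {ι κ : Type*}

/-- The union of decreasing sequences. -/
def downSet (q : ℂ) (a : ι → ℂ) : Set ℂ := ⋃ i, downSeq q (a i)

/-- The union of increasing sequences, from the reciprocals. -/
def upSet (q : ℂ) (b : κ → ℂ) : Set ℂ := ⋃ j, upSeq q (b j)⁻¹

lemma mem_downSet {a : ι → ℂ} {z : ℂ} : z ∈ downSet q a ↔ ∃ i, ∃ n : ℕ, z = a i * q ^ n := by
  simp [downSet, downSeq]

lemma mem_upSet {b : κ → ℂ} {z : ℂ} : z ∈ upSet q b ↔ ∃ j, ∃ n : ℕ, z = (b j)⁻¹ * (q ^ n)⁻¹ := by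
  simp [upSet, upSeq]

lemma qPochInf_div_ne_zero (hq : ‖q‖ < 1) {a : ι → ℂ} {z : ℂ} (hz : z ≠ 0)
    (h : z ∉ downSet q a) (i : ι) : qPochInf q (a i / z) ≠ 0 :=
  qPochInf_ne_zero hq fun n hn => h (mem_downSet.2 ⟨i, n, by
    rw [div_mul_eq_mul_div, div_eq_one_iff_eq hz] at hn; exact hn.symm⟩)

lemma qPochInf_mul_ne_zero (hq : ‖q‖ < 1) {b : κ → ℂ} {z : ℂ}
    (h : z ∉ upSet q b) (j : κ) : qPochInf q (b j * z) ≠ 0 :=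
  qPochInf_ne_zero hq fun n hn => h (mem_upSet.2 ⟨j, n, by
    rw [← mul_inv, eq_inv_of_mul_eq_one_right (a := b j * q ^ n) (b := z) (by
      rw [← hn]; ring)]⟩)

lemma disjoint_sets_iff (hq0 : q ≠ 0) {a : ι → ℂ} {b : κ → ℂ} (hb : ∀ j, b j ≠ 0) :
    Disjoint (downSet q a) (upSet q b) ↔ ∀ i j, ∀ n : ℕ, a i * b j * q ^ n ≠ 1 := by
  rw [Set.disjoint_left]
  constructor
  · intro h i j n hn
    refine h (mem_downSet.2 ⟨i, n, rfl⟩) (mem_upSet.2 ⟨j, 0, ?_⟩)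
    rw [pow_zero, inv_one, mul_one]
    exact eq_inv_of_mul_eq_one_left (by rw [← hn]; ring)
  · intro h z hz hz'
    obtain ⟨i, n, rfl⟩ := mem_downSet.1 hz
    obtain ⟨j, m, hm⟩ := mem_upSet.1 hz'
    refine h i j (n + m) ?_
    have hqm : q ^ m ≠ 0 := pow_ne_zero _ hq0
    have := hb j
    rw [pow_add, show a i * b j * (q ^ n * q ^ m) = a i * q ^ n * (b j * q ^ m) by ring, hm]
    field_simp

variable [Fintype ι] [Fintype κ]

lemma isPolarPair_sets (hq0 : q ≠ 0) (hq : ‖q‖ < 1) (a : ι → ℂ) {b : κ → ℂ} (hb : ∀ j, b j ≠ 0) :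
    IsPolarPair (downSet q a) (upSet q b) where
  down_finite ε hε := by
    have hN : ∀ i, ∃ N : ℕ, ∀ n ≥ N, ‖a i * q ^ n‖ < ε := fun i =>
      eventually_atTop.1 (((tendsto_mul_pow_zero hq (a i)).norm).eventually
        (gt_mem_nhds (by simpa using hε)))
    choose N hN using hN
    refine (Set.finite_iUnion fun i => (Finset.range (N i)).finite_toSet.image
      fun n => a i * q ^ n).subset fun z hz => ?_
    obtain ⟨i, n, rfl⟩ := mem_downSet.1 hz.1
    refine mem_iUnion.2 ⟨i, n, ?_, rfl⟩
    by_contra h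
    have := hN i n (by simpa using h)
    exact absurd hz.2 (not_le.2 this)
  up_finite M := by
    have hN : ∀ j, ∃ N : ℕ, ∀ n ≥ N, ‖b j * q ^ n‖ < (|M| + 1)⁻¹ := fun i =>
      eventually_atTop.1 (((tendsto_mul_pow_zero hq (b i)).norm).eventually
        (gt_mem_nhds (by simp; positivity)))
    choose N hN using hN
    refine (Set.finite_iUnion fun i => (Finset.range (N i)).finite_toSet.image
      fun n => (b i)⁻¹ * (q ^ n)⁻¹).subset fun z hz => ?_
    obtain ⟨i, n, rfl⟩ := mem_upSet.1 hz.1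
    refine mem_iUnion.2 ⟨i, n, ?_, rfl⟩
    by_contra h
    have h1 := hN i n (by simpa using h)
    have h2 : ‖(b i)⁻¹ * (q ^ n)⁻¹‖ ≤ M := hz.2
    rw [← mul_inv, norm_inv] at h2
    have hpos : 0 < ‖b i * q ^ n‖ := norm_pos_iff.2 (mul_ne_zero (hb i) (pow_ne_zero _ hq0))
    have h3 := inv_strictAnti₀ hpos h1
    rw [inv_inv] at h3
    linarith [le_abs_self M]

/-- A function vanishing where the sequences collide. -/
def collision (q : ℂ) (N : ℕ) (a : ι → ℂ) (b : κ → ℂ) : ℂ :=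
  ∏ i ∈ Finset.univ ×ˢ Finset.range N, ∏ j ∈ Finset.univ ×ˢ Finset.range N,
    (1 - (a i.1 * q ^ i.2) * (b j.1 * q ^ j.2))

lemma collision_ne_zero {a : ι → ℂ} {b : κ → ℂ} (h : ∀ i j, ∀ n : ℕ, a i * b j * q ^ n ≠ 1)
    (N : ℕ) : collision q N a b ≠ 0 := by
  refine Finset.prod_ne_zero_iff.2 fun i _ => Finset.prod_ne_zero_iff.2 fun j _ h0 => ?_
  refine h i.1 j.1 (i.2 + j.2) ?_
  rw [pow_add]
  linear_combination -h0

lemma analyticAt_collision {a : ι → E → ℂ} {b : κ → E → ℂ} (ha : ∀ i, AnalyticAt ℂ (a i) t₀)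
    (hb : ∀ j, AnalyticAt ℂ (b j) t₀) (N : ℕ) :
    AnalyticAt ℂ (fun t => collision q N (fun i => a i t) fun j => b j t) t₀ := by
  unfold collision
  refine Finset.analyticAt_fun_prod _ fun i _ => Finset.analyticAt_fun_prod _ fun j _ => ?_
  exact analyticAt_const.sub (((ha _).mul analyticAt_const).mul ((hb _).mul analyticAt_const))

end Continuation

/-! ### Splitting of contour integrals and their dependence on the parameters -/

section Master

open Set
open Real (circleAverage)
open Metric (sphere ball closedBall)

variable {q : ℂ} {E : Type*} [NormedAddCommGroup E] [NormedSpace ℂ E] {t₀ : E}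
  {ι κ : Type*} [Fintype ι] [Fintype κ]

/-- An integrand with poles at finitely many decreasing and increasing sequences. -/
def polarIntegrand (q : ℂ) (a : ι → ℂ) (b : κ → ℂ) (g : ℂ → ℂ) (z : ℂ) : ℂ :=
  g z / ((∏ i, qPochInf q (a i / z)) * ∏ j, qPochInf q (b j * z))

lemma prod_qPochInf_split (hq : ‖q‖ < 1) (N : ℕ) (c : ι → ℂ) :
    ∏ i, qPochInf q (c i) = (∏ p ∈ Finset.univ ×ˢ Finset.range N, (1 - c p.1 * q ^ p.2)) *
      ∏ i, qPochInf q (c i * q ^ N) := by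
  rw [Finset.prod_product, ← Finset.prod_mul_distrib]
  exact Finset.prod_congr rfl fun i _ => qPochInf_split hq _ _

/-- Partial fractions without division: X and Y are the finite initial parts of the two products, Ta
and Tb their tails. The Bezout relation h = AX + BY removes Y from the denominator of one summand
and X from that of the other. -/
lemma splitting_identity {X Y Ta Tb g A B h : ℂ} (hX : X ≠ 0) (hY : Y ≠ 0) (hTa : Ta ≠ 0)
    (hTb : Tb ≠ 0) (hh : h ≠ 0) (H : h = A * X + B * Y) :
    g / (X * Ta * (Y * Tb)) = h⁻¹ * (g * B * (X * Ta * Tb)⁻¹) + h⁻¹ * (g * A * (Y * Tb * Ta)⁻¹) := by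
  field_simp
  rw [H]
  ring

/-- Contour integrals are locally quotients of analytic functions of the parameters. -/
theorem exists_sepValue (hq0 : q ≠ 0) (hq : ‖q‖ < 1) {a : ι → E → ℂ} {b : κ → E → ℂ}
    {g : E → ℂ → ℂ} (ha : ∀ i, AnalyticAt ℂ (a i) t₀) (hb : ∀ j, AnalyticAt ℂ (b j) t₀)
    (hb0 : ∀ j, b j t₀ ≠ 0) (hg : IsHolFamily g t₀) :
    ∃ (N : ℕ) (Φ : E → ℂ), AnalyticAt ℂ Φ t₀ ∧ ∀ᶠ t in 𝓝 t₀,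
      collision q N (fun i => a i t) (fun j => b j t) ≠ 0 →
        (∀ i j, ∀ n : ℕ, a i t * b j t * q ^ n ≠ 1) ∧
        SepValue (polarIntegrand q (fun i => a i t) (fun j => b j t) (g t))
          (downSet q fun i => a i t) (upSet q fun j => b j t)
          (Φ t / collision q N (fun i => a i t) fun j => b j t) := by
  -- At t₀ all decreasing sequences lie inside the circle of radius R and, with the choice of r
  -- below, all increasing ones outside the circle of radius r. The requirement r < 1 < R makes any
  -- two such pairs of circles comparable, as used for uniqueness of the value.
  obtain ⟨R, hR1, hR⟩ : ∃ R : ℝ, 1 < R ∧ ∀ i, ‖a i t₀‖ < R := by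
    refine ⟨∑ i, ‖a i t₀‖ + 2, by have : 0 ≤ ∑ i, ‖a i t₀‖ := by positivity
                                  linarith, fun i => ?_⟩
    have := Finset.single_le_sum (f := fun i => ‖a i t₀‖) (fun _ _ => norm_nonneg _) (Finset.mem_univ i)
    linarith
  obtain ⟨r, hr0, hr1, hr⟩ : ∃ r : ℝ, 0 < r ∧ r < 1 ∧ ∀ j, ‖b j t₀‖ * r < 1 := by
    have hs : 0 ≤ ∑ j, ‖b j t₀‖ := by positivity
    refine ⟨(∑ j, ‖b j t₀‖ + 2)⁻¹, by positivity, inv_lt_one_of_one_lt₀ (by linarith), fun j => ?_⟩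
    have := Finset.single_le_sum (f := fun i => ‖b i t₀‖) (fun _ _ => norm_nonneg _) (Finset.mem_univ j)
    rw [← div_eq_mul_inv, div_lt_one (by positivity)]
    linarith
  have hR0 : 0 < R := by linarith
  -- From the N-th term on, the decreasing sequences are inside the small circle and the increasing
  -- ones outside the large circle, so only the first N terms of each need to be separated.
  obtain ⟨N, hNa, hNb⟩ : ∃ N : ℕ, (∀ i, ‖a i t₀ * q ^ N‖ < r) ∧ ∀ j, ‖b j t₀ * q ^ N‖ * R < 1 := by
    have h1 : ∀ᶠ N : ℕ in atTop, ∀ i, ‖a i t₀ * q ^ N‖ < r := by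
      rw [eventually_all]
      exact fun i => ((tendsto_mul_pow_zero hq (a i t₀)).norm).eventually
        (gt_mem_nhds (by simpa using hr0))
    have h2 : ∀ᶠ N : ℕ in atTop, ∀ j, ‖b j t₀ * q ^ N‖ * R < 1 := by
      rw [eventually_all]
      exact fun j => (((tendsto_mul_pow_zero hq (b j t₀)).norm).mul_const R).eventually
        (gt_mem_nhds (by simp))
    exact (h1.and h2).exists
  -- The elementary relation, with α = a q^n and β = b q^m, is 1 - αβ = βz (1 - α/z) + (1 - βz). The
  -- product of the left-hand sides over all pairs of indices is `collision`.
  obtain ⟨A, B, hA, hB, hAB⟩ := exists_bezout (t₀ := t₀) (Finset.univ ×ˢ Finset.range N)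
    (Finset.univ ×ˢ Finset.range N)
    (fun (p : ι × ℕ) t z => 1 - a p.1 t / z * q ^ p.2)
    (fun (p : κ × ℕ) t z => 1 - b p.1 t * z * q ^ p.2)
    (fun p p' t _ => 1 - (a p.1 t * q ^ p.2) * (b p'.1 t * q ^ p'.2))
    (fun p => by
      have := (isHolFamily_const (t₀ := t₀) (f := fun _ => 1) fun _ _ => differentiableAt_const _).add
        (((isHolFamily_param (ha p.1)).mul isHolFamily_inv).mul
        (isHolFamily_const (f := fun _ => -q ^ p.2) fun _ _ => differentiableAt_const _))
      refine cast (congrArg (fun F => IsHolFamily F t₀) ?_) this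
      funext t z
      ring)
    (fun p => by
      have := (isHolFamily_const (t₀ := t₀) (f := fun _ => 1) fun _ _ => differentiableAt_const _).add
        (((isHolFamily_param (hb p.1)).mul isHolFamily_id).mul
        (isHolFamily_const (f := fun _ => -q ^ p.2) fun _ _ => differentiableAt_const _))
      refine cast (congrArg (fun F => IsHolFamily F t₀) ?_) this
      funext t z
      ring)
    (fun p p' => ⟨fun t z => b p'.1 t * (z * q ^ p'.2), fun _ _ => 1,
      (isHolFamily_param (hb p'.1)).mul (isHolFamily_id.mul
        (isHolFamily_const (f := fun _ => q ^ p'.2) fun _ _ => differentiableAt_const _)),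
      isHolFamily_const fun _ _ => differentiableAt_const _, fun t z hz => by field_simp; ring⟩)
  have hcol : ∀ t z, z ≠ 0 → collision q N (fun i => a i t) (fun j => b j t) =
      A t z * ∏ p ∈ Finset.univ ×ˢ Finset.range N, (1 - a p.1 t / z * q ^ p.2) +
      B t z * ∏ p ∈ Finset.univ ×ˢ Finset.range N, (1 - b p.1 t * z * q ^ p.2) := hAB
  set DA : E → ℂ → ℂ := fun t z => (∏ i, qPochInf q (a i t / z)) *
    ∏ j, qPochInf q (b j t * q ^ N * z) with hDA
  set DB : E → ℂ → ℂ := fun t z => (∏ j, qPochInf q (b j t * z)) *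
    ∏ i, qPochInf q (a i t * q ^ N / z) with hDB
  have hDAf : IsHolFamily DA t₀ :=
    (IsHolFamily.prod _ fun i => isHolFamily_qPochInf_div hq (ha i)).mul
      (IsHolFamily.prod _ fun j => isHolFamily_qPochInf_mul hq ((hb j).mul analyticAt_const))
  have hDBf : IsHolFamily DB t₀ :=
    (IsHolFamily.prod _ fun j => isHolFamily_qPochInf_mul hq (hb j)).mul
      (IsHolFamily.prod _ fun i => isHolFamily_qPochInf_div hq ((ha i).mul analyticAt_const))
  set FA : E → ℂ → ℂ := fun t z => g t z * B t z * (DA t z)⁻¹ with hFA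
  set FB : E → ℂ → ℂ := fun t z => g t z * A t z * (DB t z)⁻¹ with hFB
  have hn := fun {a} => qPochInf_ne_zero_of_norm_lt_one hq (a := a)
  have hDA0 : ∀ z, ‖z‖ = R → DA t₀ z ≠ 0 := fun z hz => mul_ne_zero
    (Finset.prod_ne_zero_iff.2 fun i _ => hn (norm_div_lt_one_of (hR i) hz.ge))
    (Finset.prod_ne_zero_iff.2 fun j _ => hn (norm_mul_lt_one_of (hNb j) hz.le))
  have hDB0 : ∀ z, ‖z‖ = r → DB t₀ z ≠ 0 := fun z hz => mul_ne_zero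
    (Finset.prod_ne_zero_iff.2 fun j _ => hn (norm_mul_lt_one_of (hr j) hz.le))
    (Finset.prod_ne_zero_iff.2 fun i _ => hn (norm_div_lt_one_of (hNa i) hz.ge))
  have hΦA : AnalyticAt ℂ (fun t => circleAverage (FA t) 0 R) t₀ :=
    AnalyticFamily.circleAverage hR0
      (((hg.mul hB).family R hR0).mul ((hDAf.family R hR0).inv hDA0))
  have hΦB : AnalyticAt ℂ (fun t => circleAverage (FB t) 0 r) t₀ :=
    AnalyticFamily.circleAverage hr0
      (((hg.mul hA).family r hr0).mul ((hDBf.family r hr0).inv hDB0))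
  refine ⟨N, _, hΦA.add hΦB, ?_⟩
  have ea : ∀ᶠ t in 𝓝 t₀, ∀ i, ‖a i t‖ < R := by
    rw [eventually_all]
    exact fun i => (ha i).continuousAt.norm.eventually (gt_mem_nhds (hR i))
  have eb : ∀ᶠ t in 𝓝 t₀, ∀ j, ‖b j t‖ * r < 1 := by
    rw [eventually_all]
    exact fun j => ((hb j).continuousAt.norm.mul_const r).eventually (gt_mem_nhds (hr j))
  have ea' : ∀ᶠ t in 𝓝 t₀, ∀ i, ‖a i t * q ^ N‖ < r := by
    rw [eventually_all]
    exact fun i => (((ha i).continuousAt.mul_const _).norm).eventually (gt_mem_nhds (hNa i))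
  have eb' : ∀ᶠ t in 𝓝 t₀, ∀ j, ‖b j t * q ^ N‖ * R < 1 := by
    rw [eventually_all]
    exact fun j => ((((hb j).continuousAt.mul_const _).norm).mul_const R).eventually
      (gt_mem_nhds (hNb j))
  have eb0 : ∀ᶠ t in 𝓝 t₀, ∀ j, b j t ≠ 0 := by
    rw [eventually_all]
    exact fun j => (hb j).continuousAt.eventually_ne (hb0 j)
  filter_upwards [ea, eb, ea', eb', eb0, hDAf.differentiableAt, hDBf.differentiableAt,
    hg.differentiableAt, hA.differentiableAt, hB.differentiableAt]
    with t ha1 hb1 ha2 hb2 hb3 dDA dDB dg dA dB hne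
  refine ⟨?_, ?_⟩
  -- The product only excludes collisions with n < N. For n ≥ N they are excluded by size, since ‖a
  -- q^n‖ < r and ‖b‖ r < 1.
  · intro i j n hn1
    by_cases hnN : n < N
    · refine hne ?_
      have hi : ((i, n) : ι × ℕ) ∈ (Finset.univ : Finset ι) ×ˢ Finset.range N := by simpa using hnN
      have hj : ((j, 0) : κ × ℕ) ∈ (Finset.univ : Finset κ) ×ˢ Finset.range N := by simp; omega
      refine Finset.prod_eq_zero hi (Finset.prod_eq_zero hj ?_)
      simp only [pow_zero, mul_one]
      linear_combination -hn1
    · obtain ⟨m, rfl⟩ := Nat.exists_eq_add_of_le (not_lt.1 hnN)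
      have h1 : ‖a i t * q ^ N * q ^ m‖ < r := (norm_mul_pow_le hq _ _).trans_lt (ha2 i)
      have h2 : a i t * b j t * q ^ (N + m) = (a i t * q ^ N * q ^ m) * b j t := by ring
      rw [h2] at hn1
      have h3 : ‖(a i t * q ^ N * q ^ m) * b j t‖ = 1 := by rw [hn1, norm_one]
      rw [norm_mul] at h3
      nlinarith [hb1 j, norm_nonneg (b j t), norm_nonneg (a i t * q ^ N * q ^ m)]
  have hXd : ∀ z, z ≠ 0 → z ∉ (downSet q fun i => a i t) → ∏ i, qPochInf q (a i t / z) ≠ 0 :=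
    fun z hz0 hz => Finset.prod_ne_zero_iff.2 fun i _ => qPochInf_div_ne_zero hq hz0 hz i
  have hYu : ∀ z, z ∉ (upSet q fun j => b j t) → ∏ j, qPochInf q (b j t * z) ≠ 0 :=
    fun z hz => Finset.prod_ne_zero_iff.2 fun j _ => qPochInf_mul_ne_zero hq hz j
  have hTb : ∀ z, (z ∈ (upSet q fun j => b j t) → ‖z‖ ≤ R) →
      ∏ j, qPochInf q (b j t * q ^ N * z) ≠ 0 := by
    intro z hz
    refine Finset.prod_ne_zero_iff.2 fun j _ => qPochInf_ne_zero hq fun n hn1 => ?_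
    have hzup : z ∈ upSet q fun j => b j t := mem_upSet.2 ⟨j, N + n, by
      rw [← mul_inv, eq_inv_of_mul_eq_one_right (a := b j t * q ^ (N + n)) (b := z) (by
        rw [← hn1]; ring)]⟩
    have h1 := norm_mul_pow_lt_one hq (norm_mul_lt_one_of (hb2 j) (hz hzup)) n
    rw [hn1, norm_one] at h1
    exact lt_irrefl _ h1
  have hTa : ∀ z, z ≠ 0 → (z ∈ (downSet q fun i => a i t) → r ≤ ‖z‖) →
      ∏ i, qPochInf q (a i t * q ^ N / z) ≠ 0 := by
    intro z hz0 hz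
    refine Finset.prod_ne_zero_iff.2 fun i _ => qPochInf_ne_zero hq fun n hn1 => ?_
    have hzd : z ∈ downSet q fun i => a i t := mem_downSet.2 ⟨i, N + n, by
      rw [div_mul_eq_mul_div, div_eq_one_iff_eq hz0] at hn1
      rw [← hn1]; ring⟩
    have h1 := norm_mul_pow_lt_one hq (norm_div_lt_one_of (ha2 i) (hz hzd)) n
    rw [hn1, norm_one] at h1
    exact lt_irrefl _ h1
  set h := collision q N (fun i => a i t) (fun j => b j t) with hh
  refine ⟨fun z => h⁻¹ * FA t z, fun z => h⁻¹ * FB t z, r, R, ⟨hr0, hr1, hR1⟩, ?_, ?_, ?_, ?_, ?_, ?_⟩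
  · rintro d hd
    obtain ⟨i, n, rfl⟩ := mem_downSet.1 hd
    exact (norm_mul_pow_le hq _ _).trans_lt (ha1 i)
  · rintro u hu
    obtain ⟨j, n, rfl⟩ := mem_upSet.1 hu
    have hpos : 0 < ‖b j t * q ^ n‖ := norm_pos_iff.2 (mul_ne_zero (hb3 j) (pow_ne_zero _ hq0))
    rw [← mul_inv, norm_inv, ← one_div, lt_div_iff₀ hpos]
    have := norm_mul_pow_le hq (b j t) n
    have h2 := hb1 j
    nlinarith
  · intro z hz0 hzd hzu
    have hc := hcol t z hz0
    have e1 : ∏ i, qPochInf q (a i t / z) = (∏ p ∈ Finset.univ ×ˢ Finset.range N,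
        (1 - a p.1 t / z * q ^ p.2)) * ∏ i, qPochInf q (a i t * q ^ N / z) := by
      rw [prod_qPochInf_split hq N fun i => a i t / z]
      simp only [div_mul_eq_mul_div]
    have e2 : ∏ j, qPochInf q (b j t * z) = (∏ p ∈ Finset.univ ×ˢ Finset.range N,
        (1 - b p.1 t * z * q ^ p.2)) * ∏ j, qPochInf q (b j t * q ^ N * z) := by
      rw [prod_qPochInf_split hq N fun j => b j t * z]
      simp only [mul_right_comm]
    have n1 := hXd z hz0 hzd
    have n2 := hYu z hzu
    have n3 := hTa z hz0 fun h => absurd h hzd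
    have n4 := hTb z fun h => absurd h hzu
    simp only [polarIntegrand, hFA, hFB, hDA, hDB]
    rw [e1] at n1 ⊢
    rw [e2] at n2 ⊢
    exact splitting_identity (left_ne_zero_of_mul n1) (left_ne_zero_of_mul n2) n3 n4 hne hc
  · intro z hz0 hzd hzu
    exact (differentiableAt_const _).mul (((dg z hz0).mul (dB z hz0)).mul
      ((dDA z hz0).inv (mul_ne_zero (hXd z hz0 hzd) (hTb z hzu))))
  · intro z hz0 hzu hzd
    exact (differentiableAt_const _).mul (((dg z hz0).mul (dA z hz0)).mul
      ((dDB z hz0).inv (mul_ne_zero (hYu z hzu) (hTa z hz0 hzd))))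
  · rw [circleAverage_const_mul, circleAverage_const_mul]
    simp only [Pi.add_apply]
    ring

end Master

/-! ### The identity theorem for meromorphic functions of several variables -/

section LineMeromorphic

open Metric

variable {E F : Type*} [NormedAddCommGroup E] [NormedSpace ℂ E] [NormedAddCommGroup F]
  [NormedSpace ℂ F] {U C : Set F} {f g f₁ f₂ g₁ g₂ h₁ h₂ : F → ℂ}

/-- `g` is holomorphic on the intersection of `U` with each complex line. -/
def LineHol (g : F → ℂ) (U : Set F) : Prop :=
  ∀ p v : F, DifferentiableOn ℂ (fun s : ℂ => g (p + s • v)) {s | p + s • v ∈ U}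

lemma LineHol.of_analyticAt (h : ∀ y ∈ U, AnalyticAt ℂ g y) : LineHol g U := fun p v s hs => by
  have h1 : DifferentiableAt ℂ (fun s : ℂ => p + s • v) s := by fun_prop
  exact ((h _ hs).differentiableAt.comp s h1).differentiableWithinAt

lemma LineHol.mul (h₁ : LineHol g₁ U) (h₂ : LineHol g₂ U) : LineHol (fun y => g₁ y * g₂ y) U :=
  fun p v => (h₁ p v).mul (h₂ p v)

lemma LineHol.sub (h₁ : LineHol g₁ U) (h₂ : LineHol g₂ U) : LineHol (fun y => g₁ y - g₂ y) U :=
  fun p v => (h₁ p v).sub (h₂ p v)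

lemma LineHol.mono {V : Set F} (h : LineHol g U) (hV : V ⊆ U) : LineHol g V :=
  fun p v => (h p v).mono fun _ hs => hV hs

/-- The complex line through p and y meets the convex set U in a convex, hence connected, set, and
the one-variable identity theorem applies on it. Holomorphy on lines is therefore enough for
everything below. -/
lemma LineHol.eq_zero (h : LineHol g U) (hU : IsOpen U) (hc : Convex ℝ U) {p : F} (hp : p ∈ U)
    (h0 : ∀ᶠ y in 𝓝 p, g y = 0) {y : F} (hy : y ∈ U) : g y = 0 := by
  have hcont : Continuous fun s : ℂ => p + s • (y - p) := by fun_prop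
  have hopen : IsOpen {s : ℂ | p + s • (y - p) ∈ U} := hU.preimage hcont
  have hpre : IsPreconnected {s : ℂ | p + s • (y - p) ∈ U} := by
    refine Convex.isPreconnected fun s hs s' hs' a b ha hb hab => ?_
    have := hc hs hs' ha hb hab
    have e : a • (p + s • (y - p)) + b • (p + s' • (y - p)) =
        p + (a • s + b • s') • (y - p) := by
      have : p = a • p + b • p := by rw [← add_smul, hab, one_smul]
      rw [add_smul, smul_add, smul_add, smul_assoc, smul_assoc]
      nth_rewrite 5 [this]
      abel
    rwa [e] at this
  have han := (h p (y - p)).analyticOnNhd hopen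
  have hz : ∀ᶠ s : ℂ in 𝓝 0, g (p + s • (y - p)) = 0 := by
    have ht : Tendsto (fun s : ℂ => p + s • (y - p)) (𝓝 0) (𝓝 p) := by
      simpa using hcont.tendsto 0
    exact ht.eventually h0
  have := han.eqOn_zero_of_preconnected_of_eventuallyEq_zero hpre (z₀ := 0) (by simpa using hp) hz
    (show (1 : ℂ) ∈ _ by simpa using hy)
  simpa using this

/-- If the product vanished near y, then h₂ would vanish on an open set where h₁ ≠ 0, hence on all
of U. -/
lemma frequently_mul_ne_zero {y : F} (hU : IsOpen U) (hc : Convex ℝ U) (hy : y ∈ U)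
    (hh₂ : LineHol h₂ U) (hh₁ : ∀ y ∈ U, ContinuousAt h₁ y)
    (n₁ : ∃ᶠ z in 𝓝 y, h₁ z ≠ 0) (n₂ : ∃ᶠ z in 𝓝 y, h₂ z ≠ 0) :
    ∃ᶠ z in 𝓝 y, h₁ z * h₂ z ≠ 0 := by
  intro hz
  simp only [not_not] at hz
  obtain ⟨p, hp1, hp2, hpU⟩ := (n₁.and_eventually
    (hz.eventually_nhds.and (hU.mem_nhds hy))).exists
  have hp3 : ∀ᶠ z in 𝓝 p, h₂ z = 0 := by
    filter_upwards [hp2, (hh₁ p hpU).eventually_ne hp1] with z hz1 hz2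
    exact (mul_eq_zero.1 hz1).resolve_left hz2
  refine n₂ ?_
  filter_upwards [hU.mem_nhds hy] with z hz
  exact not_not.2 (hh₂.eq_zero hU hc hpU hp3 hz)

/-- Locally a quotient `g / h` with `g` holomorphic on complex lines and `h` analytic. -/
def IsLineMero (f : F → ℂ) (C : Set F) : Prop :=
  ∀ y ∈ C, ∃ (g h : F → ℂ) (ε : ℝ), 0 < ε ∧ LineHol g (ball y ε) ∧
    (∀ z ∈ ball y ε, AnalyticAt ℂ h z) ∧ (∃ᶠ z in 𝓝 y, h z ≠ 0) ∧
    ∀ z ∈ ball y ε, h z ≠ 0 → f z = g z / h z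

lemma IsMeromorphicOnSet.isLineMero (hC : IsOpen C) (h : IsMeromorphicOnSet f C) :
    IsLineMero f C := by
  intro y hy
  obtain ⟨g, h, hg, hh, hn, he⟩ := h y hy
  rw [hC.nhdsWithin_eq hy] at hn he
  obtain ⟨ε, hε, hb⟩ := Metric.eventually_nhds_iff_ball.1
    ((hg.eventually_analyticAt.and hh.eventually_analyticAt).and he)
  exact ⟨g, h, ε, hε, .of_analyticAt fun z hz => (hb z hz).1.1, fun z hz => (hb z hz).1.2, hn,
    fun z hz => (hb z hz).2⟩

lemma IsLineMero.mul (hf₁ : IsLineMero f₁ C) (hf₂ : IsLineMero f₂ C) :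
    IsLineMero (fun y => f₁ y * f₂ y) C := by
  intro y hy
  obtain ⟨g₁, h₁, ε₁, hε₁, hg₁, hh₁, n₁, e₁⟩ := hf₁ y hy
  obtain ⟨g₂, h₂, ε₂, hε₂, hg₂, hh₂, n₂, e₂⟩ := hf₂ y hy
  have m₁ := ball_subset_ball (x := y) (min_le_left ε₁ ε₂)
  have m₂ := ball_subset_ball (x := y) (min_le_right ε₁ ε₂)
  have hε := lt_min hε₁ hε₂
  refine ⟨_, fun y => h₁ y * h₂ y, min ε₁ ε₂, hε, (hg₁.mono m₁).mul (hg₂.mono m₂),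
    fun z hz => (hh₁ z (m₁ hz)).mul (hh₂ z (m₂ hz)), ?_, fun z hz hn => ?_⟩
  · exact frequently_mul_ne_zero isOpen_ball (convex_ball y _) (mem_ball_self hε)
      (.of_analyticAt fun z hz => hh₂ z (m₂ hz)) (fun z hz => (hh₁ z (m₁ hz)).continuousAt) n₁ n₂
  · change f₁ z * f₂ z = g₁ z * g₂ z / (h₁ z * h₂ z)
    rw [e₁ z (m₁ hz) (left_ne_zero_of_mul hn), e₂ z (m₂ hz) (right_ne_zero_of_mul hn), div_mul_div_comm]

/-- The cross-multiplied difference g₁h₂ - g₂h₁ vanishes on an open subset of the ball, hence on the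
whole ball, so the two quotients agree wherever both denominators are nonzero. -/
lemma IsLineMero.exists_local (hf₁ : IsLineMero f₁ C) (hf₂ : IsLineMero f₂ C) {y : F} (hy : y ∈ C)
    (hcl : y ∈ closure (interior {z | f₁ z = f₂ z})) :
    ∃ (h : F → ℂ) (ε : ℝ), 0 < ε ∧ (∀ z ∈ ball y ε, AnalyticAt ℂ h z) ∧ (∃ᶠ z in 𝓝 y, h z ≠ 0) ∧
      ∀ z ∈ ball y ε, h z ≠ 0 → f₁ z = f₂ z := by
  obtain ⟨g₁, h₁, ε₁, hε₁, hg₁, hh₁, n₁, e₁⟩ := hf₁ y hy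
  obtain ⟨g₂, h₂, ε₂, hε₂, hg₂, hh₂, n₂, e₂⟩ := hf₂ y hy
  have m₁ := ball_subset_ball (x := y) (min_le_left ε₁ ε₂)
  have m₂ := ball_subset_ball (x := y) (min_le_right ε₁ ε₂)
  have hε := lt_min hε₁ hε₂
  set B := ball y (min ε₁ ε₂)
  have hB : IsOpen B := isOpen_ball
  have hBc : Convex ℝ B := convex_ball y _
  have hyB : y ∈ B := mem_ball_self hε
  have lh₁ : LineHol h₁ B := .of_analyticAt fun z hz => hh₁ z (m₁ hz)
  have lh₂ : LineHol h₂ B := .of_analyticAt fun z hz => hh₂ z (m₂ hz)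
  have hn : ∃ᶠ z in 𝓝 y, h₁ z * h₂ z ≠ 0 := frequently_mul_ne_zero hB hBc hyB lh₂
    (fun z hz => (hh₁ z (m₁ hz)).continuousAt) n₁ n₂
  have hHan : ∀ z ∈ B, AnalyticAt ℂ (fun z => h₁ z * h₂ z) z :=
    fun z hz => (hh₁ z (m₁ hz)).mul (hh₂ z (m₂ hz))
  refine ⟨fun z => h₁ z * h₂ z, min ε₁ ε₂, hε, hHan, hn, ?_⟩
  have hD : LineHol (fun z => g₁ z * h₂ z - g₂ z * h₁ z) B :=
    ((hg₁.mono m₁).mul lh₂).sub ((hg₂.mono m₂).mul lh₁)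
  obtain ⟨p, hpB, hpS⟩ := mem_closure_iff.1 hcl B hB hyB
  have hpn : ∃ᶠ z in 𝓝 p, h₁ z * h₂ z ≠ 0 := by
    intro hz
    refine hn ?_
    filter_upwards [hB.mem_nhds hyB] with z hzB
    exact not_not.2 ((lh₁.mul lh₂).eq_zero hB hBc hpB (hz.mono fun _ => not_not.1) hzB)
  obtain ⟨p', hp'n, hp'S, hp'B⟩ := (hpn.and_eventually
    ((isOpen_interior.eventually_mem hpS).and (hB.eventually_mem hpB))).exists
  have hzero : ∀ᶠ z in 𝓝 p', g₁ z * h₂ z - g₂ z * h₁ z = 0 := by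
    filter_upwards [isOpen_interior.mem_nhds hp'S, hB.mem_nhds hp'B,
      (hHan p' hp'B).continuousAt.eventually_ne hp'n] with z hzS hzB hzn
    have h1 : z ∈ {z | f₁ z = f₂ z} := interior_subset hzS
    replace h1 : f₁ z = f₂ z := h1
    rw [e₁ z (m₁ hzB) (left_ne_zero_of_mul hzn), e₂ z (m₂ hzB) (right_ne_zero_of_mul hzn),
      div_eq_div_iff (left_ne_zero_of_mul hzn) (right_ne_zero_of_mul hzn)] at h1
    rw [h1, sub_self]
  intro z hzB hzn
  have h1 := hD.eq_zero hB hBc hp'B hzero hzB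
  rw [e₁ z (m₁ hzB) (left_ne_zero_of_mul hzn), e₂ z (m₂ hzB) (right_ne_zero_of_mul hzn),
      div_eq_div_iff (left_ne_zero_of_mul hzn) (right_ne_zero_of_mul hzn)]
  exact sub_eq_zero.1 h1

/-- The interior of the closure of the open locus of agreement is open, and by `exists_local` it is
also closed relative to C; connectedness of C does the rest. -/
lemma IsLineMero.subset_closure (hf₁ : IsLineMero f₁ C) (hf₂ : IsLineMero f₂ C)
    (hC : IsPreconnected C) {y₀ : F} (hy₀ : y₀ ∈ C) (h : ∀ᶠ y in 𝓝 y₀, f₁ y = f₂ y) :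
    C ⊆ closure (interior {z | f₁ z = f₂ z}) := by
  have hy₀' : y₀ ∈ interior {z | f₁ z = f₂ z} := mem_interior_iff_mem_nhds.2 h
  refine (hC.subset_of_closure_inter_subset
    (u := interior (closure (interior {z | f₁ z = f₂ z}))) isOpen_interior
    ⟨y₀, hy₀, ?_⟩ ?_).trans interior_subset
  · exact interior_maximal _root_.subset_closure isOpen_interior hy₀'
  · rintro y ⟨hycl, hy⟩
    have hycl' : y ∈ closure (interior {z | f₁ z = f₂ z}) :=
      closure_minimal interior_subset isClosed_closure hycl
    obtain ⟨H, ε, hε, hH, hn, he⟩ := hf₁.exists_local hf₂ hy hycl'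
    refine mem_interior.2 ⟨ball y ε, fun z hz => ?_, isOpen_ball, mem_ball_self hε⟩
    by_contra hzc
    refine hn ?_
    have hzero : ∀ᶠ w in 𝓝 z, H w = 0 := by
      filter_upwards [isClosed_closure.isOpen_compl.mem_nhds hzc, isOpen_ball.mem_nhds hz]
        with w hw hwB
      by_contra hHw
      refine hw (_root_.subset_closure (mem_interior_iff_mem_nhds.2 ?_))
      filter_upwards [isOpen_ball.mem_nhds hwB, (hH w hwB).continuousAt.eventually_ne hHw]
        with w' h1 h2 using he w' h1 h2
    filter_upwards [isOpen_ball.mem_nhds (mem_ball_self hε)] with w hw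
    exact not_not.2 ((LineHol.of_analyticAt hH).eq_zero isOpen_ball (convex_ball y ε) hz hzero hw)

/-- Meromorphic functions which agree on an open set agree generically. -/
theorem IsLineMero.genericallyOn_eq (hf₁ : IsLineMero f₁ C) (hf₂ : IsLineMero f₂ C)
    (hC : IsPreconnected C) (hCo : IsOpen C) {y₀ : F} (hy₀ : y₀ ∈ C)
    (h : ∀ᶠ y in 𝓝 y₀, f₁ y = f₂ y) : GenericallyOn C fun y => f₁ y = f₂ y := by
  intro y hy
  obtain ⟨H, ε, hε, hH, hn, he⟩ := hf₁.exists_local hf₂ hy (hf₁.subset_closure hf₂ hC hy₀ h hy)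
  refine ⟨H, hH y (mem_ball_self hε), ?_, ?_⟩ <;> rw [hCo.nhdsWithin_eq hy]
  · exact hn
  · filter_upwards [ball_mem_nhds y hε] with z hz using he z hz

lemma frequently_ne_zero_of_preconnected {h : F → ℂ} (hC : IsPreconnected C)
    (hh : AnalyticOnNhd ℂ h C) {y₀ : F} (hy₀ : y₀ ∈ C) (hn : h y₀ ≠ 0) {y : F} (hy : y ∈ C) :
    ∃ᶠ z in 𝓝 y, h z ≠ 0 := fun hz =>
  hn (hh.eqOn_zero_of_preconnected_of_eventuallyEq_zero hC hy (hz.mono fun _ => not_not.1) hy₀)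

/-! ### Charts -/

/-- `Ψ` is an analytic map from `C` to `X` which is open for the topology of `X`. -/
structure IsOpenChart (Ψ : F → E) (C : Set F) (X : Set E) : Prop where
  analyticAt : ∀ y ∈ C, AnalyticAt ℂ Ψ y
  mapsTo : ∀ y ∈ C, Ψ y ∈ X
  le_map : ∀ y ∈ C, 𝓝[X] (Ψ y) ≤ map Ψ (𝓝 y)

lemma le_map_of_section {α β : Type*} {l : Filter β} {l' : Filter α} {Ψ : α → β} {σ : β → α}
    (hσ : Tendsto σ l l') (h : ∀ᶠ z in l, Ψ (σ z) = z) : l ≤ map Ψ l' := by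
  intro S hS
  filter_upwards [hσ.eventually (mem_map.1 hS), h] with z h1 h2
  rwa [← h2]

lemma IsMeromorphicOnSet.comp {f : E → ℂ} {X : Set E} {Ψ : F → E} (hf : IsMeromorphicOnSet f X)
    (hΨ : IsOpenChart Ψ C X) (hC : IsOpen C) : IsMeromorphicOnSet (fun y => f (Ψ y)) C := by
  intro y hy
  obtain ⟨g, h, hg, hh, hn, he⟩ := hf (Ψ y) (hΨ.mapsTo y hy)
  have ht : Tendsto Ψ (𝓝 y) (𝓝[X] (Ψ y)) := tendsto_nhdsWithin_iff.2
    ⟨(hΨ.analyticAt y hy).continuousAt, by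
      filter_upwards [hC.mem_nhds hy] with z hz using hΨ.mapsTo z hz⟩
  refine ⟨_, _, hg.comp (hΨ.analyticAt y hy), hh.comp (hΨ.analyticAt y hy), ?_, ?_⟩ <;>
    rw [hC.nhdsWithin_eq hy]
  · intro hz
    exact hn (hΨ.le_map y hy (mem_map.2 hz))
  · exact ht.eventually he

/-- `Ψ` is a local parametrization of `X` by `C`, with analytic local sections. -/
structure IsFullChart (Ψ : F → E) (C : Set F) (X : Set E) : Prop where
  analyticAt : ∀ y ∈ C, AnalyticAt ℂ Ψ y
  mapsTo : ∀ y ∈ C, Ψ y ∈ X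
  surj : ∀ x ∈ X, ∃ y ∈ C, Ψ y = x
  exists_section : ∀ y ∈ C, ∃ σ : E → F, AnalyticAt ℂ σ (Ψ y) ∧ σ (Ψ y) = y ∧
    (∀ᶠ z in 𝓝[X] (Ψ y), Ψ (σ z) = z) ∧ ∀ᶠ w in 𝓝 y, σ (Ψ w) = w

variable {Ψ : F → E} {X : Set E}

lemma IsFullChart.isOpenChart (h : IsFullChart Ψ C X) : IsOpenChart Ψ C X where
  analyticAt := h.analyticAt
  mapsTo := h.mapsTo
  le_map y hy := by
    obtain ⟨σ, hσ, hy', h1, -⟩ := h.exists_section y hy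
    refine le_map_of_section (σ := σ) ?_ h1
    have := hσ.continuousAt.tendsto
    rw [hy'] at this
    exact this.mono_left nhdsWithin_le_nhds

lemma IsFullChart.restrict (h : IsFullChart Ψ C X) {X' : Set E} (hX : X' ⊆ X) :
    IsFullChart Ψ (C ∩ Ψ ⁻¹' X') X' where
  analyticAt y hy := h.analyticAt y hy.1
  mapsTo y hy := hy.2
  surj x hx := by
    obtain ⟨y, hy, rfl⟩ := h.surj x (hX hx)
    exact ⟨y, ⟨hy, hx⟩, rfl⟩
  exists_section y hy := by
    obtain ⟨σ, h1, h2, h3, h4⟩ := h.exists_section y hy.1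
    exact ⟨σ, h1, h2, h3.filter_mono (nhdsWithin_mono _ hX), h4⟩

lemma IsFullChart.tendsto (h : IsFullChart Ψ C X) (hC : IsOpen C) {y : F} (hy : y ∈ C) :
    Tendsto Ψ (𝓝 y) (𝓝[X] (Ψ y)) := tendsto_nhdsWithin_iff.2
  ⟨(h.analyticAt y hy).continuousAt, by
    filter_upwards [hC.mem_nhds hy] with z hz using h.mapsTo z hz⟩

/-- Pulled back to the connected set C, an analytic function that is nonzero at one point is not
identically zero near any point. This is how denominators on X are seen to be nontrivial. -/
lemma IsFullChart.frequently_ne_zero (h : IsFullChart Ψ C X) (hC : IsOpen C)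
    (hCp : IsPreconnected C) {H : E → ℂ} (hH : ∀ x ∈ X, AnalyticAt ℂ H x) {x₀ : E} (hx₀ : x₀ ∈ X)
    (hn : H x₀ ≠ 0) {x : E} (hx : x ∈ X) : ∃ᶠ z in 𝓝[X] x, H z ≠ 0 := by
  obtain ⟨y₀, hy₀, rfl⟩ := h.surj x₀ hx₀
  obtain ⟨y, hy, rfl⟩ := h.surj x hx
  refine (h.tendsto hC hy).frequently ?_
  exact frequently_ne_zero_of_preconnected (h := fun y => H (Ψ y)) hCp
    (fun y hy => (hH _ (h.mapsTo y hy)).comp (h.analyticAt y hy)) hy₀ hn hy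

/-- The exceptional function on C is transported to the ambient space by composing it with an
analytic local section of the chart. -/
lemma IsFullChart.genericallyOn (h : IsFullChart Ψ C X) (hC : IsOpen C) {P : E → Prop}
    (hP : GenericallyOn C fun y => P (Ψ y)) : GenericallyOn X P := by
  intro x hx
  obtain ⟨y, hy, rfl⟩ := h.surj x hx
  obtain ⟨H, hH, hn, he⟩ := hP y hy
  rw [hC.nhdsWithin_eq hy] at hn he
  obtain ⟨σ, h1, h2, h3, h4⟩ := h.exists_section y hy
  have hH' : AnalyticAt ℂ H (σ (Ψ y)) := by rwa [h2]
  refine ⟨fun z => H (σ z), hH'.comp h1, ?_, ?_⟩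
  · refine (h.tendsto hC hy).frequently ?_
    refine (hn.and_eventually h4).mono fun w hw => ?_
    change H (σ (Ψ w)) ≠ 0
    rw [hw.2]
    exact hw.1
  · have ht : Tendsto σ (𝓝[X] (Ψ y)) (𝓝 y) := by
      have := h1.continuousAt.tendsto
      rw [h2] at this
      exact this.mono_left nhdsWithin_le_nhds
    filter_upwards [ht.eventually he, h3] with z hz1 hz2 hz3
    rw [← hz2]
    exact hz1 hz3

lemma GenericallyOn.mono {P Q : E → Prop} (h : GenericallyOn X P)
    (hPQ : ∀ x ∈ X, P x → Q x) : GenericallyOn X Q := by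
  intro x hx
  obtain ⟨H, h1, h2, h3⟩ := h x hx
  refine ⟨H, h1, h2, ?_⟩
  filter_upwards [h3, self_mem_nhdsWithin] with y hy hyX hn using hPQ y hyX (hy hn)

/-- The coordinatewise exponential. -/
def expMap {n : ℕ} (y : Fin n → ℂ) : Fin n → ℂ := fun j => Complex.exp (y j)

lemma analyticAt_apply {n : ℕ} (j : Fin n) (y : Fin n → ℂ) :
    AnalyticAt ℂ (fun y : Fin n → ℂ => y j) y :=
  (ContinuousLinearMap.proj (R := ℂ) (φ := fun _ : Fin n => ℂ) j).analyticAt y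

lemma analyticAt_expMap {n : ℕ} (y : Fin n → ℂ) : AnalyticAt ℂ expMap y :=
  AnalyticAt.pi fun j => (analyticAt_apply j y).cexp

lemma exp_add_log_div {y z : ℂ} (hz : z ≠ 0) :
    Complex.exp (y + Complex.log (z / Complex.exp y)) = z := by
  rw [Complex.exp_add, Complex.exp_log (div_ne_zero hz (Complex.exp_ne_zero _))]
  exact mul_div_cancel₀ _ (Complex.exp_ne_zero _)

lemma eventually_add_log_exp {n : ℕ} (y : Fin n → ℂ) (j : Fin n) :
    ∀ᶠ w : Fin n → ℂ in 𝓝 y, y j + Complex.log (Complex.exp (w j) / Complex.exp (y j)) = w j := by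
  have h1 : Tendsto (fun w : Fin n → ℂ => (w j - y j).im) (𝓝 y) (𝓝 0) := by
    have : Continuous fun w : Fin n → ℂ => (w j - y j).im := by fun_prop
    simpa using this.tendsto y
  filter_upwards [h1.eventually (Ioo_mem_nhds (neg_lt_zero.2 Real.pi_pos) Real.pi_pos)] with w hw
  rw [← Complex.exp_sub, Complex.log_exp hw.1 hw.2.le]
  ring

lemma analyticAt_add_log {n m : ℕ} (y : Fin n → ℂ) (j : Fin n) (k : Fin m) {z : Fin m → ℂ}
    (hz : z k = Complex.exp (y j)) :
    AnalyticAt ℂ (fun z : Fin m → ℂ => y j + Complex.log (z k / Complex.exp (y j))) z := by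
  refine analyticAt_const.add (((analyticAt_apply k z).div analyticAt_const
    (Complex.exp_ne_zero _)).clog ?_)
  change z k / Complex.exp (y j) ∈ _
  rw [hz, div_self (Complex.exp_ne_zero _)]
  simp

lemma isFullChart_expMap (n : ℕ) :
    IsFullChart (expMap (n := n)) Set.univ {t | ∀ j, t j ≠ 0} where
  analyticAt y _ := analyticAt_expMap y
  mapsTo y _ j := Complex.exp_ne_zero _
  surj x hx := ⟨fun j => Complex.log (x j), trivial, funext fun j => Complex.exp_log (hx j)⟩
  exists_section y _ := by
    -- The argument of the logarithm is 1 at the base point, so the branch cut is avoided nearby.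
    refine ⟨fun z j => y j + Complex.log (z j / Complex.exp (y j)),
      AnalyticAt.pi fun j => analyticAt_add_log y j j rfl, ?_, ?_, ?_⟩
    · funext j
      simp [expMap]
    · filter_upwards [self_mem_nhdsWithin] with z hz
      exact funext fun j => exp_add_log_div (hz j)
    · filter_upwards [eventually_all.2 fun j => eventually_add_log_exp y j] with w hw
      exact funext hw

/-- Logarithmic coordinates on the hypersurface `t₁ ⋯ t₈ = 1`. -/
def balancedExp (y : Fin 7 → ℂ) : Fin 8 → ℂ :=
  Fin.snoc (expMap y) (Complex.exp (-∑ j, y j))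

/-- The last coordinate is determined by the other seven, so the hypersurface is parametrized by
ℂ^7. There the square roots s and v have global branches, exponentials of halves of linear forms. -/
lemma isFullChart_balancedExp : IsFullChart balancedExp Set.univ balancedSet where
  analyticAt y _ := by
    refine AnalyticAt.pi fun j => ?_
    refine Fin.lastCases ?_ (fun i => ?_) j
    · simp only [balancedExp, Fin.snoc_last]
      exact (Finset.analyticAt_fun_sum _ fun i _ => analyticAt_apply i y).neg.cexp
    · simp only [balancedExp, Fin.snoc_castSucc]
      exact (analyticAt_apply i y).cexp
  mapsTo y _ := by
    rw [balancedSet, Set.mem_ofPred_eq, Fin.prod_univ_castSucc]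
    simp only [balancedExp, Fin.snoc_castSucc, Fin.snoc_last, expMap]
    rw [← Complex.exp_sum, ← Complex.exp_add, add_neg_cancel, Complex.exp_zero]
  surj x hx := by
    have hx' : (∏ j : Fin 7, x j.castSucc) * x (Fin.last 7) = 1 := by
      rw [← Fin.prod_univ_castSucc]; exact hx
    have hx0 : ∀ j : Fin 7, x j.castSucc ≠ 0 := fun j =>
      Finset.prod_ne_zero_iff.1 (left_ne_zero_of_mul_eq_one hx') j (Finset.mem_univ j)
    refine ⟨fun j => Complex.log (x j.castSucc), trivial, funext fun j => ?_⟩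
    refine Fin.lastCases ?_ (fun i => ?_) j
    · simp only [balancedExp, Fin.snoc_last]
      rw [Complex.exp_neg, Complex.exp_sum]
      simp only [Complex.exp_log (hx0 _)]
      exact inv_eq_of_mul_eq_one_right hx'
    · simp only [balancedExp, Fin.snoc_castSucc]
      exact Complex.exp_log (hx0 i)
  exists_section y _ := by
    refine ⟨fun z j => y j + Complex.log (z j.castSucc / Complex.exp (y j)),
      AnalyticAt.pi fun j => analyticAt_add_log y j j.castSucc (by
        simp only [balancedExp, Fin.snoc_castSucc]; rfl), ?_, ?_, ?_⟩
    · funext j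
      simp [balancedExp, expMap]
    · filter_upwards [self_mem_nhdsWithin] with z hz
      have hx' : (∏ j : Fin 7, z j.castSucc) * z (Fin.last 7) = 1 := by
        rw [← Fin.prod_univ_castSucc]; exact hz
      have hx0 : ∀ j : Fin 7, z j.castSucc ≠ 0 := fun j =>
        Finset.prod_ne_zero_iff.1 (left_ne_zero_of_mul_eq_one hx') j (Finset.mem_univ j)
      funext j
      refine Fin.lastCases ?_ (fun i => ?_) j
      · simp only [balancedExp, Fin.snoc_last]
        rw [Complex.exp_neg, Complex.exp_sum]
        simp only [exp_add_log_div (hx0 _)]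
        exact inv_eq_of_mul_eq_one_right hx'
      · simp only [balancedExp, Fin.snoc_castSucc]
        exact exp_add_log_div (hx0 i)
    · filter_upwards [eventually_all.2 fun j => eventually_add_log_exp y j] with w hw
      funext j
      simp only [balancedExp, Fin.snoc_castSucc]
      exact hw j

/-- Monomial maps with a right inverse are open charts. -/
lemma isOpenChart_exp_comp {n m : ℕ} {A : (Fin n → ℂ) → Fin m → ℂ} {R : (Fin m → ℂ) → Fin n → ℂ}
    (hA : ∀ y, AnalyticAt ℂ A y) (hR : Continuous R) (hR0 : R 0 = 0)
    (h : ∀ y w, A (y + R w) = A y + w) :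
    IsOpenChart (fun y => expMap (A y)) Set.univ {t | ∀ j, t j ≠ 0} where
  analyticAt y _ := (analyticAt_expMap _).comp (hA y)
  mapsTo y _ j := Complex.exp_ne_zero _
  le_map y _ := by
    refine ((isFullChart_expMap m).isOpenChart.le_map (A y) trivial).trans ?_
    change _ ≤ map (expMap ∘ A) (𝓝 y)
    rw [← map_map]
    refine map_mono (le_map_of_section (σ := fun w => y + R (w - A y)) ?_ (.of_forall fun w => ?_))
    · have : Continuous fun w => y + R (w - A y) := by fun_prop
      simpa [hR0] using this.tendsto (A y)
    · rw [h]; abel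

end LineMeromorphic

/-! ### Existence of the integrals -/

section Existence

variable {q : ℂ} {E : Type*} [NormedAddCommGroup E] [NormedSpace ℂ E] {t₀ : E}
  {ι κ : Type*}

/-- The value of a contour integral, when it is determined by a splitting of the integrand. -/
def contourValue (f : ℂ → ℂ) (down up : Set ℂ) : ℂ := Classical.epsilon (SepValue f down up)

lemma SepValue.contourValue_eq {f : ℂ → ℂ} {down up : Set ℂ} {I : ℂ} (h : SepValue f down up I)
    (hP : IsPolarPair down up) (hdis : Disjoint down up) : contourValue f down up = I :=
  (Classical.epsilon_spec ⟨I, h⟩).unique h hP hdis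

/-- The two predicates are equal as predicates, so the chosen values agree even where no value
exists. Evenness thus holds at every parameter, poles included. -/
lemma contourValue_comp_neg {f g : ℂ → ℂ} {down up down' up' : Set ℂ} (hg : ∀ z, g z = f (-z))
    (hd : ∀ z, z ∈ down' ↔ -z ∈ down) (hu : ∀ z, z ∈ up' ↔ -z ∈ up) :
    contourValue g down' up' = contourValue f down up := by
  have : SepValue g down' up' = SepValue f down up := funext fun I => propext
    ⟨fun h => h.comp_neg (fun z => by rw [hg, neg_neg]) (fun z => by rw [hd, neg_neg])
      (fun z => by rw [hu, neg_neg]), fun h => h.comp_neg hg hd hu⟩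
  rw [contourValue, this, contourValue]

lemma mem_downSet_neg {a : ι → ℂ} {z : ℂ} :
    z ∈ downSet q (fun i => -a i) ↔ -z ∈ downSet q a := by
  simp only [mem_downSet, neg_mul, neg_eq_iff_eq_neg (a := z)]

lemma mem_upSet_neg {b : κ → ℂ} {z : ℂ} :
    z ∈ upSet q (fun j => -b j) ↔ -z ∈ upSet q b := by
  simp only [mem_upSet, inv_neg, neg_mul, neg_eq_iff_eq_neg (a := z)]

variable [Fintype ι] [Fintype κ]

/-- The contour integral of `polarIntegrand`. -/
def polarValue (q : ℂ) (a : ι → ℂ) (b : κ → ℂ) (g : ℂ → ℂ) : ℂ :=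
  contourValue (polarIntegrand q a b g) (downSet q a) (upSet q b)

lemma polarValue_neg {a : ι → ℂ} {b : κ → ℂ} {g g' : ℂ → ℂ} (hg : ∀ z, g' z = g (-z)) :
    polarValue q (fun i => -a i) (fun j => -b j) g' = polarValue q a b g := by
  refine contourValue_comp_neg (fun z => ?_) (fun z => mem_downSet_neg) (fun z => mem_upSet_neg)
  simp only [polarIntegrand, hg, neg_div, div_neg, neg_mul, mul_neg]

lemma disjoint_of_isSeparatingContour {γ : ℝ → ℂ} {down up : Set ℂ}
    (h : IsSeparatingContour γ down up) : Disjoint down up := by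
  rw [Set.disjoint_left]
  intro z h1 h2
  have := (h.winding_down z h1).symm.trans (h.winding_up z h2)
  exact one_ne_zero this

lemma exists_polarValue_eq (hq0 : q ≠ 0) (hq : ‖q‖ < 1) {a : ι → E → ℂ} {b : κ → E → ℂ}
    {g : E → ℂ → ℂ} (ha : ∀ i, AnalyticAt ℂ (a i) t₀) (hb : ∀ j, AnalyticAt ℂ (b j) t₀)
    (hb0 : ∀ j, b j t₀ ≠ 0) (hg : IsHolFamily g t₀) :
    ∃ (N : ℕ) (Φ : E → ℂ), AnalyticAt ℂ Φ t₀ ∧ ∀ᶠ t in 𝓝 t₀,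
      collision q N (fun i => a i t) (fun j => b j t) ≠ 0 →
        (∀ i j, ∀ n : ℕ, a i t * b j t * q ^ n ≠ 1) ∧
        polarValue q (fun i => a i t) (fun j => b j t) (g t) =
          Φ t / collision q N (fun i => a i t) fun j => b j t := by
  obtain ⟨N, Φ, hΦ, h⟩ := exists_sepValue hq0 hq ha hb hb0 hg
  have eb0 : ∀ᶠ t in 𝓝 t₀, ∀ j, b j t ≠ 0 := by
    rw [eventually_all]
    exact fun j => (hb j).continuousAt.eventually_ne (hb0 j)
  refine ⟨N, Φ, hΦ, ?_⟩
  filter_upwards [h, eb0] with t h1 h2 h3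
  exact ⟨(h1 h3).1, (h1 h3).2.contourValue_eq (isPolarPair_sets hq0 hq _ h2)
    ((disjoint_sets_iff hq0 h2).2 (h1 h3).1)⟩

/-- This is needed for the Barnes integral: an identity known generically then holds at every
collision-free parameter. -/
lemma polarValue_continuousAt (hq0 : q ≠ 0) (hq : ‖q‖ < 1) {a : ι → E → ℂ} {b : κ → E → ℂ}
    {g : E → ℂ → ℂ} (ha : ∀ i, AnalyticAt ℂ (a i) t₀) (hb : ∀ j, AnalyticAt ℂ (b j) t₀)
    (hb0 : ∀ j, b j t₀ ≠ 0) (hg : IsHolFamily g t₀)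
    (hn : ∀ i j, ∀ n : ℕ, a i t₀ * b j t₀ * q ^ n ≠ 1) :
    ContinuousAt (fun t => polarValue q (fun i => a i t) (fun j => b j t) (g t)) t₀ := by
  obtain ⟨N, Φ, hΦ, h⟩ := exists_polarValue_eq hq0 hq ha hb hb0 hg
  have hc := collision_ne_zero hn N
  have hca := (analyticAt_collision (q := q) ha hb N).continuousAt
  refine (hΦ.continuousAt.div hca hc).congr ?_
  filter_upwards [h, hca.eventually_ne hc] with t h1 h2
  exact (h1 h2).2.symm

/-- A separating contour forces the two pole sets to be disjoint, since winding numbers tell them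
apart. The splitting is then obtained from `exists_sepValue` for constant families. -/
lemma polarValue_eq_normCurveInt (hq0 : q ≠ 0) (hq : ‖q‖ < 1) {a : ι → ℂ} {b : κ → ℂ}
    {g : ℂ → ℂ} (hb0 : ∀ j, b j ≠ 0) (hg : ∀ z, z ≠ 0 → DifferentiableAt ℂ g z) {γ : ℝ → ℂ}
    (hγ : IsSeparatingContour γ (downSet q a) (upSet q b)) :
    polarValue q a b g = normCurveInt (polarIntegrand q a b g) γ := by
  have hdis := disjoint_of_isSeparatingContour hγ
  have hn := (disjoint_sets_iff hq0 hb0).1 hdis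
  obtain ⟨N, Φ, -, h⟩ := exists_sepValue (E := ℂ) (t₀ := 0) (a := fun i _ => a i)
    (b := fun j _ => b j) (g := fun _ => g) hq0 hq (fun _ => analyticAt_const)
    (fun _ => analyticAt_const) hb0 (isHolFamily_const hg)
  have hP := isPolarPair_sets hq0 hq a hb0
  have h1 := (h.self_of_nhds (collision_ne_zero hn N)).2
  rw [h1.normCurveInt_eq hP hγ]
  exact h1.contourValue_eq hP hdis

lemma normCurveInt_const_mul (c : ℂ) (f : ℂ → ℂ) (γ : ℝ → ℂ) :
    normCurveInt (fun z => c * f z) γ = c * normCurveInt f γ := by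
  simp only [normCurveInt, curveInt, mul_div_assoc, mul_assoc]
  exact intervalIntegral.integral_const_mul _ _

lemma isOpen_torusSix : IsOpen torusSix := by
  have : torusSix = ⋂ j : Fin 6, {t | t j ≠ 0} := by ext; simp [torusSix]
  rw [this]
  exact isOpen_iInter_of_finite fun j => isOpen_ne_fun (continuous_apply j) continuous_const

/-! #### The Euler integral -/

/-- The numerator of the Euler integrand. -/
def eulerNumerator (q : ℂ) (t : Fin 6 → ℂ) (z : ℂ) : ℂ :=
  qPochs q [z ^ 2, (z ^ 2)⁻¹, (t 0)⁻¹ * z, (t 0)⁻¹ * z⁻¹]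

lemma prod_one_five (f : Fin 6 → ℂ) :
    ∏ j ∈ {1, 2, 3, 4, 5}, f j = ∏ i : Fin 5, f i.succ := by
  rw [Fin.prod_univ_five]
  rw [Finset.prod_insert (by decide), Finset.prod_insert (by decide), Finset.prod_insert (by decide),
    Finset.prod_insert (by decide), Finset.prod_singleton]
  simp only [mul_assoc]
  rfl

lemma eulerIntegrand_eq (q : ℂ) (t : Fin 6 → ℂ) : eulerIntegrand q t =
    polarIntegrand q (fun i : Fin 5 => t i.succ) (fun i : Fin 5 => t i.succ) (eulerNumerator q t) := by
  funext z
  rw [eulerIntegrand, polarIntegrand, prod_one_five, ← Finset.prod_mul_distrib, eulerNumerator]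
  congr 1
  refine Finset.prod_congr rfl fun i _ => ?_
  simp [qPochs, div_eq_mul_inv, mul_comm]

lemma iUnion_one_five (S : Fin 6 → Set ℂ) :
    (⋃ j ∈ ({1, 2, 3, 4, 5} : Set (Fin 6)), S j) = ⋃ i : Fin 5, S i.succ := by
  ext z
  simp only [Set.mem_iUnion, Set.mem_insert_iff, Set.mem_singleton_iff, exists_prop]
  constructor
  · rintro ⟨j, hj, hz⟩
    rcases hj with rfl | rfl | rfl | rfl | rfl
    exacts [⟨0, hz⟩, ⟨1, hz⟩, ⟨2, hz⟩, ⟨3, hz⟩, ⟨4, hz⟩]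
  · rintro ⟨i, hz⟩
    exact ⟨i.succ, by fin_cases i <;> simp, hz⟩

lemma isEulerContour_iff {t : Fin 6 → ℂ} {γ : ℝ → ℂ} : IsEulerContour q t γ ↔
    IsSeparatingContour γ (downSet q fun i : Fin 5 => t i.succ) (upSet q fun i : Fin 5 => t i.succ) := by
  rw [IsEulerContour, iUnion_one_five, iUnion_one_five]
  rfl

lemma isHolFamily_pow_two : IsHolFamily (fun (_ : E) z => z ^ 2) t₀ :=
  isHolFamily_const fun _ _ => by fun_prop

lemma isHolFamily_inv_pow_two : IsHolFamily (fun (_ : E) z => (z ^ 2)⁻¹) t₀ :=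
  isHolFamily_const fun z hz => by
    have : z ^ 2 ≠ 0 := pow_ne_zero 2 hz
    fun_prop (disch := assumption)

lemma isHolFamily_eulerNumerator (hq : ‖q‖ < 1) {t : Fin 6 → ℂ} (ht : t ∈ torusSix) :
    IsHolFamily (eulerNumerator q) t := by
  have h0 : AnalyticAt ℂ (fun t : Fin 6 → ℂ => (t 0)⁻¹) t := (analyticAt_apply 0 t).inv (ht 0)
  have := ((isHolFamily_pow_two (t₀ := t)).entire (differentiable_qPochInf hq)).mul
    (((isHolFamily_inv_pow_two (t₀ := t)).entire (differentiable_qPochInf hq)).mul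
    ((isHolFamily_qPochInf_mul hq h0).mul (isHolFamily_qPochInf_div hq h0)))
  refine cast (congrArg (fun F => IsHolFamily F t) ?_) this
  funext t z
  simp only [eulerNumerator, qPochs, List.map_cons, List.map_nil, List.prod_cons, List.prod_nil,
    mul_one, div_eq_mul_inv]

/-- The Euler integral, extended meromorphically. -/
def trigEuler (q : ℂ) (t : Fin 6 → ℂ) : ℂ :=
  polarValue q (fun i : Fin 5 => t i.succ) (fun i : Fin 5 => t i.succ) (eulerNumerator q t)

lemma isTrigEuler_trigEuler (hq0 : q ≠ 0) (hq : ‖q‖ < 1) : IsTrigEuler q (trigEuler q) where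
  meromorphic t ht := by
    obtain ⟨N, Φ, hΦ, h⟩ := exists_polarValue_eq (t₀ := t) (a := fun (i : Fin 5) t => t i.succ)
      (b := fun (i : Fin 5) t => t i.succ) (g := eulerNumerator q) hq0 hq
      (fun i => analyticAt_apply _ t) (fun i => analyticAt_apply _ t) (fun j => ht _)
      (isHolFamily_eulerNumerator hq ht)
    have hcol := fun x : Fin 6 → ℂ => analyticAt_collision (q := q)
      (a := fun (i : Fin 5) (t : Fin 6 → ℂ) => t i.succ)
      (b := fun (i : Fin 5) t => t i.succ) (fun i => analyticAt_apply _ x)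
      (fun i => analyticAt_apply _ x) N
    refine ⟨Φ, _, hΦ, hcol t, ?_, ?_⟩
    -- At the point with all coordinates 1/2 every product of two parameters is 1/4, so no sequences
    -- collide.
    · refine (isFullChart_expMap 6).frequently_ne_zero isOpen_univ isPreconnected_univ
        (fun x _ => hcol x) (x₀ := fun _ => 1 / 2) (fun _ => by norm_num) ?_ ht
      refine collision_ne_zero (fun i j n h1 => ?_) N
      have h2 := norm_mul_pow_lt_one hq (a := (1 / 2 : ℂ) * (1 / 2)) (by norm_num) n
      rw [h1, norm_one] at h2
      exact lt_irrefl _ h2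
    · exact nhdsWithin_le_nhds (h.mono fun t h1 h2 => (h1 h2).2)
  even t ht := polarValue_neg fun z => by
    simp [eulerNumerator, qPochs, inv_neg]
  eq_integral t ht γ hγ := by
    rw [eulerIntegrand_eq]
    exact polarValue_eq_normCurveInt hq0 hq (fun j => ht _)
      (isHolFamily_eulerNumerator hq ht).differentiableAt.self_of_nhds (isEulerContour_iff.1 hγ)

/-! #### The third integral -/

/-- The numerator of the integrand of `V`. -/
def vNumerator (q : ℂ) (t : Fin 6 → ℂ) (z : ℂ) : ℂ :=
  qTheta q (q * t 1 * t 2 * t 3 * t 4 * t 5 * z) * (1 - z ^ 2 / q) *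
    ∏ i : Fin 5, qPochInf q (z / t i.succ)

/-- The normalization of the integrand of `V`. -/
def vNorm (q : ℂ) (t : Fin 6 → ℂ) : ℂ := qTheta q (q * t 0 * t 1 * t 2 * t 3 * t 4 * t 5)

/-- The parameters of the increasing sequences of `V`. -/
def vUp (q : ℂ) (j : Fin 6) (t : Fin 6 → ℂ) : ℂ := if j = 0 then t 0 / q else t j

lemma vUp_succ (i : Fin 5) (t : Fin 6 → ℂ) : vUp q i.succ t = t i.succ :=
  if_neg (Fin.succ_ne_zero i)

lemma analyticAt_vUp (j : Fin 6) (t : Fin 6 → ℂ) : AnalyticAt ℂ (vUp q j) t := by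
  unfold vUp
  split_ifs with h
  · exact (analyticAt_apply 0 t).div_const
  · exact analyticAt_apply j t

lemma vUp_ne_zero (hq0 : q ≠ 0) {t : Fin 6 → ℂ} (ht : t ∈ torusSix) (j : Fin 6) :
    vUp q j t ≠ 0 := by
  unfold vUp
  split_ifs with h
  · exact div_ne_zero (ht 0) hq0
  · exact ht j

lemma vIntegrand_eq (q : ℂ) (t : Fin 6 → ℂ) : vIntegrand q t = fun z => (vNorm q t)⁻¹ *
    polarIntegrand q (fun _ : Fin 1 => t 0) (fun j => vUp q j t) (vNumerator q t) z := by
  funext z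
  have h0 : vUp q 0 t = t 0 / q := if_pos rfl
  rw [vIntegrand, polarIntegrand, prod_one_five, Fin.prod_univ_succ (n := 5)]
  simp only [vUp_succ, h0, Finset.prod_div_distrib, vNumerator, vNorm, qPochs, List.map_cons,
    List.map_nil, List.prod_cons, List.prod_nil, mul_one, Finset.univ_unique, Finset.prod_singleton]
  rw [div_mul_eq_mul_div (t 0)]
  simp only [div_eq_mul_inv, mul_inv]
  ring

lemma isVContour_iff {t : Fin 6 → ℂ} {γ : ℝ → ℂ} : IsVContour q t γ ↔
    IsSeparatingContour γ (downSet q fun _ : Fin 1 => t 0) (upSet q fun j => vUp q j t) := by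
  have h0 : vUp q 0 t = t 0 / q := if_pos rfl
  have h1 : downSeq q (t 0) = downSet q fun _ : Fin 1 => t 0 := by
    rw [downSet, Set.iUnion_const]
  have h2 : upSeq q (q / t 0) ∪ ⋃ j ∈ ({1, 2, 3, 4, 5} : Set (Fin 6)), upSeq q (t j)⁻¹ =
      upSet q fun j => vUp q j t := by
    rw [iUnion_one_five]
    ext z
    simp only [upSet, Set.mem_union, Set.mem_iUnion, Fin.exists_fin_succ (n := 5), h0, inv_div, vUp_succ]
  rw [IsVContour, h1, h2]

lemma analyticAt_qTheta (hq : ‖q‖ < 1) {f : E → ℂ} (hf : AnalyticAt ℂ f t₀) (h0 : f t₀ ≠ 0) :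
    AnalyticAt ℂ (fun t => qTheta q (f t)) t₀ := by
  have hP : ∀ z, AnalyticAt ℂ (qPochInf q) z := fun z =>
    (differentiable_qPochInf hq).analyticAt z
  simp only [qTheta_eq]
  exact ((hP _).comp hf).mul ((hP _).fun_comp (analyticAt_const.div hf h0))

lemma analyticAt_vNorm (hq0 : q ≠ 0) (hq : ‖q‖ < 1) {t : Fin 6 → ℂ} (ht : t ∈ torusSix) :
    AnalyticAt ℂ (vNorm q) t := by
  have h := fun j => analyticAt_apply j t
  refine analyticAt_qTheta hq ((((((analyticAt_const.mul (h 0)).mul (h 1)).mul (h 2)).mul (h 3)).mul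
    (h 4)).mul (h 5)) ?_
  have := ht 0; have := ht 1; have := ht 2; have := ht 3; have := ht 4; have := ht 5
  simp [*]

lemma isHolFamily_vNumerator (hq0 : q ≠ 0) (hq : ‖q‖ < 1) {t : Fin 6 → ℂ} (ht : t ∈ torusSix) :
    IsHolFamily (vNumerator q) t := by
  have h := fun j => analyticAt_apply j t
  have h1 := isHolFamily_qTheta hq (a := fun t : Fin 6 → ℂ => q * t 1 * t 2 * t 3 * t 4 * t 5)
    (((((analyticAt_const.mul (h 1)).mul (h 2)).mul (h 3)).mul (h 4)).mul (h 5)) (by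
      have := ht 1; have := ht 2; have := ht 3; have := ht 4; have := ht 5
      simp [*])
  have h2 : IsHolFamily (fun (_ : Fin 6 → ℂ) z => 1 - z ^ 2 / q) t :=
    isHolFamily_const fun _ _ => by fun_prop
  have h3 := IsHolFamily.prod Finset.univ fun i : Fin 5 =>
    isHolFamily_qPochInf_mul hq ((h i.succ).inv (ht _))
  refine cast (congrArg (fun F => IsHolFamily F t) ?_) ((h1.mul h2).mul h3)
  funext t z
  simp only [vNumerator, div_eq_mul_inv, mul_comm, Pi.inv_apply]

/-- The integral `V`, extended meromorphically. -/
def trigV (q : ℂ) (t : Fin 6 → ℂ) : ℂ :=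
  2 * ((vNorm q t)⁻¹ *
    polarValue q (fun _ : Fin 1 => t 0) (fun j => vUp q j t) (vNumerator q t))

/-- With κ = √‖q‖ the point (q, 1/κ, 1/κ, 1/κ, 1, 1) works: each product of the inner parameter with
an outer one has norm κ or ‖q‖, less than 1, and the argument of the normalizing theta function has
norm ‖q‖²/κ³ = κ, strictly between ‖q‖ and 1. -/
lemma exists_vWitness (hq0 : q ≠ 0) (hq : ‖q‖ < 1) : ∃ x ∈ torusSix,
    (∀ (i : Fin 1) j, ∀ n : ℕ, (fun _ : Fin 1 => x 0) i * vUp q j x * q ^ n ≠ 1) ∧ vNorm q x ≠ 0 := by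
  set κ := Real.sqrt ‖q‖ with hκ
  have hqp : 0 < ‖q‖ := norm_pos_iff.2 hq0
  have hκ0 : 0 < κ := Real.sqrt_pos.2 hqp
  have hκ2 : κ * κ = ‖q‖ := Real.mul_self_sqrt hqp.le
  have hκ1 : κ < 1 := by nlinarith
  have hκc : (κ : ℂ) ≠ 0 := by exact_mod_cast hκ0.ne'
  have hn : ‖(κ : ℂ)‖ = κ := by rw [Complex.norm_real, Real.norm_of_nonneg hκ0.le]
  have hb : ‖q * (κ : ℂ)⁻¹‖ < 1 := by
    rw [norm_mul, norm_inv, hn, ← hκ2, mul_inv_cancel_right₀ hκ0.ne']; exact hκ1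
  refine ⟨![q, (κ : ℂ)⁻¹, (κ : ℂ)⁻¹, (κ : ℂ)⁻¹, 1, 1], fun j => ?_, fun i j n h => ?_, ?_⟩
  · fin_cases j <;> simp [hq0, hκc]
  · have h2 : ‖q * vUp q j ![q, (κ : ℂ)⁻¹, (κ : ℂ)⁻¹, (κ : ℂ)⁻¹, 1, 1]‖ < 1 := by
      rw [norm_mul, norm_inv, hn] at hb
      fin_cases j <;> simp [vUp, hq0, abs_of_pos hκ0, hb, hq]
    have h3 := norm_mul_pow_lt_one hq h2 n
    have h4 : q * vUp q j ![q, (κ : ℂ)⁻¹, (κ : ℂ)⁻¹, (κ : ℂ)⁻¹, 1, 1] * q ^ n = 1 := h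
    rw [h4, norm_one] at h3
    exact lt_irrefl _ h3
  · have h1 : ‖q * q * (κ : ℂ)⁻¹ * (κ : ℂ)⁻¹ * (κ : ℂ)⁻¹ * 1 * 1‖ = κ := by
      simp only [norm_mul, norm_inv, hn, mul_one, ← hκ2]
      field_simp
    refine qTheta_ne_zero_of_annulus hq ?_ ?_ <;>
    · simp only [Matrix.cons_val]
      rw [h1]
      nlinarith

lemma isTrigV_trigV (hq0 : q ≠ 0) (hq : ‖q‖ < 1) : IsTrigV q (trigV q) where
  meromorphic t ht := by
    obtain ⟨N, Φ, hΦ, h⟩ := exists_polarValue_eq (t₀ := t) (a := fun (_ : Fin 1) t => t 0)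
      (b := vUp q) (g := vNumerator q) hq0 hq
      (fun i => analyticAt_apply _ t) (fun i => analyticAt_vUp _ t) (fun j => vUp_ne_zero hq0 ht j)
      (isHolFamily_vNumerator hq0 hq ht)
    have hcol := fun x : Fin 6 → ℂ => analyticAt_collision (q := q)
      (a := fun (_ : Fin 1) (t : Fin 6 → ℂ) => t 0)
      (b := vUp q) (fun i => analyticAt_apply _ x) (fun i => analyticAt_vUp _ x) N
    obtain ⟨x, hx, hx1, hx2⟩ := exists_vWitness hq0 hq
    refine ⟨fun t => 2 * Φ t, fun t => vNorm q t * collision q N (fun _ : Fin 1 => t 0)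
      (fun j => vUp q j t), analyticAt_const.mul hΦ, (analyticAt_vNorm hq0 hq ht).mul (hcol t), ?_, ?_⟩
    · exact (isFullChart_expMap 6).frequently_ne_zero isOpen_univ isPreconnected_univ
        (fun x hx => (analyticAt_vNorm hq0 hq hx).mul (hcol x)) hx
        (mul_ne_zero hx2 (collision_ne_zero hx1 N)) ht
    · refine nhdsWithin_le_nhds (h.mono fun t h1 h2 => ?_)
      rw [trigV, (h1 (right_ne_zero_of_mul h2)).2]
      have := left_ne_zero_of_mul h2
      have := right_ne_zero_of_mul h2
      field_simp
  even t ht := by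
    have h1 : vNorm q (-t) = vNorm q t := by simp [vNorm]
    have h2 : (fun j => vUp q j (-t)) = fun j => -vUp q j t := by
      funext j
      unfold vUp
      split_ifs <;> simp [neg_div]
    rw [trigV, trigV, h1, h2]
    congr 2
    refine polarValue_neg fun z => ?_
    simp [vNumerator, neg_div, div_neg]
  eq_integral t ht _ γ hγ := by
    rw [vIntegrand_eq, normCurveInt_const_mul, trigV]
    rw [polarValue_eq_normCurveInt hq0 hq (fun j => vUp_ne_zero hq0 ht j)
      (isHolFamily_vNumerator hq0 hq ht).differentiableAt.self_of_nhds (isVContour_iff.1 hγ)]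

end Existence

/-! ### Evaluation of the integrals over circles -/

section Region

open Real (circleAverage)

variable {q : ℂ} {ι κ : Type*}

lemma norm_lt_of_mem_downSet (hq : ‖q‖ < 1) {a : ι → ℂ} {r : ℝ} (h : ∀ i, ‖a i‖ < r) :
    ∀ w ∈ downSet q a, ‖w‖ < r := by
  intro w hw
  obtain ⟨i, n, rfl⟩ := mem_downSet.1 hw
  exact (norm_mul_pow_le hq _ _).trans_lt (h i)

lemma lt_norm_of_mem_upSet (hq0 : q ≠ 0) (hq : ‖q‖ < 1) {b : κ → ℂ} (hb : ∀ j, b j ≠ 0) {r : ℝ}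
    (hr : 0 < r) (h : ∀ j, ‖b j‖ * r < 1) : ∀ w ∈ upSet q b, r < ‖w‖ := by
  intro w hw
  obtain ⟨j, n, rfl⟩ := mem_upSet.1 hw
  have hpos : 0 < ‖b j * q ^ n‖ := norm_pos_iff.2 (mul_ne_zero (hb j) (pow_ne_zero _ hq0))
  rw [← mul_inv, norm_inv, ← one_div, lt_div_iff₀ hpos]
  have := norm_mul_pow_le hq (b j) n
  have h2 := h j
  nlinarith

lemma circleAverage_smul_arg (f : ℂ → ℂ) (v : ℂ) (ρ : ℝ) :
    circleAverage f 0 (‖v‖ * ρ) = circleAverage (fun w => f (v * w)) 0 ρ := by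
  rw [Real.circleAverage_eq_integral_add v.arg, Real.circleAverage_def]
  congr 1
  refine intervalIntegral.integral_congr fun θ _ => ?_
  have : circleMap 0 (‖v‖ * ρ) (θ + v.arg) = v * circleMap 0 ρ θ := by
    have hv := Complex.norm_mul_exp_arg_mul_I v
    simp only [circleMap_zero, Complex.ofReal_mul, Complex.ofReal_add, add_mul, Complex.exp_add]
    linear_combination (ρ * Complex.exp (θ * Complex.I)) * hv
  simp only [this]

/-! #### The Euler integral -/

lemma IsTrigEuler.eq_eulerCircle {E : (Fin 6 → ℂ) → ℂ} (hE : IsTrigEuler q E) (hq0 : q ≠ 0)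
    (hq : ‖q‖ < 1) {t : Fin 6 → ℂ} (ht : t ∈ torusSix) (h : ∀ i : Fin 5, ‖t i.succ‖ < 1) :
    E t = eulerCircle q (t 0)⁻¹ (t 1) (t 2) (t 3) (t 4) (t 5) := by
  have hγ : IsEulerContour q t (circleCurve 1) := isEulerContour_iff.2
    (isSeparatingContour_circleCurve one_pos (norm_lt_of_mem_downSet hq h)
      (lt_norm_of_mem_upSet hq0 hq (fun j => ht _) one_pos fun j => by rw [mul_one]; exact h j))
  rw [hE.eq_integral t ht _ hγ, normCurveInt_circleCurve one_pos, eulerCircle]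
  congr 1
  funext z
  rw [eulerIntegrand, prod_one_five, Fin.prod_univ_five]
  simp only [qPochs, qWeyl, qPair, List.map_cons, List.map_nil, List.prod_cons, List.prod_nil,
    mul_one, mul_assoc]
  rfl

/-! #### The third integral -/

lemma IsTrigV.eq_circleAverage {V : (Fin 6 → ℂ) → ℂ} (hV : IsTrigV q V) (hq0 : q ≠ 0)
    (hq : ‖q‖ < 1) {t : Fin 6 → ℂ} (ht : t ∈ torusSix) {r : ℝ} (h0 : ‖t 0‖ < r)
    (h0' : ‖t 0‖ * r < ‖q‖) (h : ∀ i : Fin 5, ‖t i.succ‖ * r < 1)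
    (hθ : qTheta q (q * t 0 * (t 1 * t 2 * t 3 * t 4 * t 5)) ≠ 0) :
    V t = 2 * circleAverage (vForm q (t 0) (t 1) (t 2) (t 3) (t 4) (t 5)) 0 r := by
  have hr : 0 < r := norm_ne_zero_of_lt h0
  have hqpos := norm_pos_iff.2 hq0
  have e1 : q * t 0 * t 1 * t 2 * t 3 * t 4 * t 5 = q * t 0 * (t 1 * t 2 * t 3 * t 4 * t 5) := by ring
  have hγ : IsVContour q t (circleCurve r) := isVContour_iff.2
    (isSeparatingContour_circleCurve hr (norm_lt_of_mem_downSet hq fun _ => h0)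
      (lt_norm_of_mem_upSet hq0 hq (vUp_ne_zero hq0 ht) hr fun j => by
        refine Fin.cases ?_ (fun i => ?_) j
        · rw [vUp, if_pos rfl, norm_div, div_mul_eq_mul_div, div_lt_one hqpos]; exact h0'
        · rw [vUp_succ]; exact h i))
  rw [hV.eq_integral t ht (by rw [e1]; exact hθ) _ hγ, normCurveInt_circleCurve hr]
  congr 2
  funext z
  rw [vIntegrand, prod_one_five, Fin.prod_univ_five, e1,
    show q * t 1 * t 2 * t 3 * t 4 * t 5 * z = q * (t 1 * t 2 * t 3 * t 4 * t 5) * z by ring]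
  simp only [qPochs, List.map_cons, List.map_nil, List.prod_cons, List.prod_nil, mul_one, vForm]
  rfl

/-! #### The Barnes integral -/

/-- The numerator of the Barnes integrand. -/
def barnesNumerator (q μ : ℂ) (t : Fin 8 → ℂ) (z : ℂ) : ℂ :=
  qTheta q (t 1 * t 6 / (μ * z)) * qTheta q (z / μ) * (qPochInf q (z / t 0) * qPochInf q (z / t 7))

/-- The normalization of the Barnes integrand. -/
def barnesNorm (q μ : ℂ) (t : Fin 8 → ℂ) : ℂ := qTheta q (t 1 / μ) * qTheta q (t 6 / μ)

/-- The parameters of the decreasing sequences of the Barnes integrand. -/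
def barnesDown (i : Fin 2) (t : Fin 8 → ℂ) : ℂ := t (![1, 6] i)

/-- The parameters of the increasing sequences of the Barnes integrand. -/
def barnesUp (j : Fin 4) (t : Fin 8 → ℂ) : ℂ := t (![2, 3, 4, 5] j)

/-- The Barnes integral without its normalization. -/
def barnesPolar (q μ : ℂ) (t : Fin 8 → ℂ) : ℂ :=
  polarValue q (fun i => barnesDown i t) (fun j => barnesUp j t) (barnesNumerator q μ t)

lemma balanced_ne_zero {t : Fin 8 → ℂ} (ht : t ∈ balancedSet) (j : Fin 8) : t j ≠ 0 := by
  have h : ∏ j, t j = 1 := ht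
  exact Finset.prod_ne_zero_iff.1 (h.trans_ne one_ne_zero) j (Finset.mem_univ j)

lemma barnesIntegrand_eq (q μ : ℂ) (t : Fin 8 → ℂ) : barnesIntegrand q μ t = fun z =>
    (barnesNorm q μ t)⁻¹ * polarIntegrand q (fun i => barnesDown i t) (fun j => barnesUp j t)
      (barnesNumerator q μ t) z := by
  funext z
  rw [barnesIntegrand, polarIntegrand, Fin.prod_univ_two, Fin.prod_univ_four,
    Finset.prod_insert (by decide), Finset.prod_insert (by decide), Finset.prod_insert (by decide),
    Finset.prod_singleton]
  simp only [barnesNumerator, barnesNorm, qPochs, List.map_cons, List.map_nil,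
    List.prod_cons, List.prod_nil, mul_one]
  simp only [barnesDown, barnesUp, Matrix.cons_val, div_eq_mul_inv, mul_inv]
  ring

lemma isBarnesContour_iff {t : Fin 8 → ℂ} {γ : ℝ → ℂ} : IsBarnesContour q t γ ↔
    IsSeparatingContour γ (downSet q fun i => barnesDown i t) (upSet q fun j => barnesUp j t) := by
  have h1 : downSeq q (t 1) ∪ downSeq q (t 6) = downSet q fun i => barnesDown i t := by
    ext z
    simp [downSet, Fin.exists_fin_two, barnesDown]
  have h2 : ⋃ j ∈ ({2, 3, 4, 5} : Set (Fin 8)), upSeq q (t j)⁻¹ = upSet q fun j => barnesUp j t := by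
    ext z
    simp [upSet, Fin.exists_fin_succ, barnesUp]
  rw [IsBarnesContour, h1, h2]

lemma isHolFamily_barnesNumerator (hq : ‖q‖ < 1) {μ : ℂ} (hμ : μ ≠ 0) {t : Fin 8 → ℂ}
    (ht : ∀ j, t j ≠ 0) : IsHolFamily (barnesNumerator q μ) t := by
  have h := fun j => analyticAt_apply j t
  have h16 : AnalyticAt ℂ (fun t : Fin 8 → ℂ => t 1 * t 6) t := (h 1).mul (h 6)
  have h1 := isHolFamily_qPochInf_div hq (h16.div_const (c := μ))
  have h2 := isHolFamily_qPochInf_mul hq ((analyticAt_const (v := q * μ)).div h16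
    (mul_ne_zero (ht 1) (ht 6)))
  have h3 := isHolFamily_qTheta hq (analyticAt_const (v := μ⁻¹) (x := t)) (inv_ne_zero hμ)
  have h4 := isHolFamily_qPochInf_mul hq ((h 0).inv (ht 0))
  have h5 := isHolFamily_qPochInf_mul hq ((h 7).inv (ht 7))
  refine cast (congrArg (fun F => IsHolFamily F t) ?_) (((h1.mul h2).mul h3).mul (h4.mul h5))
  funext t z
  simp only [barnesNumerator, qTheta_eq, Pi.div_apply, Pi.inv_apply]
  rw [div_eq_inv_mul z μ, div_eq_inv_mul z (t 0), div_eq_inv_mul z (t 7), div_div (t 1 * t 6),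
    div_div_eq_mul_div, show q * μ / (t 1 * t 6) * z = q * (μ * z) / (t 1 * t 6) by ring]

lemma barnesPolar_eq_normCurveInt (hq0 : q ≠ 0) (hq : ‖q‖ < 1) {μ : ℂ} (hμ : μ ≠ 0)
    {t : Fin 8 → ℂ} (ht : t ∈ balancedSet) {γ : ℝ → ℂ} (hγ : IsBarnesContour q t γ) :
    normCurveInt (barnesIntegrand q μ t) γ = (barnesNorm q μ t)⁻¹ * barnesPolar q μ t := by
  have ht0 := balanced_ne_zero ht
  rw [barnesIntegrand_eq, normCurveInt_const_mul, barnesPolar,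
    polarValue_eq_normCurveInt hq0 hq (b := fun j => barnesUp j t) (fun j => ht0 _)
      (isHolFamily_barnesNumerator hq hμ ht0).differentiableAt.self_of_nhds (isBarnesContour_iff.1 hγ)]

/-- The Barnes parameters corresponding to the Euler parameters `e`, with an additional scaling
parameter `v`. -/
def barnesParam (e : Fin 6 → ℂ) (v : ℂ) : Fin 8 → ℂ :=
  ![v / (e 2 * e 3 * e 4), e 5 * v, e 2 / v, e 3 / v, e 4 / v, 1 / (e 0 * e 1 * e 5 * v), e 1 * v,
    e 0 * v]

/-- `barnesParam` inverts the change of variables of the theorem: the Euler parameters formed from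
`barnesParam e v` with the square root v are e, and v² is indeed the product of the coordinates 1,
5, 6, 7. -/
lemma barnesParam_mem {e : Fin 6 → ℂ} {v : ℂ} (he : e ∈ torusSix) (hv : v ≠ 0) :
    barnesParam e v ∈ balancedSet := by
  have := he 0; have := he 1; have := he 2; have := he 3; have := he 4; have := he 5
  simp only [balancedSet, Set.mem_ofPred_eq, Fin.prod_univ_eight, barnesParam, Matrix.cons_val]
  field_simp

/-- A set of parameters for which the integrals are taken over circles. -/
structure EulerRegion (q : ℂ) (e : Fin 6 → ℂ) : Prop where
  ne_zero : e ∈ torusSix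
  norm_lt : ∀ i : Fin 5, ‖e i.succ‖ < 1
  ne : e 1 ≠ e 5
  ne' : e 2 ≠ e 3
  ratio : ‖q‖ * ‖e 1‖ < ‖e 5‖
  ratio_symm : ‖q‖ * ‖e 5‖ < ‖e 1‖
  ratio' : ‖q‖ * ‖e 2‖ < ‖e 3‖
  ratio'_symm : ‖q‖ * ‖e 3‖ < ‖e 2‖
  one_lt : 1 < ‖e 0‖ * ‖e 1‖
  one_lt' : 1 < ‖e 0‖ * ‖e 5‖
  lt_one : ‖q‖ * (‖e 0‖ * ‖e 1‖) < 1
  prod_lt : ‖e 0‖ * (‖e 1‖ * ‖e 2‖ * ‖e 3‖ * ‖e 4‖ * ‖e 5‖) < 1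
  prod_lt' : ‖e 1‖ * (‖e 1‖ * ‖e 2‖ * ‖e 3‖ * ‖e 4‖ * ‖e 5‖) < ‖q‖

lemma isOpen_eulerRegion (q : ℂ) : IsOpen {e | EulerRegion q e} := by
  have : {e | EulerRegion q e} = torusSix ∩ ((⋂ i : Fin 5, {e : Fin 6 → ℂ | ‖e i.succ‖ < 1}) ∩
      {e | e 1 ≠ e 5} ∩ {e | e 2 ≠ e 3} ∩ {e | ‖q‖ * ‖e 1‖ < ‖e 5‖} ∩ {e | ‖q‖ * ‖e 5‖ < ‖e 1‖} ∩
      {e | ‖q‖ * ‖e 2‖ < ‖e 3‖} ∩ {e | ‖q‖ * ‖e 3‖ < ‖e 2‖} ∩ {e | 1 < ‖e 0‖ * ‖e 1‖} ∩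
      {e | 1 < ‖e 0‖ * ‖e 5‖} ∩ {e | ‖q‖ * (‖e 0‖ * ‖e 1‖) < 1} ∩
      {e | ‖e 0‖ * (‖e 1‖ * ‖e 2‖ * ‖e 3‖ * ‖e 4‖ * ‖e 5‖) < 1} ∩
      {e | ‖e 1‖ * (‖e 1‖ * ‖e 2‖ * ‖e 3‖ * ‖e 4‖ * ‖e 5‖) < ‖q‖}) := by
    ext e
    simp only [Set.mem_inter_iff, Set.mem_iInter, Set.mem_ofPred_eq, and_assoc]
    exact ⟨fun h => ⟨h.1, h.2, h.3, h.4, h.5, h.6, h.7, h.8, h.9, h.10, h.11, h.12, h.13⟩,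
      fun ⟨h1, h2, h3, h4, h5, h6, h7, h8, h9, h10, h11, h12, h13⟩ =>
        ⟨h1, h2, h3, h4, h5, h6, h7, h8, h9, h10, h11, h12, h13⟩⟩
  rw [this]
  refine isOpen_torusSix.inter ?_
  repeat' refine IsOpen.inter ?_ ?_
  · exact isOpen_iInter_of_finite fun i => isOpen_lt (by fun_prop) (by fun_prop)
  · exact isOpen_ne_fun (by fun_prop) (by fun_prop)
  · exact isOpen_ne_fun (by fun_prop) (by fun_prop)
  all_goals exact isOpen_lt (by fun_prop) (by fun_prop)

/-- The point is (2/l, 1/2, 1/2, σ/2, ‖q‖/2, σ/2) with ‖q‖ < l < σ < 1. Then ‖e₀e₁‖ = 1/l and ‖e₀e₅‖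
= σ/l exceed 1 while ‖q‖/l < 1, and the small e₄ bounds the full products. The pairs (e₁, e₅) and
(e₂, e₃) have ratio σ and play the roles of a1, a2 in the Barnes–Euler relation and in Rahman's
integral. -/
lemma exists_eulerRegion (hq0 : q ≠ 0) (hq : ‖q‖ < 1) : ∃ e, EulerRegion q e := by
  have hqp := norm_pos_iff.2 hq0
  obtain ⟨l, hl, hl1⟩ := exists_between hq
  obtain ⟨σ, hσ, hσ1⟩ := exists_between hl1
  have hl0 : 0 < l := hqp.trans hl
  have hσ0 : 0 < σ := hl0.trans hσ
  have n : ∀ x : ℝ, 0 < x → ‖(x : ℂ)‖ = x := fun x hx => by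
    rw [Complex.norm_real, Real.norm_of_nonneg hx.le]
  have n0 := n (2 / l) (by positivity)
  have n1 := n (1 / 2) (by norm_num)
  have n3 := n (σ / 2) (by positivity)
  have n4 := n (‖q‖ / 2) (by positivity)
  obtain ⟨e, he⟩ : ∃ e : Fin 6 → ℂ, e = ![((2 / l : ℝ) : ℂ), ((1 / 2 : ℝ) : ℂ), ((1 / 2 : ℝ) : ℂ),
    ((σ / 2 : ℝ) : ℂ), ((‖q‖ / 2 : ℝ) : ℂ), ((σ / 2 : ℝ) : ℂ)] := ⟨_, rfl⟩
  have e0 : ‖e 0‖ = 2 / l := by rw [he]; exact n0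
  have e1 : ‖e 1‖ = 1 / 2 := by rw [he]; exact n1
  have e2 : ‖e 2‖ = 1 / 2 := by rw [he]; exact n1
  have e3 : ‖e 3‖ = σ / 2 := by rw [he]; exact n3
  have e4 : ‖e 4‖ = ‖q‖ / 2 := by rw [he]; exact n4
  have e5 : ‖e 5‖ = σ / 2 := by rw [he]; exact n3
  have hqσ : ‖q‖ * σ < 1 := by nlinarith
  have hσσ : σ * σ < 1 := by nlinarith
  have hqσσ : ‖q‖ * (σ * σ) < ‖q‖ := by nlinarith
  refine ⟨e, ?_, ?_, ?_, ?_, ?_, ?_, ?_, ?_, ?_, ?_, ?_, ?_, ?_⟩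
  · intro j
    rw [← norm_pos_iff]
    fin_cases j
    · change 0 < ‖e 0‖; rw [e0]; positivity
    · change 0 < ‖e 1‖; rw [e1]; positivity
    · change 0 < ‖e 2‖; rw [e2]; positivity
    · change 0 < ‖e 3‖; rw [e3]; positivity
    · change 0 < ‖e 4‖; rw [e4]; positivity
    · change 0 < ‖e 5‖; rw [e5]; positivity
  · intro j
    fin_cases j
    · change ‖e 1‖ < 1; rw [e1]; norm_num
    · change ‖e 2‖ < 1; rw [e2]; norm_num
    · change ‖e 3‖ < 1; rw [e3]; linarith
    · change ‖e 4‖ < 1; rw [e4]; linarith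
    · change ‖e 5‖ < 1; rw [e5]; linarith
  · intro h; rw [h, e5] at e1; linarith
  · intro h; rw [h, e3] at e2; linarith
  · rw [e1, e5]; linarith
  · rw [e1, e5]; linarith
  · rw [e2, e3]; linarith
  · rw [e2, e3]; linarith
  · rw [e0, e1, div_mul_eq_mul_div, lt_div_iff₀ hl0]; linarith
  · rw [e0, e5, div_mul_eq_mul_div, lt_div_iff₀ hl0]; linarith
  · rw [e0, e1, show ‖q‖ * (2 / l * (1 / 2)) = ‖q‖ / l by ring, div_lt_one hl0]; exact hl
  · rw [e0, e1, e2, e3, e4, e5, div_mul_eq_mul_div, div_lt_one hl0]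
    nlinarith
  · rw [e1, e2, e3, e4, e5]
    nlinarith

variable {e : Fin 6 → ℂ} {v : ℂ}

/-- The substitution z = vw removes the scaling parameter v and replaces μ by μ/v, which leads to
`barnesCircle_eq_eulerCircle` with u = 1/e₀, a1 = e₁, a2 = e₅. -/
lemma EulerRegion.barnesPolar_eq (h : EulerRegion q e) (hq0 : q ≠ 0) (hq : ‖q‖ < 1) (hv : v ≠ 0) :
    (∃ γ, IsBarnesContour q (barnesParam e v) γ) ∧ ∀ μ : ℂ, μ ≠ 0 →
    2 * (qPochInf q (1 / (e 0 * e 1)) * qPochInf q (1 / (e 0 * e 5))) *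
      barnesPolar q μ (barnesParam e v) = barnesNorm q μ (barnesParam e v) *
      (qPochInf q (e 2 * e 3) * qPochInf q (e 2 * e 4) * qPochInf q (e 3 * e 4) *
      qPochInf q (e 1 * e 5)) * eulerCircle q (e 0)⁻¹ (e 1) (e 5) (e 2) (e 3) (e 4) := by
  have h0 := h.ne_zero 0
  have h1 := h.ne_zero 1
  have h2 := h.ne_zero 2
  have h3 := h.ne_zero 3
  have h4 := h.ne_zero 4
  have h5 := h.ne_zero 5
  have p0 := norm_pos_iff.2 h0
  have p1 := norm_pos_iff.2 h1
  have p5 := norm_pos_iff.2 h5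
  have pv := norm_pos_iff.2 hv
  -- In the variable w = z/v, the decreasing sequences start at e₁ and e₅, the increasing ones at
  -- 1/e₂, 1/e₃, 1/e₄ and e₀e₁e₅. The inequalities ‖e₀e₁‖ > 1 and ‖e₀e₅‖ > 1 leave room for a
  -- separating circle.
  obtain ⟨ρ, hρ1, hρ2⟩ : ∃ ρ, max ‖e 1‖ ‖e 5‖ < ρ ∧ ρ < min 1 (‖e 0‖ * ‖e 1‖ * ‖e 5‖) := by
    refine exists_between (lt_min (max_lt (h.norm_lt 0) (h.norm_lt 4)) (max_lt ?_ ?_))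
    · nlinarith [h.one_lt']
    · nlinarith [h.one_lt]
  rw [max_lt_iff] at hρ1
  rw [lt_min_iff] at hρ2
  have hρ : 0 < ρ := p1.trans hρ1.1
  have hr : 0 < ‖v‖ * ρ := by positivity
  have hb := barnesParam_mem h.ne_zero hv
  have hu : ‖(e 0)⁻¹ / (e 1 * e 5)‖ * ρ < 1 := by
    rw [norm_div, norm_inv, norm_mul, inv_eq_one_div, div_div, div_mul_eq_mul_div, one_mul, div_lt_one (by positivity)]
    linarith [hρ2.2]
  have hγ : IsBarnesContour q (barnesParam e v) (circleCurve (‖v‖ * ρ)) := by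
    refine isBarnesContour_iff.2 (isSeparatingContour_circleCurve hr
      (norm_lt_of_mem_downSet hq fun i => ?_)
      (lt_norm_of_mem_upSet hq0 hq (fun j => balanced_ne_zero hb _) hr fun j => ?_))
    · fin_cases i
      · change ‖e 5 * v‖ < _
        rw [norm_mul, mul_comm]; exact mul_lt_mul_of_pos_left hρ1.2 pv
      · change ‖e 1 * v‖ < _
        rw [norm_mul, mul_comm]; exact mul_lt_mul_of_pos_left hρ1.1 pv
    · have key : ∀ x : ℂ, ‖x‖ < 1 → ‖x / v‖ * (‖v‖ * ρ) < 1 := fun x hx => by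
        rw [norm_div, div_mul_eq_mul_div, ← mul_assoc, mul_right_comm, mul_div_assoc,
          div_self pv.ne', mul_one]
        nlinarith [norm_nonneg x]
      fin_cases j
      · exact key _ (h.norm_lt 1)
      · exact key _ (h.norm_lt 2)
      · exact key _ (h.norm_lt 3)
      · change ‖1 / (e 0 * e 1 * e 5 * v)‖ * (‖v‖ * ρ) < 1
        have : ‖1 / (e 0 * e 1 * e 5 * v)‖ * (‖v‖ * ρ) = ‖(e 0)⁻¹ / (e 1 * e 5)‖ * ρ := by
          simp only [norm_div, norm_mul, norm_inv, norm_one]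
          field_simp
        rw [this]; exact hu
  refine ⟨⟨_, hγ⟩, fun μ hμ => ?_⟩
  have hμv : μ / v ≠ 0 := div_ne_zero hμ hv
  have key := barnesCircle_eq_eulerCircle hq0 hq (u := (e 0)⁻¹) hμv h1 h5 hρ1.1 hρ1.2 h.ne h.ratio
    h.ratio_symm hρ2.1 (h.norm_lt 1) (h.norm_lt 2) (h.norm_lt 3) hu
  have e1 : barnesPolar q μ (barnesParam e v) =
      barnesCircle q (μ / v) ρ (e 0)⁻¹ (e 1) (e 5) (e 2) (e 3) (e 4) := by
    rw [barnesPolar, polarValue_eq_normCurveInt hq0 hq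
      (b := fun j => barnesUp j (barnesParam e v)) (fun j => balanced_ne_zero hb _)
      (isHolFamily_barnesNumerator hq hμ (balanced_ne_zero hb)).differentiableAt.self_of_nhds
      (isBarnesContour_iff.1 hγ), normCurveInt_circleCurve hr, circleAverage_smul_arg, barnesCircle]
    refine circleAverage_congr_on hρ fun w hw => ?_
    have hw0 : w ≠ 0 := norm_pos_iff.1 (by rw [hw]; exact hρ)
    rw [polarIntegrand, Fin.prod_univ_two, Fin.prod_univ_four]
    simp only [barnesNumerator, barnesDown, barnesUp, barnesParam, Matrix.cons_val, barnesTheta]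
    rw [show e 5 * v * (e 1 * v) / (μ * (v * w)) = e 1 * e 5 / (μ / v * w) by field_simp,
      show v * w / μ = w / (μ / v) by field_simp,
      show v * w / (v / (e 2 * e 3 * e 4)) = e 2 * e 3 * e 4 * w by field_simp,
      show v * w / (e 0 * v) = (e 0)⁻¹ * w by field_simp,
      show e 5 * v / (v * w) = e 5 / w by field_simp,
      show e 1 * v / (v * w) = e 1 / w by field_simp,
      show e 2 / v * (v * w) = e 2 * w by field_simp,
      show e 3 / v * (v * w) = e 3 * w by field_simp,
      show e 4 / v * (v * w) = e 4 * w by field_simp,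
      show 1 / (e 0 * e 1 * e 5 * v) * (v * w) = (e 0)⁻¹ / (e 1 * e 5) * w by field_simp]
    simp only [div_eq_mul_inv, mul_inv]
    ring
  have e2 : barnesNorm q μ (barnesParam e v) = qTheta q (e 1 / (μ / v)) * qTheta q (e 5 / (μ / v)) := by
    simp only [barnesNorm, barnesParam, Matrix.cons_val, div_div_eq_mul_div]
    ring
  rw [e1, e2]
  rw [show (e 0)⁻¹ / e 1 = 1 / (e 0 * e 1) by field_simp,
    show (e 0)⁻¹ / e 5 = 1 / (e 0 * e 5) by field_simp] at key
  exact key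

end Region

/-! ### Identities between the integrals in a region of the parameters -/

section RegionIdentities

open Real (circleAverage)

variable {q : ℂ} {e : Fin 6 → ℂ} {v : ℂ}

lemma qTheta_ne_zero (hq : ‖q‖ < 1) {z : ℂ} (h1 : ∀ n : ℕ, z * q ^ n ≠ 1)
    (h2 : ∀ n : ℕ, q / z * q ^ n ≠ 1) : qTheta q z ≠ 0 := by
  rw [qTheta_eq]
  exact mul_ne_zero (qPochInf_ne_zero hq h1) (qPochInf_ne_zero hq h2)

/-- For fixed a and b the forbidden values of μ form a countable set. -/
lemma exists_qTheta_ne_zero (hq0 : q ≠ 0) (hq : ‖q‖ < 1) {a b : ℂ} (ha : a ≠ 0) (hb : b ≠ 0) :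
    ∃ μ : ℂ, μ ≠ 0 ∧ qTheta q (a / μ) ≠ 0 ∧ qTheta q (b / μ) ≠ 0 := by
  have hcount : (insert 0 ((Set.range fun n : ℕ => a * q ^ n) ∪ (Set.range fun n : ℕ => b * q ^ n) ∪
      ((Set.range fun n : ℕ => a / (q * q ^ n)) ∪ Set.range fun n : ℕ => b / (q * q ^ n)))).Countable :=
    (((Set.countable_range _).union (Set.countable_range _)).union
      ((Set.countable_range _).union (Set.countable_range _))).insert 0
  obtain ⟨μ, hμ⟩ := (hcount.dense_compl ℂ).nonempty
  simp only [Set.mem_compl_iff, Set.mem_insert_iff, Set.mem_union, Set.mem_range, not_or,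
    not_exists] at hμ
  obtain ⟨h0, ⟨h1, h2⟩, h3, h4⟩ := hμ
  have key : ∀ c : ℂ, c ≠ 0 → (∀ n : ℕ, ¬c * q ^ n = μ) → (∀ n : ℕ, ¬c / (q * q ^ n) = μ) →
      qTheta q (c / μ) ≠ 0 := by
    refine fun c hc h h' => qTheta_ne_zero hq (fun n hn => h n ?_) fun n hn => h' n ?_
    · rw [div_mul_eq_mul_div, div_eq_one_iff_eq h0] at hn; exact hn
    · have hqn : q * q ^ n ≠ 0 := mul_ne_zero hq0 (pow_ne_zero _ hq0)
      rw [div_eq_iff hqn]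
      field_simp at hn
      linear_combination -hn
  exact ⟨μ, h0, key a ha h1 h3, key b hb h2 h4⟩

lemma EulerRegion.poch_ne_zero (h : EulerRegion q e) (hq : ‖q‖ < 1) :
    qPochInf q (1 / (e 0 * e 1)) ≠ 0 ∧ qPochInf q (1 / (e 0 * e 5)) ≠ 0 ∧
    qPochInf q (e 0 * (e 1 * e 2 * e 3 * e 4 * e 5)) ≠ 0 ∧
    (∀ i j : Fin 5, qPochInf q (e i.succ * e j.succ) ≠ 0) := by
  have hn := fun {a} => qPochInf_ne_zero_of_norm_lt_one hq (a := a)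
  refine ⟨hn ?_, hn ?_, hn ?_, fun i j => hn ?_⟩
  · rw [norm_div, norm_mul, norm_one, div_lt_one (by linarith [h.one_lt])]; exact h.one_lt
  · rw [norm_div, norm_mul, norm_one, div_lt_one (by linarith [h.one_lt'])]; exact h.one_lt'
  · simp only [norm_mul]; exact h.prod_lt
  · rw [norm_mul]
    nlinarith [h.norm_lt i, h.norm_lt j, norm_nonneg (e i.succ), norm_nonneg (e j.succ)]

/-- An admissible μ is chosen, the integral is taken over the contour of `barnesPolar_eq`, and the
normalization by theta functions cancels. -/
lemma EulerRegion.barnes_eq (h : EulerRegion q e) (hq0 : q ≠ 0) (hq : ‖q‖ < 1) (hv : v ≠ 0)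
    {B : (Fin 8 → ℂ) → ℂ} (hB : IsTrigBarnes q B) {E : (Fin 6 → ℂ) → ℂ} (hE : IsTrigEuler q E) :
    qPochInf q (1 / (e 0 * e 1)) * qPochInf q (1 / (e 0 * e 5)) * B (barnesParam e v) =
      qPochInf q (e 2 * e 3) * qPochInf q (e 2 * e 4) * qPochInf q (e 3 * e 4) *
      qPochInf q (e 1 * e 5) * E e := by
  obtain ⟨⟨γ, hγ⟩, hp⟩ := h.barnesPolar_eq hq0 hq hv
  have hb := barnesParam_mem h.ne_zero hv
  have hb0 := balanced_ne_zero hb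
  obtain ⟨μ, hμ, h1, h6⟩ := exists_qTheta_ne_zero hq0 hq (hb0 1) (hb0 6)
  have hN : barnesNorm q μ (barnesParam e v) ≠ 0 := mul_ne_zero h1 h6
  have key := hp μ hμ
  rw [hB.eq_integral _ hb μ hμ h1 h6 γ hγ, barnesPolar_eq_normCurveInt hq0 hq hμ hb hγ,
    hE.eq_eulerCircle hq0 hq h.ne_zero h.norm_lt]
  have e1 : eulerCircle q (e 0)⁻¹ (e 1) (e 5) (e 2) (e 3) (e 4) =
      eulerCircle q (e 0)⁻¹ (e 1) (e 2) (e 3) (e 4) (e 5) := by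
    unfold eulerCircle
    congr 1; funext z; congr 1; ring
  rw [e1] at key
  refine mul_left_cancel₀ hN ?_
  rw [show ∀ P1 P2 N X : ℂ, N * (P1 * P2 * (2 * (N⁻¹ * X))) = (N * N⁻¹) * (2 * (P1 * P2) * X) from
    fun _ _ _ _ => by ring, mul_inv_cancel₀ hN, one_mul, key]
  ring

lemma EulerRegion.hasSum_wpTerm (h : EulerRegion q e) (hq0 : q ≠ 0) (hq : ‖q‖ < 1)
    {E : (Fin 6 → ℂ) → ℂ} (hE : IsTrigEuler q E) {T : ℂ} (hT : T = e 1 * e 2 * e 3 * e 4 * e 5) :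
    HasSum (fun k => 2 * (qPochInf q (1 / (e 0 * e 1)) * qPochInf q (e 0 * T)) *
      wpTerm q (e 1 * T) (e 1 * e 2) (e 1 * e 3) (e 1 * e 4) (e 1 * e 5) (e 0 * T) (1 / (e 0 * e 1)) k)
    (qPochInf q q * qPochInf q (e 1 * T) * (qPochInf q (e 2 * e 3) * qPochInf q (e 2 * e 4) *
      qPochInf q (e 2 * e 5) * qPochInf q (e 3 * e 4) * qPochInf q (e 3 * e 5) *
      qPochInf q (e 4 * e 5)) * E e) := by
  have h0 := h.ne_zero 0
  have h1 := h.ne_zero 1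
  have p0 := norm_pos_iff.2 h0
  have e1 : e 0 * T = T / (e 0)⁻¹ := by rw [div_inv_eq_mul, mul_comm]
  have e2 : 1 / (e 0 * e 1) = (e 0)⁻¹ / e 1 := by field_simp
  have hTn := h.poch_ne_zero hq
  rw [e1, e2, hE.eq_eulerCircle hq0 hq h.ne_zero h.norm_lt]
  refine nassrallahRahman_circle hq0 hq hT h1 (h.ne_zero 4) (h.ne_zero 5) (inv_ne_zero h0)
    (h.norm_lt 0) (h.norm_lt 1) (h.norm_lt 2) h.ne' h.ratio' h.ratio'_symm (h.norm_lt 3)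
    (h.norm_lt 4) ?_ ?_
  · rw [norm_inv, inv_lt_iff_one_lt_mul₀ p0, mul_comm]; exact h.one_lt
  · rw [← e1, hT]; exact hTn.2.2.1

/-- All the conditions hold strictly at r = α except α < r itself, so they persist for r slightly
larger than α. -/
lemma exists_radius {α Q : ℝ} {ι : Type*} [Finite ι] {β : ι → ℝ} (h0 : 0 < α) (hQ : Q < 1)
    (h1 : α * α < Q) (hβ : ∀ i, β i * α < 1) :
    ∃ r, α < r ∧ Q * r < α ∧ α * r < Q ∧ ∀ i, β i * r < 1 := by
  have t1 : ∀ᶠ r in 𝓝 α, Q * r < α := by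
    have : Continuous fun r : ℝ => Q * r := by fun_prop
    exact (this.tendsto α).eventually (gt_mem_nhds (by nlinarith))
  have t2 : ∀ᶠ r in 𝓝 α, α * r < Q := by
    have : Continuous fun r : ℝ => α * r := by fun_prop
    exact (this.tendsto α).eventually (gt_mem_nhds h1)
  have t3 : ∀ᶠ r in 𝓝 α, ∀ i, β i * r < 1 := eventually_all.2 fun i => by
    have : Continuous fun r : ℝ => β i * r := by fun_prop
    exact (this.tendsto α).eventually (gt_mem_nhds (hβ i))
  have t4 : ∀ᶠ r in 𝓝[>] α, α < r := self_mem_nhdsWithin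
  obtain ⟨r, hr, h⟩ := (t4.and (nhdsWithin_le_nhds (t1.and (t2.and t3)))).exists
  exact ⟨r, hr, h⟩

/-- Under the relations between τ and e, the residue series of V and the Nassrallah–Rahman series of
E have the same base, the same five parameters and the same argument, so uniqueness of the sum gives
the identity. -/
lemma EulerRegion.trigV_eq (h : EulerRegion q e) (hq0 : q ≠ 0) (hq : ‖q‖ < 1)
    {E V : (Fin 6 → ℂ) → ℂ} (hE : IsTrigEuler q E) (hV : IsTrigV q V) {T : ℂ}
    (hT : T = e 1 * e 2 * e 3 * e 4 * e 5) {τ : Fin 6 → ℂ} (hτ : τ ∈ torusSix)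
    (r0 : τ 0 * τ 0 = e 1 * T) (r1 : τ 0 * τ 1 = e 1 * e 2) (r2 : τ 0 * τ 2 = e 1 * e 3)
    (r3 : τ 0 * τ 3 = e 1 * e 4) (r4 : τ 0 * τ 4 = e 1 * e 5) (r5 : τ 0 * τ 5 = e 0 * T) :
    qPochInf q (1 / (e 0 * e 1)) * qPochInf q (e 0 * T) * V τ =
      qPochInf q (e 2 * e 3) * qPochInf q (e 2 * e 4) *
      qPochInf q (e 2 * e 5) * qPochInf q (e 3 * e 4) * qPochInf q (e 3 * e 5) *
      qPochInf q (e 4 * e 5) * E e := by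
  have p0 := norm_pos_iff.2 (hτ 0)
  have pe0 := norm_pos_iff.2 (h.ne_zero 0)
  have pe1 := norm_pos_iff.2 (h.ne_zero 1)
  have hqp := norm_pos_iff.2 hq0
  have hT0 : T ≠ 0 := by
    rw [hT]
    have := h.ne_zero 1; have := h.ne_zero 2; have := h.ne_zero 3
    have := h.ne_zero 4; have := h.ne_zero 5
    simp [*]
  have hTn : ‖T‖ = ‖e 1‖ * ‖e 2‖ * ‖e 3‖ * ‖e 4‖ * ‖e 5‖ := by rw [hT]; simp only [norm_mul]
  -- Multiplying the five relations for τ₀τ_j and dividing by τ₀⁴ = (e₁T)². Thus the argument 1/(τ₀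
  -- ⋯ τ₅) of the residue series is the Nassrallah–Rahman argument 1/(e₀e₁).
  have hprod : τ 0 * (τ 1 * τ 2 * τ 3 * τ 4 * τ 5) = e 0 * e 1 := by
    have h1 : (τ 0 * τ 0) * (τ 0 * τ 0) * (τ 0 * (τ 1 * τ 2 * τ 3 * τ 4 * τ 5)) =
        (τ 0 * τ 1) * (τ 0 * τ 2) * (τ 0 * τ 3) * (τ 0 * τ 4) * (τ 0 * τ 5) := by ring
    rw [r0, r1, r2, r3, r4, r5] at h1
    have h2 : e 1 * T * (e 1 * T) ≠ 0 := by
      have := mul_ne_zero (h.ne_zero 1) hT0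
      exact mul_ne_zero this this
    refine mul_left_cancel₀ h2 (h1.trans ?_)
    linear_combination -(e 0 * e 1 * e 1 * e 1 * T) * hT
  have hlt : ∀ i j : Fin 5, ‖e i.succ * e j.succ‖ < 1 := fun i j => by
    rw [norm_mul]
    nlinarith [h.norm_lt i, h.norm_lt j, norm_nonneg (e i.succ), norm_nonneg (e j.succ)]
  have hα : ‖τ 0‖ * ‖τ 0‖ < ‖q‖ := by
    rw [← norm_mul, r0, norm_mul, hTn]; exact h.prod_lt'
  have hβ : ∀ i : Fin 5, ‖τ i.succ‖ * ‖τ 0‖ < 1 := fun i => by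
    rw [← norm_mul, mul_comm]
    fin_cases i
    · change ‖τ 0 * τ 1‖ < 1; rw [r1]; exact hlt 0 1
    · change ‖τ 0 * τ 2‖ < 1; rw [r2]; exact hlt 0 2
    · change ‖τ 0 * τ 3‖ < 1; rw [r3]; exact hlt 0 3
    · change ‖τ 0 * τ 4‖ < 1; rw [r4]; exact hlt 0 4
    · change ‖τ 0 * τ 5‖ < 1; rw [r5, norm_mul, hTn]; exact h.prod_lt
  obtain ⟨r, hr1, hr2, hr3, hr4⟩ := exists_radius p0 hq hα hβ
  have hB : 1 < ‖τ 0 * (τ 1 * τ 2 * τ 3 * τ 4 * τ 5)‖ := by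
    rw [hprod, norm_mul]; exact h.one_lt
  have hθ : qTheta q (q * τ 0 * (τ 1 * τ 2 * τ 3 * τ 4 * τ 5)) ≠ 0 := by
    rw [mul_assoc, hprod]
    refine qTheta_ne_zero_of_annulus hq ?_ ?_
    · rw [norm_mul, norm_mul]; nlinarith [h.one_lt]
    · rw [norm_mul, norm_mul]; exact h.lt_one
  have hs := hasSum_vForm hq0 hq (hτ 0) (hτ 1) (hτ 2) (hτ 3) (hτ 4) (hτ 5) hr1 hr2 hr3 (hr4 0) (hr4 1)
    (hr4 2) (hr4 3) (hr4 4) hB hθ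
  have hVe := hV.eq_circleAverage hq0 hq hτ hr1 hr3 hr4 hθ
  rw [hprod, r0, r1, r2, r3, r4, r5] at hs
  have hs' := (hs.mul_left (2 * (qPochInf q (1 / (e 0 * e 1)) * qPochInf q (e 0 * T)))).unique
    (h.hasSum_wpTerm hq0 hq hE hT)
  have hne : qPochInf q q * qPochInf q (e 1 * T) ≠ 0 := by
    refine mul_ne_zero (qPochInf_self_ne_zero hq) (qPochInf_ne_zero_of_norm_lt_one hq ?_)
    rw [norm_mul, hTn]; linarith [h.prod_lt']
  refine mul_left_cancel₀ hne ?_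
  rw [hVe]
  linear_combination hs'

/-! #### Logarithmic coordinates for the parameters -/

/-- The logarithm of the shift in the Euler parameters. -/
def eulerShift (y : Fin 7 → ℂ) : ℂ := -(y 0 + y 2 + y 3 + y 4) / 2

/-- The logarithms of the Euler parameters. -/
def eulerLog (y : Fin 7 → ℂ) : Fin 6 → ℂ :=
  ![-∑ j, y j - eulerShift y, y 6 - eulerShift y, y 2 + eulerShift y, y 3 + eulerShift y,
    y 4 + eulerShift y, y 1 - eulerShift y]

/-- A right inverse of `eulerLog`. -/
def eulerLogInv (w : Fin 6 → ℂ) : Fin 7 → ℂ :=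
  ![-(w 2 + w 3 + w 4), w 5, w 2, w 3, w 4, -(w 0 + w 1 + w 5), w 1]

/-- The logarithm of the shift in the parameters of `V`. -/
def vShift (y : Fin 7 → ℂ) : ℂ := -(y 1 + y 2 + y 3 + y 4) / 2

/-- The logarithms of the parameters of `V`. -/
def vLog (y : Fin 7 → ℂ) : Fin 6 → ℂ :=
  ![y 6 - vShift y, y 2 + vShift y, y 3 + vShift y, y 4 + vShift y, y 0 - vShift y,
    -∑ j, y j - vShift y]

/-- A right inverse of `vLog`. -/
def vLogInv (w : Fin 6 → ℂ) : Fin 7 → ℂ :=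
  ![w 4, -(w 1 + w 2 + w 3), w 1, w 2, w 3, -(w 4 + w 0 + w 5), w 0]

/-- The points produced by `eulerLogInv` have zero shift, so the six coordinates can be prescribed
directly. The same holds for `vLogInv`. -/
lemma eulerLog_add (y : Fin 7 → ℂ) (w : Fin 6 → ℂ) :
    eulerLog (y + eulerLogInv w) = eulerLog y + w := by
  funext j
  fin_cases j <;>
    simp [eulerLog, eulerLogInv, eulerShift, Fin.sum_univ_seven] <;> ring

lemma vLog_add (y : Fin 7 → ℂ) (w : Fin 6 → ℂ) :
    vLog (y + vLogInv w) = vLog y + w := by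
  funext j
  fin_cases j <;>
    simp [vLog, vLogInv, vShift, Fin.sum_univ_seven] <;> ring

lemma isOpenChart_eulerLog : IsOpenChart (fun y => expMap (eulerLog y)) Set.univ torusSix := by
  refine isOpenChart_exp_comp (R := eulerLogInv) (fun y => ?_) ?_ ?_ eulerLog_add
  · rw [analyticAt_pi_iff]
    have h := fun j => analyticAt_apply (n := 7) j y
    intro j
    have hs : AnalyticAt ℂ eulerShift y :=
      ((((h 0).add (h 2)).add (h 3)).add (h 4)).neg.div_const
    have hsum : AnalyticAt ℂ (fun y : Fin 7 → ℂ => -∑ j, y j) y :=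
      (Finset.analyticAt_fun_sum _ fun i _ => h i).neg
    fin_cases j
    exacts [hsum.sub hs, (h 6).sub hs, (h 2).add hs, (h 3).add hs, (h 4).add hs, (h 1).sub hs]
  · refine continuous_pi fun j => ?_
    fin_cases j <;> simp [eulerLogInv] <;> fun_prop
  · funext j
    fin_cases j <;> simp [eulerLogInv]

lemma isOpenChart_vLog : IsOpenChart (fun y => expMap (vLog y)) Set.univ torusSix := by
  refine isOpenChart_exp_comp (R := vLogInv) (fun y => ?_) ?_ ?_ vLog_add
  · rw [analyticAt_pi_iff]
    have h := fun j => analyticAt_apply (n := 7) j y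
    intro j
    have hs : AnalyticAt ℂ vShift y :=
      ((((h 1).add (h 2)).add (h 3)).add (h 4)).neg.div_const
    have hsum : AnalyticAt ℂ (fun y : Fin 7 → ℂ => -∑ j, y j) y :=
      (Finset.analyticAt_fun_sum _ fun i _ => h i).neg
    fin_cases j
    exacts [(h 6).sub hs, (h 2).add hs, (h 3).add hs, (h 4).add hs, (h 0).sub hs, hsum.sub hs]
  · refine continuous_pi fun j => ?_
    fin_cases j <;> simp [vLogInv] <;> fun_prop
  · funext j
    fin_cases j <;> simp [vLogInv]

lemma balancedExp_eq (y : Fin 7 → ℂ) : balancedExp y =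
    ![Complex.exp (y 0), Complex.exp (y 1), Complex.exp (y 2), Complex.exp (y 3), Complex.exp (y 4),
      Complex.exp (y 5), Complex.exp (y 6), Complex.exp (-∑ j, y j)] := by
  funext j
  refine Fin.lastCases ?_ (fun i => ?_) j
  · simp only [balancedExp, Fin.snoc_last]; rfl
  · simp only [balancedExp, Fin.snoc_castSucc, expMap]
    fin_cases i <;> rfl

lemma balancedExp_eq_barnesParam (y : Fin 7 → ℂ) :
    balancedExp y = barnesParam (expMap (eulerLog y)) (Complex.exp (eulerShift y)) := by
  rw [balancedExp_eq]
  funext j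
  fin_cases j <;>
    simp only [barnesParam, expMap, eulerLog, Fin.zero_eta, Fin.mk_one, Fin.reduceFinMk,
      Matrix.cons_val, ← Complex.exp_add, ← Complex.exp_sub, one_div, ← Complex.exp_neg] <;>
    congr 1 <;> simp only [eulerShift, Fin.sum_univ_seven] <;> ring

lemma exists_eventually_eulerRegion (hq0 : q ≠ 0) (hq : ‖q‖ < 1) :
    ∃ y₀ : Fin 7 → ℂ, ∀ᶠ y in 𝓝 y₀, EulerRegion q (expMap (eulerLog y)) := by
  obtain ⟨e, he⟩ := exists_eulerRegion hq0 hq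
  have h1 : expMap (eulerLog (eulerLogInv fun j => Complex.log (e j))) = e := by
    have := eulerLog_add 0 fun j => Complex.log (e j)
    have h0 : eulerLog 0 = 0 := by
      funext j
      fin_cases j <;> simp [eulerLog, eulerShift]
    rw [zero_add, h0, zero_add] at this
    rw [this]
    exact funext fun j => Complex.exp_log (he.ne_zero j)
  refine ⟨eulerLogInv fun j => Complex.log (e j), ?_⟩
  have hc := (isOpenChart_eulerLog.analyticAt (eulerLogInv fun j => Complex.log (e j)) trivial).continuousAt
  refine hc.eventually ((isOpen_eulerRegion q).eventually_mem ?_)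
  change EulerRegion q (expMap (eulerLog (eulerLogInv fun j => Complex.log (e j))))
  rwa [h1]

end RegionIdentities

/-! ### Existence of the Barnes integral -/

section BarnesExistence

variable {q : ℂ}

lemma IsLineMero.of_analyticAt {F : Type*} [NormedAddCommGroup F] [NormedSpace ℂ F] {C : Set F}
    {g : F → ℂ} (hC : IsOpen C) (h : ∀ y ∈ C, AnalyticAt ℂ g y) : IsLineMero g C :=
  IsMeromorphicOnSet.isLineMero hC fun y hy => ⟨g, fun _ => 1, h y hy, analyticAt_const, by
    rw [hC.nhdsWithin_eq hy]
    exact Frequently.of_forall fun _ => one_ne_zero, .of_forall fun _ _ => (div_one _).symm⟩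

/-- The locus of agreement is dense in C, so two functions continuous at a point cannot differ
there. -/
lemma IsLineMero.eq_of_continuousAt {F : Type*} [NormedAddCommGroup F] [NormedSpace ℂ F]
    {C : Set F} {f₁ f₂ : F → ℂ} (hf₁ : IsLineMero f₁ C) (hf₂ : IsLineMero f₂ C)
    (hC : IsPreconnected C) {y₀ : F} (hy₀ : y₀ ∈ C) (h : ∀ᶠ y in 𝓝 y₀, f₁ y = f₂ y) {y : F}
    (hy : y ∈ C) (h₁ : ContinuousAt f₁ y) (h₂ : ContinuousAt f₂ y) : f₁ y = f₂ y := by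
  by_contra hne
  have hev : ∀ᶠ z in 𝓝 y, f₁ z - f₂ z ≠ 0 := (h₁.sub h₂).eventually_ne (sub_ne_zero.2 hne)
  have hcl := hf₁.subset_closure hf₂ hC hy₀ h hy
  obtain ⟨z, hz1, hz2⟩ := (mem_closure_iff_frequently.1 hcl |>.and_eventually hev).exists
  have hz3 : z ∈ {z | f₁ z = f₂ z} := interior_subset hz1
  exact hz2 (sub_eq_zero.2 hz3)

lemma analyticAt_barnesNorm (hq : ‖q‖ < 1) {μ : ℂ} (hμ : μ ≠ 0) {t : Fin 8 → ℂ}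
    (ht : t ∈ balancedSet) : AnalyticAt ℂ (barnesNorm q μ) t := by
  have ht0 := balanced_ne_zero ht
  exact (analyticAt_qTheta hq ((analyticAt_apply 1 t).div_const) (div_ne_zero (ht0 1) hμ)).mul
    (analyticAt_qTheta hq ((analyticAt_apply 6 t).div_const) (div_ne_zero (ht0 6) hμ))

lemma analyticAt_barnesCollision (N : ℕ) (t : Fin 8 → ℂ) :
    AnalyticAt ℂ (fun t => collision q N (fun i => barnesDown i t) fun j => barnesUp j t) t :=
  analyticAt_collision (fun _ => analyticAt_apply _ t) (fun _ => analyticAt_apply _ t) N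

lemma frequently_barnesCollision (hq0 : q ≠ 0) (hq : ‖q‖ < 1) (N : ℕ) {t : Fin 8 → ℂ}
    (ht : t ∈ balancedSet) : ∃ᶠ t in 𝓝[balancedSet] t,
      collision q N (fun i => barnesDown i t) (fun j => barnesUp j t) ≠ 0 := by
  obtain ⟨e, he⟩ := exists_eulerRegion hq0 hq
  obtain ⟨⟨γ, hγ⟩, -⟩ := he.barnesPolar_eq hq0 hq one_ne_zero
  have hb := barnesParam_mem he.ne_zero one_ne_zero
  exact isFullChart_balancedExp.frequently_ne_zero isOpen_univ isPreconnected_univ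
    (fun x _ => analyticAt_barnesCollision N x) hb (collision_ne_zero ((disjoint_sets_iff hq0
      fun j => balanced_ne_zero hb _).1 (disjoint_of_isSeparatingContour
        (isBarnesContour_iff.1 hγ))) N) ht

lemma exists_barnesPolar_eq (hq0 : q ≠ 0) (hq : ‖q‖ < 1) {μ : ℂ} (hμ : μ ≠ 0) {t₀ : Fin 8 → ℂ}
    (ht : t₀ ∈ balancedSet) : ∃ (N : ℕ) (Φ : (Fin 8 → ℂ) → ℂ), AnalyticAt ℂ Φ t₀ ∧ ∀ᶠ t in 𝓝 t₀,
      collision q N (fun i => barnesDown i t) (fun j => barnesUp j t) ≠ 0 →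
        (∀ i j, ∀ n : ℕ, barnesDown i t * barnesUp j t * q ^ n ≠ 1) ∧
        barnesPolar q μ t =
          Φ t / collision q N (fun i => barnesDown i t) fun j => barnesUp j t :=
  exists_polarValue_eq hq0 hq (fun _ => analyticAt_apply _ _) (fun _ => analyticAt_apply _ _)
    (fun _ => balanced_ne_zero ht _) (isHolFamily_barnesNumerator hq hμ (balanced_ne_zero ht))

lemma isMeromorphicOnSet_barnesPolar (hq0 : q ≠ 0) (hq : ‖q‖ < 1) {μ : ℂ} (hμ : μ ≠ 0) :
    IsMeromorphicOnSet (barnesPolar q μ) balancedSet := by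
  intro t ht
  obtain ⟨N, Φ, hΦ, h⟩ := exists_barnesPolar_eq hq0 hq hμ ht
  exact ⟨Φ, _, hΦ, analyticAt_barnesCollision N t, frequently_barnesCollision hq0 hq N ht,
    nhdsWithin_le_nhds (h.mono fun t h1 h2 => (h1 h2).2)⟩

/-- The normalized Barnes integral does not depend on the auxiliary parameter. -/
lemma barnesNorm_mul_barnesPolar_comm (hq0 : q ≠ 0) (hq : ‖q‖ < 1) {μ ν : ℂ} (hμ : μ ≠ 0)
    (hν : ν ≠ 0) {t : Fin 8 → ℂ} (ht : t ∈ balancedSet)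
    (hn : ∀ i j, ∀ n : ℕ, barnesDown i t * barnesUp j t * q ^ n ≠ 1) :
    barnesNorm q ν t * barnesPolar q μ t = barnesNorm q μ t * barnesPolar q ν t := by
  obtain ⟨y, -, rfl⟩ := isFullChart_balancedExp.surj t ht
  have hΨ := fun y => isFullChart_balancedExp.analyticAt y trivial
  have hm := fun y => isFullChart_balancedExp.mapsTo y trivial
  have hmero : ∀ {μ ν : ℂ}, μ ≠ 0 → ν ≠ 0 →
      IsLineMero (fun y => barnesNorm q ν (balancedExp y) * barnesPolar q μ (balancedExp y))
        Set.univ := fun hμ hν =>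
    (IsLineMero.of_analyticAt isOpen_univ fun y _ =>
      (analyticAt_barnesNorm hq hν (hm y)).comp (hΨ y)).mul
      (((isMeromorphicOnSet_barnesPolar hq0 hq hμ).comp isFullChart_balancedExp.isOpenChart
        isOpen_univ).isLineMero isOpen_univ)
  have hcont : ∀ {μ ν : ℂ}, μ ≠ 0 → ν ≠ 0 → ContinuousAt
      (fun y => barnesNorm q ν (balancedExp y) * barnesPolar q μ (balancedExp y)) y := by
    intro μ ν hμ hν
    have h1 : ContinuousAt (barnesPolar q μ) (balancedExp y) := polarValue_continuousAt hq0 hq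
      (fun _ => analyticAt_apply _ _) (fun _ => analyticAt_apply _ _)
      (fun _ => balanced_ne_zero ht _) (isHolFamily_barnesNumerator hq hμ (balanced_ne_zero ht)) hn
    exact ((analyticAt_barnesNorm hq hν ht).continuousAt.comp (hΨ y).continuousAt).mul
      (h1.comp (hΨ y).continuousAt)
  -- In the Euler region the integrals for μ and ν are, up to their normalizations, the same
  -- multiple of one Euler integral; the rest is continuation.
  obtain ⟨y₀, hy₀⟩ := exists_eventually_eulerRegion hq0 hq
  refine (hmero hμ hν).eq_of_continuousAt (hmero hν hμ) isPreconnected_univ (y₀ := y₀) trivial ?_ trivial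
    (hcont hμ hν) (hcont hν hμ)
  filter_upwards [hy₀] with y h
  obtain ⟨-, hp⟩ := h.barnesPolar_eq hq0 hq (Complex.exp_ne_zero (eulerShift y))
  rw [balancedExp_eq_barnesParam]
  have hne := h.poch_ne_zero hq
  refine mul_left_cancel₀ (mul_ne_zero two_ne_zero (mul_ne_zero hne.1 hne.2.1)) ?_
  have h1 := hp μ hμ
  have h2 := hp ν hν
  generalize barnesParam (expMap (eulerLog y)) (Complex.exp (eulerShift y)) = b at h1 h2 ⊢
  linear_combination barnesNorm q ν b * h1 - barnesNorm q μ b * h2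

/-- The Barnes integral, extended meromorphically. -/
def trigBarnes (q : ℂ) (t : Fin 8 → ℂ) : ℂ :=
  Classical.epsilon fun w => ∃ μ : ℂ, μ ≠ 0 ∧ barnesNorm q μ t ≠ 0 ∧
    w = 2 * ((barnesNorm q μ t)⁻¹ * barnesPolar q μ t)

lemma trigBarnes_eq (hq0 : q ≠ 0) (hq : ‖q‖ < 1) {μ : ℂ} (hμ : μ ≠ 0) {t : Fin 8 → ℂ}
    (ht : t ∈ balancedSet) (hN : barnesNorm q μ t ≠ 0)
    (hn : ∀ i j, ∀ n : ℕ, barnesDown i t * barnesUp j t * q ^ n ≠ 1) :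
    trigBarnes q t = 2 * ((barnesNorm q μ t)⁻¹ * barnesPolar q μ t) := by
  obtain ⟨ν, hν, hNν, h⟩ : ∃ ν : ℂ, ν ≠ 0 ∧ barnesNorm q ν t ≠ 0 ∧
      trigBarnes q t = 2 * ((barnesNorm q ν t)⁻¹ * barnesPolar q ν t) :=
    Classical.epsilon_spec (p := fun w => ∃ μ : ℂ, μ ≠ 0 ∧ barnesNorm q μ t ≠ 0 ∧
      w = 2 * ((barnesNorm q μ t)⁻¹ * barnesPolar q μ t)) ⟨_, μ, hμ, hN, rfl⟩
  rw [h]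
  congr 1
  rw [inv_mul_eq_div, inv_mul_eq_div, div_eq_div_iff hNν hN]
  linear_combination barnesNorm_mul_barnesPolar_comm hq0 hq hν hμ ht hn

lemma barnesNorm_neg (μ : ℂ) (t : Fin 8 → ℂ) : barnesNorm q (-μ) (-t) = barnesNorm q μ t := by
  simp [barnesNorm]

lemma barnesPolar_neg (μ : ℂ) (t : Fin 8 → ℂ) : barnesPolar q (-μ) (-t) = barnesPolar q μ t :=
  polarValue_neg fun z => by simp [barnesNumerator, neg_div, div_neg]

lemma isTrigBarnes_trigBarnes (hq0 : q ≠ 0) (hq : ‖q‖ < 1) : IsTrigBarnes q (trigBarnes q) where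
  meromorphic t ht := by
    have ht0 := balanced_ne_zero ht
    -- One μ serves in a neighbourhood of t, although none serves on the whole hypersurface;
    -- independence of μ makes the local quotients fit `trigBarnes`.
    obtain ⟨μ, hμ, h1, h6⟩ := exists_qTheta_ne_zero hq0 hq (ht0 1) (ht0 6)
    have hN : barnesNorm q μ t ≠ 0 := mul_ne_zero h1 h6
    obtain ⟨N, Φ, hΦ, h⟩ := exists_barnesPolar_eq hq0 hq hμ ht
    have han := analyticAt_barnesNorm hq hμ ht
    refine ⟨fun t => 2 * ((barnesNorm q μ t)⁻¹ * Φ t), _,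
      analyticAt_const.mul ((han.inv hN).mul hΦ), analyticAt_barnesCollision N t,
      frequently_barnesCollision hq0 hq N ht, ?_⟩
    filter_upwards [nhdsWithin_le_nhds h, self_mem_nhdsWithin,
      nhdsWithin_le_nhds (han.continuousAt.eventually_ne hN)] with t h1 h2 h3 h4
    rw [trigBarnes_eq hq0 hq hμ h2 h3 (h1 h4).1, (h1 h4).2]
    ring
  even t ht := by
    -- The defining predicates for t and -t correspond under μ ↦ -μ, so the chosen values are equal.
    unfold trigBarnes
    congr 1
    funext w
    refine propext ⟨fun ⟨μ, h1, h2, h3⟩ => ⟨-μ, neg_ne_zero.2 h1, ?_, ?_⟩,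
      fun ⟨μ, h1, h2, h3⟩ => ⟨-μ, neg_ne_zero.2 h1, ?_, ?_⟩⟩
    · rwa [← barnesNorm_neg, neg_neg]
    · rwa [← barnesNorm_neg, ← barnesPolar_neg, neg_neg]
    · rwa [barnesNorm_neg]
    · rwa [barnesNorm_neg, barnesPolar_neg]
  eq_integral t ht μ hμ h1 h6 γ hγ := by
    rw [barnesPolar_eq_normCurveInt hq0 hq hμ ht hγ]
    exact trigBarnes_eq hq0 hq hμ ht (mul_ne_zero h1 h6) ((disjoint_sets_iff hq0
      fun j => balanced_ne_zero ht _).1 (disjoint_of_isSeparatingContour (isBarnesContour_iff.1 hγ)))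

end BarnesExistence

/-! ### Generic identities between the integrals -/

section GenericIdentities

variable {q : ℂ}

lemma IsLineMero.of_div {F : Type*} [NormedAddCommGroup F] [NormedSpace ℂ F] {C : Set F}
    {g h : F → ℂ} (hC : IsOpen C) (hCp : IsPreconnected C) (hg : ∀ y ∈ C, AnalyticAt ℂ g y)
    (hh : ∀ y ∈ C, AnalyticAt ℂ h y) {y₀ : F} (hy₀ : y₀ ∈ C) (h0 : h y₀ ≠ 0) :
    IsLineMero (fun y => g y / h y) C :=
  IsMeromorphicOnSet.isLineMero hC fun y hy => ⟨g, h, hg y hy, hh y hy, by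
    rw [hC.nhdsWithin_eq hy]
    exact frequently_ne_zero_of_preconnected hCp hh hy₀ h0 hy, .of_forall fun _ _ => rfl⟩

lemma analyticAt_qPochInf {E : Type*} [NormedAddCommGroup E] [NormedSpace ℂ E] {t₀ : E}
    (hq : ‖q‖ < 1) {f : E → ℂ} (hf : AnalyticAt ℂ f t₀) :
    AnalyticAt ℂ (fun t => qPochInf q (f t)) t₀ :=
  ((differentiable_qPochInf hq).analyticAt _).comp hf

/-- The factor in the relation between the Barnes and Euler integrals. -/
def eulerFactor (q : ℂ) (t : Fin 8 → ℂ) : ℂ :=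
  qPochs q [1 / (t 0 * t 2), 1 / (t 0 * t 3), 1 / (t 0 * t 4), 1 / (t 5 * t 7)] /
    qPochs q [t 1 * t 5, t 6 * t 5]

/-- The factor in the relation between the integrals `B` and `V`. -/
def vFactor (q : ℂ) (t : Fin 8 → ℂ) : ℂ :=
  qPochs q [1 / (t 0 * t 5), 1 / (t 7 * t 5)] /
    qPochs q [t 1 * t 2, t 1 * t 3, t 1 * t 4, t 5 * t 6]

lemma eulerFactor_barnesParam {e : Fin 6 → ℂ} {v : ℂ} (he : e ∈ torusSix) (hv : v ≠ 0) :
    eulerFactor q (barnesParam e v) =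
      qPochInf q (e 3 * e 4) * qPochInf q (e 2 * e 4) * qPochInf q (e 2 * e 3) *
        qPochInf q (e 1 * e 5) / (qPochInf q (1 / (e 0 * e 1)) * qPochInf q (1 / (e 0 * e 5))) := by
  have := he 0; have := he 1; have := he 2; have := he 3; have := he 4; have := he 5
  simp only [eulerFactor, barnesParam, qPochs, List.map_cons, List.map_nil, List.prod_cons,
    List.prod_nil, mul_one, Matrix.cons_val]
  rw [show 1 / (v / (e 2 * e 3 * e 4) * (e 2 / v)) = e 3 * e 4 by field_simp,
    show 1 / (v / (e 2 * e 3 * e 4) * (e 3 / v)) = e 2 * e 4 by field_simp,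
    show 1 / (v / (e 2 * e 3 * e 4) * (e 4 / v)) = e 2 * e 3 by field_simp,
    show 1 / (1 / (e 0 * e 1 * e 5 * v) * (e 0 * v)) = e 1 * e 5 by field_simp,
    show e 5 * v * (1 / (e 0 * e 1 * e 5 * v)) = 1 / (e 0 * e 1) by field_simp,
    show e 1 * v * (1 / (e 0 * e 1 * e 5 * v)) = 1 / (e 0 * e 5) by field_simp]
  ring

lemma vFactor_barnesParam {e : Fin 6 → ℂ} {v : ℂ} (he : e ∈ torusSix) (hv : v ≠ 0) :
    vFactor q (barnesParam e v) =
      qPochInf q (e 0 * (e 1 * e 2 * e 3 * e 4 * e 5)) * qPochInf q (e 1 * e 5) /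
        (qPochInf q (e 2 * e 5) * qPochInf q (e 3 * e 5) * qPochInf q (e 4 * e 5) *
          qPochInf q (1 / (e 0 * e 5))) := by
  have := he 0; have := he 1; have := he 2; have := he 3; have := he 4; have := he 5
  simp only [vFactor, barnesParam, qPochs, List.map_cons, List.map_nil, List.prod_cons,
    List.prod_nil, mul_one, Matrix.cons_val]
  rw [show 1 / (v / (e 2 * e 3 * e 4) * (1 / (e 0 * e 1 * e 5 * v))) =
      e 0 * (e 1 * e 2 * e 3 * e 4 * e 5) by field_simp,
    show 1 / (e 0 * v * (1 / (e 0 * e 1 * e 5 * v))) = e 1 * e 5 by field_simp,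
    show e 5 * v * (e 2 / v) = e 2 * e 5 by field_simp,
    show e 5 * v * (e 3 / v) = e 3 * e 5 by field_simp,
    show e 5 * v * (e 4 / v) = e 4 * e 5 by field_simp,
    show 1 / (e 0 * e 1 * e 5 * v) * (e 1 * v) = 1 / (e 0 * e 5) by field_simp]
  ring

lemma analyticAt_balancedExp_apply (j : Fin 8) (y : Fin 7 → ℂ) :
    AnalyticAt ℂ (fun y => balancedExp y j) y :=
  (analyticAt_apply j _).comp (isFullChart_balancedExp.analyticAt y trivial)

lemma balancedExp_ne_zero (y : Fin 7 → ℂ) (j : Fin 8) : balancedExp y j ≠ 0 :=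
  balanced_ne_zero (isFullChart_balancedExp.mapsTo y trivial) j

lemma isLineMero_factors (hq0 : q ≠ 0) (hq : ‖q‖ < 1) :
    IsLineMero (fun y => eulerFactor q (balancedExp y)) Set.univ ∧
      IsLineMero (fun y => vFactor q (balancedExp y)) Set.univ := by
  obtain ⟨y₀, hy₀⟩ := exists_eventually_eulerRegion hq0 hq
  have h := hy₀.self_of_nhds
  have hne := h.poch_ne_zero hq
  have a := analyticAt_balancedExp_apply
  have n := balancedExp_ne_zero
  have m : ∀ i j y, AnalyticAt ℂ (fun y => qPochInf q (balancedExp y i * balancedExp y j)) y :=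
    fun i j y => analyticAt_qPochInf hq ((a i y).mul (a j y))
  have d : ∀ i j y, AnalyticAt ℂ (fun y => qPochInf q (1 / (balancedExp y i * balancedExp y j))) y :=
    fun i j y => analyticAt_qPochInf hq
      (analyticAt_const.div ((a i y).mul (a j y)) (mul_ne_zero (n y i) (n y j)))
  have hv : Complex.exp (eulerShift y₀) ≠ 0 := Complex.exp_ne_zero _
  have e0 := h.ne_zero 0; have e1 := h.ne_zero 1; have e5 := h.ne_zero 5
  unfold eulerFactor vFactor
  simp only [qPochs, List.map_cons, List.map_nil, List.prod_cons, List.prod_nil, mul_one]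
  constructor
  · refine IsLineMero.of_div isOpen_univ isPreconnected_univ
      (fun y _ => (d _ _ y).mul ((d _ _ y).mul ((d _ _ y).mul (d _ _ y))))
      (fun y _ => (m _ _ y).mul (m _ _ y)) (y₀ := y₀) trivial ?_
    rw [balancedExp_eq_barnesParam]
    generalize expMap (eulerLog y₀) = e at *
    generalize Complex.exp (eulerShift y₀) = v at *
    simp only [barnesParam, Matrix.cons_val]
    rw [show e 5 * v * (1 / (e 0 * e 1 * e 5 * v)) = 1 / (e 0 * e 1) by field_simp,
      show e 1 * v * (1 / (e 0 * e 1 * e 5 * v)) = 1 / (e 0 * e 5) by field_simp]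
    exact mul_ne_zero hne.1 hne.2.1
  · refine IsLineMero.of_div isOpen_univ isPreconnected_univ
      (fun y _ => (d _ _ y).mul (d _ _ y))
      (fun y _ => (m _ _ y).mul ((m _ _ y).mul ((m _ _ y).mul (m _ _ y)))) (y₀ := y₀) trivial ?_
    rw [balancedExp_eq_barnesParam]
    generalize expMap (eulerLog y₀) = e at *
    generalize Complex.exp (eulerShift y₀) = v at *
    simp only [barnesParam, Matrix.cons_val]
    rw [show e 5 * v * (e 2 / v) = e 5 * e 2 by field_simp,
      show e 5 * v * (e 3 / v) = e 5 * e 3 by field_simp,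
      show e 5 * v * (e 4 / v) = e 5 * e 4 by field_simp,
      show 1 / (e 0 * e 1 * e 5 * v) * (e 1 * v) = 1 / (e 0 * e 5) by field_simp]
    exact mul_ne_zero (hne.2.2.2 4 1) (mul_ne_zero (hne.2.2.2 4 2)
      (mul_ne_zero (hne.2.2.2 4 3) hne.2.1))

lemma balanced_mul_eq {t : Fin 8 → ℂ} (ht : t ∈ balancedSet) :
    t 0 * t 5 * t 6 * t 7 = 1 / (t 1 * t 2 * t 3 * t 4) ∧
      t 1 * t 5 * t 6 * t 7 = 1 / (t 0 * t 2 * t 3 * t 4) := by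
  have h0 := balanced_ne_zero ht
  have h : ∏ j, t j = 1 := ht
  rw [Fin.prod_univ_eight] at h
  have n := fun i j k l => mul_ne_zero (mul_ne_zero (mul_ne_zero (h0 i) (h0 j)) (h0 k)) (h0 l)
  exact ⟨(eq_div_iff (n _ _ _ _)).2 (by rw [← h]; ring),
    (eq_div_iff (n _ _ _ _)).2 (by rw [← h]; ring)⟩

lemma exp_vShift_sq (y : Fin 7 → ℂ) : Complex.exp (vShift y) ^ 2 =
    balancedExp y 0 * balancedExp y 5 * balancedExp y 6 * balancedExp y 7 := by
  rw [(balanced_mul_eq (isFullChart_balancedExp.mapsTo y trivial)).1, balancedExp_eq]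
  simp only [Matrix.cons_val, ← Complex.exp_add, one_div, ← Complex.exp_neg, sq]
  congr 1
  simp only [vShift]
  ring

lemma exp_eulerShift_sq (y : Fin 7 → ℂ) : Complex.exp (eulerShift y) ^ 2 =
    balancedExp y 1 * balancedExp y 5 * balancedExp y 6 * balancedExp y 7 := by
  rw [(balanced_mul_eq (isFullChart_balancedExp.mapsTo y trivial)).2, balancedExp_eq]
  simp only [Matrix.cons_val, ← Complex.exp_add, one_div, ← Complex.exp_neg, sq]
  congr 1
  simp only [eulerShift]
  ring

lemma vArgs_eq (y : Fin 7 → ℂ) (s : ℂ) (hs : s = Complex.exp (vShift y)) :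
    ![balancedExp y 6 / s, balancedExp y 2 * s, balancedExp y 3 * s, balancedExp y 4 * s,
      balancedExp y 0 / s, balancedExp y 7 / s] = expMap (vLog y) := by
  rw [hs, balancedExp_eq]
  simp only [Matrix.cons_val, ← Complex.exp_add, ← Complex.exp_sub]
  funext j
  fin_cases j <;> rfl

lemma eulerArgs_eq (y : Fin 7 → ℂ) (s : ℂ) (hs : s = Complex.exp (eulerShift y)) :
    ![balancedExp y 7 / s, balancedExp y 6 / s, balancedExp y 2 * s, balancedExp y 3 * s,
      balancedExp y 4 * s, balancedExp y 1 / s] = expMap (eulerLog y) := by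
  rw [hs, balancedExp_eq]
  simp only [Matrix.cons_val, ← Complex.exp_add, ← Complex.exp_sub]
  funext j
  fin_cases j <;> rfl

lemma args_neg (a b c d e f s : ℂ) :
    ![a / -s, b * -s, c * -s, d * -s, e / -s, f / -s] = -![a / s, b * s, c * s, d * s, e / s, f / s] := by
  funext j
  fin_cases j <;> simp [div_neg]

lemma args_neg' (a b c d e f s : ℂ) :
    ![a / -s, b / -s, c * -s, d * -s, e * -s, f / -s] = -![a / s, b / s, c * s, d * s, e * s, f / s] := by
  funext j
  fin_cases j <;> simp [div_neg]

/-- The relation between the Barnes and Euler integrals. -/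
theorem genericallyOn_barnes_euler (hq0 : q ≠ 0) (hq : ‖q‖ < 1) {B : (Fin 8 → ℂ) → ℂ}
    {E : (Fin 6 → ℂ) → ℂ} (hB : IsTrigBarnes q B) (hE : IsTrigEuler q E) :
    GenericallyOn balancedSet fun t => ∀ v : ℂ, v ^ 2 = t 1 * t 5 * t 6 * t 7 →
      v ^ 2 = 1 / (t 0 * t 2 * t 3 * t 4) ∧
      B t = eulerFactor q t * E ![t 7 / v, t 6 / v, t 2 * v, t 3 * v, t 4 * v, t 1 / v] := by
  obtain ⟨y₀, hy₀⟩ := exists_eventually_eulerRegion hq0 hq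
  -- In logarithmic coordinates v is the single-valued function exp(`eulerShift`), so both sides are
  -- meromorphic on ℂ^7 and it suffices to compare them near y₀.
  have key : GenericallyOn Set.univ fun y => B (balancedExp y) =
      eulerFactor q (balancedExp y) * E (expMap (eulerLog y)) := by
    refine IsLineMero.genericallyOn_eq (f₁ := fun y => B (balancedExp y))
      ((hB.meromorphic.comp isFullChart_balancedExp.isOpenChart isOpen_univ).isLineMero isOpen_univ)
      ((isLineMero_factors hq0 hq).1.mul
        ((hE.meromorphic.comp isOpenChart_eulerLog isOpen_univ).isLineMero isOpen_univ))
      isPreconnected_univ isOpen_univ (y₀ := y₀) trivial ?_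
    filter_upwards [hy₀] with y h
    have hv := Complex.exp_ne_zero (eulerShift y)
    have h1 := h.barnes_eq hq0 hq hv hB hE
    have hne := h.poch_ne_zero hq
    rw [balancedExp_eq_barnesParam, eulerFactor_barnesParam h.ne_zero hv, div_mul_eq_mul_div,
      eq_div_iff (mul_ne_zero hne.1 hne.2.1)]
    linear_combination h1
  refine isFullChart_balancedExp.genericallyOn isOpen_univ (key.mono fun y _ hy v hv => ?_)
  have hb := (balanced_mul_eq (isFullChart_balancedExp.mapsTo y trivial)).2
  refine ⟨hv.trans hb, ?_⟩
  rw [hy]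
  congr 1
  -- The given v is one of the two square roots; the other choice negates all six arguments, and E
  -- is even.
  rcases sq_eq_sq_iff_eq_or_eq_neg.1 (hv.trans (exp_eulerShift_sq y).symm) with h | h
  · rw [eulerArgs_eq y v h]
  · rw [h, args_neg', eulerArgs_eq y _ rfl, hE.even _ (isOpenChart_eulerLog.mapsTo y trivial)]

/-- The relation between the integrals `B` and `V`. -/
theorem genericallyOn_barnes_v (hq0 : q ≠ 0) (hq : ‖q‖ < 1) {B : (Fin 8 → ℂ) → ℂ}
    {V : (Fin 6 → ℂ) → ℂ} (hB : IsTrigBarnes q B) (hV : IsTrigV q V) :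
    GenericallyOn balancedSet fun t => ∀ s : ℂ, s ^ 2 = t 0 * t 5 * t 6 * t 7 →
      s ^ 2 = 1 / (t 1 * t 2 * t 3 * t 4) ∧
      B t = vFactor q t * V ![t 6 / s, t 2 * s, t 3 * s, t 4 * s, t 0 / s, t 7 / s] := by
  -- B and V are compared through the Euler integral, whose existence has been shown.
  have hE := isTrigEuler_trigEuler hq0 hq
  obtain ⟨y₀, hy₀⟩ := exists_eventually_eulerRegion hq0 hq
  have key : GenericallyOn Set.univ fun y => B (balancedExp y) =
      vFactor q (balancedExp y) * V (expMap (vLog y)) := by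
    refine IsLineMero.genericallyOn_eq (f₁ := fun y => B (balancedExp y))
      ((hB.meromorphic.comp isFullChart_balancedExp.isOpenChart isOpen_univ).isLineMero isOpen_univ)
      ((isLineMero_factors hq0 hq).2.mul
        ((hV.meromorphic.comp isOpenChart_vLog isOpen_univ).isLineMero isOpen_univ))
      isPreconnected_univ isOpen_univ (y₀ := y₀) trivial ?_
    filter_upwards [hy₀] with y h
    have hv := Complex.exp_ne_zero (eulerShift y)
    have h1 := h.barnes_eq hq0 hq hv hB hE
    have h2 := h.trigV_eq hq0 hq hE hV rfl (τ := expMap (vLog y))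
      (isOpenChart_vLog.mapsTo y trivial) ?_ ?_ ?_ ?_ ?_ ?_
    · have hne := h.poch_ne_zero hq
      rw [balancedExp_eq_barnesParam, vFactor_barnesParam h.ne_zero hv, div_mul_eq_mul_div]
      refine (eq_div_iff (mul_ne_zero (mul_ne_zero (mul_ne_zero (hne.2.2.2 1 4) (hne.2.2.2 2 4))
          (hne.2.2.2 3 4)) hne.2.1)).2 ?_
      refine mul_left_cancel₀ hne.1 ?_
      generalize barnesParam (expMap (eulerLog y)) (Complex.exp (eulerShift y)) = b at h1 ⊢
      generalize expMap (eulerLog y) = e at *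
      change _ * (B b * (qPochInf q (e 2 * e 5) * qPochInf q (e 3 * e 5) *
        qPochInf q (e 4 * e 5) * qPochInf q (1 / (e 0 * e 5)))) = _
      linear_combination (qPochInf q (e 2 * e 5) * qPochInf q (e 3 * e 5) *
        qPochInf q (e 4 * e 5)) * h1 - qPochInf q (e 1 * e 5) * h2
    -- The six relations between τ and e are identities between linear forms in the logarithms.
    all_goals
      simp only [expMap, ← Complex.exp_add]
      congr 1
      simp only [vLog, eulerLog, vShift, eulerShift, Matrix.cons_val, Fin.sum_univ_seven]
      ring
  refine isFullChart_balancedExp.genericallyOn isOpen_univ (key.mono fun y _ hy s hs => ?_)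
  have hb := (balanced_mul_eq (isFullChart_balancedExp.mapsTo y trivial)).1
  refine ⟨hs.trans hb, ?_⟩
  rw [hy]
  congr 1
  rcases sq_eq_sq_iff_eq_or_eq_neg.1 (hs.trans (exp_vShift_sq y).symm) with h | h
  · rw [vArgs_eq y s h]
  · rw [h, args_neg, vArgs_eq y _ rfl, hV.even _ (isOpenChart_vLog.mapsTo y trivial)]

end GenericIdentities

/-! ### The Nassrallah–Rahman integral representation -/

section NassrallahRahman

open Metric

variable {q : ℂ}

/-- The terms of the very-well-poised series, multiplied by the infinite products in the
denominators. -/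
def nrTerm (q c : ℂ) (b d : Fin 5 → ℂ) (ζ : ℂ) (k : ℕ) : ℂ :=
  wpCoef q c k * (qFin q q k)⁻¹ * ζ ^ k * ∏ i, (qPochInf q (d i * q ^ k) * qFin q (b i) k)

/-- Multiplying by the products (b_i)_∞ turns 1/(b_i q^k)_∞ into the finite (b_i; q)_k, so the terms
no longer have poles in the b_i. -/
lemma wpTerm_mul_prod (hq : ‖q‖ < 1) {c : ℂ} {b d : Fin 5 → ℂ} (hd : ∀ i, d i = c / b i)
    (hb : ∀ i, qPochInf q (b i) ≠ 0) (ζ : ℂ) (k : ℕ) :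
    wpTerm q c (b 0) (b 1) (b 2) (b 3) (b 4) ζ k * ∏ i, qPochInf q (b i) = nrTerm q c b d ζ k := by
  have key : ∀ i, qPochInf q (d i * q ^ k) * qFin q (b i) k =
      qPochInf q (c / b i * q ^ k) / qPochInf q (b i * q ^ k) * qPochInf q (b i) := fun i => by
    have h := hb i
    have h1 := qPochInf_eq_qFin_mul hq (b i) k
    rw [h1] at h ⊢
    have := right_ne_zero_of_mul h
    rw [hd]
    field_simp
  simp only [wpTerm, nrTerm, key, Fin.prod_univ_five]
  ring

lemma qFin_mul_left (a : ℂ) (n : ℕ) : qFin q a (n + 1) = (1 - a) * qFin q (a * q) n := by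
  unfold qFin
  rw [Finset.prod_range_succ', mul_comm]
  simp only [pow_zero, mul_one, pow_succ', mul_assoc]

lemma qFin_mul_left' (r : ℂ) (n : ℕ) : qFin q (q * r) n * (1 - r) = qFin q r n * (1 - r * q ^ n) := by
  rw [← qFin_succ, qFin_mul_left, mul_comm, mul_comm q]

lemma qFin_mul_wp (a : ℂ) (n : ℕ) :
    qFin q a n * (1 - a * q ^ (2 * n)) = (1 - a) * wpCoef q (a * q) n := by
  cases n with
  | zero => simp [qFin, wpCoef]
  | succ n =>
    rw [qFin_mul_left, wpCoef]
    ring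

lemma qFin_ne_zero (hq : ‖q‖ < 1) {a : ℂ} (h : qPochInf q a ≠ 0) (n : ℕ) : qFin q a n ≠ 0 := by
  rw [qPochInf_eq_qFin_mul hq a n] at h
  exact left_ne_zero_of_mul h

/-- The quotient (qr, -qr)_n/(r, -r)_n telescopes to (1 - aq^{2n})/(1 - a), which depends only on r²
= a. So the choice of the square root in the series does not matter. -/
lemma qFin_wellPoised (hq : ‖q‖ < 1) {a r : ℂ} (hr : r * r = a) (ha : qPochInf q a ≠ 0) (n : ℕ) :
    qFin q a n * (qFin q (q * r) n * qFin q (-q * r) n) / (qFin q r n * qFin q (-r) n) =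
      wpCoef q (a * q) n := by
  have hne : ∀ m : ℕ, a * q ^ m ≠ 1 := fun m hm => ha (qPochInf_eq_zero hq hm)
  have hr1 : qFin q r n ≠ 0 := Finset.prod_ne_zero_iff.2 fun j _ h => hne (2 * j) (by
    rw [← hr]
    linear_combination (-(1 + r * q ^ j)) * h)
  have hr2 : qFin q (-r) n ≠ 0 := Finset.prod_ne_zero_iff.2 fun j _ h => hne (2 * j) (by
    rw [← hr]
    linear_combination (-(1 - r * q ^ j)) * h)
  have ha1 : 1 - a ≠ 0 := fun h => hne 0 (by linear_combination -h)
  have h1 := qFin_mul_left' (q := q) r n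
  have h2 := qFin_mul_left' (q := q) (-r) n
  rw [show q * -r = -q * r by ring] at h2
  have h3 := qFin_mul_wp (q := q) a n
  rw [div_eq_iff (mul_ne_zero hr1 hr2)]
  refine mul_left_cancel₀ ha1 ?_
  have e1 : (1 - a) = (1 - r) * (1 - -r) := by rw [← hr]; ring
  have e2 : 1 - a * q ^ (2 * n) = (1 - r * q ^ n) * (1 - -r * q ^ n) := by rw [← hr]; ring
  calc (1 - a) * (qFin q a n * (qFin q (q * r) n * qFin q (-q * r) n))
      = qFin q a n * ((qFin q (q * r) n * (1 - r)) * (qFin q (-q * r) n * (1 - -r))) := by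
        rw [e1]; ring
    _ = qFin q a n * (1 - a * q ^ (2 * n)) * (qFin q r n * qFin q (-r) n) := by
        rw [h1, h2, e2]; ring
    _ = _ := by rw [h3]; ring

lemma wellPoised_term_aux {A Y₁ Y₂ x₁ x₂ Q Z B₁ B₂ B₃ B₄ B₅ D₁ D₂ D₃ D₄ D₅ E₁ E₂ E₃ E₄ E₅ : ℂ}
    (h₁ : D₁ ≠ 0) (h₂ : D₂ ≠ 0) (h₃ : D₃ ≠ 0) (h₄ : D₄ ≠ 0) (h₅ : D₅ ≠ 0) :
    A * (Y₁ * (Y₂ * (B₁ * (B₂ * (B₃ * (B₄ * B₅)))))) /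
      (Q * (x₁ * (x₂ * (D₁ * (D₂ * (D₃ * (D₄ * D₅))))))) * Z *
      (D₁ * E₁ * (D₂ * E₂) * (D₃ * E₃) * (D₄ * E₄) * (D₅ * E₅)) =
    A * (Y₁ * Y₂) / (x₁ * x₂) * Q⁻¹ * Z * (E₁ * B₁ * (E₂ * B₂) * (E₃ * B₃) * (E₄ * B₄) * (E₅ * B₅)) := by
  calc _ = A * (Y₁ * Y₂) / (x₁ * x₂) * Q⁻¹ * Z *
      (E₁ * B₁ * (E₂ * B₂) * (E₃ * B₃) * (E₄ * B₄) * (E₅ * B₅)) *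
      ((D₁ * D₁⁻¹) * (D₂ * D₂⁻¹) * (D₃ * D₃⁻¹) * (D₄ * D₄⁻¹) * (D₅ * D₅⁻¹)) := by
        generalize hi₁ : D₁⁻¹ = I₁
        generalize hi₂ : D₂⁻¹ = I₂
        generalize hi₃ : D₃⁻¹ = I₃
        generalize hi₄ : D₄⁻¹ = I₄
        generalize hi₅ : D₅⁻¹ = I₅
        simp only [div_eq_mul_inv, mul_inv, hi₁, hi₂, hi₃, hi₄, hi₅]
        ring
    _ = _ := by
        rw [mul_inv_cancel₀ h₁, mul_inv_cancel₀ h₂, mul_inv_cancel₀ h₃, mul_inv_cancel₀ h₄,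
          mul_inv_cancel₀ h₅]
        simp only [mul_one]

lemma qVeryWellPoised_mul_prod (hq : ‖q‖ < 1) {a b1 b2 b3 b4 b5 : ℂ} {d : Fin 5 → ℂ} (ζ : ℂ)
    (ha : qPochInf q a ≠ 0) (hd : ∀ i, qPochInf q (d i) ≠ 0)
    (h1 : q * a / b1 = d 0) (h2 : q * a / b2 = d 1) (h3 : q * a / b3 = d 2) (h4 : q * a / b4 = d 3)
    (h5 : q * a / b5 = d 4) :
    qVeryWellPoised q a [b1, b2, b3, b4, b5] ζ * ∏ i, qPochInf q (d i) =
      ∑' k, nrTerm q (a * q) ![b1, b2, b3, b4, b5] d ζ k := by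
  rw [qVeryWellPoised, qHypergeometric, ← tsum_mul_right]
  refine tsum_congr fun n => ?_
  have hr : a ^ (1 / 2 : ℂ) * a ^ (1 / 2 : ℂ) = a := by
    rw [← sq, ← Complex.cpow_nat_mul]
    norm_num
  have hw := qFin_wellPoised hq hr ha n
  have hd' := fun i => qFin_ne_zero hq (hd i) n
  have hsplit := fun i => qPochInf_eq_qFin_mul hq (d i) n
  simp only [qPochsFin, List.map_cons, List.map_nil, List.prod_cons, List.prod_nil, mul_one, h1, h2,
    h3, h4, h5]
  have eF : ∀ x, ∏ j ∈ Finset.range n, (1 - x * q ^ j) = qFin q x n := fun _ => rfl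
  simp only [eF]
  rw [nrTerm, ← hw]
  simp only [Fin.prod_univ_five, Matrix.cons_val, hsplit]
  exact wellPoised_term_aux (hd' 0) (hd' 1) (hd' 2) (hd' 3) (hd' 4)

variable {F : Type*} [NormedAddCommGroup F] [NormedSpace ℂ F]

lemma norm_nrTerm_le (hq : ‖q‖ < 1) {R ρ : ℝ} {c ζ : ℂ} {b d : Fin 5 → ℂ} (hc : ‖c‖ ≤ R)
    (hb : ∀ i, ‖b i‖ ≤ R) (hd : ∀ i, ‖d i‖ ≤ R) (hζ : ‖ζ‖ ≤ ρ) (k : ℕ) :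
    ‖nrTerm q c b d ζ k‖ ≤ (Real.exp (R / (1 - ‖q‖)) * (1 + R)) *
      (Real.exp (1 / (1 - ‖q‖)) / ‖qPochInf q q‖) *
      (∏ _i : Fin 5, (Real.exp (R / (1 - ‖q‖)) * Real.exp (R / (1 - ‖q‖)))) * ρ ^ k := by
  have hρ : 0 ≤ ρ := (norm_nonneg _).trans hζ
  have hR : 0 ≤ R := (norm_nonneg _).trans hc
  rw [nrTerm, norm_mul, norm_mul, norm_mul, norm_prod, norm_pow]
  have h1 : ∏ i, ‖qPochInf q (d i * q ^ k) * qFin q (b i) k‖ ≤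
      ∏ _i : Fin 5, (Real.exp (R / (1 - ‖q‖)) * Real.exp (R / (1 - ‖q‖))) := by
    refine Finset.prod_le_prod (fun _ _ => norm_nonneg _) fun i _ => ?_
    rw [norm_mul]
    exact mul_le_mul (norm_qPochInf_le_of hq ((norm_mul_pow_le hq _ _).trans (hd i)))
      (norm_qFin_le hq (hb i) k) (norm_nonneg _) (Real.exp_pos _).le
  calc _ ≤ (Real.exp (R / (1 - ‖q‖)) * (1 + R)) *
      (Real.exp (1 / (1 - ‖q‖)) / ‖qPochInf q q‖) * ρ ^ k *
      ∏ _i : Fin 5, (Real.exp (R / (1 - ‖q‖)) * Real.exp (R / (1 - ‖q‖))) := by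
        gcongr
        · exact norm_wpCoef_le hq hc k
        · exact norm_inv_qFin_self_le hq k
    _ = _ := by ring

lemma differentiable_qFin (k : ℕ) : Differentiable ℂ fun a => qFin q a k := by
  unfold qFin
  fun_prop

lemma differentiable_wpCoef (k : ℕ) : Differentiable ℂ fun c => wpCoef q c k := by
  cases k with
  | zero => exact differentiable_const _
  | succ k => exact (differentiable_qFin k).mul (by fun_prop)

lemma analyticAt_nrTerm (hq : ‖q‖ < 1) {c ζ : F → ℂ} {b d : F → Fin 5 → ℂ} {y : F}
    (hc : AnalyticAt ℂ c y) (hζ : AnalyticAt ℂ ζ y) (hb : ∀ i, AnalyticAt ℂ (fun y => b y i) y)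
    (hd : ∀ i, AnalyticAt ℂ (fun y => d y i) y) (k : ℕ) :
    AnalyticAt ℂ (fun y => nrTerm q (c y) (b y) (d y) (ζ y) k) y := by
  refine ((((differentiable_wpCoef k).analyticAt _).comp hc).mul analyticAt_const).mul (hζ.pow k)
    |>.mul (Finset.analyticAt_fun_prod _ fun i _ => ?_)
  exact (analyticAt_qPochInf hq ((hd i).mul analyticAt_const)).mul
    (((differentiable_qFin k).analyticAt _).comp (hb i))

/-- The terms are dominated by a geometric series uniformly near y, and Weierstrass' theorem in one
variable applies on each complex line. This is the reason for working with functions that are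
holomorphic on lines. -/
lemma exists_lineHol_tsum_nrTerm (hq : ‖q‖ < 1) {c ζ : F → ℂ} {b d : F → Fin 5 → ℂ} {y : F}
    (hc : AnalyticAt ℂ c y) (hζ : AnalyticAt ℂ ζ y) (hb : ∀ i, AnalyticAt ℂ (fun y => b y i) y)
    (hd : ∀ i, AnalyticAt ℂ (fun y => d y i) y) (hζ1 : ‖ζ y‖ < 1) :
    ∃ ε > 0, LineHol (fun y => ∑' k, nrTerm q (c y) (b y) (d y) (ζ y) k) (ball y ε) := by
  obtain ⟨ρ, hρ, hρ1⟩ := exists_between hζ1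
  obtain ⟨R, hRc, hRb, hRd⟩ : ∃ R : ℝ, ‖c y‖ < R ∧ (∀ i, ‖b y i‖ < R) ∧ ∀ i, ‖d y i‖ < R := by
    refine ⟨‖c y‖ + ∑ i, ‖b y i‖ + ∑ i, ‖d y i‖ + 1, ?_, fun i => ?_, fun i => ?_⟩
    · have : 0 ≤ ∑ i, ‖b y i‖ := by positivity
      have : 0 ≤ ∑ i, ‖d y i‖ := by positivity
      linarith
    · have := Finset.single_le_sum (f := fun i => ‖b y i‖) (fun _ _ => norm_nonneg _) (Finset.mem_univ i)
      have : 0 ≤ ∑ i, ‖d y i‖ := by positivity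
      linarith [norm_nonneg (c y)]
    · have := Finset.single_le_sum (f := fun i => ‖d y i‖) (fun _ _ => norm_nonneg _) (Finset.mem_univ i)
      have : 0 ≤ ∑ i, ‖b y i‖ := by positivity
      linarith [norm_nonneg (c y)]
  obtain ⟨ε, hε, hball⟩ := Metric.eventually_nhds_iff_ball.1
    ((hc.continuousAt.norm.eventually (gt_mem_nhds hRc)).and
      ((eventually_all.2 fun i => (hb i).continuousAt.norm.eventually (gt_mem_nhds (hRb i))).and
      ((eventually_all.2 fun i => (hd i).continuousAt.norm.eventually (gt_mem_nhds (hRd i))).and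
      ((hζ.continuousAt.norm.eventually (gt_mem_nhds hρ)).and
      (hc.eventually_analyticAt.and (hζ.eventually_analyticAt.and
      ((eventually_all.2 fun i => (hb i).eventually_analyticAt).and
      (eventually_all.2 fun i => (hd i).eventually_analyticAt))))))))
  refine ⟨ε, hε, fun p v => ?_⟩
  have hopen : IsOpen {s : ℂ | p + s • v ∈ ball y ε} :=
    isOpen_ball.preimage (by fun_prop : Continuous fun s : ℂ => p + s • v)
  have hρ0 : 0 ≤ ρ := (norm_nonneg _).trans hρ.le
  refine Complex.differentiableOn_tsum_of_summable_norm
    ((summable_geometric_of_lt_one hρ0 hρ1).mul_left ((Real.exp (R / (1 - ‖q‖)) * (1 + R)) *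
      (Real.exp (1 / (1 - ‖q‖)) / ‖qPochInf q q‖) *
      ∏ _i : Fin 5, (Real.exp (R / (1 - ‖q‖)) * Real.exp (R / (1 - ‖q‖))))) (fun k => ?_) hopen
    fun k s hs => ?_
  · refine LineHol.of_analyticAt (U := ball y ε)
      (g := fun y => nrTerm q (c y) (b y) (d y) (ζ y) k) (fun z hz => ?_) p v
    obtain ⟨-, -, -, -, h1, h2, h3, h4⟩ := hball z hz
    exact analyticAt_nrTerm hq h1 h2 h3 h4 k
  · obtain ⟨h1, h2, h3, h4, -⟩ := hball _ hs
    exact norm_nrTerm_le hq h1.le (fun i => (h2 i).le) (fun i => (h3 i).le) h4.le k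

/-- The numerator parameters of the series. -/
def nrUpper (t : Fin 6 → ℂ) : Fin 5 → ℂ :=
  ![t 1 * t 2, t 1 * t 3, t 1 * t 4, t 1 * t 5, t 0 * t 1 * t 2 * t 3 * t 4 * t 5]

/-- The denominator parameters of the series. -/
def nrLower (t : Fin 6 → ℂ) : Fin 5 → ℂ :=
  ![t 1 * t 3 * t 4 * t 5, t 1 * t 2 * t 4 * t 5, t 1 * t 2 * t 3 * t 5, t 1 * t 2 * t 3 * t 4,
    t 1 / t 0]

/-- The right-hand side of the Nassrallah–Rahman representation. -/
def nrValue (q : ℂ) (t : Fin 6 → ℂ) : ℂ :=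
  2 * qPochs q [1 / (t 0 * t 1), t 1 / t 0, t 1 * t 3 * t 4 * t 5,
      t 1 * t 2 * t 4 * t 5, t 1 * t 2 * t 3 * t 5, t 1 * t 2 * t 3 * t 4] /
    (qPochs q [q, t 1 ^ 2 * t 2 * t 3 * t 4 * t 5, t 1 * t 2, t 1 * t 3, t 1 * t 4,
        t 1 * t 5] *
      qPochs q [t 2 * t 3, t 2 * t 4, t 2 * t 5, t 3 * t 4, t 3 * t 5, t 4 * t 5]) *
  qVeryWellPoised q (t 1 ^ 2 * t 2 * t 3 * t 4 * t 5 / q)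
    [t 1 * t 2, t 1 * t 3, t 1 * t 4, t 1 * t 5, t 0 * t 1 * t 2 * t 3 * t 4 * t 5]
    (1 / (t 0 * t 1))

/-- The denominator of `nrValue`. -/
def nrDen (q : ℂ) (t : Fin 6 → ℂ) : ℂ :=
  qPochs q [q, t 1 ^ 2 * t 2 * t 3 * t 4 * t 5, t 1 * t 2, t 1 * t 3, t 1 * t 4, t 1 * t 5] *
    qPochs q [t 2 * t 3, t 2 * t 4, t 2 * t 5, t 3 * t 4, t 3 * t 5, t 4 * t 5]

/-- The product of the conditions for the series to be well defined. -/
def nrCond (q : ℂ) (t : Fin 6 → ℂ) : ℂ :=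
  qPochInf q (t 1 ^ 2 * t 2 * t 3 * t 4 * t 5 / q) * ∏ i, qPochInf q (nrLower t i)

/-- The series in `nrValue`, multiplied by infinite products. -/
def nrSeries (q : ℂ) (t : Fin 6 → ℂ) : ℂ :=
  ∑' k, nrTerm q (t 1 ^ 2 * t 2 * t 3 * t 4 * t 5) (nrUpper t) (nrLower t) (1 / (t 0 * t 1)) k

/-- Five of the products in the numerator of the prefactor are those that clear the denominators of
the series. What remains is the locally uniformly convergent `nrSeries`, which has no poles from the
lower parameters. -/
lemma nrValue_eq (hq0 : q ≠ 0) (hq : ‖q‖ < 1) {t : Fin 6 → ℂ} (ht : t ∈ torusSix)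
    (h : nrCond q t ≠ 0) : nrValue q t =
      2 * qPochInf q (1 / (t 0 * t 1)) * nrSeries q t / nrDen q t := by
  have hd : ∀ i, qPochInf q (nrLower t i) ≠ 0 := fun i =>
    Finset.prod_ne_zero_iff.1 (right_ne_zero_of_mul h) i (Finset.mem_univ i)
  have h0 := ht 0; have h1 := ht 1; have h2 := ht 2; have h3 := ht 3; have h4 := ht 4; have h5 := ht 5
  have key := qVeryWellPoised_mul_prod hq (1 / (t 0 * t 1)) (left_ne_zero_of_mul h) hd
    (b1 := t 1 * t 2) (b2 := t 1 * t 3) (b3 := t 1 * t 4) (b4 := t 1 * t 5)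
    (b5 := t 0 * t 1 * t 2 * t 3 * t 4 * t 5)
    (by simp only [nrLower, Matrix.cons_val]; field_simp)
    (by simp only [nrLower, Matrix.cons_val]; field_simp)
    (by simp only [nrLower, Matrix.cons_val]; field_simp)
    (by simp only [nrLower, Matrix.cons_val]; field_simp)
    (by simp only [nrLower, Matrix.cons_val]; field_simp)
  rw [div_mul_cancel₀ _ hq0] at key
  rw [nrSeries, nrUpper, ← key, nrValue, nrDen, Fin.prod_univ_five]
  simp only [qPochs, List.map_cons, List.map_nil, List.prod_cons, List.prod_nil, mul_one, nrLower,
    Matrix.cons_val]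
  ring

lemma EulerRegion.nr_ne_zero {t : Fin 6 → ℂ} (h : EulerRegion q t) (hq0 : q ≠ 0) (hq : ‖q‖ < 1) :
    nrCond q t ≠ 0 ∧ nrDen q t ≠ 0 := by
  have hn := fun {a} => qPochInf_ne_zero_of_norm_lt_one hq (a := a)
  have hp := (h.poch_ne_zero hq).2.2.2
  have hqp := norm_pos_iff.2 hq0
  have n1 : ‖t 1‖ < 1 := h.norm_lt 0
  have n2 : ‖t 2‖ < 1 := h.norm_lt 1
  have n3 : ‖t 3‖ < 1 := h.norm_lt 2
  have n4 : ‖t 4‖ < 1 := h.norm_lt 3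
  have n5 : ‖t 5‖ < 1 := h.norm_lt 4
  have mul4 : ∀ a b c d : ℂ, ‖a‖ < 1 → ‖b‖ < 1 → ‖c‖ < 1 → ‖d‖ < 1 → ‖a * b * c * d‖ < 1 := by
    intro a b c d ha hb hc hd
    have m : ∀ x y : ℂ, ‖x‖ < 1 → ‖y‖ < 1 → ‖x * y‖ < 1 := fun x y hx hy => by
      rw [norm_mul]; nlinarith [norm_nonneg x, norm_nonneg y]
    exact m _ _ (m _ _ (m _ _ ha hb) hc) hd
  have hc : ‖t 1 ^ 2 * t 2 * t 3 * t 4 * t 5‖ < ‖q‖ := by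
    have := h.prod_lt'
    have e : t 1 ^ 2 * t 2 * t 3 * t 4 * t 5 = t 1 * (t 1 * t 2 * t 3 * t 4 * t 5) := by ring
    rw [e]
    simpa only [norm_mul] using this
  have p0 := norm_pos_iff.2 (h.ne_zero 0)
  have p1 := norm_pos_iff.2 (h.ne_zero 1)
  have h10 : ‖t 1 / t 0‖ < 1 := by
    rw [norm_div, div_lt_one p0]
    nlinarith [h.one_lt]
  constructor
  · refine mul_ne_zero (hn ?_) (Finset.prod_ne_zero_iff.2 fun i _ => hn ?_)
    · rw [norm_div, div_lt_one hqp]; exact hc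
    · fin_cases i
      exacts [mul4 _ _ _ _ n1 n3 n4 n5, mul4 _ _ _ _ n1 n2 n4 n5, mul4 _ _ _ _ n1 n2 n3 n5,
        mul4 _ _ _ _ n1 n2 n3 n4, h10]
  · simp only [nrDen, qPochs, List.map_cons, List.map_nil, List.prod_cons, List.prod_nil, mul_one]
    have m := fun {a b : ℂ} => mul_ne_zero (a := a) (b := b)
    exact m (m (qPochInf_self_ne_zero hq) (m (hn (hc.trans hq)) (m (hp 0 1) (m (hp 0 2)
      (m (hp 0 3) (hp 0 4)))))) (m (hp 1 2) (m (hp 1 3) (m (hp 1 4) (m (hp 2 3) (m (hp 2 4)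
      (hp 3 4))))))

/-- The series of `hasSum_wpTerm` is cleared by the products over the upper parameters and that of
`nrValue` by those over the lower ones; both become `nrSeries`. -/
lemma EulerRegion.euler_eq_nrValue {t : Fin 6 → ℂ} (h : EulerRegion q t) (hq0 : q ≠ 0)
    (hq : ‖q‖ < 1) {E : (Fin 6 → ℂ) → ℂ} (hE : IsTrigEuler q E) : E t = nrValue q t := by
  obtain ⟨hc, hd⟩ := h.nr_ne_zero hq0 hq
  have h0 := h.ne_zero 0; have h1 := h.ne_zero 1; have h2 := h.ne_zero 2; have h3 := h.ne_zero 3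
  have h4 := h.ne_zero 4; have h5 := h.ne_zero 5
  have hp := h.poch_ne_zero hq
  rw [nrValue_eq hq0 hq h.ne_zero hc, eq_div_iff hd]
  have hup : ∀ i, qPochInf q (nrUpper t i) ≠ 0 := by
    intro i
    fin_cases i
    · exact hp.2.2.2 0 1
    · exact hp.2.2.2 0 2
    · exact hp.2.2.2 0 3
    · exact hp.2.2.2 0 4
    · change qPochInf q (t 0 * t 1 * t 2 * t 3 * t 4 * t 5) ≠ 0
      rw [show t 0 * t 1 * t 2 * t 3 * t 4 * t 5 = t 0 * (t 1 * t 2 * t 3 * t 4 * t 5) by ring]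
      exact hp.2.2.1
  have hlow : ∀ i, nrLower t i = t 1 ^ 2 * t 2 * t 3 * t 4 * t 5 / nrUpper t i := by
    intro i
    fin_cases i <;> simp [nrLower, nrUpper] <;> field_simp
  have hs := h.hasSum_wpTerm hq0 hq hE rfl
  rw [show t 1 * (t 1 * t 2 * t 3 * t 4 * t 5) = t 1 ^ 2 * t 2 * t 3 * t 4 * t 5 by ring,
    show t 0 * (t 1 * t 2 * t 3 * t 4 * t 5) = t 0 * t 1 * t 2 * t 3 * t 4 * t 5 by ring] at hs
  have hs' := (hs.mul_right (∏ i, qPochInf q (nrUpper t i))).tsum_eq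
  have e1 : ∀ k, wpTerm q (t 1 ^ 2 * t 2 * t 3 * t 4 * t 5) (t 1 * t 2) (t 1 * t 3) (t 1 * t 4)
      (t 1 * t 5) (t 0 * t 1 * t 2 * t 3 * t 4 * t 5) (1 / (t 0 * t 1)) k *
      ∏ i, qPochInf q (nrUpper t i) = nrTerm q (t 1 ^ 2 * t 2 * t 3 * t 4 * t 5) (nrUpper t)
        (nrLower t) (1 / (t 0 * t 1)) k := fun k => wpTerm_mul_prod hq hlow hup _ k
  have e2 : (∑' k, 2 * (qPochInf q (1 / (t 0 * t 1)) *
      qPochInf q (t 0 * t 1 * t 2 * t 3 * t 4 * t 5)) *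
      wpTerm q (t 1 ^ 2 * t 2 * t 3 * t 4 * t 5) (t 1 * t 2) (t 1 * t 3) (t 1 * t 4)
      (t 1 * t 5) (t 0 * t 1 * t 2 * t 3 * t 4 * t 5) (1 / (t 0 * t 1)) k *
      ∏ i, qPochInf q (nrUpper t i)) = 2 * (qPochInf q (1 / (t 0 * t 1)) *
      qPochInf q (t 0 * t 1 * t 2 * t 3 * t 4 * t 5)) * nrSeries q t := by
    rw [nrSeries, ← tsum_mul_left]
    exact tsum_congr fun k => by rw [mul_assoc, e1]
  rw [e2] at hs'
  have h5' : qPochInf q (t 0 * t 1 * t 2 * t 3 * t 4 * t 5) ≠ 0 := hup 4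
  refine mul_left_cancel₀ h5' ?_
  simp only [Fin.prod_univ_five, nrUpper, Matrix.cons_val] at hs'
  simp only [nrDen, qPochs, List.map_cons, List.map_nil, List.prod_cons, List.prod_nil, mul_one]
  linear_combination -hs'

/-- The domain of the representation. -/
def nrDomain : Set (Fin 6 → ℂ) := {t ∈ torusSix | 1 < ‖t 0 * t 1‖}

/-- In logarithmic coordinates the domain is the half-space Re(y₀ + y₁) > 0. Convexity provides the
connectedness that continuation requires. -/
lemma convex_nrDomain_log :
    Convex ℝ ((Set.univ : Set (Fin 6 → ℂ)) ∩ expMap ⁻¹' nrDomain) ∧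
      IsOpen ((Set.univ : Set (Fin 6 → ℂ)) ∩ expMap ⁻¹' nrDomain) := by
  have e : (Set.univ : Set (Fin 6 → ℂ)) ∩ expMap ⁻¹' nrDomain = {y | 0 < (y 0 + y 1).re} := by
    ext y
    have h1 : ‖expMap y 0 * expMap y 1‖ = Real.exp (y 0 + y 1).re := by
      rw [expMap, expMap, ← Complex.exp_add, Complex.norm_exp]
    have h2 : expMap y ∈ torusSix := fun j => Complex.exp_ne_zero _
    simp only [Set.univ_inter, Set.mem_preimage, nrDomain, Set.mem_ofPred_eq, h1, h2, true_and,
      Real.one_lt_exp_iff]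
  rw [e]
  refine ⟨?_, isOpen_lt continuous_const (by fun_prop)⟩
  intro x hx y hy a b ha hb hab
  simp only [Set.mem_ofPred_eq, Pi.add_apply, Pi.smul_apply, Complex.add_re, Complex.real_smul,
    Complex.mul_re, Complex.ofReal_re, Complex.ofReal_im, zero_mul, sub_zero] at *
  rcases ha.eq_or_lt with rfl | ha
  · rw [zero_add] at hab; subst hab; linarith
  · nlinarith [mul_pos ha hx, mul_nonneg hb hy.le]

/-- The Nassrallah–Rahman integral representation. -/
theorem genericallyOn_nassrallahRahman (hq0 : q ≠ 0) (hq : ‖q‖ < 1) {E : (Fin 6 → ℂ) → ℂ}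
    (hE : IsTrigEuler q E) :
    GenericallyOn {t ∈ torusSix | 1 < ‖t 0 * t 1‖} fun t => E t = nrValue q t := by
  change GenericallyOn nrDomain _
  have hchart := (isFullChart_expMap 6).restrict (X' := nrDomain) fun t ht => ht.1
  obtain ⟨hconv, hopen⟩ := convex_nrDomain_log
  obtain ⟨e, he⟩ := exists_eulerRegion hq0 hq
  have hmem : e ∈ nrDomain := ⟨he.ne_zero, by rw [norm_mul]; exact he.one_lt⟩
  obtain ⟨y₀, hy₀, rfl⟩ := hchart.surj e hmem
  refine hchart.genericallyOn hopen (P := fun t => E t = nrValue q t) ?_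
  have hEm : IsLineMero (fun y => E (expMap y)) (Set.univ : Set (Fin 6 → ℂ)) :=
    (hE.meromorphic.comp (isFullChart_expMap 6).isOpenChart isOpen_univ).isLineMero isOpen_univ
  have a : ∀ j y, AnalyticAt ℂ (fun y : Fin 6 → ℂ => expMap y j) y := fun j y =>
    (analyticAt_apply j y).cexp
  have n : ∀ j (y : Fin 6 → ℂ), expMap y j ≠ 0 := fun j y => Complex.exp_ne_zero _
  have aup : ∀ i y, AnalyticAt ℂ (fun y : Fin 6 → ℂ => nrUpper (expMap y) i) y := by
    intro i y
    have h := fun j => a j y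
    fin_cases i
    exacts [(h 1).mul (h 2), (h 1).mul (h 3), (h 1).mul (h 4), (h 1).mul (h 5),
      (((((h 0).mul (h 1)).mul (h 2)).mul (h 3)).mul (h 4)).mul (h 5)]
  have alow : ∀ i y, AnalyticAt ℂ (fun y : Fin 6 → ℂ => nrLower (expMap y) i) y := by
    intro i y
    have h := fun j => a j y
    fin_cases i
    exacts [(((h 1).mul (h 3)).mul (h 4)).mul (h 5), (((h 1).mul (h 2)).mul (h 4)).mul (h 5),
      (((h 1).mul (h 2)).mul (h 3)).mul (h 5), (((h 1).mul (h 2)).mul (h 3)).mul (h 4),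
      (h 1).div (h 0) (n 0 y)]
  have ac : ∀ y, AnalyticAt ℂ (fun y : Fin 6 → ℂ => expMap y 1 ^ 2 * expMap y 2 * expMap y 3 *
      expMap y 4 * expMap y 5) y := fun y =>
    (((((a 1 y).pow 2).mul (a 2 y)).mul (a 3 y)).mul (a 4 y)).mul (a 5 y)
  have aζ : ∀ y, AnalyticAt ℂ (fun y : Fin 6 → ℂ => 1 / (expMap y 0 * expMap y 1)) y := fun y =>
    analyticAt_const.div ((a 0 y).mul (a 1 y)) (mul_ne_zero (n 0 y) (n 1 y))
  have acond : ∀ y, AnalyticAt ℂ (fun y : Fin 6 → ℂ => nrCond q (expMap y)) y := fun y =>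
    (analyticAt_qPochInf hq (ac y).div_const).mul
      (Finset.analyticAt_fun_prod _ fun i _ => analyticAt_qPochInf hq (alow i y))
  have aden : ∀ y, AnalyticAt ℂ (fun y : Fin 6 → ℂ => nrDen q (expMap y)) y := by
    intro y
    have m := fun i j => analyticAt_qPochInf hq ((a i y).mul (a j y))
    have c := analyticAt_qPochInf hq (ac y)
    simp only [nrDen, qPochs, List.map_cons, List.map_nil, List.prod_cons, List.prod_nil, mul_one]
    exact (analyticAt_const.mul (c.mul ((m 1 2).mul ((m 1 3).mul ((m 1 4).mul (m 1 5)))))).mul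
      ((m 2 3).mul ((m 2 4).mul ((m 2 5).mul ((m 3 4).mul ((m 3 5).mul (m 4 5))))))
  -- The formula through `nrSeries` is only valid where `nrCond` is nonzero, so numerator and
  -- denominator are both multiplied by `nrCond`; its zeros thereby become part of the exceptional
  -- set.
  have hline : IsLineMero (fun y => nrValue q (expMap y)) (Set.univ ∩ expMap ⁻¹' nrDomain) := by
    intro y hy
    have hζ : ‖1 / (expMap y 0 * expMap y 1)‖ < 1 := by
      have h1 : 1 < ‖expMap y 0 * expMap y 1‖ := hy.2.2
      rw [norm_div, norm_one, div_lt_one (by linarith)]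
      exact h1
    obtain ⟨ε, hε, hl⟩ := exists_lineHol_tsum_nrTerm hq (ac y) (aζ y) (fun i => aup i y)
      (fun i => alow i y) hζ
    have hl2 : LineHol (fun y : Fin 6 → ℂ => 2 * qPochInf q (1 / (expMap y 0 * expMap y 1)) *
        nrCond q (expMap y)) (ball y ε) := .of_analyticAt fun z _ =>
      (analyticAt_const.mul (analyticAt_qPochInf hq (aζ z))).mul (acond z)
    refine ⟨_, fun y => nrCond q (expMap y) * nrDen q (expMap y), ε, hε, hl2.mul hl,
      fun z _ => (acond z).mul (aden z), ?_, fun z _ hz => ?_⟩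
    · obtain ⟨h1, h2⟩ := he.nr_ne_zero hq0 hq
      exact frequently_ne_zero_of_preconnected isPreconnected_univ
        (fun z _ => (acond z).mul (aden z)) trivial (mul_ne_zero h1 h2) trivial
    · have h1 := left_ne_zero_of_mul hz
      change nrValue q (expMap z) = 2 * qPochInf q (1 / (expMap z 0 * expMap z 1)) *
        nrCond q (expMap z) * nrSeries q (expMap z) / (nrCond q (expMap z) * nrDen q (expMap z))
      rw [nrValue_eq hq0 hq (fun j => n j z) h1]
      rw [mul_right_comm (2 * _) (nrCond q (expMap z)), mul_comm (nrCond q (expMap z)) (nrDen q _),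
        mul_div_mul_right _ _ h1]
  -- On the half-space both sides are meromorphic on lines, and near the logarithm of the chosen
  -- point they agree by the evaluation over the unit circle.
  refine IsLineMero.genericallyOn_eq (fun y _ => hEm y trivial) hline hconv.isPreconnected hopen hy₀ ?_
  have hev : ∀ᶠ y in 𝓝 y₀, EulerRegion q (expMap y) :=
    (analyticAt_expMap y₀).continuousAt.eventually ((isOpen_eulerRegion q).eventually_mem he)
  filter_upwards [hev] with y hy using hy.euler_eq_nrValue hq0 hq hE

end NassrallahRahman

end

theorem proposition5p13 (q : ℂ) (hq0 : q ≠ 0) (hq1 : ‖q‖ < 1) :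
    ((∃ B, IsTrigBarnes q B) ∧ (∃ V, IsTrigV q V) ∧ (∃ E, IsTrigEuler q E)) ∧
    ∀ (B : (Fin 8 → ℂ) → ℂ) (V E : (Fin 6 → ℂ) → ℂ),
      IsTrigBarnes q B → IsTrigV q V → IsTrigEuler q E →
      GenericallyOn balancedSet (fun t => ∀ s : ℂ, s ^ 2 = t 0 * t 5 * t 6 * t 7 →
        s ^ 2 = 1 / (t 1 * t 2 * t 3 * t 4) ∧
        B t = qPochs q [1 / (t 0 * t 5), 1 / (t 7 * t 5)] /
            qPochs q [t 1 * t 2, t 1 * t 3, t 1 * t 4, t 5 * t 6] *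
          V ![t 6 / s, t 2 * s, t 3 * s, t 4 * s, t 0 / s, t 7 / s]) ∧
      GenericallyOn balancedSet (fun t => ∀ v : ℂ, v ^ 2 = t 1 * t 5 * t 6 * t 7 →
        v ^ 2 = 1 / (t 0 * t 2 * t 3 * t 4) ∧
        B t = qPochs q [1 / (t 0 * t 2), 1 / (t 0 * t 3), 1 / (t 0 * t 4), 1 / (t 5 * t 7)] /
            qPochs q [t 1 * t 5, t 6 * t 5] *
          E ![t 7 / v, t 6 / v, t 2 * v, t 3 * v, t 4 * v, t 1 / v]) ∧
      -- the Nassrallah-Rahman integral representation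
      GenericallyOn {t ∈ torusSix | 1 < ‖t 0 * t 1‖} (fun t =>
        E t = 2 * qPochs q [1 / (t 0 * t 1), t 1 / t 0, t 1 * t 3 * t 4 * t 5,
              t 1 * t 2 * t 4 * t 5, t 1 * t 2 * t 3 * t 5, t 1 * t 2 * t 3 * t 4] /
            (qPochs q [q, t 1 ^ 2 * t 2 * t 3 * t 4 * t 5, t 1 * t 2, t 1 * t 3, t 1 * t 4,
                t 1 * t 5] *
              qPochs q [t 2 * t 3, t 2 * t 4, t 2 * t 5, t 3 * t 4, t 3 * t 5, t 4 * t 5]) *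
          qVeryWellPoised q (t 1 ^ 2 * t 2 * t 3 * t 4 * t 5 / q)
            [t 1 * t 2, t 1 * t 3, t 1 * t 4, t 1 * t 5, t 0 * t 1 * t 2 * t 3 * t 4 * t 5]
            (1 / (t 0 * t 1))) := by
  refine ⟨⟨⟨_, isTrigBarnes_trigBarnes hq0 hq1⟩, ⟨_, isTrigV_trigV hq0 hq1⟩,
    ⟨_, isTrigEuler_trigEuler hq0 hq1⟩⟩, fun B V E hB hV hE => ?_⟩
  exact ⟨genericallyOn_barnes_v hq0 hq1 hB hV, genericallyOn_barnes_euler hq0 hq1 hB hE,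
    genericallyOn_nassrallahRahman hq0 hq1 hE⟩
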